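/- **Notation.** Let $n\ge 2$, $0<q<1$, and let $\kappa\in\mathbb C$; put $q^x=e^{x\log q}$. Let $\theta(x;q)=\prod_{j\ge0}(1-q^jx)(1-q^{j+1}/x)$ and $\theta(x_1,\dots,x_r;q)=\prod_i\theta(x_i;q)$. Let $V=\mathbb C^2=\mathbb Cv_+\oplus\mathbb Cv_-$ and $hv_{\pm}=\pm v_{\pm}$. On $V^{\otimes m}$ let $h_i$ be $h$ acting on the $i$-th tensor factor and, for $v$ with $h_iv=\mu_iv$ for all $i$, put $S(\xi+\alpha h_i)v:=S(\xi+\alpha\mu_i)v$ (similarly for sums of the $h_i$, such as $\Delta(h)=h_1+h_2$ on $V\otimes V$); let $(T_{\alpha h_i}f)(\xi)=\sum_{\underline\mu}f_{\underline\mu}(\xi+\alpha\mu_i)$, where $f_{\underline\mu}$ is the component of $f$ of weight $\underline\mu$. Subscripts on operators indicate the tensor legs they act on. Identities are identities of meromorphic functions. Baxter's dynamical $R$-matrix is, in the basis $v_+\otimes v_+,v_+\otimes v_-,v_-\otimes v_+,v_-\otimes v_-$, $$R_{Ba}(z,\xi)=\begin{pmatrix}1&0&0&0\\0&A(z,\xi)&B(z,\xi)&0\\0&B(z,-\xi)&A(z,-\xi)&0\\0&0&0&1\end{pmatrix},\quad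 A(z,\xi)=\frac{\theta(q^{-z},q^{2\kappa+\xi};q)}{\theta(q^{2\kappa-z},q^{\xi};q)},\quad B(z,\xi)=\frac{\theta(q^{-z-\xi},q^{2\kappa};q)}{\theta(q^{2\kappa-z},q^{-\xi};q)}.$$ For $\zeta,\zeta',\upsilon,\upsilon'\in\mathbb C$ let $\tilde a=q^{\zeta+\zeta'}$, $\tilde b=-q^{\zeta-\zeta'}$, $\tilde c=q^{\frac12+\upsilon+\upsilon'}$, $d=-q^{\frac12+\zeta'-\upsilon'}$ and $$\mathcal C(z,\xi)=\frac{\theta(\tilde aq^{\xi},\tilde bq^{\xi},\tilde cq^{\xi},dq^{\xi-z}/\tilde a;q)}{\theta(q^{2\xi},dq^{-z};q)}\,q^{-(\zeta+\upsilon-z)(\zeta+\zeta'-\xi)},$$ let $\widetilde{\mathcal C}$ be $\mathcal C$ with $\upsilon$ and $\zeta'$ interchanged, and in the basis $v_+,v_-$ put $$K_{Ba}(z,\xi;\zeta,\zeta',\upsilon,\upsilon')=\begin{pmatrix}\alpha(z,\xi)&\beta(z,\xi)\\\beta(z,-\xi)&\alpha(z,-\xi)\end{pmatrix},\quad \alpha(z,\xi)=\frac{\mathcal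 C(z,\xi)-\widetilde{\mathcal C}(\xi,z)}{\widetilde{\mathcal C}(\xi,-z)}\,q^{2z\xi},\quad \beta(z,\xi)=\frac{\mathcal C(z,\xi)}{\widetilde{\mathcal C}(-\xi,-z)}.$$ Let $W_0=S_n\ltimes\{\pm1\}^n$ act on $\mathbb C^n$ by permutations and sign changes of the coordinates, and let $W=W_0\ltimes\mathbb Z^n$ act on $\mathbb C^n$ with $\tau(\lambda)\mathbf z=\mathbf z+\lambda$, where $\tau(\lambda)\in W$ is the element attached to $\lambda\in\mathbb Z^n$. Let $s_i$ ($1\le i<n$) interchange $z_i$ and $z_{i+1}$, let $s_n$ change the sign of $z_n$, and let $s_0\mathbf z=(1-z_1,z_2,\dots,z_n)$. **Statement.** Let $\kappa,\zeta_l,\zeta_l',\upsilon_l,\upsilon_l',\zeta,\zeta',\upsilon,\upsilon'$ be arbitrary complex numbers and put $$\underline K(z,\xi)=K_{Ba}(z,-\xi;\zeta_l,\zeta_l',\upsilon_l,\upsilon_l'),\qquad K(z,\xi)=K_{Ba}(z,\xi;\zeta,\zeta',\upsilon,\upsilon'),\qquad R=R_{Ba}.$$ 1. $R$ is a unitary dynamical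 $R$-matrix satisfying the ice rule: it is meromorphic, $[R(z,\xi),h_1+h_2]=0$, $R_{21}(z,\xi)R(-z,\xi)=\mathrm{Id}$ and $$\begin{aligned}&R_{12}(z_1-z_2,\xi-2\kappa h_3)R_{13}(z_1-z_3,\xi)R_{23}(z_2-z_3,\xi-2\kappa h_1)\\&\quad=R_{23}(z_2-z_3,\xi)R_{13}(z_1-z_3,\xi-2\kappa h_2)R_{12}(z_1-z_2,\xi).\end{aligned}$$ 2. $\underline K$ is a unitary left dynamical $K$-matrix for $R$: it is meromorphic, $\underline K(z,\xi)\underline K(-z,\xi)=\mathrm{Id}$ and $$\begin{aligned}&R(z_1-z_2,2\xi+2\kappa\Delta(h))\underline K_1(z_1,\xi+\kappa h_2)R_{21}(z_1+z_2,2\xi+2\kappa\Delta(h))\underline K_2(z_2,\xi+\kappa h_1)\\&\quad=\underline K_2(z_2,\xi+\kappa h_1)R(z_1+z_2,2\xi+2\kappa\Delta(h))\underline K_1(z_1,\xi+\kappa h_2)R_{21}(z_1-z_2,2\xi+2\kappa\Delta(h)).\end{aligned}$$ $K$ is a unitary right dynamical $K$-matrix for $R$: it is meromorphic, $K(z,\xi)K(-z,\xi)=\mathrm{Id}$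 and $$\begin{aligned}&R_{21}(z_1-z_2,2\xi)K_1(z_1,\xi-\kappa h_2)R_{12}(z_1+z_2,2\xi)K_2(z_2,\xi-\kappa h_1)\\&\quad=K_2(z_2,\xi-\kappa h_1)R_{21}(z_1+z_2,2\xi)K_1(z_1,\xi-\kappa h_2)R_{12}(z_1-z_2,2\xi).\end{aligned}$$ 3. There is a unique family $\{M^v(\mathbf z)\}_{v\in W}$ of difference operators in $\xi$ (finite sums of shifts in $\xi$ with $\mathrm{End}(V^{\otimes n})$-valued coefficients meromorphic in $(\mathbf z,\xi)$), acting on $V^{\otimes n}$-valued meromorphic functions on $\mathbb C^n\times\mathbb C$, such that $M^e(\mathbf z)=\mathrm{Id}$ and $M^{uv}(\mathbf z)=M^u(\mathbf z)M^v(u^{-1}\mathbf z)$ for all $u,v\in W$, and such that $$\begin{aligned}M^{s_0}(\mathbf z)&=T_{-\kappa h_1}\,\underline K_1(\tfrac12-z_1,\cdot)\,T_{\kappa h_1},\\ M^{s_i}(\mathbf z)&=P_{i,i+1}R_{i,i+1}(z_i-z_{i+1},2\xi-2\kappa(h_1+\dots+h_{i-1}))\quad(1\le i<n),\\ M^{s_n}(\mathbf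 z)&=K_n(z_n,\xi-\kappa(h_1+\dots+h_{n-1})),\end{aligned}$$ where $P$ is the permutation operator. 4. The resulting boundary quantum KZB equations $$M^{\tau(\lambda)}(\mathbf z)f(\mathbf z-\lambda,\cdot)=f(\mathbf z,\cdot)\qquad(\lambda\in\mathbb Z^n)$$ for $V^{\otimes n}$-valued meromorphic functions $f(\mathbf z,\xi)$, which depend besides on $q$ on the nine parameters above, form a compatible system: $M^{\tau(\lambda)}(\mathbf z)M^{\tau(\mu)}(\mathbf z-\lambda)=M^{\tau(\mu)}(\mathbf z)M^{\tau(\lambda)}(\mathbf z-\mu)$ for all $\lambda,\mu\in\mathbb Z^n$, and the operators $f\mapsto M^{\tau(\lambda)}(\mathbf z)f(\mathbf z-\lambda,\cdot)$ represent the group $\mathbb Z^n$. Its coefficients are elliptic: for each $\lambda$ one has $(M^{\tau(\lambda)}(\mathbf z)f(\mathbf z,\cdot))(\xi)=\sum_kc_k(\mathbf z,\xi)f(\mathbf z,\xi+2\kappa k)$, a finite sum over integers $k$, where every matrix entry of every $c_k$ is meromorphic and is an elliptic function of the second kind in each of the variables $z_1,\dots,z_n,\xi$ with periods $1$ and $2\pi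 i/\log q$; that is, a shift of one variable by a period multiplies the entry by the exponential of an affine function of the other variables. -/

import Mathlib

open Filter Topology

noncomputable section

/-! ## Meromorphic functions of several variables -/

/-- The filter of sets containing a dense open set.  Identities between meromorphic functions are
identities along this filter (the values at poles are irrelevant). -/
def generic (E : Type*) [TopologicalSpace E] : Filter E where
  sets := {s | Dense (interior s)}
  univ_sets := by simp
  sets_of_superset := fun hs hst => Dense.mono (interior_mono hst) hs
  inter_sets := fun hs ht => by
    change Dense (interior (_ ∩ _))
    rw [interior_inter]
    exact Dense.inter_of_isOpen_left hs ht isOpen_interior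

section Meromorphic

variable {E F : Type*} [NormedAddCommGroup E] [NormedSpace ℂ E]
  [NormedAddCommGroup F] [NormedSpace ℂ F]

/-- `f` is (generically equal to) a meromorphic function: near every point it is a quotient `g / h`
of two holomorphic functions, the zero set of `h` being nowhere dense. -/
def IsMeromorphic (f : E → ℂ) : Prop :=
  ∀ x, ∃ g h : E → ℂ, AnalyticAt ℂ g x ∧ AnalyticAt ℂ h x ∧
    ∀ᶠ y in 𝓝 x ⊓ generic E, h y ≠ 0 ∧ f y = g y / h y

theorem generic_tendsto {X Y : Type*} [TopologicalSpace X] [TopologicalSpace Y] (φ : X ≃ₜ Y) : Tendsto φ (generic X) (generic Y) := by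
  intro s hs
  change Dense (interior (φ ⁻¹' s))
  rw [← φ.preimage_interior]
  exact hs.preimage φ.isOpenMap

theorem IsMeromorphic.zero : IsMeromorphic (fun _ : E => (0 : ℂ)) := fun _ =>
  ⟨fun _ => 0, fun _ => 1, analyticAt_const, analyticAt_const, by simp⟩

theorem IsMeromorphic.add {f₁ f₂ : E → ℂ} (h₁ : IsMeromorphic f₁) (h₂ : IsMeromorphic f₂) :
    IsMeromorphic (fun x => f₁ x + f₂ x) := by
  intro x
  obtain ⟨g₁, k₁, hg₁, hk₁, e₁⟩ := h₁ x
  obtain ⟨g₂, k₂, hg₂, hk₂, e₂⟩ := h₂ x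
  refine ⟨fun y => g₁ y * k₂ y + k₁ y * g₂ y, fun y => k₁ y * k₂ y,
    (hg₁.mul hk₂).add (hk₁.mul hg₂), hk₁.mul hk₂, ?_⟩
  filter_upwards [e₁, e₂] with y a b
  refine ⟨mul_ne_zero a.1 b.1, ?_⟩
  rw [a.2, b.2, div_add_div _ _ a.1 b.1]

theorem IsMeromorphic.const_mul {f : E → ℂ} (c : ℂ) (hf : IsMeromorphic f) :
    IsMeromorphic (fun x => c * f x) := by
  intro x
  obtain ⟨g, k, hg, hk, e⟩ := hf x
  refine ⟨fun y => c * g y, k, analyticAt_const.mul hg, hk, ?_⟩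
  filter_upwards [e] with y a
  exact ⟨a.1, by rw [a.2, mul_div_assoc]⟩

theorem IsMeromorphic.comp_homeo {f : F → ℂ} (hf : IsMeromorphic f) (φ : E ≃ₜ F)
    (hφ : ∀ x, AnalyticAt ℂ φ x) : IsMeromorphic (fun x => f (φ x)) := by
  intro x
  obtain ⟨g, k, hg, hk, e⟩ := hf (φ x)
  refine ⟨fun y => g (φ y), fun y => k (φ y), AnalyticAt.comp hg (hφ x),
    AnalyticAt.comp hk (hφ x), ?_⟩
  have : Tendsto φ (𝓝 x ⊓ generic E) (𝓝 (φ x) ⊓ generic F) :=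
    Tendsto.inf (φ.continuous.tendsto x) (generic_tendsto φ)
  exact this.eventually e

end Meromorphic

/-! ## The hyperoctahedral group and the affine Weyl group of type `C_n` -/

/-- The hyperoctahedral group `S_n ⋉ {±1}^n`. -/
abbrev HypOct (n : ℕ) : Type :=
  (Fin n → ℤˣ) ⋊[(mulAutArrow : Equiv.Perm (Fin n) →* MulAut (Fin n → ℤˣ))] Equiv.Perm (Fin n)

/-- Action of the hyperoctahedral group by permutations and sign changes of the coordinates. -/
def HypOct.act {n : ℕ} {A : Type*} [AddCommGroup A] (w : HypOct n) (x : Fin n → A) : Fin n → A :=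
  fun i => w.left i • x (w.right⁻¹ i)

theorem HypOct.act_one {n : ℕ} {A : Type*} [AddCommGroup A] (x : Fin n → A) :
    (1 : HypOct n).act x = x := by
  funext i; simp [HypOct.act]

theorem HypOct.act_mul {n : ℕ} {A : Type*} [AddCommGroup A] (v w : HypOct n) (x : Fin n → A) :
    (v * w).act x = v.act (w.act x) := by
  funext i
  change (v.left i * w.left (v.right⁻¹ i)) • x (w.right⁻¹ (v.right⁻¹ i)) =
    v.left i • w.left (v.right⁻¹ i) • x (w.right⁻¹ (v.right⁻¹ i))
  rw [mul_smul]

theorem HypOct.act_add {n : ℕ} {A : Type*} [AddCommGroup A] (w : HypOct n) (x y : Fin n → A) :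
    w.act (x + y) = w.act x + w.act y := by
  funext i; simp [HypOct.act]

/-- The action of the hyperoctahedral group on the lattice `ℤ^n`, by group automorphisms. -/
def HypOct.latticeAut (n : ℕ) : HypOct n →* MulAut (Multiplicative (Fin n → ℤ)) where
  toFun w :=
    { toFun := fun l => Multiplicative.ofAdd (w.act l.toAdd)
      invFun := fun l => Multiplicative.ofAdd (w⁻¹.act l.toAdd)
      left_inv := fun l => by simp [← HypOct.act_mul, HypOct.act_one]
      right_inv := fun l => by simp [← HypOct.act_mul, HypOct.act_one]
      map_mul' := fun l m => by simp [HypOct.act_add] }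
  map_one' := by ext1 l; simp [HypOct.act_one]
  map_mul' := fun v w => by ext1 l; simp [HypOct.act_mul]

/-- The affine Weyl group `W = W₀ ⋉ ℤ^n` of type `C_n`. -/
abbrev AffWeyl (n : ℕ) : Type := Multiplicative (Fin n → ℤ) ⋊[HypOct.latticeAut n] HypOct n

namespace AffWeyl

variable {n : ℕ}

/-- The translation `τ(λ)`. -/
def tau (l : Fin n → ℤ) : AffWeyl n := SemidirectProduct.inl (Multiplicative.ofAdd l)

/-- The transposition of the coordinates `i` and `j`. -/
def swap (i j : Fin n) : AffWeyl n :=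
  SemidirectProduct.inr (SemidirectProduct.inr (Equiv.swap i j))

/-- The sign change of the coordinate `i`. -/
def flip (i : Fin n) : AffWeyl n :=
  SemidirectProduct.inr (SemidirectProduct.inl (Function.update 1 i (-1)))

/-- The affine reflection sending `z_i` to `1 - z_i` and fixing the other coordinates. -/
def affFlip (i : Fin n) : AffWeyl n := tau (Pi.single i 1) * flip i

/-- The action of `W` on `ℂ^n`: `W₀` acts by signed permutations and `τ(λ) z = z + λ`. -/
def act (w : AffWeyl n) (z : Fin n → ℂ) : Fin n → ℂ :=
  fun i => w.right.act z i + ((w.left.toAdd i : ℤ) : ℂ)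

theorem act_one (z : Fin n → ℂ) : (1 : AffWeyl n).act z = z := by
  funext i; simp [act, HypOct.act_one]

theorem act_mul (v w : AffWeyl n) (z : Fin n → ℂ) : (v * w).act z = v.act (w.act z) := by
  funext i
  have hs : ∀ (e : ℤˣ) (m : ℤ), ((e • m : ℤ) : ℂ) = e • (m : ℂ) := by
    intro e m
    rcases Int.units_eq_one_or e with rfl | rfl <;> simp
  have h1 : (v * w).right.act z i = v.right.act (w.right.act z) i := by
    rw [SemidirectProduct.mul_right, HypOct.act_mul]
  have h2 : (v * w).left.toAdd i = v.left.toAdd i + v.right.act w.left.toAdd i := rfl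
  have h3 : v.right.act (w.act z) i =
      v.right.act (w.right.act z) i + ((v.right.act w.left.toAdd i : ℤ) : ℂ) := by
    simp only [HypOct.act, act, smul_add, hs]
  simp only [act] at h3 ⊢
  rw [h1, h2, h3]
  push_cast
  ring

end AffWeyl

/-! ## Vector-valued meromorphic functions and difference operators -/

/-- The space `ℂ^n × ℂ` of the variables `(z, ξ)`. -/
abbrev Vars (n : ℕ) : Type := (Fin n → ℂ) × ℂ

/-- `(ℂ²)^{⊗n}` in coordinates with respect to the basis `v_ε = v_{ε₁} ⊗ ⋯ ⊗ v_{ε_n}`,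
`ε ∈ {±1}^n`. -/
abbrev Spin (n : ℕ) : Type := (Fin n → ℤˣ) → ℂ

/-- Linear operators on `(ℂ²)^{⊗n}`; the entry at `(ε', ε)` is the coefficient of `v_{ε'}` in the
image of `v_ε`. -/
abbrev SpinOp (n : ℕ) : Type := Matrix (Fin n → ℤˣ) (Fin n → ℤˣ) ℂ

/-- The eigenvalue of `h` on `v_ε`, that is, the sign `ε` as a complex number. -/
def wt (ε : ℤˣ) : ℂ := ((ε : ℤ) : ℂ)

/-- The space of `(ℂ²)^{⊗n}`-valued meromorphic functions on `ℂ^n × ℂ`; functions that agree on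
a dense open set are identified. -/
def MeroSpin (n : ℕ) : Submodule ℂ (Germ (generic (Vars n)) (Spin n)) where
  carrier := {F | ∃ f : Vars n → Spin n, (∀ ε, IsMeromorphic fun x => f x ε) ∧ F = ↑f}
  zero_mem' := ⟨fun _ => 0, fun _ => IsMeromorphic.zero, rfl⟩
  add_mem' := by
    rintro _ _ ⟨f, hf, rfl⟩ ⟨g, hg, rfl⟩
    exact ⟨fun x => f x + g x, fun ε => (hf ε).add (hg ε), rfl⟩
  smul_mem' := by
    rintro c _ ⟨f, hf, rfl⟩
    exact ⟨fun x => c • f x, fun ε => (hf ε).const_mul c, rfl⟩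

/-- The linear operator `D` on meromorphic functions is given by the formula `f ↦ Φ f`. -/
def ActsAs {n : ℕ} (D : Module.End ℂ (MeroSpin n)) (Φ : (Vars n → Spin n) → Vars n → Spin n) :
    Prop :=
  ∀ (f : Vars n → Spin n) (hf : (f : Germ (generic (Vars n)) (Spin n)) ∈ MeroSpin n),
    ((D ⟨f, hf⟩ : MeroSpin n) : Germ (generic (Vars n)) (Spin n)) = ↑(Φ f)

/-- `D` is a difference operator in `ξ` whose matrix coefficients are meromorphic in `(z, ξ)`:
`(D f)(z, ξ) = ∑_{a ∈ s} c_a(z, ξ) f(z, ξ + a)` with `s` a finite set of complex numbers. -/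
def IsDifferenceOperator {n : ℕ} (D : Module.End ℂ (MeroSpin n)) : Prop :=
  ∃ (s : Finset ℂ) (c : ℂ → Vars n → SpinOp n),
    (∀ a ∈ s, ∀ ε' ε, IsMeromorphic fun x => c a x ε' ε) ∧
    ActsAs D fun f x => ∑ a ∈ s, (c a x).mulVec (f (x.1, x.2 + a))

/-- The homeomorphism `(z, ξ) ↦ (u z, ξ)` of `ℂ^n × ℂ`. -/
def varsHomeo {n : ℕ} (u : AffWeyl n) : Vars n ≃ₜ Vars n where
  toFun x := (u.act x.1, x.2)
  invFun x := (u⁻¹.act x.1, x.2)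
  left_inv x := by simp [← AffWeyl.act_mul, AffWeyl.act_one]
  right_inv x := by simp [← AffWeyl.act_mul, AffWeyl.act_one]
  continuous_toFun := by
    unfold AffWeyl.act HypOct.act; simp only [Units.smul_def, zsmul_eq_mul]; fun_prop
  continuous_invFun := by
    unfold AffWeyl.act HypOct.act; simp only [Units.smul_def, zsmul_eq_mul]; fun_prop

theorem varsHomeo_analyticAt {n : ℕ} (u : AffWeyl n) (x : Vars n) :
    AnalyticAt ℂ (varsHomeo u) x := by
  have h : ∀ i, AnalyticAt ℂ (fun y : Vars n => y.1 i) x := fun i =>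
    ((ContinuousLinearMap.proj (R := ℂ) (φ := fun _ : Fin n => ℂ) i).comp
      (ContinuousLinearMap.fst ℂ (Fin n → ℂ) ℂ)).analyticAt x
  refine AnalyticAt.prod (f := fun y : Vars n => u.act y.1) (g := fun y : Vars n => y.2) ?_
    analyticAt_snd
  rw [analyticAt_pi_iff]
  intro i
  simp only [AffWeyl.act, HypOct.act, Units.smul_def, zsmul_eq_mul]
  exact (analyticAt_const.mul (h _)).add analyticAt_const

/-- The action of `W` on meromorphic functions through the spectral parameters,
`(u f)(z, ξ) = f(u⁻¹ z, ξ)`. -/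
def weylAct {n : ℕ} (u : AffWeyl n) : Module.End ℂ (MeroSpin n) where
  toFun F := ⟨F.1.compTendsto (varsHomeo u⁻¹) (generic_tendsto _), by
    obtain ⟨_, f, hf, rfl⟩ := F
    exact ⟨fun x => f (varsHomeo u⁻¹ x),
      fun ε => (hf ε).comp_homeo (varsHomeo u⁻¹) (varsHomeo_analyticAt _), rfl⟩⟩
  map_add' F G := by
    obtain ⟨_, f, hf, rfl⟩ := F
    obtain ⟨_, g, hg, rfl⟩ := G
    rfl
  map_smul' c F := by
    obtain ⟨_, f, hf, rfl⟩ := F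
    rfl

/-- The substitution `D(z) ↦ D(u⁻¹ z)` in the coefficients of a difference operator in `ξ`. -/
def substOp {n : ℕ} (u : AffWeyl n) (D : Module.End ℂ (MeroSpin n)) : Module.End ℂ (MeroSpin n) :=
  weylAct u * D * weylAct u⁻¹

/-- A `W`-cocycle of difference operators in `ξ` depending meromorphically on `z`:
`M^e(z) = Id` and `M^{uv}(z) = M^u(z) M^v(u⁻¹ z)`. -/
structure IsCocycle {n : ℕ} (M : AffWeyl n → Module.End ℂ (MeroSpin n)) : Prop where
  isDifferenceOperator : ∀ v, IsDifferenceOperator (M v)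
  map_one : M 1 = 1
  map_mul : ∀ u v, M (u * v) = M u * substOp u (M v)

/-! ## Dynamical `R`- and `K`-matrices on `ℂ²` -/

/-- The operator `S_{ij}` on `(ℂ²)^{⊗n}` for a family `S` of operators on `ℂ² ⊗ ℂ²`; the operator
may depend on the weights `ε` of the basis vector `v_ε` it is applied to, as in
`S_{ij}(ξ + α h_k) v_ε = S_{ij}(ξ + α ε_k) v_ε`. -/
def leg₂ {n : ℕ} (i j : Fin n) (S : (Fin n → ℤˣ) → Matrix (ℤˣ × ℤˣ) (ℤˣ × ℤˣ) ℂ) : SpinOp n :=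
  Matrix.of fun ε' ε =>
    if ∀ k, k ≠ i → k ≠ j → ε' k = ε k then S ε (ε' i, ε' j) (ε i, ε j) else 0

/-- The operator `S_i` on `(ℂ²)^{⊗n}` for a family `S` of operators on `ℂ²`, which may depend on
the weights of the basis vector it is applied to. -/
def leg₁ {n : ℕ} (i : Fin n) (S : (Fin n → ℤˣ) → Matrix ℤˣ ℤˣ ℂ) : SpinOp n :=
  Matrix.of fun ε' ε => if ∀ k, k ≠ i → ε' k = ε k then S ε (ε' i) (ε i) else 0

/-- The operator permuting the tensor legs `i` and `j`. -/
def permOp {n : ℕ} (i j : Fin n) : SpinOp n :=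
  Matrix.of fun ε' ε => if ε' = ε ∘ Equiv.swap i j then 1 else 0

/-- Families of linear operators on `ℂ² ⊗ ℂ²` depending on `(z, ξ)`. -/
abbrev RFamily : Type := ℂ → ℂ → Matrix (ℤˣ × ℤˣ) (ℤˣ × ℤˣ) ℂ

/-- Families of linear operators on `ℂ²` depending on `(z, ξ)`. -/
abbrev KFamily : Type := ℂ → ℂ → Matrix ℤˣ ℤˣ ℂ

/-- `R` is a dynamical `R`-matrix with step parameter `κ`: a meromorphic family satisfying the
dynamical quantum Yang-Baxter equation. -/
structure IsDynamicalR (κ : ℂ) (R : RFamily) : Prop where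
  meromorphic : ∀ ν μ, IsMeromorphic fun p : ℂ × ℂ => R p.1 p.2 ν μ
  yangBaxter : ∀ᶠ p : (Fin 3 → ℂ) × ℂ in generic ((Fin 3 → ℂ) × ℂ),
    let z := p.1
    let ξ := p.2
    (leg₂ (n := 3) 0 1 fun ε => R (z 0 - z 1) (ξ - 2 * κ * wt (ε 2))) *
        (leg₂ 0 2 fun _ => R (z 0 - z 2) ξ) *
        (leg₂ 1 2 fun ε => R (z 1 - z 2) (ξ - 2 * κ * wt (ε 0))) =
      (leg₂ 1 2 fun _ => R (z 1 - z 2) ξ) *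
        (leg₂ 0 2 fun ε => R (z 0 - z 2) (ξ - 2 * κ * wt (ε 1))) *
        (leg₂ 0 1 fun _ => R (z 0 - z 1) ξ)

/-- The ice rule: `R(z, ξ)` commutes with `h₁ + h₂`. -/
def IceRule (R : RFamily) : Prop :=
  ∀ᶠ p : ℂ × ℂ in generic (ℂ × ℂ),
    Commute (R p.1 p.2) (Matrix.diagonal fun μ : ℤˣ × ℤˣ => wt μ.1 + wt μ.2)

/-- Unitarity of a dynamical `R`-matrix: `R₂₁(z, ξ) R(-z, ξ) = Id`. -/
def IsUnitaryR (R : RFamily) : Prop :=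
  ∀ᶠ p : ℂ × ℂ in generic (ℂ × ℂ),
    (leg₂ (n := 2) 1 0 fun _ => R p.1 p.2) * (leg₂ 0 1 fun _ => R (-p.1) p.2) = 1

/-- `K` is a right dynamical `K`-matrix with respect to `R`: a meromorphic family satisfying the
right dynamical reflection equation. -/
structure IsRightDynamicalK (κ : ℂ) (R : RFamily) (K : KFamily) : Prop where
  meromorphic : ∀ ν μ, IsMeromorphic fun p : ℂ × ℂ => K p.1 p.2 ν μ
  reflection : ∀ᶠ p : (Fin 2 → ℂ) × ℂ in generic ((Fin 2 → ℂ) × ℂ),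
    let z := p.1
    let ξ := p.2
    (leg₂ (n := 2) 1 0 fun _ => R (z 0 - z 1) (2 * ξ)) *
        (leg₁ 0 fun ε => K (z 0) (ξ - κ * wt (ε 1))) *
        (leg₂ 0 1 fun _ => R (z 0 + z 1) (2 * ξ)) *
        (leg₁ 1 fun ε => K (z 1) (ξ - κ * wt (ε 0))) =
      (leg₁ 1 fun ε => K (z 1) (ξ - κ * wt (ε 0))) *
        (leg₂ 1 0 fun _ => R (z 0 + z 1) (2 * ξ)) *
        (leg₁ 0 fun ε => K (z 0) (ξ - κ * wt (ε 1))) *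
        (leg₂ 0 1 fun _ => R (z 0 - z 1) (2 * ξ))

/-- `K` is a left dynamical `K`-matrix with respect to `R`: a meromorphic family satisfying the
left dynamical reflection equation. -/
structure IsLeftDynamicalK (κ : ℂ) (R : RFamily) (K : KFamily) : Prop where
  meromorphic : ∀ ν μ, IsMeromorphic fun p : ℂ × ℂ => K p.1 p.2 ν μ
  reflection : ∀ᶠ p : (Fin 2 → ℂ) × ℂ in generic ((Fin 2 → ℂ) × ℂ),
    let z := p.1
    let ξ := p.2
    (leg₂ (n := 2) 0 1 fun ε => R (z 0 - z 1) (2 * ξ + 2 * κ * (wt (ε 0) + wt (ε 1)))) *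
        (leg₁ 0 fun ε => K (z 0) (ξ + κ * wt (ε 1))) *
        (leg₂ 1 0 fun ε => R (z 0 + z 1) (2 * ξ + 2 * κ * (wt (ε 0) + wt (ε 1)))) *
        (leg₁ 1 fun ε => K (z 1) (ξ + κ * wt (ε 0))) =
      (leg₁ 1 fun ε => K (z 1) (ξ + κ * wt (ε 0))) *
        (leg₂ 0 1 fun ε => R (z 0 + z 1) (2 * ξ + 2 * κ * (wt (ε 0) + wt (ε 1)))) *
        (leg₁ 0 fun ε => K (z 0) (ξ + κ * wt (ε 1))) *
        (leg₂ 1 0 fun ε => R (z 0 - z 1) (2 * ξ + 2 * κ * (wt (ε 0) + wt (ε 1))))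

/-- Unitarity of a (left or right) dynamical `K`-matrix: `K(z, ξ) K(-z, ξ) = Id`. -/
def IsUnitaryK (K : KFamily) : Prop :=
  ∀ᶠ p : ℂ × ℂ in generic (ℂ × ℂ), K p.1 p.2 * K (-p.1) p.2 = 1

/-! ## The boundary quantum KZB equations -/

/-- The shift operator `T_{α h_i}` in `ξ`: the `v_ε`-component of `T_{α h_i} f` at `(z, ξ)` is the
`v_ε`-component of `f` at `(z, ξ + α ε_i)`. -/
def weightShift {n : ℕ} (α : ℂ) (i : Fin n) (f : Vars n → Spin n) : Vars n → Spin n :=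
  fun x ε => f (x.1, x.2 + α * wt (ε i)) ε

/-- The prescribed values at the simple reflections of `W` of the cocycle attached to an `R`-matrix
`R`, a left `K`-matrix `Kl` and a right `K`-matrix `Kr`. -/
structure HasGeneratorValues {n : ℕ} (κ : ℂ) (R : RFamily) (Kl Kr : KFamily)
    (M : AffWeyl n → Module.End ℂ (MeroSpin n)) : Prop where
  /-- `M^{s_0}(z) = T_{-κ h₁} ∘ (Kl)₁(1/2 - z₁, ·) ∘ T_{κ h₁}` -/
  left_boundary : ∀ i : Fin n, (i : ℕ) = 0 → ActsAs (M (AffWeyl.affFlip i)) fun f =>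
    weightShift (-κ) i fun x =>
      (leg₁ i fun _ => Kl (1 / 2 - x.1 i) x.2).mulVec (weightShift κ i f x)
  /-- `M^{s_i}(z, ξ) = P_{i,i+1} R_{i,i+1}(z_i - z_{i+1}, 2ξ - 2κ(h₁ + ⋯ + h_{i-1}))` -/
  bulk : ∀ i j : Fin n, (j : ℕ) = i + 1 → ActsAs (M (AffWeyl.swap i j)) fun f x =>
    (permOp i j * leg₂ i j fun ε =>
      R (x.1 i - x.1 j) (2 * x.2 - 2 * κ * ∑ k ∈ Finset.Iio i, wt (ε k))).mulVec (f x)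
  /-- `M^{s_n}(z, ξ) = (Kr)_n(z_n, ξ - κ(h₁ + ⋯ + h_{n-1}))` -/
  right_boundary : ∀ i : Fin n, (i : ℕ) + 1 = n → ActsAs (M (AffWeyl.flip i)) fun f x =>
    (leg₁ i fun ε => Kr (x.1 i) (x.2 - κ * ∑ k ∈ Finset.Iio i, wt (ε k))).mulVec (f x)

/-- The operator `f ↦ M^{τ(λ)}(z) f(z - λ, ·)` on the left-hand side of the boundary quantum KZB
equations `M^{τ(λ)}(z) f(z - λ, ·) = f(z, ·)`, `λ ∈ ℤ^n`. -/
def kzbOp {n : ℕ} (M : AffWeyl n → Module.End ℂ (MeroSpin n)) (l : Fin n → ℤ) :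
    Module.End ℂ (MeroSpin n) :=
  M (AffWeyl.tau l) * weylAct (AffWeyl.tau l)

/-- The equations `M^{τ(λ)}(z) f(z - λ, ·) = f(z, ·)`, `λ ∈ ℤ^n`, form a compatible system:
`M^{τ(λ)}(z) M^{τ(μ)}(z - λ) = M^{τ(μ)}(z) M^{τ(λ)}(z - μ)`, and the operators on the left-hand
sides represent the group `ℤ^n`. -/
structure IsCompatibleSystem {n : ℕ} (M : AffWeyl n → Module.End ℂ (MeroSpin n)) : Prop where
  comm : ∀ l m, M (AffWeyl.tau l) * substOp (AffWeyl.tau l) (M (AffWeyl.tau m)) =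
    M (AffWeyl.tau m) * substOp (AffWeyl.tau m) (M (AffWeyl.tau l))
  kzbOp_zero : kzbOp M 0 = 1
  kzbOp_add : ∀ l m, kzbOp M (l + m) = kzbOp M l * kzbOp M m

/-- `f` is elliptic (of the second kind) in the direction `e`: for both periods `p = 1` and
`p = 2πi / log q` one has `f(x + p e) = exp(ℓ(x)) f(x)` with `ℓ` an affine function that does not
depend on the variable in the direction `e`. -/
def IsEllipticAlong (q : ℝ) {E : Type*} [NormedAddCommGroup E] [NormedSpace ℂ E] (e : E)
    (f : E → ℂ) : Prop :=
  ∀ p : ℂ, p = 1 ∨ p = 2 * Real.pi * Complex.I / Real.log q →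
    ∃ ℓ : E →ᵃ[ℂ] ℂ, ℓ.linear e = 0 ∧ ∀ᶠ x in generic E, f (x + p • e) = Complex.exp (ℓ x) * f x

/-- `f` is a meromorphic function on `ℂ^n × ℂ` that is elliptic (of the second kind) in each of the
variables `z₁, …, z_n` and `ξ`. -/
def IsElliptic {n : ℕ} (q : ℝ) (f : Vars n → ℂ) : Prop :=
  IsMeromorphic f ∧ (∀ j, IsEllipticAlong q ((Pi.single j 1, 0) : Vars n) f) ∧
    IsEllipticAlong q ((0, 1) : Vars n) f

/-- `D` is a difference operator in `ξ` with step `2κ` and elliptic coefficients: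
`(D f)(z, ξ) = ∑_{k ∈ s} c_k(z, ξ) f(z, ξ + 2κk)` with `s` a finite set of integers and all the
matrix entries of the `c_k` elliptic. -/
def HasEllipticCoefficients {n : ℕ} (q : ℝ) (κ : ℂ) (D : Module.End ℂ (MeroSpin n)) : Prop :=
  ∃ (s : Finset ℤ) (c : ℤ → Vars n → SpinOp n),
    (∀ k ∈ s, ∀ ε' ε, IsElliptic q fun x => c k x ε' ε) ∧
    ActsAs D fun f x => ∑ k ∈ s, (c k x).mulVec (f (x.1, x.2 + 2 * κ * k))

/-! ## Baxter's dynamical `R`-matrix and the associated `K`-matrices -/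

/-- The renormalised Jacobi theta function `θ(x; q) = ∏_{j ≥ 0} (1 - q^j x)(1 - q^{j+1} / x)`. -/
def theta (q : ℝ) (x : ℂ) : ℂ :=
  ∏' j : ℕ, ((1 - (q : ℂ) ^ j * x) * (1 - (q : ℂ) ^ (j + 1) / x))

/-- `A_Ba(z, ξ) = θ(q^{-z}, q^{2κ+ξ}; q) / θ(q^{2κ-z}, q^ξ; q)` -/
def ABa (q : ℝ) (κ z ξ : ℂ) : ℂ :=
  (theta q ((q : ℂ) ^ (-z)) * theta q ((q : ℂ) ^ (2 * κ + ξ))) /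
    (theta q ((q : ℂ) ^ (2 * κ - z)) * theta q ((q : ℂ) ^ ξ))

/-- `B_Ba(z, ξ) = θ(q^{-z-ξ}, q^{2κ}; q) / θ(q^{2κ-z}, q^{-ξ}; q)` -/
def BBa (q : ℝ) (κ z ξ : ℂ) : ℂ :=
  (theta q ((q : ℂ) ^ (-z - ξ)) * theta q ((q : ℂ) ^ (2 * κ))) /
    (theta q ((q : ℂ) ^ (2 * κ - z)) * theta q ((q : ℂ) ^ (-ξ)))

/-- Baxter's dynamical `R`-matrix.  With respect to the ordered basis
`v₊⊗v₊, v₊⊗v₋, v₋⊗v₊, v₋⊗v₋` it is the matrix with rows `(1, 0, 0, 0)`,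
`(0, A_Ba(z, ξ), B_Ba(z, ξ), 0)`, `(0, B_Ba(z, -ξ), A_Ba(z, -ξ), 0)`, `(0, 0, 0, 1)`. -/
def RBa (q : ℝ) (κ : ℂ) : RFamily := fun z ξ => Matrix.of fun ν μ =>
  if ν = μ then (if ν.1 = ν.2 then 1 else ABa q κ z (wt ν.1 * ξ))
  else if ν = μ.swap then BBa q κ z (wt ν.1 * ξ)
  else 0

/-- The boundary coupling parameters `(ζ, ζ', υ, υ')`. -/
structure BoundaryParams where
  ζ : ℂ
  ζ' : ℂ
  υ : ℂ
  υ' : ℂ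

/-- The duality involution, which interchanges `υ` and `ζ'`. -/
def BoundaryParams.dual (P : BoundaryParams) : BoundaryParams := ⟨P.ζ, P.υ, P.ζ', P.υ'⟩

/-- The function
`𝓒(z, ξ) = θ(ã q^ξ, b̃ q^ξ, c̃ q^ξ, d q^{ξ-z} / ã; q) / θ(q^{2ξ}, d q^{-z}; q)
  * q^{-(ζ+υ-z)(ζ+ζ'-ξ)}`,
where `ã = q^{ζ+ζ'}`, `b̃ = -q^{ζ-ζ'}`, `c̃ = q^{1/2+υ+υ'}` and `d = -q^{1/2+ζ'-υ'}`.  The function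
`𝓒~` is obtained from it by the duality involution. -/
def Cfun (q : ℝ) (P : BoundaryParams) (z ξ : ℂ) : ℂ :=
  let a' : ℂ := (q : ℂ) ^ (P.ζ + P.ζ')
  let b' : ℂ := -(q : ℂ) ^ (P.ζ - P.ζ')
  let c' : ℂ := (q : ℂ) ^ (1 / 2 + P.υ + P.υ')
  let d : ℂ := -(q : ℂ) ^ (1 / 2 + P.ζ' - P.υ')
  (theta q (a' * (q : ℂ) ^ ξ) * theta q (b' * (q : ℂ) ^ ξ) * theta q (c' * (q : ℂ) ^ ξ) *
        theta q (d * (q : ℂ) ^ (ξ - z) / a')) /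
      (theta q ((q : ℂ) ^ (2 * ξ)) * theta q (d * (q : ℂ) ^ (-z))) *
    (q : ℂ) ^ (-((P.ζ + P.υ - z) * (P.ζ + P.ζ' - ξ)))

/-- `α_Ba(z, ξ) = (𝓒(z, ξ) - 𝓒~(ξ, z)) / 𝓒~(ξ, -z) * q^{2zξ}` -/
def alphaBa (q : ℝ) (P : BoundaryParams) (z ξ : ℂ) : ℂ :=
  (Cfun q P z ξ - Cfun q P.dual ξ z) / Cfun q P.dual ξ (-z) * (q : ℂ) ^ (2 * z * ξ)

/-- `β_Ba(z, ξ) = 𝓒(z, ξ) / 𝓒~(-ξ, -z)` -/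
def betaBa (q : ℝ) (P : BoundaryParams) (z ξ : ℂ) : ℂ :=
  Cfun q P z ξ / Cfun q P.dual (-ξ) (-z)

/-- The `K`-matrix `K_Ba(z, ξ; ζ, ζ', υ, υ')`.  With respect to the ordered basis `v₊, v₋` it is
the matrix with rows `(α_Ba(z, ξ), β_Ba(z, ξ))` and `(β_Ba(z, -ξ), α_Ba(z, -ξ))`. -/
def KBa (q : ℝ) (P : BoundaryParams) : KFamily := fun z ξ => Matrix.of fun ν μ =>
  if ν = μ then alphaBa q P z (wt ν * ξ) else betaBa q P z (wt ν * ξ)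

/-- The left `K`-matrix `K_Ba(z, -ξ; ζ, ζ', υ, υ')`. -/
def KBaLeft (q : ℝ) (P : BoundaryParams) : KFamily := fun z ξ => KBa q P z (-ξ)

end

/-! Put [ξ] = q^{-ξ/2} θ(q^ξ; q) and p = 2πi/log q. All entries of R and K are built from brackets
[·] and powers of q. The analytic engine is the rigidity of theta functions: an entire function with
the multipliers of a product of m brackets, vanishing at m points that are incongruent modulo ℤ +
ℤp, is the product of the corresponding brackets times a theta function of degree zero
(`IsThetaLike.exists_eq_mul_prod`). The latter is a multiple of an exponential, so it vanishes
identically if it has a zero or if its exponent lies off the lattice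
(`IsThetaLike.eq_zero_of_br_ne_zero`). This gives Weierstrass's three-term identity, and with it
Fay's identity for the Kronecker function [x + a]/([x][a]).

Up to a scalar, the zero-weight block of R has a diagonal independent of z and Kronecker functions
off the diagonal. The dynamical Yang-Baxter equation becomes seven scalar relations
(`iceOp_yangBaxter`), which follow from Fay's and Weierstrass's identities.

Up to a factor depending on z alone, the off-diagonal entry of K depends on the dynamical variable x
alone. The diagonal entry has a partial fraction expansion into four Kronecker functions with poles
in x at the half periods, the coefficients depending on neither z nor x (`aFrac_eq_aSer`). The
relations that the reflection equation demands beyond unitarity are linear in the diagonal entry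
(`iceOp_bdryOp_reflection`), so they can be checked for one Kronecker function, where they come from
Fay's identity (`halfKron_four_term`). The expansion is odd under (x, z) ↦ (-x, -z), which the
closed formula hides; this oddness yields unitarity (`aSer_mul_add`). The left equation is the right
one at -ξ.

Cocycles M correspond to representations ρ of W through ρ(v) = M^v · v, with v acting on the
spectral parameters. The prescribed values fix ρ on the simple reflections. These generate W, hence
uniqueness. For existence, W is presented by the Coxeter relations of affine type C
(`IsAffineTypeC.exists_hom`); the involution, braid and reflection relations are unitarity,
Yang-Baxter and the two reflection equations, and the commutations follow from conservation of
weight. Compatibility of the system is commutativity of ℤ^n.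

For ellipticity, the multipliers of the generators under a shift by a period are written as
differences of one gauge function, taken at the source and at the target of each matrix entry. This
form survives products (`IsTwistedOperator.mul`), and for a translation the difference is affine in
the variables that are not shifted (`isElliptic_of_isQuasiPeriodic`). -/

noncomputable section

/-! ## The theta function in additive notation -/

/-- The second period `2πi / log q` of the function `ξ ↦ q^ξ`. -/
def qper (q : ℝ) : ℂ := 2 * Real.pi * Complex.I / Real.log q

/-- The `q`-shifted factorial `(x; q)_∞`. -/
def qPoch (q : ℝ) (x : ℂ) : ℂ := ∏' j : ℕ, (1 - (q : ℂ) ^ j * x)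

/-- The odd theta function `[ξ] = q^{-ξ/2} θ(q^ξ; q)`. -/
def br (q : ℝ) (ξ : ℂ) : ℂ := (q : ℂ) ^ (-ξ / 2) * theta q ((q : ℂ) ^ ξ)

section Basic

variable {q : ℝ}

theorem ofReal_q_ne_zero (hq0 : 0 < q) : (q : ℂ) ≠ 0 := by exact_mod_cast hq0.ne'

theorem log_q_ne_zero (hq0 : 0 < q) (hq1 : q < 1) : (Real.log q : ℂ) ≠ 0 := by
  exact_mod_cast (Real.log_neg hq0 hq1).ne

theorem qpow_eq_exp (hq0 : 0 < q) (x : ℂ) : (q : ℂ) ^ x = Complex.exp (Real.log q * x) := by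
  rw [Complex.cpow_def_of_ne_zero (ofReal_q_ne_zero hq0), Complex.ofReal_log hq0.le]

theorem qpow_add (hq0 : 0 < q) (x y : ℂ) : (q : ℂ) ^ (x + y) = (q : ℂ) ^ x * (q : ℂ) ^ y :=
  Complex.cpow_add _ _ (ofReal_q_ne_zero hq0)

theorem qpow_ne_zero (hq0 : 0 < q) (x : ℂ) : (q : ℂ) ^ x ≠ 0 := by
  rw [qpow_eq_exp hq0]; exact Complex.exp_ne_zero _

theorem qpow_differentiable (hq0 : 0 < q) : Differentiable ℂ fun x : ℂ => (q : ℂ) ^ x := by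
  have : (fun x : ℂ => (q : ℂ) ^ x) = fun x => Complex.exp (Real.log q * x) :=
    funext (qpow_eq_exp hq0)
  rw [this]; fun_prop

theorem log_mul_qper (hq0 : 0 < q) (hq1 : q < 1) :
    (Real.log q : ℂ) * qper q = 2 * Real.pi * Complex.I := by
  have := log_q_ne_zero hq0 hq1
  rw [qper]; field_simp

theorem qpow_eq_one_iff (hq0 : 0 < q) (hq1 : q < 1) (x : ℂ) :
    (q : ℂ) ^ x = 1 ↔ ∃ n : ℤ, x = n * qper q := by
  have h := log_q_ne_zero hq0 hq1
  rw [qpow_eq_exp hq0, Complex.exp_eq_one_iff]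
  refine exists_congr fun n => ?_
  rw [← log_mul_qper hq0 hq1]
  constructor
  · intro e
    apply mul_left_cancel₀ h
    rw [e]; ring
  · rintro rfl; ring

theorem qpow_qper (hq0 : 0 < q) (hq1 : q < 1) : (q : ℂ) ^ qper q = 1 :=
  (qpow_eq_one_iff hq0 hq1 _).2 ⟨1, by simp⟩

theorem qpow_half_qper (hq0 : 0 < q) (hq1 : q < 1) : (q : ℂ) ^ (qper q / 2) = -1 := by
  rw [qpow_eq_exp hq0, mul_div_assoc', log_mul_qper hq0 hq1,
    show 2 * Real.pi * Complex.I / 2 = Real.pi * Complex.I by ring, Complex.exp_pi_mul_I]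

theorem summable_qpow_mul (hq0 : 0 < q) (hq1 : q < 1) (x : ℂ) :
    Summable fun j : ℕ => ‖-((q : ℂ) ^ j * x)‖ := by
  have : ‖(q : ℂ)‖ < 1 := by simpa [abs_of_pos hq0] using hq1
  simpa [norm_neg, norm_mul, norm_pow] using
    (summable_geometric_of_lt_one (norm_nonneg (q : ℂ)) this).mul_right ‖x‖

theorem multipliable_qPoch (hq0 : 0 < q) (hq1 : q < 1) (x : ℂ) :
    Multipliable fun j : ℕ => 1 - (q : ℂ) ^ j * x := by
  simpa [sub_eq_add_neg] using multipliable_one_add_of_summable (summable_qpow_mul hq0 hq1 x)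

theorem qPoch_eq_mul (hq0 : 0 < q) (hq1 : q < 1) (x : ℂ) :
    qPoch q x = (1 - x) * qPoch q (q * x) := by
  have h : (fun j : ℕ => 1 - (q : ℂ) ^ (j + 1) * x) = fun j : ℕ => 1 - (q : ℂ) ^ j * (q * x) := by
    funext j; ring
  rw [qPoch, qPoch, tprod_eq_zero_mul' (h ▸ multipliable_qPoch hq0 hq1 (q * x)), h]
  simp

/-- An absolutely convergent product of nonzero factors is nonzero. Conversely, j applications of
`qPoch_eq_mul` bring a point with q^j x = 1 to the zero of the first factor. -/
theorem qPoch_eq_zero_iff (hq0 : 0 < q) (hq1 : q < 1) (x : ℂ) :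
    qPoch q x = 0 ↔ ∃ j : ℕ, (q : ℂ) ^ j * x = 1 := by
  constructor
  · intro h
    by_contra! hne
    refine tprod_one_add_ne_zero_of_summable (f := fun j : ℕ => -((q : ℂ) ^ j * x)) ?_
      (summable_qpow_mul hq0 hq1 x) (by simpa [qPoch, sub_eq_add_neg] using h)
    intro j
    rw [← sub_eq_add_neg, sub_ne_zero]
    exact (hne j).symm
  · rintro ⟨j, hj⟩
    induction j generalizing x with
    | zero => rw [qPoch_eq_mul hq0 hq1]; simp at hj; simp [hj]
    | succ k ih =>
      rw [qPoch_eq_mul hq0 hq1, ih (q * x) (by rw [← hj]; ring), mul_zero]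

/-- On a compact set the factors are dominated by a geometric series, so the partial products, which
are polynomials, converge locally uniformly. -/
theorem qPoch_differentiable (hq0 : 0 < q) (hq1 : q < 1) : Differentiable ℂ (qPoch q) := by
  have hq : ‖(q : ℂ)‖ < 1 := by simpa [abs_of_pos hq0] using hq1
  have h : HasProdLocallyUniformlyOn (fun (j : ℕ) (x : ℂ) => 1 + -((q : ℂ) ^ j * x))
      (fun x => ∏' j : ℕ, (1 + -((q : ℂ) ^ j * x))) Set.univ := by
    apply hasProdLocallyUniformlyOn_of_forall_compact isOpen_univ
    intro K _ hK
    obtain ⟨C, hC⟩ := hK.isBounded.exists_norm_le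
    apply Summable.hasProdUniformlyOn_nat_one_add (u := fun j => ‖(q : ℂ)‖ ^ j * C) hK
      ((summable_geometric_of_lt_one (norm_nonneg _) hq).mul_right C)
    · filter_upwards with j x hx
      rw [norm_neg, norm_mul, norm_pow]
      exact mul_le_mul_of_nonneg_left (hC x hx) (by positivity)
    · intro j; fun_prop
  have h2 := (h.tendstoLocallyUniformlyOn_finsetRange).differentiableOn
    (.of_forall fun s => by fun_prop) isOpen_univ
  rw [differentiableOn_univ] at h2
  have : qPoch q = fun x => ∏' j : ℕ, (1 + -((q : ℂ) ^ j * x)) := by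
    funext x; simp [qPoch, sub_eq_add_neg]
  rw [this]; exact h2

theorem theta_eq_qPoch (hq0 : 0 < q) (hq1 : q < 1) (x : ℂ) :
    theta q x = qPoch q x * qPoch q (q / x) := by
  have h : ∀ j : ℕ, (q : ℂ) ^ (j + 1) / x = (q : ℂ) ^ j * (q / x) := fun j => by ring
  rw [theta, qPoch, qPoch, ← Multipliable.tprod_mul (multipliable_qPoch hq0 hq1 x)
    (multipliable_qPoch hq0 hq1 (q / x))]
  simp only [h]

/-- The factor 1 - q^ξ of the first factorial is merged with q^{-ξ/2} into an odd function, and the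
remaining product is even. Oddness, the zero at 0 and the derivative there can be read off. -/
theorem br_eq_qPoch (hq0 : 0 < q) (hq1 : q < 1) (ξ : ℂ) :
    br q ξ = ((q : ℂ) ^ (-ξ / 2) - (q : ℂ) ^ (ξ / 2)) *
      (qPoch q ((q : ℂ) ^ (1 + ξ)) * qPoch q ((q : ℂ) ^ (1 - ξ))) := by
  have h0 := ofReal_q_ne_zero hq0
  have e1 : (q : ℂ) / (q : ℂ) ^ ξ = (q : ℂ) ^ (1 - ξ) := by
    rw [Complex.cpow_sub _ _ h0, Complex.cpow_one]
  have e2 : (q : ℂ) * (q : ℂ) ^ ξ = (q : ℂ) ^ (1 + ξ) := by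
    rw [Complex.cpow_add _ _ h0, Complex.cpow_one]
  have e3 : (q : ℂ) ^ (-ξ / 2) * (q : ℂ) ^ ξ = (q : ℂ) ^ (ξ / 2) := by
    rw [← qpow_add hq0]; congr 1; ring
  rw [br, theta_eq_qPoch hq0 hq1, e1, qPoch_eq_mul hq0 hq1 ((q : ℂ) ^ ξ), e2, ← e3]
  ring

theorem br_neg (hq0 : 0 < q) (hq1 : q < 1) (ξ : ℂ) : br q (-ξ) = -br q ξ := by
  rw [br_eq_qPoch hq0 hq1, br_eq_qPoch hq0 hq1, neg_neg, sub_neg_eq_add, ← sub_eq_add_neg]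
  ring

theorem br_zero (hq0 : 0 < q) (hq1 : q < 1) : br q 0 = 0 := by
  simp [br_eq_qPoch hq0 hq1]

theorem br_add_one (hq0 : 0 < q) (hq1 : q < 1) (ξ : ℂ) :
    br q (ξ + 1) = -(q : ℂ) ^ (-1 / 2 - ξ) * br q ξ := by
  have h0 := ofReal_q_ne_zero hq0
  have e1 : (q : ℂ) / (q : ℂ) ^ (ξ + 1) = (q : ℂ) ^ (-ξ) := by
    nth_rw 1 [← Complex.cpow_one (q : ℂ)]
    rw [← Complex.cpow_sub _ _ h0]; congr 1; ring
  have e2 : (q : ℂ) * (q : ℂ) ^ (-ξ) = (q : ℂ) ^ (1 - ξ) := by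
    rw [sub_eq_add_neg, Complex.cpow_add _ _ h0, Complex.cpow_one]
  have e3 : (q : ℂ) ^ (-(ξ + 1) / 2) = (q : ℂ) ^ (-1 / 2 - ξ) * (q : ℂ) ^ (ξ / 2) := by
    rw [← qpow_add hq0]; congr 1; ring
  have e4 : (q : ℂ) ^ (-(ξ + 1) / 2) * (q : ℂ) ^ (-ξ) =
      (q : ℂ) ^ (-1 / 2 - ξ) * (q : ℂ) ^ (-ξ / 2) := by
    rw [← qpow_add hq0, ← qpow_add hq0]; congr 1; ring
  rw [br, theta_eq_qPoch hq0 hq1, e1, qPoch_eq_mul hq0 hq1 ((q : ℂ) ^ (-ξ)), e2,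
    br_eq_qPoch hq0 hq1, add_comm 1 ξ]
  linear_combination qPoch q ((q : ℂ) ^ (ξ + 1)) * qPoch q ((q : ℂ) ^ (1 - ξ)) * (e3 - e4)

theorem br_add_qper (hq0 : 0 < q) (hq1 : q < 1) (ξ : ℂ) : br q (ξ + qper q) = -br q ξ := by
  have h := qpow_half_qper hq0 hq1
  have e : (q : ℂ) ^ (-(ξ + qper q) / 2) * (q : ℂ) ^ (qper q / 2) = (q : ℂ) ^ (-ξ / 2) := by
    rw [← qpow_add hq0]; congr 1; ring
  rw [br, qpow_add hq0, qpow_qper hq0 hq1, mul_one, br, ← e, h]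
  ring

theorem br_differentiable (hq0 : 0 < q) (hq1 : q < 1) : Differentiable ℂ (br q) := by
  have h := qpow_differentiable hq0
  have hp := qPoch_differentiable hq0 hq1
  have : br q = fun ξ => ((q : ℂ) ^ (-ξ / 2) - (q : ℂ) ^ (ξ / 2)) *
      (qPoch q ((q : ℂ) ^ (1 + ξ)) * qPoch q ((q : ℂ) ^ (1 - ξ))) :=
    funext (br_eq_qPoch hq0 hq1)
  rw [this]
  exact ((h.comp (by fun_prop)).sub (h.comp (by fun_prop))).mul
    ((hp.comp (h.comp (by fun_prop))).mul (hp.comp (h.comp (by fun_prop))))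

/-- Quasi-periodicity of `[ξ]` with respect to the lattice `ℤ + ℤ p`. -/
theorem br_add_lattice (hq0 : 0 < q) (hq1 : q < 1) (m n : ℤ) (ξ : ℂ) :
    br q (ξ + m + n * qper q) =
      (-1) ^ (m + n) * (q : ℂ) ^ (-(m : ℂ) ^ 2 / 2 - m * ξ) * br q ξ := by
  have hper : ∀ (n : ℤ) (x : ℂ), br q (x + n * qper q) = (-1) ^ n * br q x := by
    intro n x
    induction n with
    | zero => simp
    | succ i ih =>
      have := br_add_qper hq0 hq1 (x + i * qper q)
      push_cast at ih ⊢
      rw [show x + ((i : ℂ) + 1) * qper q = x + i * qper q + qper q by ring, this, ih,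
        zpow_add_one₀ (by norm_num)]
      ring
    | pred i ih =>
      have := br_add_qper hq0 hq1 (x + (-(i : ℂ) - 1) * qper q)
      push_cast at ih ⊢
      rw [show x + (-(i : ℂ) - 1) * qper q + qper q = x + -(i : ℂ) * qper q by ring, ih] at this
      rw [zpow_sub_one₀ (by norm_num), inv_neg_one]
      linear_combination this
  have hone : ∀ (m : ℤ) (x : ℂ),
      br q (x + m) = (-1) ^ m * (q : ℂ) ^ (-(m : ℂ) ^ 2 / 2 - m * x) * br q x := by
    intro m x
    induction m with
    | zero => simp
    | succ i ih =>
      have := br_add_one hq0 hq1 (x + i)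
      push_cast at ih ⊢
      rw [← add_assoc, this, ih, zpow_add_one₀ (by norm_num),
        show -((i : ℂ) + 1) ^ 2 / 2 - ((i : ℂ) + 1) * x =
          (-1 / 2 - (x + i)) + (-(i : ℂ) ^ 2 / 2 - i * x) by ring, qpow_add hq0]
      ring
    | pred i ih =>
      have := br_add_one hq0 hq1 (x + (-(i : ℂ) - 1))
      push_cast at ih ⊢
      rw [show x + (-(i : ℂ) - 1) + 1 = x + -(i : ℂ) by ring, ih] at this
      rw [show -(-(i : ℂ)) ^ 2 / 2 - -(i : ℂ) * x = (-1 / 2 - (x + (-(i : ℂ) - 1))) +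
        (-(-(i : ℂ) - 1) ^ 2 / 2 - (-(i : ℂ) - 1) * x) by ring, qpow_add hq0] at this
      rw [zpow_sub_one₀ (by norm_num), inv_neg_one]
      apply mul_left_cancel₀ (qpow_ne_zero hq0 (-1 / 2 - (x + (-(i : ℂ) - 1))))
      linear_combination this
  rw [hper, hone, zpow_add₀ (by norm_num)]
  ring

/-- The factorial in q^ξ accounts for the zeros with nonpositive integral part, the one in q^{1-ξ}
for those with positive integral part. -/
theorem br_eq_zero_iff (hq0 : 0 < q) (hq1 : q < 1) (ξ : ℂ) :
    br q ξ = 0 ↔ ∃ m n : ℤ, ξ = m + n * qper q := by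
  constructor
  · intro h
    rw [br, theta_eq_qPoch hq0 hq1, mul_eq_zero, mul_eq_zero] at h
    have key : ∀ (j : ℕ) (x : ℂ), (q : ℂ) ^ j * (q : ℂ) ^ x = 1 → ∃ n : ℤ, x = n * qper q - j := by
      intro j x hx
      rw [← Complex.cpow_natCast, ← qpow_add hq0, qpow_eq_one_iff hq0 hq1] at hx
      obtain ⟨n, hn⟩ := hx
      exact ⟨n, by linear_combination hn⟩
    rcases h with h | h | h
    · exact absurd h (qpow_ne_zero hq0 _)
    · obtain ⟨j, hj⟩ := (qPoch_eq_zero_iff hq0 hq1 _).1 h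
      obtain ⟨n, hn⟩ := key j ξ hj
      exact ⟨-j, n, by rw [hn]; push_cast; ring⟩
    · obtain ⟨j, hj⟩ := (qPoch_eq_zero_iff hq0 hq1 _).1 h
      have e1 : (q : ℂ) / (q : ℂ) ^ ξ = (q : ℂ) ^ (1 - ξ) := by
        rw [Complex.cpow_sub _ _ (ofReal_q_ne_zero hq0), Complex.cpow_one]
      rw [e1] at hj
      obtain ⟨n, hn⟩ := key j _ hj
      exact ⟨1 + j, -n, by push_cast; linear_combination -hn⟩
  · rintro ⟨m, n, rfl⟩
    have := br_add_lattice hq0 hq1 m n 0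
    rw [zero_add, br_zero hq0 hq1, mul_zero] at this
    exact this

/-- In the factorisation `br_eq_qPoch` the odd factor has slope -log q at 0 and the even one takes
the nonzero value (q; q)_∞². -/
theorem deriv_br_zero_ne_zero (hq0 : 0 < q) (hq1 : q < 1) : deriv (br q) 0 ≠ 0 := by
  have h := qpow_differentiable hq0
  have hp := qPoch_differentiable hq0 hq1
  have e : br q = fun ξ => ((q : ℂ) ^ (-ξ / 2) - (q : ℂ) ^ (ξ / 2)) *
      (qPoch q ((q : ℂ) ^ (1 + ξ)) * qPoch q ((q : ℂ) ^ (1 - ξ))) :=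
    funext (br_eq_qPoch hq0 hq1)
  have hr : DifferentiableAt ℂ
      (fun ξ : ℂ => qPoch q ((q : ℂ) ^ (1 + ξ)) * qPoch q ((q : ℂ) ^ (1 - ξ))) 0 := by
    have h1 : Differentiable ℂ fun ξ : ℂ => qPoch q ((q : ℂ) ^ (1 + ξ)) :=
      hp.comp (h.comp (f := fun ξ : ℂ => 1 + ξ) (by fun_prop))
    have h2 : Differentiable ℂ fun ξ : ℂ => qPoch q ((q : ℂ) ^ (1 - ξ)) :=
      hp.comp (h.comp (f := fun ξ : ℂ => 1 - ξ) (by fun_prop))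
    exact (h1.mul h2).differentiableAt
  have hs : HasDerivAt (fun ξ : ℂ => (q : ℂ) ^ (-ξ / 2) - (q : ℂ) ^ (ξ / 2)) (-Real.log q) 0 := by
    simp only [qpow_eq_exp hq0]
    have h1 : HasDerivAt (fun ξ : ℂ => Complex.exp (Real.log q * (-ξ / 2)))
        (Complex.exp (Real.log q * (-0 / 2)) * (Real.log q * (-1 / 2))) 0 :=
      ((((hasDerivAt_id (0 : ℂ)).neg).div_const 2).const_mul _).cexp
    have h2 : HasDerivAt (fun ξ : ℂ => Complex.exp (Real.log q * (ξ / 2)))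
        (Complex.exp (Real.log q * (0 / 2)) * (Real.log q * (1 / 2))) 0 :=
      (((hasDerivAt_id (0 : ℂ)).div_const 2).const_mul _).cexp
    exact (h1.sub h2).congr_deriv (by simp only [neg_zero, zero_div, mul_zero, Complex.exp_zero]; ring)
  have hd := (hs.mul hr.hasDerivAt).deriv
  have e' : br q = (fun ξ : ℂ => (q : ℂ) ^ (-ξ / 2) - (q : ℂ) ^ (ξ / 2)) *
      (fun ξ : ℂ => qPoch q ((q : ℂ) ^ (1 + ξ)) * qPoch q ((q : ℂ) ^ (1 - ξ))) := e
  rw [e', hd]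
  have : qPoch q ((q : ℂ) ^ (1 : ℂ)) ≠ 0 := by
    intro hz
    obtain ⟨j, hj⟩ := (qPoch_eq_zero_iff hq0 hq1 _).1 hz
    rw [Complex.cpow_one, ← pow_succ] at hj
    have hj' : q ^ (j + 1) = 1 := by exact_mod_cast hj
    exact absurd hj' (pow_lt_one₀ hq0.le hq1 (by omega)).ne
  simp only [add_zero, sub_zero, neg_zero, sub_self, zero_mul]
  exact mul_ne_zero (neg_ne_zero.2 (log_q_ne_zero hq0 hq1)) (mul_ne_zero this this)

end Basic

/-! ## Theta functions of higher degree -/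

/-- By the identity theorem on a connected space, a zero set with an interior point is everything.
-/
theorem dense_ne_zero_of_analytic {E : Type*} [NormedAddCommGroup E] [NormedSpace ℂ E]
    {h : E → ℂ} (hh : ∀ x, AnalyticAt ℂ h x) (x₀ : E) (h0 : h x₀ ≠ 0) : Dense {x | h x ≠ 0} := by
  intro x
  by_contra hx
  rw [mem_closure_iff_frequently, not_frequently] at hx
  have : ∀ᶠ y in 𝓝 x, h y = 0 := by filter_upwards [hx] with y hy using not_not.1 hy
  have := AnalyticOnNhd.eqOn_zero_of_preconnected_of_eventuallyEq_zero
    (fun y _ => hh y) isPreconnected_univ (Set.mem_univ x) this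
  exact h0 (this (Set.mem_univ x₀))

section

variable {q : ℝ}

theorem exists_br_ne_zero (hq0 : 0 < q) (hq1 : q < 1) : ∃ x, br q x ≠ 0 := by
  by_contra! h
  have : br q = fun _ => 0 := funext h
  exact deriv_br_zero_ne_zero hq0 hq1 (by rw [this]; simp)

theorem dense_br_ne_zero (hq0 : 0 < q) (hq1 : q < 1) {c : ℂ} (hc : c ≠ 0) (a : ℂ) :
    Dense {x : ℂ | br q (c * x + a) ≠ 0} := by
  obtain ⟨y, hy⟩ := exists_br_ne_zero hq0 hq1
  have hd : Differentiable ℂ fun x : ℂ => br q (c * x + a) :=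
    (br_differentiable hq0 hq1).comp (by fun_prop)
  refine dense_ne_zero_of_analytic (h := fun x : ℂ => br q (c * x + a))
    (fun x => hd.analyticAt x) ((y - a) / c) ?_
  rw [mul_div_cancel₀ _ hc, sub_add_cancel]
  exact hy

/-- Holomorphic functions with the quasi-periodicity of a product of `m` functions
`ξ ↦ [ξ - a_i]` and a power `q^{bξ}` with `b` an integer. -/
structure IsThetaLike (q : ℝ) (m : ℕ) (e : ℂ) (f : ℂ → ℂ) : Prop where
  differentiable : Differentiable ℂ f
  add_one : ∀ x, f (x + 1) = (-1) ^ m * (q : ℂ) ^ (e - m * x) * f x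
  add_qper : ∀ x, f (x + qper q) = (-1) ^ m * f x

namespace IsThetaLike

variable {m m' : ℕ} {e e' : ℂ} {f g : ℂ → ℂ}

theorem congr_exponent (hf : IsThetaLike q m e f) (h : e = e') : IsThetaLike q m e' f := h ▸ hf

theorem add (hf : IsThetaLike q m e f) (hg : IsThetaLike q m e g) :
    IsThetaLike q m e fun x => f x + g x where
  differentiable := hf.differentiable.add hg.differentiable
  add_one x := by rw [hf.add_one, hg.add_one]; ring
  add_qper x := by rw [hf.add_qper, hg.add_qper]; ring

theorem const_mul (c : ℂ) (hf : IsThetaLike q m e f) : IsThetaLike q m e fun x => c * f x where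
  differentiable := hf.differentiable.const_mul c
  add_one x := by rw [hf.add_one]; ring
  add_qper x := by rw [hf.add_qper]; ring

theorem sub (hf : IsThetaLike q m e f) (hg : IsThetaLike q m e g) :
    IsThetaLike q m e fun x => f x - g x := by
  simpa [sub_eq_add_neg] using hf.add (hg.const_mul (-1))

theorem sum {ι : Type*} (s : Finset ι) {f : ι → ℂ → ℂ} (hf : ∀ i ∈ s, IsThetaLike q m e (f i)) :
    IsThetaLike q m e fun x => ∑ i ∈ s, f i x where
  differentiable := Differentiable.fun_sum fun i hi => (hf i hi).differentiable
  add_one x := by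
    rw [Finset.mul_sum]
    exact Finset.sum_congr rfl fun i hi => (hf i hi).add_one x
  add_qper x := by
    rw [Finset.mul_sum]
    exact Finset.sum_congr rfl fun i hi => (hf i hi).add_qper x

theorem mul (hq0 : 0 < q) (hf : IsThetaLike q m e f) (hg : IsThetaLike q m' e' g) :
    IsThetaLike q (m + m') (e + e') fun x => f x * g x where
  differentiable := hf.differentiable.mul hg.differentiable
  add_one x := by
    rw [hf.add_one, hg.add_one, pow_add, Nat.cast_add,
      show e + e' - ((m : ℂ) + m') * x = (e - m * x) + (e' - m' * x) by ring, qpow_add hq0]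
    ring
  add_qper x := by rw [hf.add_qper, hg.add_qper, pow_add]; ring

theorem prod (hq0 : 0 < q) {ι : Type*} [DecidableEq ι] (s : Finset ι) {e : ι → ℂ} {f : ι → ℂ → ℂ}
    (hf : ∀ i ∈ s, IsThetaLike q 1 (e i) (f i)) :
    IsThetaLike q s.card (∑ i ∈ s, e i) fun x => ∏ i ∈ s, f i x := by
  induction s using Finset.induction_on with
  | empty => exact ⟨by simp, by simp, by simp⟩
  | insert a s ha ih =>
    have h1 := hf a (Finset.mem_insert_self _ _)
    have h2 := ih fun i hi => hf i (Finset.mem_insert_of_mem hi)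
    simp only [Finset.prod_insert ha, Finset.sum_insert ha, Finset.card_insert_of_notMem ha]
    rw [add_comm s.card 1]
    exact h1.mul hq0 h2

theorem br_add (hq0 : 0 < q) (hq1 : q < 1) (t : ℂ) :
    IsThetaLike q 1 (-1 / 2 - t) fun x => br q (x + t) where
  differentiable := (br_differentiable hq0 hq1).comp (by fun_prop)
  add_one x := by
    rw [show x + 1 + t = x + t + 1 by ring, br_add_one hq0 hq1,
      show -1 / 2 - (x + t) = -1 / 2 - t - (1 : ℕ) * x by push_cast; ring]
    ring
  add_qper x := by
    rw [show x + qper q + t = x + t + qper q by ring, br_add_qper hq0 hq1]; ring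

theorem br_sub (hq0 : 0 < q) (hq1 : q < 1) (t : ℂ) :
    IsThetaLike q 1 (-1 / 2 + t) fun x => br q (t - x) := by
  have h : (fun x => br q (t - x)) = fun x => (-1) * br q (x + -t) := by
    funext x
    rw [show t - x = -(x + -t) by ring, br_neg hq0 hq1]; ring
  rw [h]
  exact ((br_add hq0 hq1 (-t)).const_mul _).congr_exponent (by ring)

theorem qpow (hq0 : 0 < q) (hq1 : q < 1) : IsThetaLike q 0 1 fun x => (q : ℂ) ^ x where
  differentiable := qpow_differentiable hq0
  add_one x := by rw [qpow_add hq0]; simp; ring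
  add_qper x := by rw [qpow_add hq0, qpow_qper hq0 hq1]; simp

/-- Adding a period to x adds twice that period to 2x, and multipliers are quadratic in the period;
hence degree 2² = 4. -/
theorem br_two_mul (hq0 : 0 < q) (hq1 : q < 1) :
    IsThetaLike q 4 (-2) fun x => br q (2 * x) where
  differentiable := (br_differentiable hq0 hq1).comp (by fun_prop)
  add_one x := by
    have := br_add_lattice hq0 hq1 2 0 (2 * x)
    push_cast at this
    rw [show 2 * (x + 1) = 2 * x + 2 + 0 * qper q by ring, this,
      show -(2 : ℂ) ^ 2 / 2 - 2 * (2 * x) = -2 - (4 : ℕ) * x by push_cast; ring]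
    norm_num
  add_qper x := by
    have := br_add_lattice hq0 hq1 0 2 (2 * x)
    push_cast at this
    rw [show 2 * (x + qper q) = 2 * x + 0 + 2 * qper q by ring, this]
    norm_num

/-- A theta function of degree zero is a multiple of an exponential function. -/
theorem eq_exp (hq0 : 0 < q) (hq1 : q < 1) (hf : IsThetaLike q 0 e f) :
    ∃ C, ∀ x, f x = C * (q : ℂ) ^ ((e.re : ℂ) * x) := by
  have hL := log_q_ne_zero hq0 hq1
  -- Multiplication by q^{-rx} with r = Re e makes both multipliers constants of modulus one. Then
  -- |h| is doubly periodic, hence bounded, and Liouville's theorem applies.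
  set r : ℂ := (e.re : ℂ) with hr
  let h : ℂ → ℂ := fun x => (q : ℂ) ^ (-r * x) * f x
  have hd : Differentiable ℂ h :=
    ((qpow_differentiable hq0).comp (f := fun x => -r * x) (by fun_prop)).mul hf.differentiable
  have nrm : ∀ x : ℂ, ‖(q : ℂ) ^ x‖ = Real.exp (Real.log q * x.re) := by
    intro x
    rw [qpow_eq_exp hq0, Complex.norm_exp, Complex.re_ofReal_mul]
  have h1 : ∀ x, ‖h (x + 1)‖ = ‖h x‖ := by
    intro x
    have e1 : (q : ℂ) ^ (-r * (x + 1)) * (q : ℂ) ^ (e - (0 : ℕ) * x) =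
        (q : ℂ) ^ (e - r) * (q : ℂ) ^ (-r * x) := by
      rw [← qpow_add hq0, ← qpow_add hq0]; congr 1; push_cast; ring
    have e2 : h (x + 1) = (q : ℂ) ^ (e - r) * h x := by
      simp only [h, hf.add_one]
      linear_combination f x * e1
    rw [e2, norm_mul, nrm]
    simp [hr]
  have h2 : ∀ x, ‖h (x + qper q)‖ = ‖h x‖ := by
    intro x
    have e1 : h (x + qper q) = (q : ℂ) ^ (-r * qper q) * h x := by
      simp only [h, hf.add_qper, mul_add, qpow_add hq0]
      ring
    rw [e1, norm_mul, qpow_eq_exp hq0,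
      show (Real.log q : ℂ) * (-r * qper q) = ((-e.re * (2 * Real.pi) : ℝ) : ℂ) * Complex.I by
        rw [show (Real.log q : ℂ) * (-r * qper q) = -r * (Real.log q * qper q) by ring,
          log_mul_qper hq0 hq1]
        push_cast; ring, Complex.norm_exp_ofReal_mul_I, one_mul]
  have h3 : ∀ (n : ℤ) x, ‖h (x + n)‖ = ‖h x‖ := by
    intro n
    induction n with
    | zero => simp
    | succ i ih => intro x; push_cast at ih ⊢; rw [← add_assoc, h1, ih]
    | pred i ih =>
      intro x; push_cast at ih ⊢
      rw [← h1, show x + (-(i : ℂ) - 1) + 1 = x + -(i : ℂ) by ring, ih]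
  have h4 : ∀ (n : ℤ) x, ‖h (x + n * qper q)‖ = ‖h x‖ := by
    intro n
    induction n with
    | zero => simp
    | succ i ih => intro x; push_cast at ih ⊢; rw [add_mul, one_mul, ← add_assoc, h2, ih]
    | pred i ih =>
      intro x; push_cast at ih ⊢
      rw [← h2, show x + (-(i : ℂ) - 1) * qper q + qper q = x + -(i : ℂ) * qper q by ring, ih]
  have hK : IsCompact ((fun p : ℝ × ℝ => (p.1 : ℂ) + p.2 * qper q) ''
      (Set.Icc 0 1 ×ˢ Set.Icc 0 1)) :=
    (isCompact_Icc.prod isCompact_Icc).image (by fun_prop)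
  obtain ⟨B, hB⟩ := hK.exists_bound_of_continuousOn hd.continuous.continuousOn
  have hbd : ∀ x, ‖h x‖ ≤ B := by
    intro x
    -- The coordinate of x along the purely imaginary period; subtracting integral parts moves x
    -- into the fundamental parallelogram.
    set y : ℝ := x.im * Real.log q / (2 * Real.pi) with hy
    have hx : x = (x.re : ℂ) + y * qper q := by
      have hp : (Real.pi : ℂ) ≠ 0 := by exact_mod_cast Real.pi_ne_zero
      conv_lhs => rw [← Complex.re_add_im x]
      rw [hy, qper]; push_cast; field_simp
    have key : x = ((Int.fract x.re : ℝ) : ℂ) + (Int.fract y : ℝ) * qper q + (⌊y⌋ : ℤ) * qper q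
        + (⌊x.re⌋ : ℤ) := by
      have e1 : ((Int.fract x.re : ℝ) : ℂ) + (⌊x.re⌋ : ℤ) = x.re := by
        exact_mod_cast Int.fract_add_floor x.re
      have e2 : ((Int.fract y : ℝ) : ℂ) + (⌊y⌋ : ℤ) = y := by
        exact_mod_cast Int.fract_add_floor y
      linear_combination hx - e1 - qper q * e2
    rw [key, h3, h4]
    apply hB
    exact ⟨(Int.fract x.re, Int.fract y), ⟨⟨Int.fract_nonneg _, (Int.fract_lt_one _).le⟩,
      ⟨Int.fract_nonneg _, (Int.fract_lt_one _).le⟩⟩, rfl⟩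
  have hc : ∀ x, h x = h 0 := fun x => hd.apply_eq_apply_of_bounded
    (isBounded_iff_forall_norm_le.2 ⟨B, by rintro _ ⟨x, rfl⟩; exact hbd x⟩) x 0
  refine ⟨h 0, fun x => ?_⟩
  rw [← hc x]
  have e1 : (q : ℂ) ^ (-r * x) * (q : ℂ) ^ (r * x) = 1 := by
    rw [← qpow_add hq0]; simp
  simp only [h]
  linear_combination -f x * e1

/-- A nonzero f equals C q^{x Re e}. Invariance under p forces Re e to be an integer n, and the
shift by 1 then forces q^{e-n} = 1. So e lies in the lattice, where the bracket vanishes. -/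
theorem eq_zero_of_br_ne_zero (hq0 : 0 < q) (hq1 : q < 1) (hf : IsThetaLike q 0 e f)
    (he : br q e ≠ 0) (x : ℂ) : f x = 0 := by
  obtain ⟨C, hC⟩ := hf.eq_exp hq0 hq1
  by_contra hx
  have hC0 : C ≠ 0 := by rintro rfl; exact hx (by rw [hC]; simp)
  have h1 := hf.add_one 0
  have h2 := hf.add_qper 0
  simp only [hC, zero_add, mul_zero, mul_one, pow_zero, one_mul, Nat.cast_zero, sub_zero,
    Complex.cpow_zero] at h1 h2
  have h2' : (q : ℂ) ^ ((e.re : ℂ) * qper q) = 1 := mul_left_cancel₀ hC0 (by rw [h2, mul_one])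
  obtain ⟨n, hn⟩ := (qpow_eq_one_iff hq0 hq1 _).1 h2'
  have hp : qper q ≠ 0 := by
    intro h
    have := log_mul_qper hq0 hq1
    rw [h, mul_zero] at this
    exact Complex.two_pi_I_ne_zero this.symm
  have hre : (e.re : ℂ) = n := mul_right_cancel₀ hp hn
  have h1' : (q : ℂ) ^ (e - n) = 1 := by
    apply mul_left_cancel₀ (qpow_ne_zero hq0 (n : ℂ))
    rw [← qpow_add hq0, ← hre, add_sub_cancel, mul_one]
    apply mul_left_cancel₀ hC0
    rw [h1]; ring
  obtain ⟨k, hk⟩ := (qpow_eq_one_iff hq0 hq1 _).1 h1'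
  exact he ((br_eq_zero_iff hq0 hq1 e).2 ⟨n, k, by linear_combination hk⟩)

theorem eq_zero_of_apply_eq_zero (hq0 : 0 < q) (hq1 : q < 1) (hf : IsThetaLike q 0 e f)
    {b : ℂ} (hb : f b = 0) (x : ℂ) : f x = 0 := by
  obtain ⟨C, hC⟩ := hf.eq_exp hq0 hq1
  have : C = 0 := by
    rw [hC] at hb
    exact (mul_eq_zero.1 hb).resolve_right (qpow_ne_zero hq0 _)
  rw [hC, this, zero_mul]

theorem apply_add_lattice (hq0 : 0 < q) (hf : IsThetaLike q m e f) {a : ℂ} (ha : f a = 0)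
    (i j : ℤ) : f (a + i + j * qper q) = 0 := by
  have h1 : ∀ (i : ℤ) (a : ℂ), f a = 0 → f (a + i) = 0 := by
    intro i a ha
    induction i with
    | zero => simpa using ha
    | succ i ih => push_cast at ih ⊢; rw [← add_assoc, hf.add_one, ih, mul_zero]
    | pred i ih =>
      push_cast at ih ⊢
      have := hf.add_one (a + (-(i : ℂ) - 1))
      rw [show a + (-(i : ℂ) - 1) + 1 = a + -(i : ℂ) by ring, ih] at this
      simpa [qpow_ne_zero hq0] using this.symm
  have h2 : ∀ (i : ℤ) (a : ℂ), f a = 0 → f (a + i * qper q) = 0 := by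
    intro i a ha
    induction i with
    | zero => simpa using ha
    | succ i ih =>
      push_cast at ih ⊢; rw [add_mul, one_mul, ← add_assoc, hf.add_qper, ih, mul_zero]
    | pred i ih =>
      push_cast at ih ⊢
      have := hf.add_qper (a + (-(i : ℂ) - 1) * qper q)
      rw [show a + (-(i : ℂ) - 1) * qper q + qper q = a + -(i : ℂ) * qper q by ring, ih] at this
      simpa using this.symm
  exact h2 j _ (h1 i a ha)

/-- Quasi-periodicity transports the simple zero at 0 to every lattice point, because the multiplier
has no zeros. -/
theorem deriv_br_ne_zero (hq0 : 0 < q) (hq1 : q < 1) {w : ℂ} (hw : br q w = 0) :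
    deriv (br q) w ≠ 0 := by
  obtain ⟨m, n, rfl⟩ := (br_eq_zero_iff hq0 hq1 w).1 hw
  set w : ℂ := m + n * qper q
  have h1 : deriv (fun x => br q (x + w)) 0 = deriv (br q) w := by
    rw [deriv_comp_add_const, zero_add]
  have hu : DifferentiableAt ℂ
      (fun x : ℂ => (-1 : ℂ) ^ (m + n) * (q : ℂ) ^ (-(m : ℂ) ^ 2 / 2 - m * x)) 0 :=
    (((qpow_differentiable hq0).comp (f := fun x : ℂ => -(m : ℂ) ^ 2 / 2 - m * x)
      (by fun_prop)).const_mul _).differentiableAt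
  have h2 := hu.hasDerivAt.mul (br_differentiable hq0 hq1 0).hasDerivAt
  have h3 : (fun x => br q (x + w)) =
      (fun x : ℂ => (-1 : ℂ) ^ (m + n) * (q : ℂ) ^ (-(m : ℂ) ^ 2 / 2 - m * x)) * br q := by
    funext x
    simp only [Pi.mul_apply, w, ← br_add_lattice hq0 hq1]
    congr 1; ring
  rw [← h1, h3, h2.deriv, br_zero hq0 hq1, mul_zero, zero_add]
  exact mul_ne_zero (mul_ne_zero (zpow_ne_zero _ (by norm_num)) (qpow_ne_zero hq0 _))
    (deriv_br_zero_ne_zero hq0 hq1)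

/-- The zeros of [x - a] are simple and form the coset of a, and f vanishes on this coset by its own
quasi-periodicity. Hence the quotient is entire; its multipliers are the quotients of the
multipliers. -/
theorem exists_eq_mul_br (hq0 : 0 < q) (hq1 : q < 1) (hf : IsThetaLike q (m + 1) e f) {a : ℂ}
    (ha : f a = 0) :
    ∃ g, IsThetaLike q m (e + 1 / 2 - a) g ∧ ∀ x, f x = g x * br q (x - a) := by
  classical
  let θ : ℂ → ℂ := fun x => br q (x - a)
  have hθ : Differentiable ℂ θ := (br_differentiable hq0 hq1).comp (by fun_prop)
  -- At a common zero the quotient takes its limit, the ratio of the derivatives.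
  let g : ℂ → ℂ := fun x => if θ x = 0 then deriv f x / deriv θ x else f x / θ x
  have hfg : ∀ x, f x = g x * θ x := by
    intro x
    by_cases hx : θ x = 0
    · obtain ⟨i, j, hij⟩ := (br_eq_zero_iff hq0 hq1 _).1 hx
      rw [hx, mul_zero, show x = a + i + j * qper q by linear_combination hij]
      exact hf.apply_add_lattice hq0 ha i j
    · simp [g, hx]
  have hdθ : ∀ x, θ x = 0 → deriv θ x ≠ 0 := by
    intro x hx
    have : deriv θ x = deriv (br q) (x - a) := deriv_comp_sub_const ..
    rw [this]
    exact deriv_br_ne_zero hq0 hq1 hx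
  have hg : Differentiable ℂ g := by
    intro b
    by_cases hb : θ b = 0
    -- Near a common zero b the quotient agrees with the ratio of the difference quotients `dslope f
    -- b` and `dslope θ b`, both holomorphic, the second nonzero at b.
    · have ds : ∀ F : ℂ → ℂ, Differentiable ℂ F → DifferentiableAt ℂ (dslope F b) b := by
        intro F hF
        exact ((Complex.differentiableOn_dslope univ_mem).2 hF.differentiableOn).differentiableAt
          univ_mem
      have hne : dslope θ b b ≠ 0 := by rw [dslope_same]; exact hdθ b hb
      have hfb : f b = 0 := by rw [hfg, hb, mul_zero]
      refine ((ds f hf.differentiable).div (ds θ hθ) hne).congr_of_eventuallyEq ?_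
      filter_upwards [(ds θ hθ).continuousAt.eventually_ne hne] with x hx
      by_cases hxb : x = b
      · subst hxb; simp [g, hb, dslope_same]
      · have h1 := sub_smul_dslope f b x
        have h2 := sub_smul_dslope θ b x
        rw [hfb, sub_zero, smul_eq_mul] at h1
        rw [hb, sub_zero, smul_eq_mul] at h2
        have hxb' : x - b ≠ 0 := sub_ne_zero.2 hxb
        have hθx : θ x ≠ 0 := by rw [← h2]; exact mul_ne_zero hxb' hx
        simp only [g, hθx, if_false, Pi.div_apply]
        rw [← h1, ← h2, mul_div_mul_left _ _ hxb']
    · refine ((hf.differentiable b).div (hθ b) hb).congr_of_eventuallyEq ?_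
      filter_upwards [(hθ b).continuousAt.eventually_ne hb] with x hx
      simp [g, hx]
  -- The factor θ is nonzero on a dense set, so continuous functions may be compared after
  -- multiplication by θ.
  have hcancel : ∀ F G : ℂ → ℂ, Continuous F → Continuous G →
      (∀ x, F x * θ x = G x * θ x) → ∀ x, F x = G x := by
    intro F G hF hG h x
    have hd : Dense {x | θ x ≠ 0} := by
      have := dense_br_ne_zero hq0 hq1 one_ne_zero (-a)
      simpa [θ, sub_eq_add_neg] using this
    exact congrFun (hF.ext_on hd hG fun y hy => mul_right_cancel₀ hy (h y)) x
  have hθ1 : ∀ x, θ (x + 1) = -(q : ℂ) ^ (-1 / 2 - (x - a)) * θ x := fun x => by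
    simp only [θ]; rw [show x + 1 - a = x - a + 1 by ring, br_add_one hq0 hq1]
  have hθ2 : ∀ x, θ (x + qper q) = -θ x := fun x => by
    simp only [θ]; rw [show x + qper q - a = x - a + qper q by ring, br_add_qper hq0 hq1]
  have hqc : Continuous fun x : ℂ => (q : ℂ) ^ (e + 1 / 2 - a - m * x) :=
    (qpow_differentiable hq0).continuous.comp (by fun_prop)
  refine ⟨g, ⟨hg, ?_, ?_⟩, hfg⟩
  · refine hcancel _ _ (hg.continuous.comp (by fun_prop)) ((continuous_const.mul hqc).mul
      hg.continuous) fun x => ?_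
    have h1 := hf.add_one x
    rw [hfg, hfg x, hθ1] at h1
    have e1 : (q : ℂ) ^ (e - (m + 1 : ℕ) * x) =
        (q : ℂ) ^ (-1 / 2 - (x - a)) * (q : ℂ) ^ (e + 1 / 2 - a - m * x) := by
      rw [← qpow_add hq0]; congr 1; push_cast; ring
    rw [e1] at h1
    apply mul_left_cancel₀ (qpow_ne_zero hq0 (-1 / 2 - (x - a)))
    linear_combination -h1
  · refine hcancel _ _ (hg.continuous.comp (by fun_prop)) (continuous_const.mul
      hg.continuous) fun x => ?_
    have h1 := hf.add_qper x
    rw [hfg, hfg x, hθ2] at h1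
    linear_combination -h1

/-- The zeros are split off one at a time; incongruence ensures that a later zero is not used up by
an earlier bracket. The exponent of the remaining factor is the quantity in Abel's theorem: it has
to be a lattice point unless f vanishes. -/
theorem exists_eq_mul_prod (hq0 : 0 < q) (hq1 : q < 1) (a : Fin m → ℂ)
    (ha : ∀ i j, i ≠ j → br q (a i - a j) ≠ 0) (hf : IsThetaLike q m e f) (hz : ∀ i, f (a i) = 0) :
    ∃ g, IsThetaLike q 0 (e + ∑ i, (1 / 2 - a i)) g ∧ ∀ x, f x = g x * ∏ i, br q (x - a i) := by
  induction m generalizing e f with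
  | zero => exact ⟨f, by simpa using hf, by simp⟩
  | succ m ih =>
    obtain ⟨g, hg, hfg⟩ := hf.exists_eq_mul_br hq0 hq1 (hz 0)
    obtain ⟨k, hk, hgk⟩ := ih (fun i => a i.succ) (fun i j hij => ha _ _ (by simpa using hij)) hg
      fun i => by
        have := hfg (a i.succ)
        rw [hz, eq_comm, mul_eq_zero] at this
        exact this.resolve_right (ha _ _ (Fin.succ_ne_zero i))
    refine ⟨k, hk.congr_exponent (by rw [Fin.sum_univ_succ]; ring), fun x => ?_⟩
    rw [hfg, hgk, Fin.prod_univ_succ]; ring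

end IsThetaLike

/-- Weierstrass's three-term identity. -/
theorem br_weierstrass (hq0 : 0 < q) (hq1 : q < 1) (a b c d : ℂ) :
    br q (a + b) * br q (a - b) * br q (c + d) * br q (c - d) -
      br q (a + c) * br q (a - c) * br q (b + d) * br q (b - d) +
      br q (a + d) * br q (a - d) * br q (b + c) * br q (b - c) = 0 := by
  have hc := (br_differentiable hq0 hq1).continuous
  have hodd : ∀ x y, br q (x - y) = -br q (y - x) := fun x y => by
    rw [← br_neg hq0 hq1, neg_sub]
  -- For generic b, c, d the left side is a theta function of degree 2 in a that vanishes at b and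
  -- c. The quotient of degree zero vanishes at d, hence identically. Density and continuity remove
  -- the genericity.
  have key : ∀ b c d, br q (b - c) ≠ 0 → br q (b - d) ≠ 0 → br q (c - d) ≠ 0 → ∀ a,
      br q (a + b) * br q (a - b) * br q (c + d) * br q (c - d) -
      br q (a + c) * br q (a - c) * br q (b + d) * br q (b - d) +
      br q (a + d) * br q (a - d) * br q (b + c) * br q (b - c) = 0 := by
    intro b c d hbc hbd hcd
    -- The exponent of [x + t][x - t] does not depend on t, so the three terms may be added.
    have hth : ∀ t u v, IsThetaLike q 2 (-1) fun x => br q (x + t) * br q (x - t) * u * v := by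
      intro t u v
      have := (((IsThetaLike.br_add hq0 hq1 t).mul hq0 (IsThetaLike.br_add hq0 hq1 (-t))).const_mul
        (u * v)).congr_exponent (e' := -1) (by ring)
      convert this using 2
      rw [← sub_eq_add_neg]; ring
    have hF := ((hth b (br q (c + d)) (br q (c - d))).sub
      (hth c (br q (b + d)) (br q (b - d)))).add (hth d (br q (b + c)) (br q (b - c)))
    obtain ⟨g, hg, hfg⟩ := hF.exists_eq_mul_prod hq0 hq1 ![b, c] (by
        intro i j hij
        fin_cases i <;> fin_cases j <;> simp at hij ⊢
        · exact hbc
        · rw [hodd]; exact neg_ne_zero.2 hbc) (by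
        intro i
        fin_cases i
        · simp [br_zero hq0 hq1]; ring
        · simp only [Fin.mk_one, Matrix.cons_val_one, Matrix.cons_val_fin_one, sub_self,
            br_zero hq0 hq1]
          rw [hodd c b, add_comm c b]; ring)
    have hd0 : g d = 0 := by
      have := hfg d
      simp only [sub_self, br_zero hq0 hq1, Fin.prod_univ_two, Matrix.cons_val_zero,
        Matrix.cons_val_one, Matrix.cons_val_fin_one] at this
      rw [hodd d b, hodd d c, add_comm d b, add_comm d c] at this
      have h2 : g d * (br q (b - d) * br q (c - d)) = 0 := by linear_combination -this
      simpa [hbd, hcd] using h2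
    intro a
    rw [hfg a, hg.eq_zero_of_apply_eq_zero hq0 hq1 hd0, zero_mul]
  have dns : ∀ t : ℂ, Dense {x : ℂ | br q (x - t) ≠ 0} := fun t => by
    simpa [sub_eq_add_neg] using dense_br_ne_zero hq0 hq1 one_ne_zero (-t)
  have opn : ∀ t : ℂ, IsOpen {x : ℂ | br q (x - t) ≠ 0} := fun t =>
    isOpen_ne_fun (hc.comp (by fun_prop)) continuous_const
  have key2 : ∀ c, br q (c - d) ≠ 0 → ∀ b,
      br q (a + b) * br q (a - b) * br q (c + d) * br q (c - d) -
      br q (a + c) * br q (a - c) * br q (b + d) * br q (b - d) +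
      br q (a + d) * br q (a - d) * br q (b + c) * br q (b - c) = 0 := fun c hcd b =>
    congrFun (Continuous.ext_on ((dns c).inter_of_isOpen_left (dns d) (opn c)) (by fun_prop)
      continuous_const fun x hx => key x c d hx.1 hx.2 hcd a) b
  exact congrFun (Continuous.ext_on (dns d) (by fun_prop)
      continuous_const fun x hx => key2 x hx b) c

end

section

variable {q : ℝ}

theorem qper_ne_zero (hq0 : 0 < q) (hq1 : q < 1) : qper q ≠ 0 := by
  intro h
  have := log_mul_qper hq0 hq1
  rw [h, mul_zero] at this
  exact Complex.two_pi_I_ne_zero this.symm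

theorem br_sub_comm (hq0 : 0 < q) (hq1 : q < 1) (x y : ℂ) : br q (x - y) = -br q (y - x) := by
  rw [← br_neg hq0 hq1, neg_sub]

theorem lattice_injective (hq0 : 0 < q) (hq1 : q < 1) {m n m' n' : ℤ}
    (h : (m : ℂ) + n * qper q = m' + n' * qper q) : m = m' ∧ n = n' := by
  have hre : (qper q).re = 0 := by
    have : qper q = ((2 * Real.pi / Real.log q : ℝ) : ℂ) * Complex.I := by
      rw [qper]; push_cast; ring
    rw [this]; simp
  have h1 := congrArg Complex.re h
  simp [hre] at h1
  have h1' : m = m' := by exact_mod_cast h1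
  subst h1'
  have h2 := mul_right_cancel₀ (qper_ne_zero hq0 hq1) (add_left_cancel h)
  exact ⟨rfl, by exact_mod_cast h2⟩

/-! ### Half periods -/

/-- Coordinates of twice the half periods with respect to the periods `1` and `2πi / log q`. -/
def halfCoord (r : Fin 4) : ℤ × ℤ := (![0, 1, 0, -1] r, ![0, 0, 1, -1] r)

/-- Representatives of the half periods, adding up to zero. -/
def halfPer (q : ℝ) (r : Fin 4) : ℂ := ((halfCoord r).1 + (halfCoord r).2 * qper q) / 2

theorem halfPer_sum (q : ℝ) : ∑ r, halfPer q r = 0 := by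
  simp [Fin.sum_univ_four, halfPer, halfCoord]; ring

theorem two_mul_halfPer (q : ℝ) (r : Fin 4) :
    2 * halfPer q r = (halfCoord r).1 + (halfCoord r).2 * qper q := by
  rw [halfPer]; ring

/-- A congruence would make the difference of the integral coordinates even in both components; a
finite check excludes this. -/
theorem br_halfPer_sub_ne_zero (hq0 : 0 < q) (hq1 : q < 1) {r s : Fin 4} (hrs : r ≠ s) :
    br q (halfPer q r - halfPer q s) ≠ 0 := by
  intro h
  obtain ⟨m, n, hmn⟩ := (br_eq_zero_iff hq0 hq1 _).1 h
  have h1 : (((halfCoord r).1 - (halfCoord s).1 : ℤ) : ℂ) +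
      ((halfCoord r).2 - (halfCoord s).2 : ℤ) * qper q = (2 * m : ℤ) + (2 * n : ℤ) * qper q := by
    push_cast
    linear_combination 2 * hmn - two_mul_halfPer q r + two_mul_halfPer q s
  obtain ⟨h2, h3⟩ := lattice_injective hq0 hq1 h1
  revert h2 h3
  fin_cases r <;> fin_cases s <;> simp [halfCoord] at hrs ⊢ <;> omega

theorem br_two_mul_halfPer (hq0 : 0 < q) (hq1 : q < 1) (r : Fin 4) :
    br q (2 * halfPer q r) = 0 :=
  (br_eq_zero_iff hq0 hq1 _).2 ⟨_, _, two_mul_halfPer q r⟩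

/-- The four half periods are zeros of a function of degree 4. Since the representatives add up to
zero, the exponent that remains is -2 + 4/2 = 0, and the quotient is a constant. -/
theorem exists_br_two_mul (hq0 : 0 < q) (hq1 : q < 1) :
    ∃ C : ℂ, C ≠ 0 ∧ ∀ x, br q (2 * x) = C * ∏ r, br q (x - halfPer q r) := by
  obtain ⟨g, hg, h⟩ := (IsThetaLike.br_two_mul hq0 hq1).exists_eq_mul_prod hq0 hq1 (halfPer q)
    (fun i j hij => br_halfPer_sub_ne_zero hq0 hq1 hij) (br_two_mul_halfPer hq0 hq1)
  obtain ⟨C, hC⟩ := hg.eq_exp hq0 hq1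
  have he : ((-2 : ℂ) + ∑ r, (1 / 2 - halfPer q r)).re = 0 := by
    rw [Finset.sum_sub_distrib, halfPer_sum]; norm_num
  simp only [he] at hC
  refine ⟨C, ?_, fun x => by rw [h, hC]; simp⟩
  rintro rfl
  obtain ⟨y, hy⟩ := exists_br_ne_zero hq0 hq1
  apply hy
  rw [show y = 2 * (y / 2) by ring, h, hC]; simp

/-- The constant relating `[2x]` to the product of the `[x - ω]` over the half periods `ω`. -/
def dupConst (q : ℝ) : ℂ := br q (2 * (1 / 4)) / ∏ r, br q (1 / 4 - halfPer q r)

theorem br_two_mul_eq (hq0 : 0 < q) (hq1 : q < 1) (x : ℂ) :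
    br q (2 * x) = dupConst q * ∏ r, br q (x - halfPer q r) := by
  obtain ⟨C, hC, h⟩ := exists_br_two_mul hq0 hq1
  have h4 : br q (2 * (1 / 4)) ≠ 0 := by
    intro h0
    obtain ⟨m, n, hmn⟩ := (br_eq_zero_iff hq0 hq1 _).1 h0
    have : ((1 : ℤ) : ℂ) + (0 : ℤ) * qper q = (2 * m : ℤ) + (2 * n : ℤ) * qper q := by
      push_cast; linear_combination 2 * hmn
    have := (lattice_injective hq0 hq1 this).1
    omega
  rw [dupConst, h (1 / 4), mul_div_assoc, div_self, mul_one, h]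
  intro h0
  rw [h, h0, mul_zero] at h4
  exact h4 rfl

theorem dupConst_ne_zero (hq0 : 0 < q) (hq1 : q < 1) : dupConst q ≠ 0 := by
  intro h
  obtain ⟨y, hy⟩ := exists_br_ne_zero hq0 hq1
  apply hy
  rw [show y = 2 * (y / 2) by ring, br_two_mul_eq hq0 hq1, h, zero_mul]

theorem br_sub_halfPer_ne_zero (hq0 : 0 < q) (hq1 : q < 1) {x : ℂ} (hx : br q (2 * x) ≠ 0)
    (r : Fin 4) : br q (x - halfPer q r) ≠ 0 := by
  rw [br_two_mul_eq hq0 hq1] at hx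
  exact Finset.prod_ne_zero_iff.1 (right_ne_zero_of_mul hx) r (Finset.mem_univ r)

/-! ### The Kronecker function -/

/-- The Kronecker function `[x + a] / ([x] [a])`. -/
def kron (q : ℝ) (x a : ℂ) : ℂ := br q (x + a) / (br q x * br q a)

/-- Weierstrass's identity in coordinates in which the arguments need no halving; three of the four
brackets on the left have independent arguments u, v, w. -/
theorem br_four_term (hq0 : 0 < q) (hq1 : q < 1) (s u v w : ℂ) :
    br q (2 * s - u - v - w) * br q u * br q v * br q w =
      br q s * br q (s - v - w) * br q (s - u - w) * br q (s - u - v) +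
      br q (s - w) * br q (s - v) * br q (s - u) * br q (u + v + w - s) := by
  have h := br_weierstrass hq0 hq1 ((2 * s - v - w) / 2) ((2 * s - 2 * u - v - w) / 2)
    ((v + w) / 2) ((v - w) / 2)
  ring_nf at h ⊢
  have e1 : br q (s - v - w - u) = -br q (-s + v + w + u) := by
    rw [← br_neg hq0 hq1]; congr 1; ring
  rw [e1] at h
  linear_combination h

theorem kron_neg (hq0 : 0 < q) (hq1 : q < 1) (x a : ℂ) : kron q (-x) (-a) = -kron q x a := by
  rw [kron, kron, ← neg_add, br_neg hq0 hq1, br_neg hq0 hq1, br_neg hq0 hq1, neg_mul_neg, neg_div]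

/-- The quadratic parts of the multipliers of [x + a] and [x] cancel, and only a factor linear in a
survives in the exponent. -/
theorem kron_add_lattice (hq0 : 0 < q) (hq1 : q < 1) (m n : ℤ) (x a : ℂ) :
    kron q (x + (m + n * qper q)) a = (q : ℂ) ^ (-(m * a)) * kron q x a := by
  have h1 := br_add_lattice hq0 hq1 m n (x + a)
  have h2 := br_add_lattice hq0 hq1 m n x
  have e : (q : ℂ) ^ (-(m : ℂ) ^ 2 / 2 - m * (x + a)) =
      (q : ℂ) ^ (-(m * a)) * (q : ℂ) ^ (-(m : ℂ) ^ 2 / 2 - m * x) := by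
    rw [← qpow_add hq0]; congr 1; ring
  have hq := qpow_ne_zero hq0 (-(m : ℂ) ^ 2 / 2 - m * x)
  have hs : ((-1 : ℂ) ^ (m + n)) ≠ 0 := zpow_ne_zero _ (by norm_num)
  rw [kron, kron, show x + (m + n * qper q) + a = x + a + m + n * qper q by ring,
    ← add_assoc, h1, h2, e]
  rw [show (-1 : ℂ) ^ (m + n) * ((q : ℂ) ^ (-(m * a)) * (q : ℂ) ^ (-(m : ℂ) ^ 2 / 2 - m * x)) *
      br q (x + a) = ((-1 : ℂ) ^ (m + n) * (q : ℂ) ^ (-(m : ℂ) ^ 2 / 2 - m * x)) *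
        ((q : ℂ) ^ (-(m * a)) * br q (x + a)) by ring, mul_assoc (_ * _) (br q x),
    mul_div_mul_left _ _ (mul_ne_zero hs hq), mul_div_assoc]

/-- Fay's identity, in a form that is valid on the diagonal. -/
theorem kron_fay' (hq0 : 0 < q) (hq1 : q < 1) {x y a b : ℂ} (hx : br q x ≠ 0) (hy : br q y ≠ 0)
    (ha : br q a ≠ 0) (hb : br q b ≠ 0) (hab : br q (a + b) ≠ 0) :
    br q (x - y) * (kron q x a * kron q y b) =
      -(kron q x (a + b) * (br q (y - x + b) / br q b)) +
        kron q y (a + b) * (br q (x - y + a) / br q a) := by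
  have h := br_four_term hq0 hq1 (x + a + b) (x - y + a) x b
  rw [show 2 * (x + a + b) - (x - y + a) - x - b = y + (a + b) by ring,
    show x + a + b - x - b = a by ring, show x + a + b - (x - y + a) - b = y by ring,
    show x + a + b - (x - y + a) - x = y - x + b by ring, show x + a + b - b = x + a by ring,
    show x + a + b - x = a + b by ring, show x + a + b - (x - y + a) = y + b by ring,
    show x - y + a + x + b - (x + a + b) = x - y by ring, add_assoc x a b] at h
  simp only [kron]
  generalize br q (x - y) = c1 at *
  generalize br q (y - x + b) = c2 at *
  generalize br q (x - y + a) = c3 at *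
  generalize br q (x + (a + b)) = c4 at *
  generalize br q (y + (a + b)) = c5 at *
  generalize br q (x + a) = c6 at *
  generalize br q (y + b) = c7 at *
  generalize br q (a + b) = c8 at *
  generalize br q x = c9 at *
  generalize br q y = c10 at *
  generalize br q a = c11 at *
  generalize br q b = c12 at *
  field_simp
  linear_combination -h

theorem kron_fay (hq0 : 0 < q) (hq1 : q < 1) {x y a b : ℂ} (hx : br q x ≠ 0) (hy : br q y ≠ 0)
    (ha : br q a ≠ 0) (hb : br q b ≠ 0) (hab : br q (a + b) ≠ 0) (hxy : br q (x - y) ≠ 0) :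
    kron q x a * kron q y b =
      kron q x (a + b) * kron q (y - x) b + kron q y (a + b) * kron q (x - y) a := by
  apply mul_left_cancel₀ hxy
  rw [kron_fay' hq0 hq1 hx hy ha hb hab, kron, kron, kron, kron, br_sub_comm hq0 hq1 y x]
  generalize br q (x - y) = c1 at *
  generalize br q b = c12 at *
  generalize br q a = c11 at *
  generalize br q (a + b) = c8 at *
  generalize br q x = c9 at *
  generalize br q y = c10 at *
  field_simp

/-! ### Elliptic functions with poles at the half periods -/

/-- The building block `q^{mz} [x - ω - 2z] / ([x - ω] [-2z])` attached to the half period `ω`. -/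
def halfKron (q : ℝ) (r : Fin 4) (x z : ℂ) : ℂ :=
  (q : ℂ) ^ ((halfCoord r).1 * z) * kron q (x - halfPer q r) (-2 * z)

/-- The arguments -x - ω and -(x - ω) differ by 2ω, a lattice vector, so quasi-periodicity of `kron`
applies. -/
theorem halfKron_neg_left (hq0 : 0 < q) (hq1 : q < 1) (r : Fin 4) (x z : ℂ) :
    halfKron q r (-x) z =
      (q : ℂ) ^ (-((halfCoord r).1 * z)) * kron q (-(x - halfPer q r)) (-2 * z) := by
  have h := kron_add_lattice hq0 hq1 (-(halfCoord r).1) (-(halfCoord r).2)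
    (-(x - halfPer q r)) (-2 * z)
  have e : -(x - halfPer q r) + (((-(halfCoord r).1 : ℤ) : ℂ) + (-(halfCoord r).2 : ℤ) * qper q) =
      -x - halfPer q r := by
    push_cast; linear_combination two_mul_halfPer q r
  rw [e] at h
  rw [halfKron, h, ← mul_assoc, ← qpow_add hq0]
  congr 2; push_cast; ring

theorem halfKron_neg (hq0 : 0 < q) (hq1 : q < 1) (r : Fin 4) (x z : ℂ) :
    halfKron q r (-x) (-z) = -halfKron q r x z := by
  rw [halfKron_neg_left hq0 hq1, halfKron, show -2 * -z = -(-2 * z) by ring, kron_neg hq0 hq1,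
    mul_neg _ z, neg_neg]
  ring

/-- Up to sign the product of `kron q x (-(z - w))` and `kron q y (-(z + w))` is expanded by Fay's
identity in two ways: with total parameter -2z, or, after replacing x by -x, with total parameter
-2w. Eliminating the product leaves four terms. The first expansion uses the form valid for [x - y]
= 0, because x - y will be -2κ with κ arbitrary. -/
theorem kron_four_term (hq0 : 0 < q) (hq1 : q < 1) {x y z w : ℂ} (hx : br q x ≠ 0)
    (hy : br q y ≠ 0) (hxy : br q (x + y) ≠ 0) (hz : br q (2 * z) ≠ 0) (hw : br q (2 * w) ≠ 0)
    (hzw : br q (z + w) ≠ 0) (hzw' : br q (z - w) ≠ 0) :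
    br q (x - y) * kron q (-(x + y)) (z + w) * kron q (-x) (-2 * w) +
      br q (x - y + (z + w)) / br q (z + w) * kron q x (-2 * z) -
      br q (y - x + (z - w)) / br q (z - w) * kron q y (-2 * z) -
      br q (x - y) * kron q (-(x + y)) (z - w) * kron q y (-2 * w) = 0 := by
  have nz : ∀ u, br q u ≠ 0 → br q (-u) ≠ 0 := fun u hu => by
    rw [br_neg hq0 hq1]; exact neg_ne_zero.2 hu
  have h1 := kron_fay' hq0 hq1 (x := y) (y := x) (a := -(z + w)) (b := -(z - w)) hy hx
    (nz _ hzw) (nz _ hzw') (by rw [show -(z + w) + -(z - w) = -(2 * z) by ring]; exact nz _ hz)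
  have h2 := kron_fay hq0 hq1 (x := -x) (y := y) (a := z - w) (b := -(z + w)) (nz _ hx) hy
    hzw' (nz _ hzw) (by rw [show z - w + -(z + w) = -(2 * w) by ring]; exact nz _ hw)
    (by rw [show -x - y = -(x + y) by ring]; exact nz _ hxy)
  have g : ∀ u v, br q (-u + -v) / br q (-v) = br q (u + v) / br q v := fun u v => by
    rw [← neg_add, br_neg hq0 hq1, br_neg hq0 hq1, neg_div_neg_eq]
  rw [show -(z + w) + -(z - w) = -2 * z by ring, show x - y + -(z - w) = -(y - x) + -(z - w) by ring,
    g, show y - x + -(z + w) = -(x - y) + -(z + w) by ring, g, br_sub_comm hq0 hq1 y x] at h1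
  rw [show z - w + -(z + w) = -2 * w by ring, show y - -x = -(-(x + y)) by ring,
    kron_neg hq0 hq1, show -x - y = -(x + y) by ring] at h2
  have h3 := kron_neg hq0 hq1 x (-(z - w))
  rw [neg_neg] at h3
  rw [h3] at h2
  linear_combination br q (x - y) * h2 - h1

/-- The previous identity at x - ω and y - ω. The sum x + y is then moved by the lattice vector 2ω,
which costs factors q^{m(z ± w)}; the prefactor q^{mz} in `halfKron` is there to absorb them. -/
theorem halfKron_four_term (hq0 : 0 < q) (hq1 : q < 1) (r : Fin 4) {x y z w : ℂ}
    (hx : br q (2 * x) ≠ 0) (hy : br q (2 * y) ≠ 0) (hxy : br q (x + y) ≠ 0)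
    (hz : br q (2 * z) ≠ 0) (hw : br q (2 * w) ≠ 0) (hzw : br q (z + w) ≠ 0)
    (hzw' : br q (z - w) ≠ 0) :
    br q (x - y) * kron q (-(x + y)) (z + w) * halfKron q r (-x) w +
      br q (x - y + (z + w)) / br q (z + w) * halfKron q r x z -
      br q (y - x + (z - w)) / br q (z - w) * halfKron q r y z -
      br q (x - y) * kron q (-(x + y)) (z - w) * halfKron q r y w = 0 := by
  set ω := halfPer q r with hω
  set m := (halfCoord r).1 with hm
  set n := (halfCoord r).2 with hn
  have h2 : 2 * ω = m + n * qper q := two_mul_halfPer q r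
  have hxy' : br q (x - ω + (y - ω)) ≠ 0 := by
    have := br_add_lattice hq0 hq1 (-m) (-n) (x + y)
    rw [show x + y + ((-m : ℤ) : ℂ) + ((-n : ℤ) : ℂ) * qper q = x - ω + (y - ω) by
      push_cast; linear_combination h2] at this
    rw [this]
    exact mul_ne_zero (mul_ne_zero (zpow_ne_zero _ (by norm_num)) (qpow_ne_zero hq0 _)) hxy
  have h := kron_four_term hq0 hq1 (br_sub_halfPer_ne_zero hq0 hq1 hx r)
    (br_sub_halfPer_ne_zero hq0 hq1 hy r) hxy' hz hw hzw hzw'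
  have hk : ∀ a, kron q (-(x + y)) a =
      (q : ℂ) ^ (m * a) * kron q (-(x - ω + (y - ω))) a := by
    intro a
    have := kron_add_lattice hq0 hq1 (-m) (-n) (-(x - ω + (y - ω))) a
    rw [show -(x - ω + (y - ω)) + (((-m : ℤ) : ℂ) + ((-n : ℤ) : ℂ) * qper q) = -(x + y) by
      push_cast; linear_combination h2] at this
    rw [this]; push_cast; rw [neg_mul, neg_neg]
  rw [halfKron_neg_left hq0 hq1, halfKron, halfKron, halfKron, hk, hk, ← hm, ← hω]
  rw [show x - ω - (y - ω) = x - y by ring, show y - ω - (x - ω) = y - x by ring] at h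
  have e1 : (q : ℂ) ^ ((m : ℂ) * (z + w)) * (q : ℂ) ^ (-((m : ℂ) * w)) = (q : ℂ) ^ ((m : ℂ) * z) := by
    rw [← qpow_add hq0]; congr 1; ring
  have e2 : (q : ℂ) ^ ((m : ℂ) * (z - w)) * (q : ℂ) ^ ((m : ℂ) * w) = (q : ℂ) ^ ((m : ℂ) * z) := by
    rw [← qpow_add hq0]; congr 1; ring
  linear_combination (q : ℂ) ^ ((m : ℂ) * z) * h +
    br q (x - y) * kron q (-(x - ω + (y - ω))) (z + w) * kron q (-(x - ω)) (-2 * w) * e1 -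
    br q (x - y) * kron q (-(x - ω + (y - ω))) (z - w) * kron q (y - ω) (-2 * w) * e2

end

/-! ## The boundary functions in additive notation -/

namespace BoundaryParams

/-- Logarithms to the base q of the multiplicative parameters: `t₁`, `t₂`, `t₃` belong to ã, b̃, c̃,
`eps` to d/ã, and `t₄` of the dual parameters to d. A minus sign becomes a half period, as q^{p/2} =
-1. The signs of the half periods are chosen so that 2 `eps` = 1 - t₁ - t₂ - t₃ + t₄ holds exactly
and not only modulo the lattice. -/
def t₁ (P : BoundaryParams) : ℂ := P.ζ + P.ζ'
def t₂ (q : ℝ) (P : BoundaryParams) : ℂ := P.ζ - P.ζ' - qper q / 2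
def t₃ (P : BoundaryParams) : ℂ := 1 / 2 + P.υ + P.υ'
def t₄ (q : ℝ) (P : BoundaryParams) : ℂ := 1 / 2 + qper q / 2 + P.υ - P.υ'
def eps (q : ℝ) (P : BoundaryParams) : ℂ := 1 / 2 + qper q / 2 - P.ζ - P.υ'
def sig (P : BoundaryParams) : ℂ := P.ζ + P.υ + 1 / 2

end BoundaryParams

open BoundaryParams

/-- The numerator `[x + t₁] [x + t₂] [x + t₃] [t₄ - x]`. -/
def pNum (q : ℝ) (P : BoundaryParams) (x : ℂ) : ℂ :=
  br q (x + P.t₁) * br q (x + P.t₂ q) * br q (x + P.t₃) * br q (P.t₄ q - x)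

def pFun (q : ℝ) (P : BoundaryParams) (x : ℂ) : ℂ := (q : ℂ) ^ P.sig * pNum q P x / br q (2 * x)

/-- The normalised diagonal entry of the `K`-matrix. -/
def aFrac (q : ℝ) (P : BoundaryParams) (x z : ℂ) : ℂ :=
  ((q : ℂ) ^ x * pFun q P x * br q (P.eps q + x - z) -
    (q : ℂ) ^ z * pFun q P.dual z * br q (P.eps q + z - x)) / br q (P.eps q - x - z)

/-- The coefficients of the partial fraction expansion of `aFrac`. -/
def aRes (q : ℝ) (P : BoundaryParams) (r : Fin 4) : ℂ :=
  (q : ℂ) ^ (P.sig + halfPer q r) * pNum q P (halfPer q r) *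
    ((-1) ^ ((halfCoord r).1 + (halfCoord r).2) *
      (q : ℂ) ^ (-((halfCoord r).1 : ℂ) ^ 2 / 2 - (halfCoord r).1 * (P.eps q - halfPer q r))) /
    (dupConst q * ∏ s ∈ Finset.univ.erase r, br q (halfPer q r - halfPer q s))

/-- The partial fraction expansion of `aFrac`. -/
def aSer (q : ℝ) (P : BoundaryParams) (x z : ℂ) : ℂ := ∑ r, aRes q P r * halfKron q r x z

section

variable {q : ℝ} (P : BoundaryParams)

theorem eps_dual : P.dual.eps q = P.eps q := rfl

theorem dual_dual : P.dual.dual = P := rfl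

/-- The substitution x = ε - z carries the factors of the numerator to those for the dual
parameters: first and fourth are exchanged, second and third up to a shift by 1, whose multiplier is
absorbed by the powers of q. Hence the numerator of `aFrac` vanishes where its denominator [ε - x -
z] does at x = ε - z. -/
theorem pNum_eps_sub (hq0 : 0 < q) (hq1 : q < 1) (z : ℂ) :
    (q : ℂ) ^ (P.sig + (P.eps q - z)) * pNum q P (P.eps q - z) =
      (q : ℂ) ^ (P.dual.sig + z) * pNum q P.dual z := by
  have h1 : ∀ u : ℂ, br q (1 - u) = (q : ℂ) ^ (-1 / 2 + u) * br q u := by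
    intro u
    rw [show 1 - u = -u + 1 by ring, br_add_one hq0 hq1, br_neg hq0 hq1, sub_neg_eq_add]; ring
  have e1 : P.eps q - z + P.t₁ = P.dual.t₄ q - z := by simp [eps, t₁, t₄, dual]; ring
  have e2 : P.eps q - z + P.t₂ q = 1 - (z + P.dual.t₃) := by simp [eps, t₂, t₃, dual]; ring
  have e3 : P.eps q - z + P.t₃ = 1 - (z + P.dual.t₂ q) := by simp [eps, t₂, t₃, dual]; ring
  have e4 : P.t₄ q - (P.eps q - z) = z + P.dual.t₁ := by simp [eps, t₁, t₄, dual]; ring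
  have e5 : (q : ℂ) ^ (P.sig + (P.eps q - z)) * (q : ℂ) ^ (-1 / 2 + (z + P.dual.t₃)) *
      (q : ℂ) ^ (-1 / 2 + (z + P.dual.t₂ q)) = (q : ℂ) ^ (P.dual.sig + z) := by
    rw [← qpow_add hq0, ← qpow_add hq0]
    congr 1
    simp [eps, t₂, t₃, sig, dual]; ring
  rw [pNum, pNum, e1, e2, e3, e4, h1, h1, ← e5]
  ring

/-- Clearing denominators in the difference of the two sides gives a theta function N of degree 5 in
x. It vanishes at the four half periods, by the choice of the coefficients `aRes`, and at ε - z,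
where the pole of `aFrac` is only apparent. The degree-zero factor that remains has exponent 2z,
which is off the lattice, so N vanishes. -/
theorem aFrac_eq_aSer (hq0 : 0 < q) (hq1 : q < 1) {x z : ℂ} (hx : br q (2 * x) ≠ 0)
    (hz : br q (2 * z) ≠ 0) (hxz : br q (P.eps q - x - z) ≠ 0)
    (hez : br q (2 * (P.eps q - z)) ≠ 0) : aFrac q P x z = aSer q P x z := by
  set C := dupConst q with hC
  have hC0 : C ≠ 0 := dupConst_ne_zero hq0 hq1
  set ε := P.eps q with hε
  set c₂ := (q : ℂ) ^ (P.dual.sig + z) * pNum q P.dual z with hc₂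
  let D : ℂ → ℂ := fun x => ∏ r, br q (x - halfPer q r)
  let D' : Fin 4 → ℂ → ℂ := fun r x => ∏ s ∈ Finset.univ.erase r, br q (x - halfPer q s)
  have hDD' : ∀ r x, D x = br q (x - halfPer q r) * D' r x := fun r x =>
    (Finset.mul_prod_erase _ _ (Finset.mem_univ r)).symm
  have h2D : ∀ x, br q (2 * x) = C * D x := br_two_mul_eq hq0 hq1
  let ρ : Fin 4 → ℂ := fun r => aRes q P r * (q : ℂ) ^ ((halfCoord r).1 * z)
  -- The common denominator is [2z] D(x) [ε - x - z]. The sum carries a plus sign since the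
  -- Kronecker functions have [-2z] = -[2z] in the denominator.
  let N : ℂ → ℂ := fun x =>
    ((q : ℂ) ^ P.sig * br q (2 * z) / C) * ((q : ℂ) ^ x * br q (x + P.t₁) * br q (x + P.t₂ q) *
        br q (x + P.t₃) * br q (P.t₄ q - x) * br q (x + (ε - z))) -
      c₂ * (br q (ε + z - x) * D x) +
      ∑ r, ρ r * (br q (ε - z - x) * D' r x * br q (x + (-halfPer q r - 2 * z)))
  have hbr : ∀ w : ℂ, IsThetaLike q 1 (-1 / 2 + w) fun x => br q (x - w) := fun w =>
    ((IsThetaLike.br_add hq0 hq1 (-w)).congr_exponent (by ring))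
  have hN : IsThetaLike q 5 (-5 / 2 + ε + z) N := by
    refine IsThetaLike.add (IsThetaLike.sub ?_ ?_) (IsThetaLike.sum _ fun r _ => ?_)
    · refine IsThetaLike.const_mul _ (IsThetaLike.congr_exponent
        ((((((IsThetaLike.qpow hq0 hq1).mul hq0 (IsThetaLike.br_add hq0 hq1 P.t₁)).mul hq0
          (IsThetaLike.br_add hq0 hq1 (P.t₂ q))).mul hq0
          (IsThetaLike.br_add hq0 hq1 P.t₃)).mul hq0 (IsThetaLike.br_sub hq0 hq1 (P.t₄ q))).mul hq0
          (IsThetaLike.br_add hq0 hq1 (ε - z))) ?_)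
      simp only [hε, eps, t₁, t₂, t₃, t₄]; ring
    · refine IsThetaLike.const_mul _ (IsThetaLike.congr_exponent
        ((IsThetaLike.br_sub hq0 hq1 (ε + z)).mul hq0
          (IsThetaLike.prod hq0 Finset.univ fun r _ => hbr (halfPer q r))) ?_)
      rw [Finset.sum_add_distrib, halfPer_sum]; simp; ring
    · have hp := IsThetaLike.prod hq0 (Finset.univ.erase r) fun s _ => hbr (halfPer q s)
      have hcard : (Finset.univ.erase r).card = 3 := by simp
      rw [hcard] at hp
      refine IsThetaLike.const_mul _ (IsThetaLike.congr_exponent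
        (((IsThetaLike.br_sub hq0 hq1 (ε - z)).mul hq0 hp).mul hq0
          (IsThetaLike.br_add hq0 hq1 _)) ?_)
      have hs : ∑ s ∈ Finset.univ.erase r, halfPer q s = -halfPer q r := by
        have := Finset.add_sum_erase Finset.univ (halfPer q) (Finset.mem_univ r)
        rw [halfPer_sum] at this
        linear_combination this
      rw [Finset.sum_add_distrib, hs, Finset.sum_const, hcard]
      simp only [nsmul_eq_mul]; push_cast; ring
  have hzero : ∀ i, N ((Fin.cons (ε - z) (halfPer q) : Fin 5 → ℂ) i) = 0 := by
    refine Fin.cases ?_ fun r => ?_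
    -- At x = ε - z every summand contains [0], and the two remaining terms cancel by
    -- `pNum_eps_sub`.
    · have h1 : ∀ r, ρ r * (br q (ε - z - (ε - z)) * D' r (ε - z) *
          br q (ε - z + (-halfPer q r - 2 * z))) = 0 := fun r => by
        rw [sub_self, br_zero hq0 hq1]; ring
      have h2 := pNum_eps_sub P hq0 hq1 z
      rw [pNum, ← hε, ← hc₂, qpow_add hq0] at h2
      have h3 := h2D (ε - z)
      simp only [Fin.cons_zero, N, h1, Finset.sum_const_zero, add_zero]
      rw [show ε - z + (ε - z) = 2 * (ε - z) by ring, h3, show ε + z - (ε - z) = 2 * z by ring,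
        ← h2]
      field_simp
      ring
    · set ω := halfPer q r with hω
      have hDω : D ω = 0 := by
        rw [hDD' r, ← hω, sub_self, br_zero hq0 hq1, zero_mul]
      have hD'ω : ∀ s, s ≠ r → D' s ω = 0 := fun s hs => by
        refine Finset.prod_eq_zero (Finset.mem_erase.2 ⟨hs.symm, Finset.mem_univ r⟩) ?_
        rw [← hω, sub_self, br_zero hq0 hq1]
      have hD'0 : D' r ω ≠ 0 := Finset.prod_ne_zero_iff.2 fun s hs =>
        br_halfPer_sub_ne_zero hq0 hq1 (Finset.ne_of_mem_erase hs).symm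
      -- At ω_r only the summand r survives, because every other one contains [ω_r - ω_r].
      have hsum : ∑ s, ρ s * (br q (ε - z - ω) * D' s ω * br q (ω + (-halfPer q s - 2 * z))) =
          ρ r * (br q (ε - z - ω) * D' r ω * br q (ω + (-halfPer q r - 2 * z))) := by
        refine Finset.sum_eq_single r (fun s _ hs => ?_) (by simp)
        rw [hD'ω s hs]; ring
      -- The brackets [ω + ε - z] and [ε - z - ω] differ by a shift by 2ω; its multiplier is the
      -- second factor in `aRes` times q^{mz}.
      have hlat := br_add_lattice hq0 hq1 (halfCoord r).1 (halfCoord r).2 (ε - z - ω)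
      rw [show ε - z - ω + (halfCoord r).1 + (halfCoord r).2 * qper q = ω + (ε - z) by
        linear_combination -two_mul_halfPer q r,
        show -((halfCoord r).1 : ℂ) ^ 2 / 2 - (halfCoord r).1 * (ε - z - ω) =
          (-((halfCoord r).1 : ℂ) ^ 2 / 2 - (halfCoord r).1 * (ε - ω)) + (halfCoord r).1 * z by ring,
        qpow_add hq0] at hlat
      have hρ : ρ r = aRes q P r * (q : ℂ) ^ ((halfCoord r).1 * z) := rfl
      have hres : aRes q P r * (C * D' r ω) = (q : ℂ) ^ (P.sig + ω) * pNum q P ω *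
          ((-1) ^ ((halfCoord r).1 + (halfCoord r).2) *
          (q : ℂ) ^ (-((halfCoord r).1 : ℂ) ^ 2 / 2 - (halfCoord r).1 * (ε - ω))) :=
        div_mul_cancel₀ _ (mul_ne_zero hC0 hD'0)
      simp only [Fin.cons_succ, N, ← hω, hsum, hDω, mul_zero, sub_zero, hlat, hρ]
      rw [show ω + (-ω - 2 * z) = -(2 * z) by ring, br_neg hq0 hq1]
      rw [qpow_add hq0, pNum] at hres
      generalize (q : ℂ) ^ (-((halfCoord r).1 : ℂ) ^ 2 / 2 - (halfCoord r).1 * (ε - ω)) = T at *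
      generalize (q : ℂ) ^ ((halfCoord r).1 * z) = Y at *
      field_simp
      linear_combination -(br q (2 * z) * Y * br q (ε - z - ω)) * hres
  have hinc : ∀ i j, i ≠ j → br q ((Fin.cons (ε - z) (halfPer q) : Fin 5 → ℂ) i -
      (Fin.cons (ε - z) (halfPer q) : Fin 5 → ℂ) j) ≠ 0 := by
    have h0 := br_sub_halfPer_ne_zero hq0 hq1 hez
    refine Fin.cases (Fin.cases (fun h => absurd rfl h) fun r _ => ?_)
      fun r => Fin.cases (fun _ => ?_) fun s hrs => ?_
    · simpa using h0 r
    · rw [br_sub_comm hq0 hq1]; simpa using h0 r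
    · simpa using br_halfPer_sub_ne_zero hq0 hq1 (fun h => hrs (by rw [h]))
  obtain ⟨g, hg, hNg⟩ := hN.exists_eq_mul_prod hq0 hq1 _ hinc hzero
  -- The exponent is (-5/2 + ε + z) + 5/2 - (ε - z) = 2z, the half periods adding up to zero.
  have hN0 : N x = 0 := by
    rw [hNg, hg.eq_zero_of_br_ne_zero hq0 hq1, zero_mul]
    rw [Finset.sum_sub_distrib, Fin.sum_univ_succ (fun i => (Fin.cons (ε - z) (halfPer q) : Fin 5 → ℂ) i)]
    simp only [Fin.cons_zero, Fin.cons_succ, halfPer_sum]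
    convert hz using 2
    simp; ring
  have hDx : D x ≠ 0 := fun h => hx (by rw [h2D, h, mul_zero])
  have hk : ∀ r, ρ r * (br q (ε - z - x) * D' r x * br q (x + (-halfPer q r - 2 * z))) =
      -(br q (2 * z) * D x * br q (ε - x - z)) * (aRes q P r * halfKron q r x z) := by
    intro r
    have h1 := br_sub_halfPer_ne_zero hq0 hq1 hx r
    rw [halfKron, kron, hDD' r x, show x - halfPer q r + -2 * z = x + (-halfPer q r - 2 * z) by ring,
      show -2 * z = -(2 * z) by ring, br_neg hq0 hq1, sub_right_comm ε z x]
    simp only [ρ]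
    generalize br q (2 * z) = u at *
    field_simp
  simp only [N, hk, ← Finset.mul_sum] at hN0
  rw [← aSer] at hN0
  have hfr : (br q (2 * z) * D x * br q (ε - x - z)) * aFrac q P x z =
      ((q : ℂ) ^ P.sig * br q (2 * z) / C) * ((q : ℂ) ^ x * br q (x + P.t₁) * br q (x + P.t₂ q) *
        br q (x + P.t₃) * br q (P.t₄ q - x) * br q (x + (ε - z))) -
      c₂ * (br q (ε + z - x) * D x) := by
    rw [aFrac, pFun, pFun, hc₂, h2D x, pNum, qpow_add hq0, ← hε,
      show ε + x - z = x + (ε - z) by ring]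
    field_simp
  apply mul_left_cancel₀ (mul_ne_zero (mul_ne_zero hz hDx) hxz)
  rw [hfr]
  linear_combination hN0

/-- This symmetry is clear for each summand but invisible in `aFrac`; it is the source of unitarity.
-/
theorem aSer_neg (hq0 : 0 < q) (hq1 : q < 1) (x z : ℂ) : aSer q P (-x) (-z) = -aSer q P x z := by
  simp only [aSer, halfKron_neg hq0 hq1, mul_neg, Finset.sum_neg_distrib]

/-- The coefficients `aRes` depend on neither variable, so a linear relation between the building
blocks passes to their sum. -/
theorem aSer_four_term (hq0 : 0 < q) (hq1 : q < 1) {x y z w : ℂ}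
    (hx : br q (2 * x) ≠ 0) (hy : br q (2 * y) ≠ 0) (hxy : br q (x + y) ≠ 0)
    (hz : br q (2 * z) ≠ 0) (hw : br q (2 * w) ≠ 0) (hzw : br q (z + w) ≠ 0)
    (hzw' : br q (z - w) ≠ 0) :
    br q (x - y) * kron q (-(x + y)) (z + w) * aSer q P (-x) w +
      br q (x - y + (z + w)) / br q (z + w) * aSer q P x z -
      br q (y - x + (z - w)) / br q (z - w) * aSer q P y z -
      br q (x - y) * kron q (-(x + y)) (z - w) * aSer q P y w = 0 := by
  simp only [aSer, Finset.mul_sum]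
  rw [← Finset.sum_add_distrib, ← Finset.sum_sub_distrib, ← Finset.sum_sub_distrib]
  refine Finset.sum_eq_zero fun r _ => ?_
  linear_combination aRes q P r * halfKron_four_term hq0 hq1 r hx hy hxy hz hw hzw hzw'

/-- The normalised off-diagonal entry of the `K`-matrix, up to a power of `q`. -/
def fFun (q : ℝ) (P : BoundaryParams) (x : ℂ) : ℂ :=
  (q : ℂ) ^ (P.sig + x) * (br q (x + P.t₁) * br q (x + P.t₂ q) * br q (x + P.t₃) *
    br q (x + P.t₄ q)) / br q (2 * x)

/-- The normalised off-diagonal entry of the `K`-matrix. -/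
def bFun (q : ℝ) (P : BoundaryParams) (x : ℂ) : ℂ := (q : ℂ) ^ (2 * (P.ζ + P.υ) * x) * fFun q P x

/-- The normalising factor of the `K`-matrix. -/
def nFun (q : ℝ) (P : BoundaryParams) (z : ℂ) : ℂ :=
  (q : ℂ) ^ (2 * (P.ζ + P.ζ') * z) / fFun q P.dual (-z)

theorem fFun_mul_neg (hq0 : 0 < q) (x : ℂ) :
    fFun q P x * fFun q P (-x) = pFun q P x * pFun q P (-x) := by
  have e : (q : ℂ) ^ (P.sig + x) * (q : ℂ) ^ (P.sig + -x) = (q : ℂ) ^ P.sig * (q : ℂ) ^ P.sig := by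
    rw [← qpow_add hq0, ← qpow_add hq0]; congr 1; ring
  simp only [fFun, pFun, pNum, div_mul_div_comm]
  congr 1
  rw [show P.t₄ q - x = -x + P.t₄ q by ring, show P.t₄ q - -x = x + P.t₄ q by ring]
  linear_combination br q (x + P.t₁) * br q (x + P.t₂ q) * br q (x + P.t₃) *
    br q (x + P.t₄ q) * br q (-x + P.t₁) * br q (-x + P.t₂ q) * br q (-x + P.t₃) *
    br q (-x + P.t₄ q) * e

theorem bFun_mul_neg (hq0 : 0 < q) (x : ℂ) :
    bFun q P x * bFun q P (-x) = pFun q P x * pFun q P (-x) := by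
  rw [← fFun_mul_neg P hq0, bFun, bFun]
  have e : (q : ℂ) ^ (2 * (P.ζ + P.υ) * x) * (q : ℂ) ^ (2 * (P.ζ + P.υ) * -x) = 1 := by
    rw [← qpow_add hq0]; simp
  linear_combination fFun q P x * fFun q P (-x) * e

/-- Both values of `aSer` are replaced by closed fractions. The oddness of `aSer` equates the
fraction at (x, z) with minus the one at (-x, -z), a relation (`a3`) that does not follow formally
from the definition of `aFrac`; the claim is a multiple of it. Note that the right side is free of
x. -/
theorem aSer_mul_add (hq0 : 0 < q) (hq1 : q < 1) {x z : ℂ} (hx : br q (2 * x) ≠ 0)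
    (hz : br q (2 * z) ≠ 0) (h1 : br q (P.eps q - x - z) ≠ 0) (h2 : br q (P.eps q + x + z) ≠ 0)
    (h4 : br q (P.eps q + z - x) ≠ 0) (h5 : br q (2 * (P.eps q - z)) ≠ 0)
    (h6 : br q (2 * (P.eps q + z)) ≠ 0) :
    aSer q P x z * aSer q P x (-z) + bFun q P x * bFun q P (-x) =
      fFun q P.dual z * fFun q P.dual (-z) := by
  have hnx : br q (2 * -x) ≠ 0 := by
    rw [mul_neg, br_neg hq0 hq1]; exact neg_ne_zero.2 hx
  have hnz : br q (2 * -z) ≠ 0 := by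
    rw [mul_neg, br_neg hq0 hq1]; exact neg_ne_zero.2 hz
  have a1 := aFrac_eq_aSer P hq0 hq1 hx hz h1 h5
  have a2 := aFrac_eq_aSer P hq0 hq1 hx hnz
    (by rwa [show P.eps q - x - -z = P.eps q + z - x by ring]) (by rwa [sub_neg_eq_add])
  have a3 := aFrac_eq_aSer P hq0 hq1 hnx hnz
    (by rwa [show P.eps q - -x - -z = P.eps q + x + z by ring]) (by rwa [sub_neg_eq_add])
  rw [aSer_neg P hq0 hq1, ← a1] at a3
  rw [← a1, ← a2, bFun_mul_neg P hq0, fFun_mul_neg P.dual hq0]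
  simp only [aFrac] at a3 ⊢
  rw [show P.eps q - -x - -z = P.eps q + x + z by ring, show P.eps q + -x - -z = P.eps q + z - x by ring,
    show P.eps q + -z - -x = P.eps q + x - z by ring] at a3
  rw [show P.eps q - x - -z = P.eps q + z - x by ring, show P.eps q + x - -z = P.eps q + x + z by ring,
    show P.eps q + -z - x = P.eps q - x - z by ring]
  have ex : (q : ℂ) ^ x * (q : ℂ) ^ (-x) = 1 := by rw [← qpow_add hq0]; simp
  have ez : (q : ℂ) ^ z * (q : ℂ) ^ (-z) = 1 := by rw [← qpow_add hq0]; simp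
  generalize (q : ℂ) ^ x = X at *
  generalize (q : ℂ) ^ (-x) = X' at *
  generalize (q : ℂ) ^ z = Z at *
  generalize (q : ℂ) ^ (-z) = Z' at *
  generalize pFun q P x = p1 at *
  generalize pFun q P (-x) = p2 at *
  generalize pFun q P.dual z = p3 at *
  generalize pFun q P.dual (-z) = p4 at *
  generalize br q (P.eps q - x - z) = e1 at *
  generalize br q (P.eps q + x + z) = e2 at *
  generalize br q (P.eps q + x - z) = e3 at *
  generalize br q (P.eps q + z - x) = e4 at *
  field_simp at a3 ⊢
  linear_combination X * p1 * a3 - e1 * e4 * p1 * p2 * ex + e1 * e4 * p3 * p4 * ez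

end

section

variable {q : ℝ}

theorem theta_qpow (hq0 : 0 < q) (ξ : ℂ) :
    theta q ((q : ℂ) ^ ξ) = (q : ℂ) ^ (ξ / 2) * br q ξ := by
  rw [br, ← mul_assoc, ← qpow_add hq0]; simp [neg_div]

/-! ### The `K`-matrix in additive notation -/

/-- Each theta factor contributes half of its argument as a power of q. Signs are absorbed through
q^{±p/2} = -1. -/
theorem Cfun_eq (hq0 : 0 < q) (hq1 : q < 1) (P : BoundaryParams) (z ξ : ℂ) :
    Cfun q P z ξ = (q : ℂ) ^ ((P.ζ + P.υ - P.ζ' + P.υ' + 1 / 2 - qper q / 2) / 2 + ξ) *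
      (br q (ξ + P.t₁) * br q (ξ + P.t₂ q) * br q (ξ + P.t₃) * br q (P.eps q + ξ - z)) /
      (br q (2 * ξ) * br q (P.dual.t₄ q - z)) *
      (q : ℂ) ^ (-((P.ζ + P.υ - z) * (P.ζ + P.ζ' - ξ))) := by
  have hh := qpow_half_qper hq0 hq1
  have hh' : (q : ℂ) ^ (-(qper q / 2)) = -1 := by
    rw [Complex.cpow_neg, hh]; norm_num
  have e1 : (q : ℂ) ^ (P.ζ + P.ζ') * (q : ℂ) ^ ξ = (q : ℂ) ^ (ξ + P.t₁) := by
    rw [← qpow_add hq0, t₁]; congr 1; ring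
  have e2 : -(q : ℂ) ^ (P.ζ - P.ζ') * (q : ℂ) ^ ξ = (q : ℂ) ^ (ξ + P.t₂ q) := by
    rw [t₂, show ξ + (P.ζ - P.ζ' - qper q / 2) = P.ζ - P.ζ' + ξ + -(qper q / 2) by ring,
      qpow_add hq0 _ (-(qper q / 2)), hh', qpow_add hq0]; ring
  have e3 : (q : ℂ) ^ (1 / 2 + P.υ + P.υ') * (q : ℂ) ^ ξ = (q : ℂ) ^ (ξ + P.t₃) := by
    rw [← qpow_add hq0, t₃]; congr 1; ring
  have e4 : -(q : ℂ) ^ (1 / 2 + P.ζ' - P.υ') * (q : ℂ) ^ (ξ - z) / (q : ℂ) ^ (P.ζ + P.ζ') =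
      (q : ℂ) ^ (P.eps q + ξ - z) := by
    rw [div_eq_iff (qpow_ne_zero hq0 _), ← qpow_add hq0, eps,
      show 1 / 2 + qper q / 2 - P.ζ - P.υ' + ξ - z + (P.ζ + P.ζ') =
        1 / 2 + P.ζ' - P.υ' + (ξ - z) + qper q / 2 by ring, qpow_add hq0 _ (qper q / 2), hh,
      qpow_add hq0]
    ring
  have e5 : -(q : ℂ) ^ (1 / 2 + P.ζ' - P.υ') * (q : ℂ) ^ (-z) = (q : ℂ) ^ (P.dual.t₄ q - z) := by
    rw [t₄, show 1 / 2 + qper q / 2 + P.dual.υ - P.dual.υ' - z =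
      1 / 2 + P.ζ' - P.υ' + -z + qper q / 2 by simp [dual]; ring, qpow_add hq0 _ (qper q / 2), hh,
      qpow_add hq0]; ring
  simp only [Cfun, e1, e2, e3, e4, e5, theta_qpow hq0]
  have e6 : (q : ℂ) ^ ((ξ + P.t₁) / 2) * (q : ℂ) ^ ((ξ + P.t₂ q) / 2) * (q : ℂ) ^ ((ξ + P.t₃) / 2) *
      (q : ℂ) ^ ((P.eps q + ξ - z) / 2) =
      (q : ℂ) ^ ((P.ζ + P.υ - P.ζ' + P.υ' + 1 / 2 - qper q / 2) / 2 + ξ) *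
        ((q : ℂ) ^ (2 * ξ / 2) * (q : ℂ) ^ ((P.dual.t₄ q - z) / 2)) := by
    simp only [← qpow_add hq0]
    congr 1
    simp only [t₁, t₂, t₃, t₄, eps, dual]; ring
  have h1 := qpow_ne_zero hq0 (2 * ξ / 2)
  have h2 := qpow_ne_zero hq0 ((P.dual.t₄ q - z) / 2)
  congr 1
  rw [show (q : ℂ) ^ ((ξ + P.t₁) / 2) * br q (ξ + P.t₁) *
      ((q : ℂ) ^ ((ξ + P.t₂ q) / 2) * br q (ξ + P.t₂ q)) *
      ((q : ℂ) ^ ((ξ + P.t₃) / 2) * br q (ξ + P.t₃)) *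
      ((q : ℂ) ^ ((P.eps q + ξ - z) / 2) * br q (P.eps q + ξ - z)) =
      ((q : ℂ) ^ ((ξ + P.t₁) / 2) * (q : ℂ) ^ ((ξ + P.t₂ q) / 2) * (q : ℂ) ^ ((ξ + P.t₃) / 2) *
      (q : ℂ) ^ ((P.eps q + ξ - z) / 2)) * (br q (ξ + P.t₁) * br q (ξ + P.t₂ q) *
        br q (ξ + P.t₃) * br q (P.eps q + ξ - z)) by ring, e6,
    show (q : ℂ) ^ (2 * ξ / 2) * br q (2 * ξ) *
      ((q : ℂ) ^ ((P.dual.t₄ q - z) / 2) * br q (P.dual.t₄ q - z)) =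
      ((q : ℂ) ^ (2 * ξ / 2) * (q : ℂ) ^ ((P.dual.t₄ q - z) / 2)) *
        (br q (2 * ξ) * br q (P.dual.t₄ q - z)) by ring]
  rw [mul_comm _ ((q : ℂ) ^ (2 * ξ / 2) * _), mul_assoc, mul_div_mul_left _ _ (mul_ne_zero h1 h2)]

/-- The values of `z` at which the normalising factor of the `K`-matrix is regular. -/
def RegularSpectral (q : ℝ) (P : BoundaryParams) (z : ℂ) : Prop :=
  br q (2 * z) ≠ 0 ∧ br q (-z + P.dual.t₁) ≠ 0 ∧ br q (-z + P.dual.t₂ q) ≠ 0 ∧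
    br q (-z + P.dual.t₃) ≠ 0 ∧ br q (-z + P.dual.t₄ q) ≠ 0 ∧ br q (2 * (P.eps q - z)) ≠ 0

/-- The values of `(z, x)` at which the entries of the first row of the `K`-matrix can be put into
their normalised form. -/
def RegularEntry (q : ℝ) (P : BoundaryParams) (x z : ℂ) : Prop :=
  br q (2 * x) ≠ 0 ∧ br q (x + P.t₄ q) ≠ 0 ∧ br q (P.t₄ q - x) ≠ 0 ∧
    br q (P.eps q - x - z) ≠ 0 ∧ br q (P.eps q + x - z) ≠ 0

/-- The normaliser depends on z alone. With `betaBa_eq`, which has the same normaliser times a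
function of x alone, this is the form of K in which the reflection equation separates. -/
theorem alphaBa_eq (hq0 : 0 < q) (hq1 : q < 1) {P : BoundaryParams} {z x : ℂ}
    (hz : RegularSpectral q P z) (hx : RegularEntry q P x z) :
    alphaBa q P z x = nFun q P z * aSer q P x z := by
  obtain ⟨z1, z2, z3, z4, z5, z6⟩ := hz
  obtain ⟨x1, x2, x3, x4, x5⟩ := hx
  rw [← aFrac_eq_aSer P hq0 hq1 x1 z1 x4 z6, alphaBa, Cfun_eq hq0 hq1, Cfun_eq hq0 hq1,
    Cfun_eq hq0 hq1, aFrac, nFun, fFun, pFun, pFun, pNum, pNum, eps_dual, dual_dual]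
  have d1 : P.dual.ζ = P.ζ := rfl
  have d2 : P.dual.ζ' = P.υ := rfl
  have d3 : P.dual.υ = P.ζ' := rfl
  have d4 : P.dual.υ' = P.υ' := rfl
  rw [show P.dual.t₄ q - z = -z + P.dual.t₄ q by ring, show 2 * -z = -(2 * z) by ring,
    br_neg hq0 hq1 (2 * z), show P.eps q + -z - x = P.eps q - x - z by ring,
    d1, d2, d3, d4]
  have e0 : (q : ℂ) ^ (-((P.ζ + P.ζ' - x) * (P.ζ + P.υ - z))) * (q : ℂ) ^ (2 * z * x) =
      (q : ℂ) ^ (2 * (P.ζ + P.ζ') * z) * (q : ℂ) ^ (-((P.ζ + P.ζ' - x) * (P.ζ + P.υ - -z))) := by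
    simp only [← qpow_add hq0]; congr 1; ring
  have e0' : (q : ℂ) ^ (-((P.ζ + P.υ - z) * (P.ζ + P.ζ' - x))) =
      (q : ℂ) ^ (-((P.ζ + P.ζ' - x) * (P.ζ + P.υ - z))) := by congr 1; ring
  have e1 : (q : ℂ) ^ ((P.ζ + P.υ - P.ζ' + P.υ' + 1 / 2 - qper q / 2) / 2 + x) *
        (q : ℂ) ^ (P.dual.sig + -z) =
      (q : ℂ) ^ x * (q : ℂ) ^ P.sig *
        (q : ℂ) ^ ((P.ζ + P.ζ' - P.υ + P.υ' + 1 / 2 - qper q / 2) / 2 + -z) := by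
    simp only [← qpow_add hq0]; congr 1; simp only [sig, dual]; ring
  have e2 : (q : ℂ) ^ ((P.ζ + P.ζ' - P.υ + P.υ' + 1 / 2 - qper q / 2) / 2 + z) *
        (q : ℂ) ^ (P.dual.sig + -z) =
      (q : ℂ) ^ z * (q : ℂ) ^ P.dual.sig *
        (q : ℂ) ^ ((P.ζ + P.ζ' - P.υ + P.υ' + 1 / 2 - qper q / 2) / 2 + -z) := by
    simp only [← qpow_add hq0]; congr 1; ring
  rw [e0']
  have n1 := qpow_ne_zero hq0 (P.dual.sig + -z)
  have n2 := qpow_ne_zero hq0 ((P.ζ + P.ζ' - P.υ + P.υ' + 1 / 2 - qper q / 2) / 2 + -z)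
  have n3 := qpow_ne_zero hq0 (-((P.ζ + P.ζ' - x) * (P.ζ + P.υ - -z)))
  generalize (q : ℂ) ^ (-((P.ζ + P.ζ' - x) * (P.ζ + P.υ - z))) = W at *
  generalize (q : ℂ) ^ (-((P.ζ + P.ζ' - x) * (P.ζ + P.υ - -z))) = W' at *
  generalize (q : ℂ) ^ (2 * z * x) = Y at *
  generalize (q : ℂ) ^ (2 * (P.ζ + P.ζ') * z) = T at *
  generalize (q : ℂ) ^ ((P.ζ + P.ζ' - P.υ + P.υ' + 1 / 2 - qper q / 2) / 2 + -z) = k1 at *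
  generalize (q : ℂ) ^ ((P.ζ + P.ζ' - P.υ + P.υ' + 1 / 2 - qper q / 2) / 2 + z) = k2 at *
  generalize (q : ℂ) ^ ((P.ζ + P.υ - P.ζ' + P.υ' + 1 / 2 - qper q / 2) / 2 + x) = k3 at *
  generalize (q : ℂ) ^ (P.dual.sig + -z) = s1 at *
  generalize (q : ℂ) ^ P.dual.sig = s2 at *
  generalize (q : ℂ) ^ P.sig = s3 at *
  generalize (q : ℂ) ^ x = X at *
  generalize (q : ℂ) ^ z = Z at *
  generalize br q (2 * z) = b1 at *
  generalize br q (2 * x) = b2 at *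
  generalize br q (-z + P.dual.t₁) = b3 at *
  generalize br q (-z + P.dual.t₂ q) = b4 at *
  generalize br q (-z + P.dual.t₃) = b5 at *
  generalize br q (-z + P.dual.t₄ q) = b6 at *
  generalize br q (P.t₄ q - x) = b7 at *
  generalize br q (P.eps q - x - z) = b8 at *
  generalize br q (P.eps q + x - z) = b9 at *
  generalize br q (P.eps q + z - x) = b10 at *
  generalize br q (x + P.t₁) = c1 at *
  generalize br q (x + P.t₂ q) = c2 at *
  generalize br q (x + P.t₃) = c3 at *
  generalize br q (z + P.dual.t₁) = c4 at *
  generalize br q (z + P.dual.t₂ q) = c5 at *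
  generalize br q (z + P.dual.t₃) = c6 at *
  field_simp
  linear_combination s1 * (k2 * b2 * b6 * c4 * c5 * c6 * b10 - k3 * c1 * c2 * c3 * b9 * b1 * b7) * e0 -
    T * W' * c1 * c2 * c3 * b1 * b7 * b9 * e1 + T * W' * c4 * c5 * c6 * b2 * b6 * b10 * e2

/-- The only factor mixing the two variables, [ε + x - z], occurs in the numerator and in the
denominator and cancels; the mixed exponentials cancel as well. -/
theorem betaBa_eq (hq0 : 0 < q) (hq1 : q < 1) {P : BoundaryParams} {z x : ℂ}
    (hz : RegularSpectral q P z) (hx : RegularEntry q P x z) :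
    betaBa q P z x = nFun q P z * bFun q P x := by
  obtain ⟨z1, z2, z3, z4, z5, z6⟩ := hz
  obtain ⟨x1, x2, x3, x4, x5⟩ := hx
  rw [betaBa, Cfun_eq hq0 hq1, Cfun_eq hq0 hq1, nFun, bFun, fFun, fFun, eps_dual, dual_dual]
  have d1 : P.dual.ζ = P.ζ := rfl
  have d2 : P.dual.ζ' = P.υ := rfl
  have d3 : P.dual.υ = P.ζ' := rfl
  have d4 : P.dual.υ' = P.υ' := rfl
  rw [show P.dual.t₄ q - z = -z + P.dual.t₄ q by ring, show P.t₄ q - -x = x + P.t₄ q by ring,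
    show P.eps q + -z - -x = P.eps q + x - z by ring, d1, d2, d3, d4,
    show 2 * -z = -(2 * z) by ring, br_neg hq0 hq1 (2 * z)]
  have e0 : (q : ℂ) ^ (-((P.ζ + P.υ - z) * (P.ζ + P.ζ' - x))) =
      (q : ℂ) ^ (2 * (P.ζ + P.ζ') * z) * (q : ℂ) ^ (2 * (P.ζ + P.υ) * x) *
        (q : ℂ) ^ (-((P.ζ + P.ζ' - -x) * (P.ζ + P.υ - -z))) := by
    simp only [← qpow_add hq0]; congr 1; ring
  have e1 : (q : ℂ) ^ ((P.ζ + P.υ - P.ζ' + P.υ' + 1 / 2 - qper q / 2) / 2 + x) *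
        (q : ℂ) ^ (P.dual.sig + -z) =
      (q : ℂ) ^ (P.sig + x) *
        (q : ℂ) ^ ((P.ζ + P.ζ' - P.υ + P.υ' + 1 / 2 - qper q / 2) / 2 + -z) := by
    simp only [← qpow_add hq0]; congr 1; simp only [sig, dual]; ring
  have n1 := qpow_ne_zero hq0 (P.dual.sig + -z)
  have n2 := qpow_ne_zero hq0 ((P.ζ + P.ζ' - P.υ + P.υ' + 1 / 2 - qper q / 2) / 2 + -z)
  have n3 := qpow_ne_zero hq0 (-((P.ζ + P.ζ' - -x) * (P.ζ + P.υ - -z)))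
  rw [e0]
  generalize (q : ℂ) ^ (-((P.ζ + P.ζ' - -x) * (P.ζ + P.υ - -z))) = W' at *
  generalize (q : ℂ) ^ (2 * (P.ζ + P.υ) * x) = Y at *
  generalize (q : ℂ) ^ (2 * (P.ζ + P.ζ') * z) = T at *
  generalize (q : ℂ) ^ ((P.ζ + P.ζ' - P.υ + P.υ' + 1 / 2 - qper q / 2) / 2 + -z) = k1 at *
  generalize (q : ℂ) ^ ((P.ζ + P.υ - P.ζ' + P.υ' + 1 / 2 - qper q / 2) / 2 + x) = k3 at *
  generalize (q : ℂ) ^ (P.dual.sig + -z) = s1 at *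
  generalize (q : ℂ) ^ (P.sig + x) = s3 at *
  generalize br q (2 * z) = b1 at *
  generalize br q (2 * x) = b2 at *
  generalize br q (-z + P.dual.t₁) = b3 at *
  generalize br q (-z + P.dual.t₂ q) = b4 at *
  generalize br q (-z + P.dual.t₃) = b5 at *
  generalize br q (-z + P.dual.t₄ q) = b6 at *
  generalize br q (x + P.t₄ q) = b7 at *
  generalize br q (P.eps q + x - z) = b9 at *
  field_simp
  linear_combination -(br q (x + P.t₁) * br q (x + P.t₂ q) * br q (x + P.t₃) * T * Y) * e1

theorem nFun_mul_neg (hq0 : 0 < q) (P : BoundaryParams) (z : ℂ) :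
    nFun q P z * nFun q P (-z) = (fFun q P.dual z * fFun q P.dual (-z))⁻¹ := by
  have e : (q : ℂ) ^ (2 * (P.ζ + P.ζ') * z) * (q : ℂ) ^ (2 * (P.ζ + P.ζ') * -z) = 1 := by
    rw [← qpow_add hq0]; simp
  rw [nFun, nFun, div_mul_div_comm, e, one_div, neg_neg, mul_comm (fFun q P.dual (-z))]

theorem fFun_dual_neg_ne_zero (hq0 : 0 < q) (hq1 : q < 1) {P : BoundaryParams} {z : ℂ}
    (hz : RegularSpectral q P z) : fFun q P.dual (-z) ≠ 0 := by
  obtain ⟨z1, z2, z3, z4, z5, z6⟩ := hz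
  rw [fFun]
  refine div_ne_zero (mul_ne_zero (qpow_ne_zero hq0 _)
    (mul_ne_zero (mul_ne_zero (mul_ne_zero z2 z3) z4) z5)) ?_
  rw [mul_neg, br_neg hq0 hq1]
  exact neg_ne_zero.2 z1

end

/-! ## Exchange and reflection operators in coordinates -/

/-- The operator on functions of two signs defined by a matrix satisfying the ice rule. -/
def iceOp (D : ℂ) (A B : ℂ → ℂ) (h : ℂ) (f : ℤˣ → ℤˣ → ℂ) (a b : ℤˣ) : ℂ :=
  if a = b then D * f a b else A (wt a * h) * f a b + B (wt a * h) * f b a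

/-- The operator on functions of one sign defined by a boundary matrix. -/
def bdryOp (α β : ℂ → ℂ) (x : ℂ) (f : ℤˣ → ℂ) (a : ℤˣ) : ℂ :=
  α (wt a * x) * f a + β (wt a * x) * f (-a)

theorem iceOp_smul (c D : ℂ) (A B : ℂ → ℂ) (h : ℂ) (f : ℤˣ → ℤˣ → ℂ) (a b : ℤˣ) :
    iceOp D A B h (fun a b => c * f a b) a b = c * iceOp D A B h f a b := by
  simp only [iceOp]; split_ifs <;> ring

theorem iceOp_coeff_smul (c D : ℂ) (A B : ℂ → ℂ) (h : ℂ) (f : ℤˣ → ℤˣ → ℂ) (a b : ℤˣ) :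
    iceOp (c * D) (fun u => c * A u) (fun u => c * B u) h f a b = c * iceOp D A B h f a b := by
  simp only [iceOp]; split_ifs <;> ring

theorem wt_neg (a : ℤˣ) : wt (-a) = -wt a := by simp [wt]

theorem wt_mul_self (a : ℤˣ) : wt a * wt a = 1 := by
  rcases Int.units_eq_one_or a with rfl | rfl <;> simp [wt]

theorem sign_eq_neg_self (u : ℤˣ) : (u = -u) = False := by revert u; decide

theorem sign_neg_eq_self (u : ℤˣ) : (-u = u) = False := by revert u; decide

theorem signs_cases (a b c : ℤˣ) :
    (a = b ∧ c = b) ∨ (a = -b ∧ c = b) ∨ (b = -a ∧ c = a) ∨ (b = a ∧ c = -a) := by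
  revert a b c; decide

/-- By conservation of weight only the two three-dimensional weight spaces are nontrivial. Of the
nine entries on each, two hold identically and seven give the hypotheses, after removal of a common
factor A where there is one. A single function A serves all three factors because it will not depend
on the spectral parameters. -/
theorem iceOp_yangBaxter {A : ℂ → ℂ} {B₁₂ B₁₃ B₂₃ : ℂ → ℂ} {D₁₂ D₁₃ D₂₃ h η : ℂ}
    (h1 : ∀ m, B₁₃ (wt (-m) * h) * B₂₃ (wt m * (h - η * wt m)) +
      B₁₂ (wt (-m) * (h - η * wt m)) * D₁₃ = D₂₃ * B₁₂ (wt (-m) * h))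
    (h2 : ∀ m, A (wt (-m) * (h - η * wt m)) * A (wt m * (h - η * wt m)) * B₁₃ (wt (-m) * h) +
      B₁₂ (wt (-m) * (h - η * wt m)) * B₂₃ (wt (-m) * (h - η * wt m)) * D₁₃ =
      D₁₂ * D₂₃ * B₁₃ (wt (-m) * (h - η * wt m)))
    (h3 : ∀ m, B₁₂ (wt m * (h - η * wt m)) * D₂₃ = D₁₃ * B₁₂ (wt m * h) +
      B₂₃ (wt (-m) * h) * B₁₃ (wt m * (h - η * wt m)))
    (h4 : ∀ m, A (wt m * (h - η * wt m)) * A (wt (-m) * (h - η * wt m)) * D₁₃ +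
      B₁₂ (wt m * (h - η * wt m)) * B₁₃ (wt (-m) * h) * B₂₃ (wt m * (h - η * wt m)) =
      A (wt m * h) * A (wt (-m) * h) * D₁₃ +
      B₂₃ (wt (-m) * h) * B₁₃ (wt m * (h - η * wt m)) * B₁₂ (wt (-m) * h))
    (h5 : ∀ m, D₁₃ * B₂₃ (wt (-m) * (h - η * wt m)) +
      B₁₂ (wt m * (h - η * wt m)) * B₁₃ (wt (-m) * h) = B₂₃ (wt (-m) * h) * D₁₂)
    (h6 : ∀ m, D₁₂ * D₂₃ * B₁₃ (wt m * h) =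
      A (wt m * h) * A (wt (-m) * h) * B₁₃ (wt m * (h - η * wt m)) +
      B₂₃ (wt m * h) * B₁₂ (wt m * h) * D₁₃)
    (h7 : ∀ m, D₁₂ * B₂₃ (wt m * (h - η * wt m)) =
      B₁₃ (wt m * (h - η * wt m)) * B₁₂ (wt (-m) * h) + B₂₃ (wt m * h) * D₁₃)
    (f : ℤˣ → ℤˣ → ℤˣ → ℂ) (a b c : ℤˣ) :
    iceOp D₁₂ A B₁₂ (h - η * wt c) (fun a b => iceOp D₁₃ A B₁₃ h (fun a c =>
      iceOp D₂₃ A B₂₃ (h - η * wt a) (fun b c => f a b c) b c) a c) a b =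
    iceOp D₂₃ A B₂₃ h (fun b c => iceOp D₁₃ A B₁₃ (h - η * wt b) (fun a c =>
      iceOp D₁₂ A B₁₂ h (fun a b => f a b c) a b) a c) b c := by
  rcases signs_cases a b c with ⟨rfl, rfl⟩ | ⟨rfl, rfl⟩ | ⟨rfl, rfl⟩ | ⟨rfl, rfl⟩
  · simp only [iceOp, if_true]; ring
  · simp only [iceOp, if_true, sign_eq_neg_self, sign_neg_eq_self, if_false]
    linear_combination A (wt (-c) * (h - η * wt c)) * f c (-c) c * h1 c + f c c (-c) * h2 c
  · simp only [iceOp, if_true, sign_eq_neg_self, sign_neg_eq_self, if_false]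
    linear_combination A (wt (-c) * h) * f (-c) c c * h3 c + f c (-c) c * h4 c +
      A (wt c * (h - η * wt c)) * f c c (-c) * h5 c
  · simp only [iceOp, if_true, sign_eq_neg_self, sign_neg_eq_self, if_false]
    linear_combination f (-b) b b * h6 b + A (wt b * h) * f b (-b) b * h7 b

/-- The function β is shared by both K-operators, so besides the scalars ν₁, ν₂ only the diagonals
depend on the spectral parameters. What is needed: three relations linear in the diagonals,
unitarity of R (`hU`), and the fact that the unitarity relation of K has the same value at two
shifts of ξ (`hN`). -/
theorem iceOp_bdryOp_reflection {A : ℂ → ℂ} {B B' : ℂ → ℂ} {D D' D'' ξ κ : ℂ}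
    {α₁ α₂ β : ℂ → ℂ} {ν₁ ν₂ : ℂ}
    (h2 : ∀ m, D * α₂ (wt m * (ξ - κ * wt (-m))) =
      α₁ (wt m * (ξ - κ * wt (-m))) * B (wt m * (2 * ξ)) + α₂ (wt m * (ξ - κ * wt m)) * D' +
      B' (wt (-m) * (2 * ξ)) * α₁ (wt (-m) * (ξ - κ * wt m)))
    (h2' : ∀ m, α₁ (wt m * (ξ - κ * wt m)) * D' +
      B' (wt (-m) * (2 * ξ)) * α₂ (wt (-m) * (ξ - κ * wt m)) =
      D'' * α₁ (wt m * (ξ - κ * wt (-m))) + α₂ (wt m * (ξ - κ * wt (-m))) * B (wt (-m) * (2 * ξ)))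
    (h6 : ∀ m, B (wt (-m) * (2 * ξ)) * α₁ (wt (-m) * (ξ - κ * wt m)) +
      α₁ (wt m * (ξ - κ * wt (-m))) * B' (wt m * (2 * ξ)) + D' * α₂ (wt (-m) * (ξ - κ * wt (-m))) =
      D * α₂ (wt (-m) * (ξ - κ * wt m)))
    (hU : ∀ m, D * D'' + B (wt m * (2 * ξ)) * B (wt (-m) * (2 * ξ)) =
      A (wt m * (2 * ξ)) * A (wt (-m) * (2 * ξ)))
    (hN : ∀ m, β (wt m * (ξ - κ * wt (-m))) * β (wt (-m) * (ξ - κ * wt (-m))) -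
      β (wt m * (ξ - κ * wt m)) * β (wt (-m) * (ξ - κ * wt m)) =
      α₂ (wt m * (ξ - κ * wt (-m))) * α₂ (wt (-m) * (ξ - κ * wt (-m))) -
      α₂ (wt m * (ξ - κ * wt m)) * α₂ (wt (-m) * (ξ - κ * wt m)))
    (f : ℤˣ → ℤˣ → ℂ) (a b : ℤˣ) :
    iceOp D A B (2 * ξ) (fun a b => bdryOp (fun u => ν₁ * α₁ u) (fun u => ν₁ * β u) (ξ - κ * wt a)
      (fun b => iceOp D' A B' (2 * ξ) (fun a b => bdryOp (fun u => ν₂ * α₂ u) (fun u => ν₂ * β u)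
        (ξ - κ * wt a) (fun b => f a b) b) b a) b) b a =
    bdryOp (fun u => ν₂ * α₂ u) (fun u => ν₂ * β u) (ξ - κ * wt a) (fun b => iceOp D' A B' (2 * ξ)
      (fun a b => bdryOp (fun u => ν₁ * α₁ u) (fun u => ν₁ * β u) (ξ - κ * wt a)
        (fun b => iceOp D A B (2 * ξ) (fun a b => f a b) b a) b) b a) b := by
  have hab : b = a ∨ b = -a := by revert a b; decide
  rcases hab with rfl | rfl
  · simp only [iceOp, bdryOp, if_true, sign_eq_neg_self, sign_neg_eq_self, if_false,
      neg_neg]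
    linear_combination ν₁ * ν₂ * β (wt b * (ξ - κ * wt b)) * f b (-b) * (D * h2' b +
      B (wt (-b) * (2 * ξ)) * h2 b + α₁ (wt b * (ξ - κ * wt (-b))) * hU b) +
      ν₁ * ν₂ * β (wt b * (ξ - κ * wt b)) * A (wt (-b) * (2 * ξ)) * f (-b) b * h2 b
  · simp only [iceOp, bdryOp, if_true, sign_eq_neg_self, sign_neg_eq_self, if_false,
      neg_neg]
    linear_combination -(ν₁ * ν₂ * β (wt (-a) * (ξ - κ * wt a)) * f a a * (D * h2' a +
      B (wt (-a) * (2 * ξ)) * h2 a + α₁ (wt a * (ξ - κ * wt (-a))) * hU a)) +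
      ν₁ * ν₂ * A (wt (-a) * (2 * ξ)) * f (-a) a * (D' * hN a +
        α₂ (wt a * (ξ - κ * wt (-a))) * h6 a + α₂ (wt (-a) * (ξ - κ * wt a)) * h2 a) +
      ν₁ * ν₂ * A (wt (-a) * (2 * ξ)) * β (wt a * (ξ - κ * wt (-a))) * f (-a) (-a) * h6 a

section

variable {q : ℝ}

/-! ### Baxter's `R`-matrix in additive notation -/

/-- The diagonal entries of the normalised `R`-matrix on the highest and lowest weight vector. -/
def dHat (q : ℝ) (η z : ℂ) : ℂ := br q (η - z) / br q z

/-- After multiplication of R by `dHat` this diagonal entry has lost its dependence on the spectral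
parameter. -/
def aHat (q : ℝ) (η u : ℂ) : ℂ := -(br q (u + η) / br q u)

def bHat (q : ℝ) (η z u : ℂ) : ℂ := br q η * kron q u z

theorem ABa_eq (hq0 : 0 < q) (hq1 : q < 1) (κ z ξ : ℂ) :
    ABa q κ z ξ = (dHat q (2 * κ) z)⁻¹ * aHat q (2 * κ) ξ := by
  have e : (q : ℂ) ^ (-z / 2) * (q : ℂ) ^ ((2 * κ + ξ) / 2) =
      (q : ℂ) ^ ((2 * κ - z) / 2) * (q : ℂ) ^ (ξ / 2) := by
    rw [← qpow_add hq0, ← qpow_add hq0]; congr 1; ring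
  rw [ABa, theta_qpow hq0, theta_qpow hq0, theta_qpow hq0, theta_qpow hq0, mul_mul_mul_comm, e,
    mul_mul_mul_comm _ (br q (2 * κ - z)), mul_div_mul_left _ _
      (mul_ne_zero (qpow_ne_zero hq0 _) (qpow_ne_zero hq0 _)), dHat, aHat, br_neg hq0 hq1,
    inv_div, add_comm ξ, neg_mul, neg_div, mul_neg, div_mul_div_comm]

theorem BBa_eq (hq0 : 0 < q) (hq1 : q < 1) (κ : ℂ) {z : ℂ} (hz : br q z ≠ 0) (ξ : ℂ) :
    BBa q κ z ξ = (dHat q (2 * κ) z)⁻¹ * bHat q (2 * κ) z ξ := by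
  have e : (q : ℂ) ^ ((-z - ξ) / 2) * (q : ℂ) ^ (2 * κ / 2) =
      (q : ℂ) ^ ((2 * κ - z) / 2) * (q : ℂ) ^ (-ξ / 2) := by
    rw [← qpow_add hq0, ← qpow_add hq0]; congr 1; ring
  rw [BBa, theta_qpow hq0, theta_qpow hq0, theta_qpow hq0, theta_qpow hq0, mul_mul_mul_comm, e,
    mul_mul_mul_comm _ (br q (2 * κ - z)), mul_div_mul_left _ _
      (mul_ne_zero (qpow_ne_zero hq0 _) (qpow_ne_zero hq0 _)), dHat, bHat, kron, br_neg hq0 hq1,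
    inv_div, show -z - ξ = -(ξ + z) by ring, br_neg hq0 hq1]
  rw [mul_neg, neg_mul, neg_div_neg_eq]
  generalize br q (2 * κ - z) = d
  generalize br q ξ = x
  -- If a denominator vanishes, both sides are zero by the convention for division.
  by_cases hd : d = 0
  · simp [hd]
  by_cases hx : x = 0
  · simp [hx]
  field_simp

theorem bHat_neg_neg (hq0 : 0 < q) (hq1 : q < 1) (η z u : ℂ) :
    bHat q η (-z) (-u) = -bHat q η z u := by
  rw [bHat, bHat, kron_neg hq0 hq1, mul_neg]

/-- Weierstrass's identity at (u, η, z, 0). -/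
theorem hat_unitarity (hq0 : 0 < q) (hq1 : q < 1) (η : ℂ) {z u : ℂ} (hz : br q z ≠ 0)
    (hu : br q u ≠ 0) :
    dHat q η z * dHat q η (-z) + bHat q η z u * bHat q η z (-u) = aHat q η u * aHat q η (-u) := by
  have h := br_weierstrass hq0 hq1 u η z 0
  simp only [add_zero, sub_zero] at h
  simp only [dHat, bHat, aHat, kron, br_neg hq0 hq1, sub_neg_eq_add]
  rw [show -u + z = -(u - z) by ring, show -u + η = -(u - η) by ring, br_neg hq0 hq1,
    br_neg hq0 hq1]
  field_simp
  linear_combination -h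

/-- Fay's identity at two points at distance η: the bracket of the difference becomes [η], which
belongs to the normalisation of `bHat`. The form valid on the diagonal allows [η] = 0. -/
theorem hat_fay (hq0 : 0 < q) (hq1 : q < 1) (η : ℂ) {x a b : ℂ} (hx : br q x ≠ 0)
    (hy : br q (x + η) ≠ 0) (ha : br q a ≠ 0) (hb : br q b ≠ 0) (hab : br q (a + b) ≠ 0) :
    bHat q η a x * bHat q η b (x + η) =
      -(bHat q η (a + b) x * dHat q η (-b)) + bHat q η (a + b) (x + η) * dHat q η a := by
  have h := kron_fay' hq0 hq1 hx hy ha hb hab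
  rw [show x - (x + η) = -η by ring, show x + η - x = η by ring, br_neg hq0 hq1,
    show -η + a = -(η - a) by ring, br_neg hq0 hq1] at h
  simp only [bHat, dHat, sub_neg_eq_add, br_neg hq0 hq1, div_neg]
  linear_combination -br q η * h

/-- This relation of third order in the entries is the four-term identity at (x + η, x, η - z, η -
w). -/
theorem hat_six (hq0 : 0 < q) (hq1 : q < 1) (η : ℂ) {x z w : ℂ} (hx : br q x ≠ 0)
    (hy : br q (x - η) ≠ 0) (hz : br q z ≠ 0) (hw : br q w ≠ 0) (hzw : br q (z + w) ≠ 0) :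
    dHat q η z * dHat q η w * bHat q η (z + w) x =
      aHat q η x * aHat q η (-x) * bHat q η (z + w) (x - η) +
        bHat q η w x * bHat q η z x * dHat q η (z + w) := by
  have h := br_four_term hq0 hq1 (x + η) x (η - z) (η - w)
  rw [show 2 * (x + η) - x - (η - z) - (η - w) = x + (z + w) by ring,
    show x + η - (η - z) - (η - w) = x - η + (z + w) by ring, show x + η - x - (η - w) = w by ring,
    show x + η - x - (η - z) = z by ring, show x + η - (η - w) = x + w by ring,
    show x + η - (η - z) = x + z by ring, show x + η - x = η by ring,
    show x + (η - z) + (η - w) - (x + η) = η - (z + w) by ring] at h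
  simp only [bHat, dHat, aHat, kron]
  rw [show -x + η = -(x - η) by ring, br_neg hq0 hq1, br_neg hq0 hq1]
  generalize br q (x - η + (z + w)) = c1 at *
  generalize br q (x + (z + w)) = c2 at *
  generalize br q (η - (z + w)) = c3 at *
  generalize br q (x - η) = c4 at *
  generalize br q (z + w) = c5 at *
  field_simp
  linear_combination br q η * h

/-- The operator `R(z, h)` on functions of two signs. -/
def rOp (q : ℝ) (κ z h : ℂ) : (ℤˣ → ℤˣ → ℂ) → ℤˣ → ℤˣ → ℂ := iceOp 1 (ABa q κ z) (BBa q κ z) h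

/-- The operator `K(z, x)` on functions of one sign. -/
def kOp (q : ℝ) (P : BoundaryParams) (z x : ℂ) : (ℤˣ → ℂ) → ℤˣ → ℂ :=
  bdryOp (alphaBa q P z) (betaBa q P z) x

theorem rOp_eq (hq0 : 0 < q) (hq1 : q < 1) (κ : ℂ) {z : ℂ} (hz : br q z ≠ 0)
    (hz' : br q (2 * κ - z) ≠ 0) (h : ℂ) (f : ℤˣ → ℤˣ → ℂ) (a b : ℤˣ) :
    rOp q κ z h f a b = (dHat q (2 * κ) z)⁻¹ *
      iceOp (dHat q (2 * κ) z) (aHat q (2 * κ)) (bHat q (2 * κ) z) h f a b := by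
  have hd : dHat q (2 * κ) z ≠ 0 := div_ne_zero hz' hz
  rw [← iceOp_coeff_smul, inv_mul_cancel₀ hd, rOp]
  simp only [← ABa_eq hq0 hq1, ← BBa_eq hq0 hq1 κ hz]

theorem wt_sq_cases (m : ℤˣ) (h : ℂ) : wt m * h = h ∨ wt m * h = -h := by
  rcases Int.units_eq_one_or m with rfl | rfl <;> simp [wt]

/-- Of the seven scalar relations, the first, third, fifth and seventh are instances of `hat_fay`,
the second and sixth of `hat_six`. The fourth is the difference of unitarity at two dynamical
values, corrected by two instances of `hat_fay`. -/
theorem rOp_yangBaxter (hq0 : 0 < q) (hq1 : q < 1) (κ : ℂ) {z w h : ℂ} (hz : br q z ≠ 0)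
    (hw : br q w ≠ 0) (hzw : br q (z + w) ≠ 0) (hz' : br q (2 * κ - z) ≠ 0)
    (hw' : br q (2 * κ - w) ≠ 0) (hzw' : br q (2 * κ - (z + w)) ≠ 0) (hh : br q h ≠ 0)
    (hp : br q (h + 2 * κ) ≠ 0) (hm : br q (h - 2 * κ) ≠ 0)
    (f : ℤˣ → ℤˣ → ℤˣ → ℂ) (a b c : ℤˣ) :
    rOp q κ z (h - 2 * κ * wt c) (fun a b => rOp q κ (z + w) h (fun a c =>
      rOp q κ w (h - 2 * κ * wt a) (fun b c => f a b c) b c) a c) a b =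
    rOp q κ w h (fun b c => rOp q κ (z + w) (h - 2 * κ * wt b) (fun a c =>
      rOp q κ z h (fun a b => f a b c) a b) a c) b c := by
  have nz : ∀ u, br q u ≠ 0 → br q (-u) ≠ 0 := fun u hu => by
    rw [br_neg hq0 hq1]; exact neg_ne_zero.2 hu
  simp only [rOp_eq hq0 hq1 κ hz hz', rOp_eq hq0 hq1 κ hw hw', rOp_eq hq0 hq1 κ hzw hzw',
    iceOp_smul]
  set η := 2 * κ
  have hx : ∀ m, br q (wt m * h) ≠ 0 := fun m => by
    rcases wt_sq_cases m h with e | e <;> rw [e]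
    · exact hh
    · exact nz _ hh
  have hxm : ∀ m, br q (wt m * h - η) ≠ 0 := fun m => by
    rcases wt_sq_cases m h with e | e <;> rw [e]
    · exact hm
    · rw [show -h - η = -(h + η) by ring]; exact nz _ hp
  have e1 : ∀ m, wt (-m) * h = -(wt m * h) := fun m => by rw [wt_neg]; ring
  have e2 : ∀ m, wt m * (h - η * wt m) = wt m * h - η := fun m => by
    linear_combination -η * wt_mul_self m
  have e3 : ∀ m, wt (-m) * (h - η * wt m) = -(wt m * h - η) := fun m => by
    rw [wt_neg]; linear_combination η * wt_mul_self m
  have hzwz : z + w + -z = w := by ring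
  have hzww : z + w + -w = z := by ring
  have F : ∀ m a b, br q a ≠ 0 → br q b ≠ 0 → br q (a + b) ≠ 0 →
      bHat q η a (wt m * h - η) * bHat q η b (wt m * h) =
      -(bHat q η (a + b) (wt m * h - η) * dHat q η (-b)) +
        bHat q η (a + b) (wt m * h) * dHat q η a := fun m a b ha hb hab => by
    have := hat_fay hq0 hq1 η (hxm m) (by simpa using hx m) ha hb hab
    rwa [sub_add_cancel] at this
  have O : ∀ z u, bHat q η z (-u) = -bHat q η (-z) u := fun z u => by
    rw [← bHat_neg_neg hq0 hq1, neg_neg]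
  have k1 := fun m => F m w (-(z + w)) hw (nz _ hzw) (by
    rw [show w + -(z + w) = -z by ring]; exact nz _ hz)
  have k3 := fun m => F m (z + w) (-w) hzw (nz _ hw) (by rwa [hzww])
  have k5 := fun m => F m z (-(z + w)) hz (nz _ hzw) (by
    rw [show z + -(z + w) = -w by ring]; exact nz _ hw)
  have k7 := fun m => F m (z + w) (-z) hzw (nz _ hz) (by rwa [hzwz])
  simp only [show w + -(z + w) = -z by ring, show z + -(z + w) = -w by ring, hzww, hzwz,
    neg_neg] at k1 k3 k5 k7
  have key := iceOp_yangBaxter (A := aHat q η) (B₁₂ := bHat q η z) (B₁₃ := bHat q η (z + w))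
    (B₂₃ := bHat q η w) (D₁₂ := dHat q η z) (D₁₃ := dHat q η (z + w)) (D₂₃ := dHat q η w)
    (h := h) (η := η) ?_ ?_ ?_ ?_ ?_ ?_ ?_ f a b c
  · linear_combination (dHat q η z)⁻¹ * (dHat q η w)⁻¹ * (dHat q η (z + w))⁻¹ * key
  all_goals intro m; simp only [e1, e2, e3]
  · rw [O, O z, O z]; linear_combination -k1 m
  · have := hat_six hq0 hq1 η (x := -(wt m * h - η)) (nz _ (hxm m))
      (by rw [show -(wt m * h - η) - η = -(wt m * h) by ring]; exact nz _ (hx m)) hz hw hzw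
    rw [show -(wt m * h - η) - η = -(wt m * h) by ring, neg_neg] at this
    linear_combination -this
  · rw [O w]; linear_combination k3 m
  · have u1 := hat_unitarity hq0 hq1 η hw (hx m)
    have u2 := hat_unitarity hq0 hq1 η hw (hxm m)
    simp only [O] at u1 u2 ⊢
    linear_combination dHat q η (z + w) * (u1 - u2) - bHat q η w (wt m * h - η) * k5 m -
      bHat q η (-w) (wt m * h) * k7 m
  · rw [O w, O (z + w), O w]; linear_combination -k5 m
  · exact hat_six hq0 hq1 η (hx m) (hxm m) hz hw hzw
  · rw [O z]; linear_combination k7 m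

end

/-! ### Unitarity and the reflection equation for the operators of R and K. -/

section

variable {q : ℝ}

/-- The values of `(z, x)` at which the entries of `K(±z, ±x)` can be put into normalised form. -/
def KRegular (q : ℝ) (P : BoundaryParams) (z x : ℂ) : Prop :=
  ∀ s t : ℤˣ, RegularSpectral q P (wt t * z) ∧ RegularEntry q P (wt s * x) (wt t * z)

theorem kOp_eq (hq0 : 0 < q) (hq1 : q < 1) {P : BoundaryParams} {z x : ℂ}
    (h : KRegular q P z x) (f : ℤˣ → ℂ) (a : ℤˣ) :
    kOp q P z x f a = bdryOp (fun u => nFun q P z * aSer q P u z)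
      (fun u => nFun q P z * bFun q P u) x f a := by
  have h' := h a 1
  rw [show wt 1 = 1 by simp [wt], one_mul] at h'
  rw [kOp, bdryOp, bdryOp, alphaBa_eq hq0 hq1 h'.1 h'.2, betaBa_eq hq0 hq1 h'.1 h'.2]

theorem KRegular.neg_spectral {P : BoundaryParams} {z x : ℂ} (h : KRegular q P z x) :
    KRegular q P (-z) x := fun s t => by
  have := h s (-t)
  rwa [wt_neg, neg_mul, ← mul_neg] at this

theorem KRegular.neg_entry {P : BoundaryParams} {z x : ℂ} (h : KRegular q P z x) :
    KRegular q P z (-x) := fun s t => by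
  have := h (-s) t
  rwa [wt_neg, neg_mul, ← mul_neg] at this

theorem KRegular.aSer_mul_aSer_neg (hq0 : 0 < q) (hq1 : q < 1) {P : BoundaryParams} {z x : ℂ}
    (h : KRegular q P z x) : aSer q P x z * aSer q P x (-z) + bFun q P x * bFun q P (-x) =
      fFun q P.dual z * fFun q P.dual (-z) := by
  have h11 := h 1 1
  have h12 := h 1 (-1)
  have h21 := h (-1) 1
  have h22 := h (-1) (-1)
  simp only [wt_neg, show wt 1 = 1 by simp [wt], one_mul, neg_mul] at h11 h12 h21 h22
  refine aSer_mul_add P hq0 hq1 h11.2.1 h11.1.1 h11.2.2.2.2.1 ?_ ?_ h11.1.2.2.2.2.2 ?_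
  · have := h22.2.2.2.2.1; rwa [sub_neg_eq_add, sub_neg_eq_add] at this
  · have := h12.2.2.2.2.1
    rwa [sub_neg_eq_add, show P.eps q - x + z = P.eps q + z - x by ring] at this
  · have := h12.1.2.2.2.2.2; rwa [sub_neg_eq_add] at this

theorem kOp_unitarity (hq0 : 0 < q) (hq1 : q < 1) {P : BoundaryParams} {z x : ℂ}
    (h : KRegular q P z x) (f : ℤˣ → ℂ) (a : ℤˣ) :
    kOp q P z x (kOp q P (-z) x f) a = f a := by
  -- This is the diagonal entry of the product. The off-diagonal entries cancel because `aSer` is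
  -- odd.
  have main : ∀ y, KRegular q P z y → nFun q P z * nFun q P (-z) *
      (aSer q P y z * aSer q P y (-z) + bFun q P y * bFun q P (-y)) = 1 := fun y hy => by
    rw [hy.aSer_mul_aSer_neg hq0 hq1, nFun_mul_neg hq0, inv_mul_cancel₀]
    have h1 := fFun_dual_neg_ne_zero hq0 hq1 (hy 1 1).1
    have h2 := fFun_dual_neg_ne_zero hq0 hq1 (hy 1 (-1)).1
    simp only [wt_neg, show wt 1 = 1 by simp [wt], one_mul, neg_mul, neg_neg] at h1 h2
    exact mul_ne_zero h2 h1
  have hy : KRegular q P z (wt a * x) := by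
    rcases wt_sq_cases a x with e | e <;> rw [e]
    exacts [h, h.neg_entry]
  have e : ∀ y, aSer q P (-y) (-z) = -aSer q P y z := fun y => aSer_neg P hq0 hq1 y z
  rw [kOp_eq hq0 hq1 h, bdryOp, kOp_eq hq0 hq1 h.neg_spectral, kOp_eq hq0 hq1 h.neg_spectral,
    bdryOp, bdryOp, neg_neg, wt_neg, neg_mul, e]
  linear_combination f a * main _ hy

theorem rOp_unitarity (hq0 : 0 < q) (hq1 : q < 1) (κ : ℂ) {z h : ℂ} (hz : br q z ≠ 0)
    (h1 : br q (2 * κ - z) ≠ 0) (h2 : br q (2 * κ + z) ≠ 0) (hh : br q h ≠ 0)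
    (f : ℤˣ → ℤˣ → ℂ) (a b : ℤˣ) :
    rOp q κ z h (fun a b => rOp q κ (-z) h f b a) b a = f a b := by
  have hz' : br q (-z) ≠ 0 := by rw [br_neg hq0 hq1]; exact neg_ne_zero.2 hz
  have h2' : br q (2 * κ - -z) ≠ 0 := by rwa [sub_neg_eq_add]
  have d1 : dHat q (2 * κ) z ≠ 0 := div_ne_zero h1 hz
  have d2 : dHat q (2 * κ) (-z) ≠ 0 := div_ne_zero h2' hz'
  simp only [rOp_eq hq0 hq1 κ hz h1, rOp_eq hq0 hq1 κ hz' h2', iceOp_smul]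
  have hb : br q (wt b * h) ≠ 0 := by
    rcases wt_sq_cases b h with e | e <;> rw [e]
    exacts [hh, by rw [br_neg hq0 hq1]; exact neg_ne_zero.2 hh]
  have U := hat_unitarity hq0 hq1 (2 * κ) hz hb
  have O : ∀ u, bHat q (2 * κ) (-z) u = -bHat q (2 * κ) z (-u) := fun u => by
    rw [← bHat_neg_neg hq0 hq1, neg_neg]
  have e : ∀ x y w : ℂ, w * x * y = 1 → w * (x * y) = 1 := fun x y w h => by rw [← h]; ring
  have hab : b = a ∨ b = -a := by clear U hb; revert a b; decide
  rcases hab with rfl | rfl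
  · simp only [iceOp, if_true]
    field_simp
  · simp only [iceOp, sign_eq_neg_self, sign_neg_eq_self, if_false, wt_neg, neg_mul, O,
      neg_neg] at U ⊢
    field_simp
    linear_combination -f a (-a) * U

/-- The four-term relation is used at mξ - κ and mξ + κ, m a sign. Their difference is ∓2κ and their
sum is m·2ξ, so the Kronecker functions in it become the entries of R at 2ξ. Three instances are
needed, two of them with the spectral parameters interchanged. -/
theorem rOp_kOp_reflection (hq0 : 0 < q) (hq1 : q < 1) (κ : ℂ) {P : BoundaryParams} {z w ξ : ℂ}
    (hm : br q (z - w) ≠ 0) (hp : br q (z + w) ≠ 0) (hm' : br q (2 * κ - (z - w)) ≠ 0)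
    (hp' : br q (2 * κ - (z + w)) ≠ 0) (hξ : br q (2 * ξ) ≠ 0)
    (hz₁ : KRegular q P z (ξ + κ)) (hz₂ : KRegular q P z (ξ - κ))
    (hw₁ : KRegular q P w (ξ + κ)) (hw₂ : KRegular q P w (ξ - κ))
    (f : ℤˣ → ℤˣ → ℂ) (a b : ℤˣ) :
    rOp q κ (z - w) (2 * ξ) (fun a b => kOp q P z (ξ - κ * wt a) (fun b =>
      rOp q κ (z + w) (2 * ξ) (fun a b => kOp q P w (ξ - κ * wt a) (fun b => f a b) b)
        b a) b) b a =
    kOp q P w (ξ - κ * wt a) (fun b => rOp q κ (z + w) (2 * ξ) (fun a b =>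
      kOp q P z (ξ - κ * wt a) (fun b => rOp q κ (z - w) (2 * ξ) (fun a b => f a b) b a) b)
        b a) b := by
  have kz : ∀ a : ℤˣ, KRegular q P z (ξ - κ * wt a) := fun a => by
    rcases Int.units_eq_one_or a with rfl | rfl
    · simpa [wt] using hz₂
    · simpa [wt] using hz₁
  have kw : ∀ a : ℤˣ, KRegular q P w (ξ - κ * wt a) := fun a => by
    rcases Int.units_eq_one_or a with rfl | rfl
    · simpa [wt] using hw₂
    · simpa [wt] using hw₁
  have ez := fun a f b => kOp_eq hq0 hq1 (kz a) f b
  have ew := fun a f b => kOp_eq hq0 hq1 (kw a) f b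
  simp only [ez, ew, rOp_eq hq0 hq1 κ hm hm', rOp_eq hq0 hq1 κ hp hp']
  have bs : ∀ (c : ℂ) (α β : ℂ → ℂ) (x : ℂ) (f : ℤˣ → ℂ) (a : ℤˣ),
      bdryOp α β x (fun a => c * f a) a = c * bdryOp α β x f a := fun c α β x f a => by
    simp only [bdryOp]; ring
  simp only [bs, iceOp_smul]
  have e1 : ∀ m : ℤˣ, wt m * (ξ - κ * wt m) = wt m * ξ - κ := fun m => by
    linear_combination -κ * wt_mul_self m
  have e2 : ∀ m : ℤˣ, wt (-m) * (ξ - κ * wt m) = -(wt m * ξ - κ) := fun m => by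
    rw [wt_neg]; linear_combination κ * wt_mul_self m
  have e3 : ∀ m : ℤˣ, wt m * (ξ - κ * wt (-m)) = wt m * ξ + κ := fun m => by
    rw [wt_neg]; linear_combination κ * wt_mul_self m
  have e4 : ∀ m : ℤˣ, wt (-m) * ξ - κ = -(wt m * ξ + κ) := fun m => by
    rw [wt_neg]; ring
  have e5 : ∀ m : ℤˣ, wt (-m) * (2 * ξ) = -(wt m * (2 * ξ)) := fun m => by
    rw [wt_neg]; ring
  have kreg : ∀ (m s : ℤˣ) {v : ℂ}, (KRegular q P v (ξ + κ)) → (KRegular q P v (ξ - κ)) →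
      KRegular q P v (wt m * ξ + wt s * κ) := fun m s v h1 h2 => by
    rcases Int.units_eq_one_or m with rfl | rfl <;> rcases Int.units_eq_one_or s with rfl | rfl <;>
      simp only [wt_neg, show wt 1 = 1 by simp [wt], one_mul, neg_mul, ← sub_eq_add_neg]
    · exact h1
    · exact h2
    · have := h2.neg_entry; rwa [show -(ξ - κ) = -ξ + κ by ring] at this
    · have := h1.neg_entry; rwa [show -(ξ + κ) = -ξ - κ by ring] at this
  have wr : ∀ m : ℤˣ, KRegular q P w (wt m * ξ - κ) := fun m => by
    have := kreg m (-1) hw₁ hw₂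
    simpa [wt, sub_eq_add_neg] using this
  have wtt : ∀ m : ℤˣ, KRegular q P w (wt m * ξ + κ) := fun m => by
    have := kreg m 1 hw₁ hw₂
    simpa [wt] using this
  have nz : ∀ u, br q u ≠ 0 → br q (-u) ≠ 0 := fun u hu => by
    rw [br_neg hq0 hq1]; exact neg_ne_zero.2 hu
  have hH : ∀ m : ℤˣ, br q (wt m * (2 * ξ)) ≠ 0 := fun m => by
    rcases wt_sq_cases m (2 * ξ) with e | e <;> rw [e]
    exacts [hξ, nz _ hξ]
  have r0 : ∀ m : ℤˣ, br q (2 * (wt m * ξ - κ)) ≠ 0 := fun m => by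
    have := (wr m 1 1).2.1; rwa [show wt 1 = 1 by simp [wt], one_mul] at this
  have t0 : ∀ m : ℤˣ, br q (2 * (wt m * ξ + κ)) ≠ 0 := fun m => by
    have := (wtt m 1 1).2.1; rwa [show wt 1 = 1 by simp [wt], one_mul] at this
  have z0 : br q (2 * z) ≠ 0 := by
    have := (hz₁ 1 1).1.1; rwa [show wt 1 = 1 by simp [wt], one_mul] at this
  have w0 : br q (2 * w) ≠ 0 := by
    have := (hw₁ 1 1).1.1; rwa [show wt 1 = 1 by simp [wt], one_mul] at this
  have hm2 : br q (w - z) ≠ 0 := by rw [← neg_sub]; exact nz _ hm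
  have hp2 : br q (w + z) ≠ 0 := by rwa [add_comm]
  have O : ∀ z u, bHat q (2 * κ) z (-u) = -bHat q (2 * κ) (-z) u := fun z u => by
    rw [← bHat_neg_neg hq0 hq1, neg_neg]
  have d1 : br q (2 * κ + (w - z)) / br q (w - z) = -dHat q (2 * κ) (z - w) := by
    rw [dHat, show w - z = -(z - w) by ring, br_neg hq0 hq1, ← sub_eq_add_neg, div_neg]
  have d2 : br q (2 * κ + (z - w)) / br q (z - w) = -dHat q (2 * κ) (-(z - w)) := by
    rw [dHat, br_neg hq0 hq1, sub_neg_eq_add, div_neg, neg_neg]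
  have d3 : br q (-(2 * κ) + (z + w)) / br q (z + w) = -dHat q (2 * κ) (z + w) := by
    rw [dHat, show -(2 * κ) + (z + w) = -(2 * κ - (z + w)) by ring, br_neg hq0 hq1, neg_div]
  have b1 : ∀ u v, br q (-(2 * κ)) * kron q u v = -bHat q (2 * κ) v u := fun u v => by
    rw [br_neg hq0 hq1, bHat, neg_mul]
  have key := iceOp_bdryOp_reflection (A := aHat q (2 * κ)) (B := bHat q (2 * κ) (z - w))
    (B' := bHat q (2 * κ) (z + w)) (D := dHat q (2 * κ) (z - w)) (D' := dHat q (2 * κ) (z + w))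
    (D'' := dHat q (2 * κ) (-(z - w))) (ξ := ξ) (κ := κ) (α₁ := fun u => aSer q P u z)
    (α₂ := fun u => aSer q P u w) (β := bFun q P) (ν₁ := nFun q P z) (ν₂ := nFun q P w)
    ?_ ?_ ?_ ?_ ?_ f a b
  · linear_combination (dHat q (2 * κ) (z - w))⁻¹ * (dHat q (2 * κ) (z + w))⁻¹ * key
  all_goals intro m; simp only [e1, e2, e3, e4, e5]
  · have := aSer_four_term P hq0 hq1 (r0 m) (t0 m) (by
      rw [show wt m * ξ - κ + (wt m * ξ + κ) = wt m * (2 * ξ) by ring]; exact hH m) w0 z0 hp2 hm2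
    rw [show wt m * ξ - κ - (wt m * ξ + κ) = -(2 * κ) by ring,
      show wt m * ξ + κ - (wt m * ξ - κ) = 2 * κ by ring,
      show wt m * ξ - κ + (wt m * ξ + κ) = wt m * (2 * ξ) by ring, add_comm w z, d1, d3, b1, b1,
      O (w - z), neg_sub w z] at this
    linear_combination this
  · have := aSer_four_term P hq0 hq1 (r0 m) (t0 m) (by
      rw [show wt m * ξ - κ + (wt m * ξ + κ) = wt m * (2 * ξ) by ring]; exact hH m) z0 w0 hp hm
    rw [show wt m * ξ - κ - (wt m * ξ + κ) = -(2 * κ) by ring,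
      show wt m * ξ + κ - (wt m * ξ - κ) = 2 * κ by ring,
      show wt m * ξ - κ + (wt m * ξ + κ) = wt m * (2 * ξ) by ring, d2, d3, b1, b1] at this
    linear_combination -this
  · have := aSer_four_term P hq0 hq1 (x := -(wt m * ξ + κ)) (y := -(wt m * ξ - κ))
      (by rw [mul_neg]; exact nz _ (t0 m)) (by rw [mul_neg]; exact nz _ (r0 m)) (by
      rw [show -(wt m * ξ + κ) + -(wt m * ξ - κ) = -(wt m * (2 * ξ)) by ring]
      exact nz _ (hH m)) w0 z0 hp2 hm2
    rw [show -(wt m * ξ + κ) - -(wt m * ξ - κ) = -(2 * κ) by ring,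
      show -(wt m * ξ - κ) - -(wt m * ξ + κ) = 2 * κ by ring,
      show -(wt m * ξ + κ) + -(wt m * ξ - κ) = -(wt m * (2 * ξ)) by ring, add_comm w z, d1, d3,
      b1, b1, neg_neg, neg_neg] at this
    rw [O (z - w), neg_sub z w]
    linear_combination -this
  · have := hat_unitarity hq0 hq1 (2 * κ) hm (hH m)
    exact this
  -- The value of the unitarity relation depends on w only, so the instances at mξ - κ and mξ + κ
  -- may be subtracted.
  · have h1 := (wr m).aSer_mul_aSer_neg hq0 hq1
    have h2 := (wtt m).aSer_mul_aSer_neg hq0 hq1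
    have e : ∀ y, aSer q P y (-w) = -aSer q P (-y) w := fun y => by
      rw [← aSer_neg P hq0 hq1, neg_neg]
    rw [e] at h1 h2
    linear_combination h2 - h1

end

/-! ### Generic points and open maps. -/

section GenericFilter

variable {X Y : Type*} [TopologicalSpace X] [TopologicalSpace Y]

theorem mem_generic_of_isOpen {s : Set X} (h : IsOpen s) (hd : Dense s) : s ∈ generic X := by
  change Dense (interior s)
  rwa [h.interior_eq]

/-- The preimage of a dense set under an open map is dense. -/
theorem tendsto_generic_of_isOpenMap {φ : X → Y} (hc : Continuous φ) (ho : IsOpenMap φ) :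
    Tendsto φ (generic X) (generic Y) := by
  intro s hs
  refine Dense.mono ?_ (hs.preimage ho)
  exact interior_maximal (Set.preimage_mono interior_subset) (isOpen_interior.preimage hc)

end GenericFilter

section AffineDirections

variable {E : Type*} [NormedAddCommGroup E] [NormedSpace ℂ E]

/-- Moving along e provides a continuous section through every point. -/
theorem isOpenMap_of_direction {f : E → ℂ} (e : E) (h : ∀ x t, f (x + t • e) = f x + t) :
    IsOpenMap f :=
  IsOpenMap.of_sections fun x => ⟨fun y => x + (y - f x) • e,
    Continuous.continuousAt (by fun_prop), by simp, fun y => by rw [h]; ring⟩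

theorem isOpenMap_of_directions {f : E → ℂ × ℂ} (e₁ e₂ : E)
    (h : ∀ x s t, f (x + s • e₁ + t • e₂) = f x + (s, t)) : IsOpenMap f :=
  IsOpenMap.of_sections fun x =>
    ⟨fun y => x + (y.1 - (f x).1) • e₁ + (y.2 - (f x).2) • e₂,
      Continuous.continuousAt (by fun_prop), by simp, fun y => by rw [h]; ext <;> simp⟩

/-- Every genericity condition below is the nonvanishing of a bracket of a function with slope 1 in
some direction. Such a function is open, so it pulls the dense open set [u] ≠ 0 back to a dense open
set. -/
theorem eventually_br_ne_zero {q : ℝ} (hq0 : 0 < q) (hq1 : q < 1) {f : E → ℂ}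
    (hf : Continuous f) (e : E) (h : ∀ x t, f (x + t • e) = f x + t) :
    ∀ᶠ x in generic E, br q (f x) ≠ 0 := by
  refine (tendsto_generic_of_isOpenMap hf (isOpenMap_of_direction e h)).eventually
    (p := fun u => br q u ≠ 0) (mem_generic_of_isOpen ?_
      (by simpa using dense_br_ne_zero hq0 hq1 one_ne_zero 0))
  exact isOpen_ne_fun (br_differentiable hq0 hq1).continuous continuous_const

end AffineDirections

/-! ### Closure properties of meromorphic functions. -/

section MeromorphicFunctions

variable {E F : Type*} [NormedAddCommGroup E] [NormedSpace ℂ E]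
  [NormedAddCommGroup F] [NormedSpace ℂ F]

namespace IsMeromorphic

variable {f g : E → ℂ}

theorem congr (hf : IsMeromorphic f) (h : ∀ᶠ x in generic E, f x = g x) : IsMeromorphic g := by
  intro x
  obtain ⟨u, v, hu, hv, e⟩ := hf x
  refine ⟨u, v, hu, hv, ?_⟩
  filter_upwards [e, h.filter_mono inf_le_right] with y a b
  exact ⟨a.1, b ▸ a.2⟩

theorem of_analytic (h : ∀ x, AnalyticAt ℂ f x) : IsMeromorphic f := fun x =>
  ⟨f, fun _ => 1, h x, analyticAt_const, by simp⟩

theorem mul (hf : IsMeromorphic f) (hg : IsMeromorphic g) : IsMeromorphic fun x => f x * g x := by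
  intro x
  obtain ⟨g₁, k₁, hg₁, hk₁, e₁⟩ := hf x
  obtain ⟨g₂, k₂, hg₂, hk₂, e₂⟩ := hg x
  refine ⟨fun y => g₁ y * g₂ y, fun y => k₁ y * k₂ y, hg₁.mul hg₂, hk₁.mul hk₂, ?_⟩
  filter_upwards [e₁, e₂] with y a b
  exact ⟨mul_ne_zero a.1 b.1, by rw [a.2, b.2, div_mul_div_comm]⟩

theorem sub (hf : IsMeromorphic f) (hg : IsMeromorphic g) : IsMeromorphic fun x => f x - g x := by
  have := hf.add (hg.const_mul (-1))
  simpa [← sub_eq_add_neg] using this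

theorem inv (hf : IsMeromorphic f) (h : ∀ᶠ x in generic E, f x ≠ 0) :
    IsMeromorphic fun x => (f x)⁻¹ := by
  intro x
  obtain ⟨u, v, hu, hv, e⟩ := hf x
  refine ⟨v, u, hv, hu, ?_⟩
  filter_upwards [e, h.filter_mono inf_le_right] with y a b
  refine ⟨fun h0 => b (by rw [a.2, h0, zero_div]), by rw [a.2, inv_div]⟩

theorem div (hf : IsMeromorphic f) (hg : IsMeromorphic g) (h : ∀ᶠ x in generic E, g x ≠ 0) :
    IsMeromorphic fun x => f x / g x := by
  simpa only [div_eq_mul_inv] using hf.mul (hg.inv h)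

theorem sum {ι : Type*} {f : ι → E → ℂ} (s : Finset ι) (h : ∀ i ∈ s, IsMeromorphic (f i)) :
    IsMeromorphic fun x => ∑ i ∈ s, f i x := by
  classical
  induction s using Finset.induction_on with
  | empty => simpa using IsMeromorphic.zero
  | insert a s ha ih =>
    simp only [Finset.sum_insert ha]
    exact (h a (by simp)).add (ih fun i hi => h i (by simp [hi]))

theorem comp {f : F → ℂ} (hf : IsMeromorphic f) {φ : E → F} (hφ : ∀ x, AnalyticAt ℂ φ x)
    (ho : IsOpenMap φ) : IsMeromorphic fun x => f (φ x) := by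
  intro x
  obtain ⟨g, k, hg, hk, e⟩ := hf (φ x)
  have hc : Continuous φ := continuous_iff_continuousAt.2 fun x => (hφ x).continuousAt
  refine ⟨fun y => g (φ y), fun y => k (φ y), AnalyticAt.comp hg (hφ x),
    AnalyticAt.comp hk (hφ x), ?_⟩
  have : Tendsto φ (𝓝 x ⊓ generic E) (𝓝 (φ x) ⊓ generic F) :=
    Tendsto.inf (hc.tendsto x) (tendsto_generic_of_isOpenMap hc ho)
  exact this.eventually e

end IsMeromorphic

@[fun_prop]
theorem analyticAt_component_fst {G : Type*} [NormedAddCommGroup G] [NormedSpace ℂ G]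
    {f : E → F × G} {x : E} (hf : AnalyticAt ℂ f x) : AnalyticAt ℂ (fun x => (f x).1) x :=
  AnalyticAt.comp (g := Prod.fst) analyticAt_fst hf

@[fun_prop]
theorem analyticAt_component_snd {G : Type*} [NormedAddCommGroup G] [NormedSpace ℂ G]
    {f : E → F × G} {x : E} (hf : AnalyticAt ℂ f x) : AnalyticAt ℂ (fun x => (f x).2) x :=
  AnalyticAt.comp (g := Prod.snd) analyticAt_snd hf

variable {q : ℝ}

theorem analyticAt_br (hq0 : 0 < q) (hq1 : q < 1) {f : E → ℂ} {x : E} (hf : AnalyticAt ℂ f x) :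
    AnalyticAt ℂ (fun x => br q (f x)) x :=
  ((br_differentiable hq0 hq1).analyticAt (f x)).comp hf

theorem analyticAt_qpow (hq0 : 0 < q) {f : E → ℂ} {x : E} (hf : AnalyticAt ℂ f x) :
    AnalyticAt ℂ (fun x => (q : ℂ) ^ f x) x :=
  ((qpow_differentiable hq0).analyticAt (f x)).comp hf

end MeromorphicFunctions

/-! ### Meromorphy of the entries of R and K. -/

section Entries

variable {q : ℝ}

theorem eventually_br_affine_ne_zero (hq0 : 0 < q) (hq1 : q < 1) (a b c : ℂ)
    (h : a ≠ 0 ∨ b ≠ 0) : ∀ᶠ p : ℂ × ℂ in generic (ℂ × ℂ), br q (a * p.1 + b * p.2 + c) ≠ 0 := by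
  rcases h with h | h
  · exact eventually_br_ne_zero hq0 hq1 (by fun_prop) (a⁻¹, 0) fun x t => by
      simp only [Prod.fst_add, Prod.snd_add, Prod.smul_fst, Prod.smul_snd, smul_eq_mul]
      field_simp; ring
  · exact eventually_br_ne_zero hq0 hq1 (by fun_prop) (0, b⁻¹) fun x t => by
      simp only [Prod.fst_add, Prod.snd_add, Prod.smul_fst, Prod.smul_snd, smul_eq_mul]
      field_simp; ring

theorem eventually_br_affine_of_eq (hq0 : 0 < q) (hq1 : q < 1) {f : ℂ × ℂ → ℂ} (a b c : ℂ)
    (h : a ≠ 0 ∨ b ≠ 0) (e : ∀ p, f p = a * p.1 + b * p.2 + c) :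
    ∀ᶠ p : ℂ × ℂ in generic (ℂ × ℂ), br q (f p) ≠ 0 := by
  simp only [e]; exact eventually_br_affine_ne_zero hq0 hq1 a b c h

theorem isMeromorphic_ABa (hq0 : 0 < q) (hq1 : q < 1) (κ s : ℂ) (hs : s ≠ 0) :
    IsMeromorphic fun p : ℂ × ℂ => ABa q κ p.1 (s * p.2) := by
  simp only [ABa_eq hq0 hq1, dHat, aHat, inv_div]
  refine (IsMeromorphic.div (.of_analytic fun x => analyticAt_br hq0 hq1 (by fun_prop))
    (.of_analytic fun x => analyticAt_br hq0 hq1 (by fun_prop)) ?_).mul ?_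
  · exact eventually_br_affine_of_eq hq0 hq1 (-1) 0 (2 * κ) (by simp) (by intro p; ring)
  · have := (IsMeromorphic.div (f := fun p : ℂ × ℂ => br q (s * p.2 + 2 * κ))
      (g := fun p : ℂ × ℂ => br q (s * p.2))
      (.of_analytic fun x => analyticAt_br hq0 hq1 (by fun_prop))
      (.of_analytic fun x => analyticAt_br hq0 hq1 (by fun_prop))
      (eventually_br_affine_of_eq hq0 hq1 0 s 0 (by simp [hs]) (by intro p; ring))).const_mul (-1)
    simpa using this

theorem isMeromorphic_BBa (hq0 : 0 < q) (hq1 : q < 1) (κ s : ℂ) (hs : s ≠ 0) :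
    IsMeromorphic fun p : ℂ × ℂ => BBa q κ p.1 (s * p.2) := by
  simp only [BBa, theta_qpow hq0]
  refine IsMeromorphic.div (.of_analytic fun x => ?_) (.of_analytic fun x => ?_) ?_
  · exact ((analyticAt_qpow hq0 (by fun_prop)).mul (analyticAt_br hq0 hq1 (by fun_prop))).mul
      analyticAt_const
  · exact ((analyticAt_qpow hq0 (by fun_prop)).mul (analyticAt_br hq0 hq1 (by fun_prop))).mul
      ((analyticAt_qpow hq0 (by fun_prop)).mul (analyticAt_br hq0 hq1 (by fun_prop)))
  · filter_upwards [eventually_br_affine_of_eq hq0 hq1 (f := fun p => 2 * κ - p.1) (-1) 0 (2 * κ)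
      (by simp) (by intro p; ring), eventually_br_affine_of_eq hq0 hq1 (f := fun p => -(s * p.2))
      0 (-s) 0 (by simp [hs]) (by intro p; ring)] with p h1 h2
    exact mul_ne_zero (mul_ne_zero (qpow_ne_zero hq0 _) h1) (mul_ne_zero (qpow_ne_zero hq0 _) h2)

theorem wt_ne_zero (a : ℤˣ) : wt a ≠ 0 := by
  intro h
  have := wt_mul_self a
  rw [h] at this; simp at this

theorem isMeromorphic_RBa (hq0 : 0 < q) (hq1 : q < 1) (κ : ℂ) (ν μ : ℤˣ × ℤˣ) :
    IsMeromorphic fun p : ℂ × ℂ => RBa q κ p.1 p.2 ν μ := by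
  simp only [RBa, Matrix.of_apply]
  split_ifs
  · exact .of_analytic fun x => analyticAt_const
  · exact isMeromorphic_ABa hq0 hq1 κ _ (wt_ne_zero _)
  · exact isMeromorphic_BBa hq0 hq1 κ _ (wt_ne_zero _)
  · exact .zero


theorem isMeromorphic_Cfun (hq0 : 0 < q) (hq1 : q < 1) (P : BoundaryParams) {a b : ℂ} :
    (a ≠ 0 → b ≠ 0 → IsMeromorphic fun p : ℂ × ℂ => Cfun q P (a * p.1) (b * p.2)) ∧
    (a ≠ 0 → b ≠ 0 → IsMeromorphic fun p : ℂ × ℂ => Cfun q P (b * p.2) (a * p.1)) := by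
  simp only [Cfun_eq hq0 hq1]
  constructor
  all_goals
    intro ha hb
    refine (IsMeromorphic.div (.of_analytic fun x => ?_) (.of_analytic fun x => ?_) ?_).mul
      (.of_analytic fun x => analyticAt_qpow hq0 (by fun_prop))
    · exact (analyticAt_qpow hq0 (by fun_prop)).mul ((((analyticAt_br hq0 hq1 (by fun_prop)).mul
        (analyticAt_br hq0 hq1 (by fun_prop))).mul (analyticAt_br hq0 hq1 (by fun_prop))).mul
        (analyticAt_br hq0 hq1 (by fun_prop)))
    · exact (analyticAt_br hq0 hq1 (by fun_prop)).mul (analyticAt_br hq0 hq1 (by fun_prop))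
  · filter_upwards [eventually_br_affine_of_eq hq0 hq1 (f := fun p => 2 * (b * p.2)) 0 (2 * b) 0
      (by simp [hb]) (by intro p; ring), eventually_br_affine_of_eq hq0 hq1
      (f := fun p => P.dual.t₄ q - a * p.1) (-a) 0 (P.dual.t₄ q) (by simp [ha])
      (by intro p; ring)] with p h1 h2
    exact mul_ne_zero h1 h2
  · filter_upwards [eventually_br_affine_of_eq hq0 hq1 (f := fun p => 2 * (a * p.1)) (2 * a) 0 0
      (by simp [ha]) (by intro p; ring), eventually_br_affine_of_eq hq0 hq1
      (f := fun p => P.dual.t₄ q - b * p.2) 0 (-b) (P.dual.t₄ q) (by simp [hb])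
      (by intro p; ring)] with p h1 h2
    exact mul_ne_zero h1 h2

theorem eventually_Cfun_ne_zero (hq0 : 0 < q) (hq1 : q < 1) (P : BoundaryParams) {a b : ℂ}
    (ha : a ≠ 0) (hb : b ≠ 0) :
    ∀ᶠ p : ℂ × ℂ in generic (ℂ × ℂ), Cfun q P (b * p.2) (a * p.1) ≠ 0 := by
  have H := fun c => eventually_br_affine_of_eq hq0 hq1 (f := fun p => a * p.1 + c) a 0 c
    (by simp [ha]) (by intro p; ring)
  filter_upwards [eventually_br_affine_of_eq hq0 hq1 (f := fun p => 2 * (a * p.1)) (2 * a) 0 0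
      (by simp [ha]) (by intro p; ring), eventually_br_affine_of_eq hq0 hq1
      (f := fun p => P.dual.t₄ q - b * p.2) 0 (-b) (P.dual.t₄ q) (by simp [hb])
      (by intro p; ring), H P.t₁, H (P.t₂ q), H P.t₃, eventually_br_affine_of_eq hq0 hq1
      (f := fun p => P.eps q + a * p.1 - b * p.2) a (-b) (P.eps q) (by simp [ha])
      (by intro p; ring)] with p h1 h2 h3 h4 h5 h6
  rw [Cfun_eq hq0 hq1]
  exact mul_ne_zero (div_ne_zero (mul_ne_zero (qpow_ne_zero hq0 _)
    (mul_ne_zero (mul_ne_zero (mul_ne_zero h3 h4) h5) h6)) (mul_ne_zero h1 h2)) (qpow_ne_zero hq0 _)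

theorem isMeromorphic_alphaBa (hq0 : 0 < q) (hq1 : q < 1) (P : BoundaryParams) {s : ℂ}
    (hs : s ≠ 0) : IsMeromorphic fun p : ℂ × ℂ => alphaBa q P p.1 (s * p.2) := by
  have h1 := (isMeromorphic_Cfun hq0 hq1 P (a := 1) (b := s)).1 one_ne_zero hs
  have h2 := (isMeromorphic_Cfun hq0 hq1 P.dual (a := 1) (b := s)).2 one_ne_zero hs
  have h3 := (isMeromorphic_Cfun hq0 hq1 P.dual (a := -1) (b := s)).2 (by simp) hs
  have h4 := eventually_Cfun_ne_zero hq0 hq1 P.dual (a := -1) (b := s) (by simp) hs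
  simp only [one_mul, neg_mul] at h1 h2 h3 h4
  exact ((h1.sub h2).div h3 h4).mul (.of_analytic fun x => analyticAt_qpow hq0 (by fun_prop))

theorem isMeromorphic_betaBa (hq0 : 0 < q) (hq1 : q < 1) (P : BoundaryParams) {s : ℂ}
    (hs : s ≠ 0) : IsMeromorphic fun p : ℂ × ℂ => betaBa q P p.1 (s * p.2) := by
  have h1 := (isMeromorphic_Cfun hq0 hq1 P (a := 1) (b := s)).1 one_ne_zero hs
  have h3 := (isMeromorphic_Cfun hq0 hq1 P.dual (a := -1) (b := -s)).2 (by simp) (neg_ne_zero.2 hs)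
  have h4 := eventually_Cfun_ne_zero hq0 hq1 P.dual (a := -1) (b := -s) (by simp)
    (neg_ne_zero.2 hs)
  simp only [one_mul, neg_mul] at h1 h3 h4
  exact h1.div h3 h4

theorem isMeromorphic_KBa (hq0 : 0 < q) (hq1 : q < 1) (P : BoundaryParams) (ν μ : ℤˣ) :
    IsMeromorphic fun p : ℂ × ℂ => KBa q P p.1 p.2 ν μ := by
  simp only [KBa, Matrix.of_apply]
  split_ifs
  · exact isMeromorphic_alphaBa hq0 hq1 P (wt_ne_zero _)
  · exact isMeromorphic_betaBa hq0 hq1 P (wt_ne_zero _)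

theorem isMeromorphic_KBaLeft (hq0 : 0 < q) (hq1 : q < 1) (P : BoundaryParams) (ν μ : ℤˣ) :
    IsMeromorphic fun p : ℂ × ℂ => KBaLeft q P p.1 p.2 ν μ := by
  simp only [KBaLeft, KBa, Matrix.of_apply, mul_neg, ← neg_mul]
  split_ifs
  · exact isMeromorphic_alphaBa hq0 hq1 P (neg_ne_zero.2 (wt_ne_zero _))
  · exact isMeromorphic_betaBa hq0 hq1 P (neg_ne_zero.2 (wt_ne_zero _))

end Entries

/-! ### Action of one-leg and two-leg operators in coordinates. -/

section Legs

variable {n : ℕ}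

theorem sum_signs (f : ℤˣ → ℂ) (c : ℤˣ) : ∑ a, f a = f c + f (-c) := by
  rw [show (Finset.univ : Finset ℤˣ) = {1, -1} from rfl, Finset.sum_pair (by decide)]
  rcases Int.units_eq_one_or c with rfl | rfl
  · rfl
  · rw [neg_neg, add_comm]

/-- Replace the signs in the positions `i` and `j`. -/
def upd₂ (i j : Fin n) (ε : Fin n → ℤˣ) (a b : ℤˣ) : Fin n → ℤˣ :=
  Function.update (Function.update ε i a) j b

/-- Replace the signs in the positions `i`, `j` and `l`. -/
def upd₃ (i j l : Fin n) (ε : Fin n → ℤˣ) (a b c : ℤˣ) : Fin n → ℤˣ :=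
  Function.update (upd₂ i j ε a b) l c

section

variable {i j l : Fin n} (ε : Fin n → ℤˣ) (a b c a' b' c' : ℤˣ)

theorem upd₂_left (hij : i ≠ j) : upd₂ i j ε a b i = a := by simp [upd₂, hij]

theorem upd₂_right : upd₂ i j ε a b j = b := by simp [upd₂]

theorem upd₂_of_ne {k : Fin n} (hi : k ≠ i) (hj : k ≠ j) : upd₂ i j ε a b k = ε k := by
  simp [upd₂, hi, hj]

theorem upd₂_self : upd₂ i j ε (ε i) (ε j) = ε := by
  funext k
  by_cases hj : k = j
  · subst hj; simp [upd₂]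
  by_cases hi : k = i
  · subst hi; simp [upd₂, hj]
  · simp [upd₂, hj]

theorem upd₂_upd₂ (hij : i ≠ j) : upd₂ i j (upd₂ i j ε a b) a' b' = upd₂ i j ε a' b' := by
  funext k
  by_cases hj : k = j
  · subst hj; simp [upd₂]
  by_cases hi : k = i
  · subst hi; simp [upd₂, hij]
  · simp [upd₂, hi, hj]

theorem upd₂_comm (hij : i ≠ j) : upd₂ j i ε b a = upd₂ i j ε a b := by
  rw [upd₂, upd₂, Function.update_comm hij.symm]

theorem update_upd₂_left (hij : i ≠ j) :
    Function.update (upd₂ i j ε a b) i a' = upd₂ i j ε a' b := by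
  rw [upd₂, Function.update_comm hij.symm, Function.update_idem, upd₂]

theorem update_upd₂_right : Function.update (upd₂ i j ε a b) j b' = upd₂ i j ε a b' := by
  rw [upd₂, Function.update_idem, upd₂]

theorem upd₃_self : upd₃ i j l ε (ε i) (ε j) (ε l) = ε := by
  rw [upd₃, upd₂_self, Function.update_eq_self]

theorem upd₃_fst (hij : i ≠ j) (hil : i ≠ l) : upd₃ i j l ε a b c i = a := by
  rw [upd₃, Function.update_of_ne hil, upd₂_left _ _ _ hij]

theorem upd₃_snd (hjl : j ≠ l) : upd₃ i j l ε a b c j = b := by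
  rw [upd₃, Function.update_of_ne hjl, upd₂_right]

theorem upd₃_thd : upd₃ i j l ε a b c l = c := by simp [upd₃]

theorem upd₂_upd₃_fst (hij : i ≠ j) (hil : i ≠ l) (hjl : j ≠ l) :
    upd₂ i j (upd₃ i j l ε a b c) a' b' = upd₃ i j l ε a' b' c := by
  funext k
  by_cases hi : k = i
  · subst hi; simp [upd₃, upd₂, hij, hil]
  by_cases hj : k = j
  · subst hj; simp [upd₃, upd₂, hjl]
  by_cases hl : k = l
  · subst hl; simp [upd₃, upd₂, hi, hj]
  · simp [upd₃, upd₂, hi, hj, hl]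

theorem upd₂_upd₃_snd (hij : i ≠ j) (hil : i ≠ l) (hjl : j ≠ l) :
    upd₂ j l (upd₃ i j l ε a b c) b' c' = upd₃ i j l ε a b' c' := by
  funext k
  by_cases hi : k = i
  · subst hi; simp [upd₃, upd₂, hij, hil]
  by_cases hj : k = j
  · subst hj; simp [upd₃, upd₂, hjl]
  by_cases hl : k = l
  · subst hl; simp [upd₃, upd₂]
  · simp [upd₃, upd₂, hi, hj, hl]

theorem upd₂_upd₃_thd (hij : i ≠ j) (hil : i ≠ l) (hjl : j ≠ l) :
    upd₂ i l (upd₃ i j l ε a b c) a' c' = upd₃ i j l ε a' b c' := by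
  funext k
  by_cases hi : k = i
  · subst hi; simp [upd₃, upd₂, hij, hil]
  by_cases hj : k = j
  · subst hj; simp [upd₃, upd₂, hjl, hi]
  by_cases hl : k = l
  · subst hl; simp [upd₃, upd₂]
  · simp [upd₃, upd₂, hi, hj, hl]

end

theorem leg₁_mulVec (i : Fin n) (S : (Fin n → ℤˣ) → Matrix ℤˣ ℤˣ ℂ) (v : Spin n)
    (ε : Fin n → ℤˣ) : (leg₁ i S).mulVec v ε =
      ∑ a, S (Function.update ε i a) (ε i) a * v (Function.update ε i a) := by
  rw [Matrix.mulVec, dotProduct]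
  symm
  refine Finset.sum_of_injOn (fun a => Function.update ε i a)
    (fun a _ b _ h => Function.update_injective ε i h) (by simp) ?_ ?_
  · intro δ _ hδ
    rw [leg₁, Matrix.of_apply, if_neg, zero_mul]
    intro h
    refine hδ ⟨δ i, Finset.mem_coe.2 (Finset.mem_univ _), ?_⟩
    funext k
    by_cases hk : k = i
    · subst hk; simp
    · simp [hk, h k hk]
  · intro a _
    rw [leg₁, Matrix.of_apply, if_pos, Function.update_self]
    intro k hk
    simp [hk]

theorem leg₂_mulVec {i j : Fin n} (hij : i ≠ j)
    (S : (Fin n → ℤˣ) → Matrix (ℤˣ × ℤˣ) (ℤˣ × ℤˣ) ℂ) (v : Spin n)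
    (ε : Fin n → ℤˣ) : (leg₂ i j S).mulVec v ε =
      ∑ a, ∑ b, S (upd₂ i j ε a b) (ε i, ε j) (a, b) * v (upd₂ i j ε a b) := by
  rw [Matrix.mulVec, dotProduct, ← Finset.sum_product']
  symm
  refine Finset.sum_of_injOn (fun p : ℤˣ × ℤˣ => upd₂ i j ε p.1 p.2) ?_ (by simp) ?_ ?_
  · intro p _ r _ h
    have h1 := congrFun h i
    have h2 := congrFun h j
    simp only [upd₂_left _ _ _ hij, upd₂_right] at h1 h2
    exact Prod.ext h1 h2
  · intro δ _ hδ
    rw [leg₂, Matrix.of_apply, if_neg, zero_mul]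
    intro h
    refine hδ ⟨(δ i, δ j), Finset.mem_coe.2 (by simp only [Finset.mem_product, Finset.mem_univ, and_self]), ?_⟩
    funext k
    by_cases hj : k = j
    · subst hj; simp [upd₂]
    by_cases hi : k = i
    · subst hi; simp [upd₂, hij]
    · simp [upd₂, hi, hj, h k hi hj]
  · intro p _
    rw [leg₂, Matrix.of_apply, if_pos, upd₂_left _ _ _ hij, upd₂_right]
    intro k hi hj
    rw [upd₂_of_ne _ _ _ hi hj]

variable {q : ℝ}

/-- The matrix is evaluated at the weights of the source vector; as x does not see leg i, these may
be replaced by the weights of the target. -/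
theorem leg₁_KBa_mulVec (P : BoundaryParams) (i : Fin n) (z : ℂ) (x : (Fin n → ℤˣ) → ℂ)
    (hx : ∀ ε a, x (Function.update ε i a) = x ε) (v : Spin n) (ε : Fin n → ℤˣ) :
    (leg₁ i fun ε => KBa q P z (x ε)).mulVec v ε =
      kOp q P z (x ε) (fun a => v (Function.update ε i a)) (ε i) := by
  rw [leg₁_mulVec, sum_signs _ (ε i), kOp, bdryOp]
  simp only [hx, KBa, Matrix.of_apply, if_true, sign_eq_neg_self, if_false]

/-- By the ice rule only ε and the vector with the signs i and j exchanged contribute, so the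
dynamical argument needs to be invariant under this exchange only. -/
theorem leg₂_RBa_mulVec (κ : ℂ) {i j : Fin n} (hij : i ≠ j) (z : ℂ) (h : (Fin n → ℤˣ) → ℂ)
    (hs : ∀ ε, h (upd₂ i j ε (ε j) (ε i)) = h ε) (v : Spin n) (ε : Fin n → ℤˣ) :
    (leg₂ i j fun ε => RBa q κ z (h ε)).mulVec v ε =
      rOp q κ z (h ε) (fun a b => v (upd₂ i j ε a b)) (ε i) (ε j) := by
  rw [leg₂_mulVec hij, sum_signs _ (ε i), sum_signs _ (ε j), sum_signs _ (ε j), rOp, iceOp]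
  have hε := hs ε
  rw [upd₂_self]
  have hc : ∀ a b : ℤˣ, b = a ∨ b = -a := by decide
  rcases hc (ε i) (ε j) with e | e
  · simp [e, RBa]
  · rw [e] at hε ⊢
    simp [RBa, hε]

theorem matrix_ext_mulVec {A B : SpinOp n} (h : ∀ v ε, A.mulVec v ε = B.mulVec v ε) : A = B :=
  Matrix.toLin'.injective (LinearMap.ext fun v => funext fun ε => by simpa using h v ε)

end Legs

/-! ### The dynamical Yang-Baxter, reflection and unitarity equations in matrix form. -/

section Parts

variable {q : ℝ}

/-- R depends on ξ only on the sector a ≠ b, where the total weight is zero. -/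
theorem rOp_add_weights (κ z ξ c : ℂ) (f : ℤˣ → ℤˣ → ℂ) (a b : ℤˣ) :
    rOp q κ z (ξ + c * (wt a + wt b)) f a b = rOp q κ z ξ f a b := by
  have hc : ∀ a b : ℤˣ, b = a ∨ b = -a := by decide
  rcases hc a b with rfl | rfl
  · simp [rOp, iceOp]
  · simp [wt_neg]

/-- Changing the sign of ξ amounts to exchanging the two legs. -/
theorem rOp_neg (κ z ξ : ℂ) (f : ℤˣ → ℤˣ → ℂ) (a b : ℤˣ) :
    rOp q κ z (-ξ) f a b = rOp q κ z ξ (fun b a => f a b) b a := by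
  have hc : ∀ a b : ℤˣ, b = a ∨ b = -a := by decide
  rcases hc a b with rfl | rfl
  · simp [rOp, iceOp]
  · simp [rOp, iceOp, wt_neg]

theorem eventually_KRegular (hq0 : 0 < q) (hq1 : q < 1) (P : BoundaryParams) :
    ∀ᶠ p : ℂ × ℂ in generic (ℂ × ℂ), KRegular q P p.1 p.2 := by
  unfold KRegular
  simp only [eventually_all]
  intro s t
  unfold RegularSpectral RegularEntry
  simp only [eventually_and]
  have hs := wt_ne_zero s
  have ht := wt_ne_zero t
  have E := fun {f : ℂ × ℂ → ℂ} (a b c : ℂ) =>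
    eventually_br_affine_of_eq (f := f) hq0 hq1 a b c
  refine ⟨⟨E (2 * wt t) 0 0 ?_ ?_, E (-wt t) 0 P.dual.t₁ ?_ ?_, E (-wt t) 0 (P.dual.t₂ q) ?_ ?_,
    E (-wt t) 0 P.dual.t₃ ?_ ?_, E (-wt t) 0 (P.dual.t₄ q) ?_ ?_,
    E (-2 * wt t) 0 (2 * P.eps q) ?_ ?_⟩, E 0 (2 * wt s) 0 ?_ ?_, E 0 (wt s) (P.t₄ q) ?_ ?_,
    E 0 (-wt s) (P.t₄ q) ?_ ?_, E (-wt t) (-wt s) (P.eps q) ?_ ?_,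
    E (-wt t) (wt s) (P.eps q) ?_ ?_⟩
  all_goals first
    | (intro p; ring)
    | simp [hs, ht]

/-- `Ř₁₂Ř₂₃Ř₁₂ = Ř₂₃Ř₁₂Ř₂₃` for the braided operators `Ř`. -/
theorem rOp_braid (hq0 : 0 < q) (hq1 : q < 1) (κ : ℂ) {z w h : ℂ} (hz : br q z ≠ 0)
    (hw : br q w ≠ 0) (hzw : br q (z + w) ≠ 0) (hz' : br q (2 * κ - z) ≠ 0)
    (hw' : br q (2 * κ - w) ≠ 0) (hzw' : br q (2 * κ - (z + w)) ≠ 0) (hh : br q h ≠ 0)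
    (hp : br q (h + 2 * κ) ≠ 0) (hm : br q (h - 2 * κ) ≠ 0)
    (f : ℤˣ → ℤˣ → ℤˣ → ℂ) (a b c : ℤˣ) :
    rOp q κ z (h - 2 * κ * wt a) (fun b c => rOp q κ (z + w) h (fun a b =>
      rOp q κ w (h - 2 * κ * wt a) (fun b c => f a b c) c b) b a) c b =
    rOp q κ w h (fun a b => rOp q κ (z + w) (h - 2 * κ * wt a) (fun b c =>
      rOp q κ z h (fun a b => f a b c) b a) c b) b a :=
  rOp_yangBaxter hq0 hq1 κ hz hw hzw hz' hw' hzw' hh hp hm f c b a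

variable {n : ℕ}

theorem eventually_br_coord_sub (hq0 : 0 < q) (hq1 : q < 1) {i j : Fin n} (hij : i ≠ j) (c : ℂ) :
    ∀ᶠ x : Vars n in generic (Vars n), br q (c - (x.1 i - x.1 j)) ≠ 0 :=
  eventually_br_ne_zero hq0 hq1 (by fun_prop) (Pi.single j 1, 0) fun x t => by
    simp [hij]; ring

theorem eventually_br_coord_add (hq0 : 0 < q) (hq1 : q < 1) {i j : Fin n} (hij : i ≠ j) (c : ℂ) :
    ∀ᶠ x : Vars n in generic (Vars n), br q (c - (x.1 i + x.1 j)) ≠ 0 :=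
  eventually_br_ne_zero hq0 hq1 (by fun_prop) (Pi.single j (-1), 0) fun x t => by
    simp [hij]; ring

theorem eventually_br_dyn (hq0 : 0 < q) (hq1 : q < 1) {s : ℂ} (hs : s ≠ 0) (c : ℂ) :
    ∀ᶠ x : Vars n in generic (Vars n), br q (s * x.2 + c) ≠ 0 :=
  eventually_br_ne_zero hq0 hq1 (by fun_prop) (0, s⁻¹) fun x t => by
    simp; field_simp; ring

theorem isOpenMap_coord_dyn (i : Fin n) {s t : ℂ} (hs : s ≠ 0) (ht : t ≠ 0) (c d : ℂ) :
    IsOpenMap fun x : Vars n => (s * x.1 i + c, t * x.2 + d) :=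
  isOpenMap_of_directions (Pi.single i s⁻¹, 0) (0, t⁻¹) fun x a b => by
    ext <;> simp <;> field_simp <;> ring

theorem eventually_KRegular_coord (hq0 : 0 < q) (hq1 : q < 1) (P : BoundaryParams) (i : Fin n)
    {s t : ℂ} (hs : s ≠ 0) (ht : t ≠ 0) (c d : ℂ) :
    ∀ᶠ x : Vars n in generic (Vars n), KRegular q P (s * x.1 i + c) (t * x.2 + d) :=
  (tendsto_generic_of_isOpenMap (by fun_prop) (isOpenMap_coord_dyn i hs ht c d)).eventually
    (eventually_KRegular hq0 hq1 P)

theorem eventually_rOp_regular (hq0 : 0 < q) (hq1 : q < 1) (κ : ℂ) {i j : Fin n} (hij : i ≠ j) :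
    ∀ᶠ x : Vars n in generic (Vars n), br q (x.1 i - x.1 j) ≠ 0 ∧
      br q (2 * κ - (x.1 i - x.1 j)) ≠ 0 ∧ br q (2 * κ + (x.1 i - x.1 j)) ≠ 0 ∧
      br q (x.1 i + x.1 j) ≠ 0 ∧ br q (2 * κ - (x.1 i + x.1 j)) ≠ 0 := by
  filter_upwards [eventually_br_coord_sub hq0 hq1 hij.symm 0,
    eventually_br_coord_sub hq0 hq1 hij (2 * κ), eventually_br_coord_sub hq0 hq1 hij.symm (2 * κ),
    eventually_br_coord_add hq0 hq1 hij 0, eventually_br_coord_add hq0 hq1 hij (2 * κ)]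
    with x h1 h2 h3 h4 h5
  refine ⟨by simpa using h1, h2, by simpa [sub_eq_add_neg, add_comm] using h3, ?_, h5⟩
  rw [zero_sub, br_neg hq0 hq1, neg_ne_zero] at h4
  exact h4

theorem isDynamicalR_RBa (hq0 : 0 < q) (hq1 : q < 1) (κ : ℂ) : IsDynamicalR κ (RBa q κ) where
  meromorphic := isMeromorphic_RBa hq0 hq1 κ
  yangBaxter := by
    have h01 : (0 : Fin 3) ≠ 1 := by decide
    have h02 : (0 : Fin 3) ≠ 2 := by decide
    have h12 : (1 : Fin 3) ≠ 2 := by decide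
    filter_upwards [eventually_rOp_regular hq0 hq1 κ h01, eventually_rOp_regular hq0 hq1 κ h02,
      eventually_rOp_regular hq0 hq1 κ h12, eventually_br_dyn hq0 hq1 one_ne_zero 0,
      eventually_br_dyn hq0 hq1 one_ne_zero (2 * κ),
      eventually_br_dyn hq0 hq1 one_ne_zero (-(2 * κ))] with x r1 r2 r3 h1 h2 h3
    rw [one_mul, add_zero] at h1
    rw [one_mul] at h2 h3
    rw [← sub_eq_add_neg] at h3
    refine matrix_ext_mulVec fun v ε => ?_
    rw [← upd₃_self (i := 0) (j := 1) (l := 2) ε]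
    generalize ε 0 = a; generalize ε 1 = b; generalize ε 2 = c
    have L1 := fun z (x : ℂ) => leg₂_RBa_mulVec (q := q) κ h01 z
      (fun ε => x - 2 * κ * wt (ε 2)) fun ε => by rw [upd₂_of_ne _ _ _ h02.symm h12.symm]
    have L2 := fun z (x : ℂ) => leg₂_RBa_mulVec (q := q) κ h02 z
      (fun ε => x - 2 * κ * wt (ε 1)) fun ε => by rw [upd₂_of_ne _ _ _ h01.symm h12]
    have L3 := fun z (x : ℂ) => leg₂_RBa_mulVec (q := q) κ h12 z
      (fun ε => x - 2 * κ * wt (ε 0)) fun ε => by rw [upd₂_of_ne _ _ _ h01 h02]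
    have L1' := fun z (x : ℂ) => leg₂_RBa_mulVec (q := q) κ h01 z (fun _ => x) fun _ => rfl
    have L2' := fun z (x : ℂ) => leg₂_RBa_mulVec (q := q) κ h02 z (fun _ => x) fun _ => rfl
    have L3' := fun z (x : ℂ) => leg₂_RBa_mulVec (q := q) κ h12 z (fun _ => x) fun _ => rfl
    simp only [← Matrix.mulVec_mulVec, L1, L2, L3, L1', L2', L3',
      upd₂_upd₃_fst _ _ _ _ _ _ h01 h02 h12, upd₂_upd₃_snd _ _ _ _ _ _ h01 h02 h12,
      upd₂_upd₃_thd _ _ _ _ _ _ h01 h02 h12, upd₃_fst _ _ _ _ h01 h02, upd₃_snd _ _ _ _ h12,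
      upd₃_thd]
    have e : x.1 0 - x.1 2 = (x.1 0 - x.1 1) + (x.1 1 - x.1 2) := by ring
    rw [e] at r2 ⊢
    exact rOp_yangBaxter hq0 hq1 κ r1.1 r3.1 r2.1 r1.2.1 r3.2.1 r2.2.1 h1 h2 h3
      (fun a b c => v (upd₃ 0 1 2 ε a b c)) a b c

theorem isUnitaryR_RBa (hq0 : 0 < q) (hq1 : q < 1) (κ : ℂ) : IsUnitaryR (RBa q κ) := by
  have E := fun {f : ℂ × ℂ → ℂ} (a b c : ℂ) =>
    eventually_br_affine_of_eq (f := f) hq0 hq1 a b c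
  filter_upwards [E (f := fun p => p.1) 1 0 0 (by simp) (by intro p; ring),
    E (f := fun p => 2 * κ - p.1) (-1) 0 (2 * κ) (by simp) (by intro p; ring),
    E (f := fun p => 2 * κ + p.1) 1 0 (2 * κ) (by simp) (by intro p; ring),
    E (f := fun p => p.2) 0 1 0 (by simp) (by intro p; ring)] with p h1 h2 h3 h4
  have h01 : (0 : Fin 2) ≠ 1 := by decide
  refine matrix_ext_mulVec fun v ε => ?_
  rw [Matrix.one_mulVec, ← upd₂_self (i := 0) (j := 1) ε]
  generalize ε 0 = a; generalize ε 1 = b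
  have L1' := fun z (x : ℂ) => leg₂_RBa_mulVec (q := q) κ h01 z (fun _ => x) fun _ => rfl
  have L2' := fun z (x : ℂ) => leg₂_RBa_mulVec (q := q) κ h01.symm z (fun _ => x) fun _ => rfl
  simp only [← Matrix.mulVec_mulVec, L1', L2', upd₂_comm _ _ _ h01, upd₂_upd₂ _ _ _ _ _ h01,
    upd₂_left _ _ _ h01, upd₂_right]
  exact rOp_unitarity hq0 hq1 κ h1 h2 h3 h4 (fun a b => v (upd₂ 0 1 ε a b)) a b

theorem iceRule_RBa (κ : ℂ) : IceRule (RBa q κ) := by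
  refine Eventually.of_forall fun p => ?_
  ext ν μ
  rw [Matrix.mul_diagonal, Matrix.diagonal_mul, RBa, Matrix.of_apply]
  by_cases h1 : ν = μ
  · subst h1; rw [mul_comm]
  rw [if_neg h1]
  by_cases h2 : ν = μ.swap
  · subst h2; simp only [Prod.fst_swap, Prod.snd_swap]; ring
  · rw [if_neg h2]; ring

theorem isUnitaryK_KBa (hq0 : 0 < q) (hq1 : q < 1) (P : BoundaryParams) :
    IsUnitaryK (KBa q P) ∧ IsUnitaryK (KBaLeft q P) := by
  have main : ∀ z x, KRegular q P z x → KBa q P z x * KBa q P (-z) x = 1 := fun z x h => by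
    have e : ∀ z (v : ℤˣ → ℂ) a, (KBa q P z x).mulVec v a = kOp q P z x v a := fun z v a => by
      rw [Matrix.mulVec, dotProduct, sum_signs _ a, kOp, bdryOp]
      simp [KBa]
    refine Matrix.toLin'.injective (LinearMap.ext fun v => funext fun a => ?_)
    rw [Matrix.toLin'_apply, Matrix.toLin'_apply, ← Matrix.mulVec_mulVec, e,
      show (KBa q P (-z) x).mulVec v = kOp q P (-z) x v from funext (e _ v),
      kOp_unitarity hq0 hq1 h, Matrix.one_mulVec]
  constructor
  · filter_upwards [eventually_KRegular hq0 hq1 P] with p h using main _ _ h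
  · filter_upwards [eventually_KRegular hq0 hq1 P] with p h using main _ _ h.neg_entry

theorem isRightDynamicalK_KBa (hq0 : 0 < q) (hq1 : q < 1) (κ : ℂ) (P : BoundaryParams) :
    IsRightDynamicalK κ (RBa q κ) (KBa q P) where
  meromorphic := isMeromorphic_KBa hq0 hq1 P
  reflection := by
    have h01 : (0 : Fin 2) ≠ 1 := by decide
    have K := fun i d => eventually_KRegular_coord (n := 2) hq0 hq1 P i one_ne_zero one_ne_zero 0 d
    simp only [one_mul, add_zero] at K
    filter_upwards [eventually_rOp_regular hq0 hq1 κ h01, eventually_br_dyn hq0 hq1 two_ne_zero 0,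
      K 0 κ, K 0 (-κ), K 1 κ, K 1 (-κ)] with x r h k1 k2 k3 k4
    rw [add_zero] at h
    rw [← sub_eq_add_neg] at k2 k4
    refine matrix_ext_mulVec fun v ε => ?_
    rw [← upd₂_self (i := 0) (j := 1) ε]
    generalize ε 0 = a; generalize ε 1 = b
    have L1 := fun z (x : ℂ) => leg₂_RBa_mulVec (q := q) κ h01 z (fun _ => x) fun _ => rfl
    have L2 := fun z (x : ℂ) => leg₂_RBa_mulVec (q := q) κ h01.symm z (fun _ => x) fun _ => rfl
    have L3 := fun z (x : ℂ) => leg₁_KBa_mulVec (q := q) P (0 : Fin 2) z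
      (fun ε => x - κ * wt (ε 1)) fun ε a => by rw [Function.update_of_ne h01.symm]
    have L4 := fun z (x : ℂ) => leg₁_KBa_mulVec (q := q) P (1 : Fin 2) z
      (fun ε => x - κ * wt (ε 0)) fun ε a => by rw [Function.update_of_ne h01]
    simp only [← Matrix.mulVec_mulVec, L1, L2, L3, L4, upd₂_comm _ _ _ h01,
      upd₂_upd₂ _ _ _ _ _ h01, upd₂_left _ _ _ h01, upd₂_right, update_upd₂_right,
      update_upd₂_left _ _ _ _ h01]
    exact rOp_kOp_reflection hq0 hq1 κ r.1 r.2.2.2.1 r.2.1 r.2.2.2.2 h k1 k2 k3 k4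
      (fun a b => v (upd₂ 0 1 ε a b)) a b

/-- The shift by Δ(h) is invisible to R, and -ξ exchanges R with R₂₁. So the left equation at ξ is
the right equation at -ξ. -/
theorem isLeftDynamicalK_KBaLeft (hq0 : 0 < q) (hq1 : q < 1) (κ : ℂ) (P : BoundaryParams) :
    IsLeftDynamicalK κ (RBa q κ) (KBaLeft q P) where
  meromorphic := isMeromorphic_KBaLeft hq0 hq1 P
  reflection := by
    have h01 : (0 : Fin 2) ≠ 1 := by decide
    have K := fun i d => eventually_KRegular_coord (n := 2) hq0 hq1 P i one_ne_zero
      (neg_ne_zero.2 one_ne_zero) 0 d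
    simp only [one_mul, add_zero, neg_mul] at K
    filter_upwards [eventually_rOp_regular hq0 hq1 κ h01, eventually_br_dyn hq0 hq1
      (s := -2) (by simp) 0, K 0 κ, K 0 (-κ), K 1 κ, K 1 (-κ)] with x r h k1 k2 k3 k4
    rw [add_zero, neg_mul, ← mul_neg] at h
    rw [← sub_eq_add_neg] at k2 k4
    refine matrix_ext_mulVec fun v ε => ?_
    rw [← upd₂_self (i := 0) (j := 1) ε]
    generalize ε 0 = a; generalize ε 1 = b
    have L1 := fun z (x : ℂ) => leg₂_RBa_mulVec (q := q) κ h01 z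
      (fun ε => x + 2 * κ * (wt (ε 0) + wt (ε 1))) fun ε => by
        rw [upd₂_left _ _ _ h01, upd₂_right, add_comm (wt (ε 1))]
    have L2 := fun z (x : ℂ) => leg₂_RBa_mulVec (q := q) κ h01.symm z
      (fun ε => x + 2 * κ * (wt (ε 0) + wt (ε 1))) fun ε => by
        rw [upd₂_left _ _ _ h01.symm, upd₂_right, add_comm (wt (ε 1))]
    have L3 := fun z (x : ℂ) => leg₁_KBa_mulVec (q := q) P (0 : Fin 2) z
      (fun ε => -(x + κ * wt (ε 1))) fun ε a => by rw [Function.update_of_ne h01.symm]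
    have L4 := fun z (x : ℂ) => leg₁_KBa_mulVec (q := q) P (1 : Fin 2) z
      (fun ε => -(x + κ * wt (ε 0))) fun ε a => by rw [Function.update_of_ne h01]
    have W := fun z x f a b => (rOp_add_weights (q := q) κ z x (2 * κ) f b a)
    simp only [add_comm (wt _) (wt _)] at W
    simp only [KBaLeft, ← Matrix.mulVec_mulVec, L1, L2, L3, L4, upd₂_comm _ _ _ h01,
      upd₂_upd₂ _ _ _ _ _ h01, upd₂_left _ _ _ h01, upd₂_right, update_upd₂_right,
      update_upd₂_left _ _ _ _ h01, rOp_add_weights, W]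
    have key := rOp_kOp_reflection (ξ := -x.2) hq0 hq1 κ r.1 r.2.2.2.1 r.2.1 r.2.2.2.2 h k1 k2 k3 k4
      (fun a b => v (upd₂ 0 1 ε a b)) a b
    simp only [mul_neg, rOp_neg, ← neg_add'] at key
    exact key

end Parts

/-! ### Coxeter presentation of the symmetric group. -/

section TypeA

variable {G : Type*} [Group G]

/-- The Coxeter relations of type `A` for the elements `s 0, …, s (m - 1)`. -/
structure IsTypeA (m : ℕ) (s : ℕ → G) : Prop where
  sq : ∀ i < m, s i * s i = 1
  braid : ∀ i, i + 1 < m → s i * s (i + 1) * s i = s (i + 1) * s i * s (i + 1)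
  comm : ∀ i j, i + 1 < j → j < m → s i * s j = s j * s i

/-- The product `s k * s (k + 1) * ⋯ * s (k + d - 1)`. -/
def ascProd (s : ℕ → G) : ℕ → ℕ → G
  | _, 0 => 1
  | k, d + 1 => s k * ascProd s (k + 1) d

variable {m : ℕ} {s : ℕ → G}

theorem IsTypeA.mul_ascProd_of_lt (h : IsTypeA m s) {i k d : ℕ} (hi : i + 1 < k)
    (hk : k + d ≤ m) : s i * ascProd s k d = ascProd s k d * s i := by
  induction d generalizing k with
  | zero => simp [ascProd]
  | succ d ih =>
    rw [ascProd, ← mul_assoc, h.comm i k hi (by omega), mul_assoc, ih (by omega) (by omega),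
      mul_assoc]

/-- A generator passes through the ascending product by one braid relation, which lowers its index
by one. -/
theorem IsTypeA.mul_ascProd_of_gt (h : IsTypeA m s) {i k d : ℕ} (hi : k ≤ i)
    (hd : i + 1 < k + d) (hk : k + d ≤ m) :
    s (i + 1) * ascProd s k d = ascProd s k d * s i := by
  induction d generalizing k with
  | zero => omega
  | succ d ih =>
    rcases hi.eq_or_lt with rfl | hlt
    · obtain ⟨e, rfl⟩ : ∃ e, d = e + 1 := ⟨d - 1, by omega⟩
      rw [ascProd, ascProd, mul_assoc, mul_assoc, ← h.mul_ascProd_of_lt (by omega) (by omega)]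
      simp only [← mul_assoc]
      rw [h.braid k (by omega)]
    · rw [ascProd, ← mul_assoc, ← h.comm k (i + 1) (by omega) (by omega), mul_assoc,
        ih (by omega) (by omega) (by omega), mul_assoc]

open Classical in
/-- The products of the form `c_{N} ⋯ c_1` with `c_j = s k ⋯ s (j - 1)`, `k ≤ j`. -/
def normalForms (s : ℕ → G) : ℕ → Finset G
  | 0 => {1}
  | N + 1 => Finset.image₂ (fun k e => ascProd s k (N + 1 - k) * e) (Finset.range (N + 2))
      (normalForms s N)

theorem card_normalForms_le (s : ℕ → G) (N : ℕ) : (normalForms s N).card ≤ (N + 1).factorial := by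
  classical
  induction N with
  | zero => simp [normalForms]
  | succ N ih =>
    rw [normalForms, Nat.factorial_succ]
    refine (Finset.card_image₂_le _ _ _).trans ?_
    rw [Finset.card_range]
    exact Nat.mul_le_mul_left _ ih

theorem one_mem_normalForms (s : ℕ → G) (N : ℕ) : (1 : G) ∈ normalForms s N := by
  classical
  induction N with
  | zero => simp [normalForms]
  | succ N ih =>
    rw [normalForms, Finset.mem_image₂]
    exact ⟨N + 1, by simp, 1, ih, by simp [ascProd]⟩

/-- For c = s_k ⋯ s_N: if i + 1 < k, s_i commutes with c; if i + 1 = k, it prolongs c; if i = k, it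
cancels the first letter; if i > k, it passes through as s_{i-1}. In the first and last case the
induction hypothesis takes over. -/
theorem IsTypeA.mul_mem_normalForms (h : IsTypeA m s) {N : ℕ} (hN : N ≤ m) {i : ℕ} (hi : i < N)
    {g : G} (hg : g ∈ normalForms s N) : s i * g ∈ normalForms s N := by
  classical
  induction N generalizing i g with
  | zero => omega
  | succ N ih =>
    rw [normalForms, Finset.mem_image₂] at hg ⊢
    obtain ⟨k, hk, e, he, rfl⟩ := hg
    rw [Finset.mem_range] at hk
    rcases lt_trichotomy (i + 1) k with hlt | heq | hgt
    · exact ⟨k, Finset.mem_range.2 hk, s i * e, ih (by omega) (by omega) he, by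
        rw [← mul_assoc, ← h.mul_ascProd_of_lt hlt (by omega), mul_assoc]⟩
    · refine ⟨i, Finset.mem_range.2 (by omega), e, he, ?_⟩
      rw [show N + 1 - i = (N + 1 - k) + 1 by omega, ascProd, heq, mul_assoc]
    · rcases (Nat.lt_succ_iff.1 hgt).eq_or_lt with rfl | hlt
      · refine ⟨k + 1, Finset.mem_range.2 (by omega), e, he, ?_⟩
        rw [show N + 1 - k = (N + 1 - (k + 1)) + 1 by omega, ascProd, ← mul_assoc, ← mul_assoc,
          h.sq k (by omega), one_mul]
      · obtain ⟨j, rfl⟩ : ∃ j, i = j + 1 := ⟨i - 1, by omega⟩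
        exact ⟨k, Finset.mem_range.2 hk, s j * e, ih (by omega) (by omega) he, by
          rw [← mul_assoc, ← h.mul_ascProd_of_gt (by omega) (by omega) (by omega), mul_assoc]⟩

theorem IsTypeA.closure_subset (h : IsTypeA m s) :
    (Subgroup.closure (s '' Set.Iio m) : Set G) ⊆ normalForms s m := by
  intro g hg
  induction hg using Subgroup.closure_induction_left with
  | one => exact one_mem_normalForms s m
  | mul_left x hx y _ ih =>
    obtain ⟨i, hi, rfl⟩ := hx
    exact h.mul_mem_normalForms le_rfl hi ih
  | inv_mul_cancel x hx y _ ih =>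
    obtain ⟨i, hi, rfl⟩ := hx
    rw [inv_eq_of_mul_eq_one_left (h.sq i hi)]
    exact h.mul_mem_normalForms le_rfl hi ih

/-- The adjacent transposition `(i, i + 1)`. -/
def adjSwap (m i : ℕ) : Equiv.Perm (Fin (m + 1)) :=
  if h : i < m then Equiv.swap ⟨i, by omega⟩ ⟨i + 1, by omega⟩ else 1

theorem adjSwap_of_lt {i : ℕ} (h : i < m) :
    adjSwap m i = Equiv.swap ⟨i, by omega⟩ ⟨i + 1, by omega⟩ := dif_pos h

theorem isTypeA_adjSwap (m : ℕ) : IsTypeA m (adjSwap m) where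
  sq i hi := by rw [adjSwap_of_lt hi, Equiv.swap_mul_self]
  braid i hi := by
    rw [adjSwap_of_lt hi, adjSwap_of_lt (show i < m by omega)]
    rw [Equiv.swap_mul_swap_mul_swap, Equiv.swap_comm (⟨i, _⟩ : Fin (m + 1)),
      Equiv.swap_comm (⟨i + 1, _⟩ : Fin (m + 1)) ⟨i + 1 + 1, _⟩, Equiv.swap_mul_swap_mul_swap,
      Equiv.swap_comm]
    all_goals simp only [ne_eq, Fin.mk.injEq]; omega
  comm i j hij hj := by
    rw [adjSwap_of_lt hj, adjSwap_of_lt (show i < m by omega)]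
    refine (Equiv.Perm.Disjoint.commute ?_).eq
    rw [Equiv.Perm.disjoint_iff_disjoint_support, Equiv.Perm.support_swap (by simp [Fin.ext_iff]),
      Equiv.Perm.support_swap (by simp [Fin.ext_iff])]
    simp [Fin.ext_iff]
    omega

theorem mclosure_adjSwap (m : ℕ) : Submonoid.closure (adjSwap m '' Set.Iio m) = ⊤ := by
  rw [← Equiv.Perm.mclosure_swap_castSucc_succ m]
  congr 1
  ext p
  constructor
  · rintro ⟨i, hi, rfl⟩
    exact ⟨⟨i, hi⟩, by rw [adjSwap_of_lt hi]; rfl⟩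
  · rintro ⟨i, rfl⟩
    exact ⟨i, i.2, by rw [adjSwap_of_lt i.2]; rfl⟩

/-- The symmetric group is presented by the adjacent transpositions and the Coxeter relations. -/
theorem IsTypeA.exists_hom (h : IsTypeA m s) :
    ∃ f : Equiv.Perm (Fin (m + 1)) →* G, ∀ i < m, f (adjSwap m i) = s i := by
  -- Γ is to be the graph of the homomorphism. The pairs satisfy the Coxeter relations, so Γ has at
  -- most (m + 1)! elements; it maps onto the symmetric group, hence bijectively.
  set r : ℕ → G × Equiv.Perm (Fin (m + 1)) := fun i => (s i, adjSwap m i)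
  have a := isTypeA_adjSwap m
  have hr : IsTypeA m r :=
    ⟨fun i hi => Prod.ext (h.sq i hi) (a.sq i hi), fun i hi => Prod.ext (h.braid i hi) (a.braid i hi),
      fun i j hi hj => Prod.ext (h.comm i j hi hj) (a.comm i j hi hj)⟩
  set Γ := Subgroup.closure (r '' Set.Iio m)
  have hsub := hr.closure_subset
  have hfin : Finite Γ := (Finset.finite_toSet _).subset hsub
  have hcard : Nat.card Γ ≤ (m + 1).factorial := by
    refine le_trans ?_ (card_normalForms_le r m)
    rw [← Set.ncard_coe_finset]
    exact Set.ncard_le_ncard hsub (Finset.finite_toSet _)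
  let p : Γ →* Equiv.Perm (Fin (m + 1)) := (MonoidHom.snd _ _).comp Γ.subtype
  have hmem : ∀ i < m, r i ∈ Γ := fun i hi => Subgroup.subset_closure ⟨i, hi, rfl⟩
  have hsurj : Function.Surjective p := by
    rw [← MonoidHom.mrange_eq_top, eq_top_iff, ← mclosure_adjSwap, Submonoid.closure_le]
    rintro _ ⟨i, hi, rfl⟩
    exact ⟨⟨r i, hmem i hi⟩, rfl⟩
  have hbij : Function.Bijective p := hsurj.bijective_of_nat_card_le (by
    rw [Nat.card_perm, Nat.card_fin]; exact hcard)
  let e := MulEquiv.ofBijective p hbij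
  refine ⟨((MonoidHom.fst _ _).comp Γ.subtype).comp e.symm.toMonoidHom, fun i hi => ?_⟩
  have : e.symm (adjSwap m i) = ⟨r i, hmem i hi⟩ := by
    rw [MulEquiv.symm_apply_eq]; rfl
  simp [this, r]

end TypeA

/-! ### Coxeter presentation of the affine Weyl group of type C. -/

section Presentation

variable {G : Type*} [Group G] {m : ℕ}

section ConjFamily

variable {ι : Type*} [DecidableEq ι] (π : Equiv.Perm ι →* G)

/-- The conjugates of `x` under the images of the transpositions `(k, j)`. -/
def conjFamily (k : ι) (x : G) (j : ι) : G :=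
  π (Equiv.swap k j) * x * (π (Equiv.swap k j))⁻¹

theorem conjFamily_self (k : ι) (x : G) : conjFamily π k x k = x := by
  rw [conjFamily, Equiv.swap_self]
  change π 1 * x * (π 1)⁻¹ = x
  simp

variable {π} {k : ι} {x : G}

/-- The permutation (k p(j))⁻¹ p (k j) fixes k, so its image commutes with x. -/
theorem conj_conjFamily (h : ∀ p : Equiv.Perm ι, p k = k → Commute (π p) x)
    (p : Equiv.Perm ι) (j : ι) :
    π p * conjFamily π k x j * (π p)⁻¹ = conjFamily π k x (p j) := by
  have hc := h ((Equiv.swap k (p j))⁻¹ * p * Equiv.swap k j) (by simp)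
  rw [map_mul, map_mul, map_inv] at hc
  have hc' := hc.eq
  rw [conjFamily, conjFamily]
  rw [eq_mul_inv_iff_mul_eq]
  rw [mul_inv_eq_iff_eq_mul.symm] at hc'
  rw [← mul_right_inj (π (Equiv.swap k (p j)))⁻¹, inv_mul_cancel_left]
  nth_rw 2 [← hc']
  group

/-- Permutations act transitively on ordered pairs of distinct indices. -/
theorem commute_of_commute_pair {Y : ι → G}
    (hY : ∀ (p : Equiv.Perm ι) j, π p * Y j * (π p)⁻¹ = Y (p j)) {a b : ι} (hab : a ≠ b)
    (h : Commute (Y a) (Y b)) {i j : ι} (hij : i ≠ j) : Commute (Y i) (Y j) := by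
  let p : Equiv.Perm ι := Equiv.swap (Equiv.swap a i b) j * Equiv.swap a i
  have hb : Equiv.swap a i b ≠ i := fun e => by
    rw [Equiv.swap_apply_eq_iff, Equiv.swap_apply_right] at e
    exact hab e.symm
  have ha : p a = i := by
    simp only [p, Equiv.Perm.mul_apply, Equiv.swap_apply_left]
    exact Equiv.swap_apply_of_ne_of_ne hb.symm hij
  have hb' : p b = j := by simp [p]
  rw [← ha, ← hb', ← hY p, ← hY p]
  exact (Commute.conj_iff (π p)).2 h

end ConjFamily

/-- Since k is an end point, its stabiliser is generated by the adjacent transpositions that do not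
move k. Arbitrary transpositions are reached by induction on the distance, arbitrary permutations by
induction on the size of the support. -/
theorem commute_of_fixes {π : Equiv.Perm (Fin (m + 1)) →* G}
    {k : Fin (m + 1)} (hk : (k : ℕ) = 0 ∨ (k : ℕ) = m) {x : G}
    (h : ∀ i < m, i ≠ k → i + 1 ≠ k → Commute (π (adjSwap m i)) x) (p : Equiv.Perm (Fin (m + 1)))
    (hp : p k = k) : Commute (π p) x := by
  have h1 : ∀ d a (ha : a + d + 1 < m + 1), (a ≠ k) → (a + d + 1 ≠ k) →
      Commute (π (Equiv.swap ⟨a, by omega⟩ ⟨a + d + 1, ha⟩)) x := by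
    intro d
    induction d with
    | zero =>
      intro a ha h0 h1
      have := h a (by omega) h0 h1
      rwa [adjSwap_of_lt (by omega)] at this
    | succ d ih =>
      intro a ha h0 h1
      have e := h (a + d + 1) (by omega) (by omega) h1
      rw [adjSwap_of_lt (by omega)] at e
      have e2 := ih a (by omega) h0 (by omega)
      have key : Equiv.swap (⟨a, by omega⟩ : Fin (m + 1)) ⟨a + (d + 1) + 1, ha⟩ =
          Equiv.swap ⟨a + d + 1, by omega⟩ ⟨a + d + 1 + 1, by omega⟩ *
          Equiv.swap ⟨a, by omega⟩ ⟨a + d + 1, by omega⟩ *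
          Equiv.swap ⟨a + d + 1, by omega⟩ ⟨a + d + 1 + 1, by omega⟩ := by
        rw [Equiv.swap_mul_swap_mul_swap, Equiv.swap_comm]
        · rfl
        all_goals simp only [ne_eq, Fin.mk.injEq]; omega
      rw [key, map_mul, map_mul]
      exact (e.mul_left e2).mul_left e
  have h2 : ∀ a b : Fin (m + 1), a ≠ k → b ≠ k → a ≠ b → Commute (π (Equiv.swap a b)) x := by
    intro a b ha hb hab
    wlog hlt : a < b generalizing a b
    · rw [Equiv.swap_comm]
      exact this b a hb ha hab.symm (lt_of_le_of_ne (not_lt.1 hlt) hab.symm)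
    obtain ⟨d, hd⟩ : ∃ d, (b : ℕ) = a + d + 1 := ⟨b - a - 1, by have : (a : ℕ) < b := hlt; omega⟩
    have := h1 d a (by omega) (fun e => ha (Fin.ext e)) (fun e => hb (Fin.ext (hd.trans e)))
    rwa [show b = ⟨a + d + 1, by omega⟩ from Fin.ext hd]
  have h3 : ∀ N, ∀ p : Equiv.Perm (Fin (m + 1)), p.support.card = N → p k = k →
      Commute (π p) x := by
    intro N
    induction N using Nat.strong_induction_on with
    | _ N ih =>
      intro p hN hp
      by_cases hp1 : p = 1
      · rw [hp1, map_one]; exact Commute.one_left x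
      obtain ⟨a, ha⟩ : ∃ a, p a ≠ a := by
        by_contra! hc
        exact hp1 (Equiv.ext hc)
      have hak : a ≠ k := fun e => ha (by rw [e, hp])
      have hpk : p a ≠ k := fun e => hak (p.injective (e.trans hp.symm))
      have := ih _ (hN ▸ Equiv.Perm.card_support_swap_mul ha) (Equiv.swap a (p a) * p) rfl (by
        rw [Equiv.Perm.mul_apply, hp, Equiv.swap_apply_of_ne_of_ne hak.symm hpk.symm])
      have e : p = Equiv.swap a (p a) * (Equiv.swap a (p a) * p) := by
        rw [← mul_assoc, Equiv.swap_mul_self, one_mul]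
      rw [e, map_mul]
      exact (h2 a (p a) hak hpk ha.symm).mul_left this
  exact h3 _ p rfl hp

/-- The homomorphism from `{±1}` determined by an involution. -/
def involutionHom (g : G) (hg : g * g = 1) : ℤˣ →* G where
  toFun u := if u = 1 then 1 else g
  map_one' := if_pos rfl
  map_mul' u v := by
    rcases Int.units_eq_one_or u with rfl | rfl <;> rcases Int.units_eq_one_or v with rfl | rfl <;>
      simp [hg]

theorem involutionHom_neg_one (g : G) (hg : g * g = 1) : involutionHom g hg (-1) = g := by
  simp [involutionHom]

theorem lattice_hom_ext {ι : Type*} [Finite ι] [DecidableEq ι] {M : Type*} [Monoid M]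
    {f g : Multiplicative (ι → ℤ) →* M}
    (h : ∀ j, f (Multiplicative.ofAdd (Pi.single j 1)) = g (Multiplicative.ofAdd (Pi.single j 1))) :
    f = g := by
  let e := (MulEquiv.funMultiplicative ι ℤ).symm
  have hs : ∀ j (c : ℤ), e (Pi.mulSingle j (Multiplicative.ofAdd c)) =
      Multiplicative.ofAdd (Pi.single j c) := by
    intro j c
    apply Multiplicative.toAdd.injective
    funext i
    change Multiplicative.toAdd (Pi.mulSingle (M := fun _ => Multiplicative ℤ) j
      (Multiplicative.ofAdd c) i) = (Pi.single (M := fun _ => ℤ) j c : ι → ℤ) i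
    by_cases hi : i = j
    · subst hi; simp
    · simp [hi]
  have : f.comp e.toMonoidHom = g.comp e.toMonoidHom := by
    refine MonoidHom.pi_ext fun i x => ?_
    have : (f.comp e.toMonoidHom).comp (MonoidHom.mulSingle (fun _ : ι => Multiplicative ℤ) i) =
        (g.comp e.toMonoidHom).comp (MonoidHom.mulSingle (fun _ : ι => Multiplicative ℤ) i) := by
      refine MonoidHom.ext_mint ?_
      simp only [MonoidHom.comp_apply, MonoidHom.mulSingle_apply, MulEquiv.coe_toMonoidHom]
      rw [hs]
      exact h i
    exact DFunLike.congr_fun this x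
  refine MonoidHom.ext fun l => ?_
  have := DFunLike.congr_fun this (e.symm l)
  simpa only [MonoidHom.comp_apply, MulEquiv.coe_toMonoidHom, MulEquiv.apply_symm_apply] using this

/-- The Coxeter relations of the affine Weyl group of type `C_{m + 1}`. -/
structure IsAffineTypeC (m : ℕ) (s : ℕ → G) (t r : G) : Prop where
  typeA : IsTypeA m s
  t_sq : t * t = 1
  r_sq : r * r = 1
  t_comm : ∀ i, i + 1 < m → s i * t = t * s i
  t_braid : s (m - 1) * t * s (m - 1) * t = t * s (m - 1) * t * s (m - 1)
  r_comm : ∀ i, 0 < i → i < m → s i * r = r * s i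
  r_braid : s 0 * r * s 0 * r = r * s 0 * r * s 0
  rt_comm : r * t = t * r

theorem mulAutArrow_mulSingle {ι : Type*} [DecidableEq ι] (p : Equiv.Perm ι) (i : ι) (u : ℤˣ) :
    (mulAutArrow p : MulAut (ι → ℤˣ)) (Pi.mulSingle i u) = Pi.mulSingle (p i) u := by
  funext j
  change Pi.mulSingle (M := fun _ => ℤˣ) i u (p⁻¹ j) = Pi.mulSingle (M := fun _ => ℤˣ) (p i) u j
  by_cases h : j = p i
  · subst h; simp
  · rw [Pi.mulSingle_eq_of_ne h, Pi.mulSingle_eq_of_ne]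
    intro e; exact h (by rw [← e]; simp)

theorem latticeAut_inr {n : ℕ} (p : Equiv.Perm (Fin n)) (j : Fin n) :
    HypOct.latticeAut n (SemidirectProduct.inr p) (Multiplicative.ofAdd (Pi.single j 1)) =
      Multiplicative.ofAdd (Pi.single (p j) 1) := by
  apply Multiplicative.toAdd.injective
  funext i
  change (1 : ℤˣ) • (Pi.single (M := fun _ => ℤ) j 1 : Fin n → ℤ) (p⁻¹ i) =
    (Pi.single (M := fun _ => ℤ) (p j) 1 : Fin n → ℤ) i
  rw [one_smul]
  by_cases h : i = p j
  · subst h; simp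
  · rw [Pi.single_eq_of_ne h, Pi.single_eq_of_ne]
    intro e; exact h (by rw [← e]; simp)

theorem latticeAut_inl {n : ℕ} (ε : Fin n → ℤˣ) (j : Fin n) :
    HypOct.latticeAut n (SemidirectProduct.inl ε) (Multiplicative.ofAdd (Pi.single j 1)) =
      Multiplicative.ofAdd (Pi.single j 1) ^ (ε j : ℤ) := by
  apply Multiplicative.toAdd.injective
  funext i
  change ε i • (Pi.single (M := fun _ => ℤ) j 1 : Fin n → ℤ) i =
    ((ε j : ℤ) • (Pi.single (M := fun _ => ℤ) j 1 : Fin n → ℤ)) i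
  by_cases h : i = j
  · subst h; simp [Units.smul_def]
  · simp [h]

variable {s : ℕ → G} {t r : G}

/-- The affine Weyl group of type `C` is presented by its Coxeter generators and relations. -/
theorem IsAffineTypeC.exists_hom (hm : 0 < m) (h : IsAffineTypeC m s t r) :
    ∃ f : AffWeyl (m + 1) →* G,
      (∀ i < m, f (SemidirectProduct.inr (SemidirectProduct.inr (adjSwap m i))) = s i) ∧
      f (AffWeyl.flip (Fin.last m)) = t ∧ f (AffWeyl.affFlip 0) = r := by
  -- W is an iterated semidirect product. A homomorphism is built on permutations, on sign changes
  -- and on translations; it remains to verify that the images conjugate each other correctly.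
  obtain ⟨π, hπ⟩ := h.typeA.exists_hom
  have hl0 : (Fin.last m) ≠ 0 := by
    intro e; have := congrArg Fin.val e; simp at this; omega
  -- the sign changes
  have ht := commute_of_fixes (π := π) (k := Fin.last m) (x := t) (Or.inr rfl)
    fun i hi h1 h2 => by
      rw [hπ i hi]; exact h.t_comm i (by simp only [Fin.val_last] at h2; omega)
  set T := conjFamily π (Fin.last m) t with hT
  have Tconj : ∀ p j, π p * T j * (π p)⁻¹ = T (p j) := conj_conjFamily ht
  have Tlast : T (Fin.last m) = t := conjFamily_self π _ t
  have Tsq : ∀ j, T j * T j = 1 := fun j => by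
    rw [hT, conjFamily]
    have := h.t_sq
    calc _ = π (Equiv.swap (Fin.last m) j) * (t * t) * (π (Equiv.swap (Fin.last m) j))⁻¹ := by group
      _ = 1 := by rw [this]; group
  have hm1 : m - 1 < m := by omega
  have Tcomm : ∀ i j, i ≠ j → Commute (T i) (T j) := fun i j hij => by
    refine commute_of_commute_pair Tconj (a := Fin.last m) (b := ⟨m - 1, by omega⟩)
      (by simp only [ne_eq, Fin.ext_iff, Fin.val_last]; omega) ?_ hij
    -- For the last two indices commutation of T's is the braid relation of length four between t
    -- and s_{m-1}.
    have e : T ⟨m - 1, by omega⟩ = s (m - 1) * t * (s (m - 1))⁻¹ := by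
      have := Tconj (adjSwap m (m - 1)) (Fin.last m)
      rw [Tlast, hπ _ hm1] at this
      rw [this, adjSwap_of_lt hm1]
      congr 1
      rw [show Fin.last m = ⟨m - 1 + 1, by omega⟩ from Fin.ext (by simp; omega),
        Equiv.swap_apply_right]
    rw [e, Tlast, inv_eq_of_mul_eq_one_left (h.typeA.sq _ hm1)]
    have := h.t_braid
    change t * (s (m - 1) * t * s (m - 1)) = s (m - 1) * t * s (m - 1) * t
    rw [this]; group
  let TS : (Fin (m + 1) → ℤˣ) →* G := MonoidHom.noncommPiCoprod (fun i => involutionHom (T i) (Tsq i))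
    (fun i j hij x y => by
      rcases Int.units_eq_one_or x with rfl | rfl <;>
      rcases Int.units_eq_one_or y with rfl | rfl <;>
      simp only [map_one, Commute.one_left, Commute.one_right, involutionHom_neg_one]
      exact Tcomm i j hij)
  have TSs : ∀ i, TS (Pi.mulSingle i (-1)) = T i := fun i =>
    (MonoidHom.noncommPiCoprod_mulSingle _ i (-1)).trans (involutionHom_neg_one _ _)
  let W₀ : HypOct (m + 1) →* G := SemidirectProduct.lift TS π fun p => by
    refine MonoidHom.pi_ext fun i u => ?_
    change TS ((mulAutArrow p : MulAut (Fin (m + 1) → ℤˣ)) (Pi.mulSingle i u)) =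
      π p * TS (Pi.mulSingle i u) * (π p)⁻¹
    rw [mulAutArrow_mulSingle]
    rcases Int.units_eq_one_or u with rfl | rfl
    · simp
    · rw [TSs, TSs, Tconj]
  -- the translations
  have hr := commute_of_fixes (π := π) (k := 0) (x := r) (Or.inl rfl)
    fun i hi h1 h2 => by
      rw [hπ i hi]; exact h.r_comm i (by simp at h1; omega) hi
  have rT : ∀ i, i ≠ 0 → Commute r (T i) := fun i hi => by
    have h1 := hr (Equiv.swap (Fin.last m) i) (Equiv.swap_apply_of_ne_of_ne hl0.symm hi.symm)
    rw [hT, conjFamily]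
    exact (h1.symm.mul_right h.rt_comm).mul_right h1.symm.inv_right
  have hX := fun p (hp : p 0 = 0) => (hr p hp).mul_right (c := T 0) (by
    have := Tconj p 0
    rw [hp, mul_inv_eq_iff_eq_mul] at this
    exact this)
  -- The affine reflection is the translation by the first basis vector times the sign change, so
  -- that translation must go to r T₀.
  set X := conjFamily π 0 (r * T 0) with hXd
  have Xconj : ∀ p j, π p * X j * (π p)⁻¹ = X (p j) := conj_conjFamily hX
  have X0 : X 0 = r * T 0 := conjFamily_self π _ _
  have TX0 : ∀ i, i ≠ 0 → Commute (T i) (X 0) := fun i hi => by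
    rw [X0]; exact (rT i hi).symm.mul_right (Tcomm i 0 hi)
  have TX : ∀ i j, i ≠ j → Commute (T i) (X j) := fun i j hij => by
    have h1 := TX0 (Equiv.swap 0 j i) (by
      rw [ne_eq, Equiv.swap_apply_eq_iff, Equiv.swap_apply_left]; exact hij)
    have h2 := (Commute.conj_iff (π (Equiv.swap 0 j))).2 h1
    rwa [Tconj, Xconj, Equiv.swap_apply_left, Equiv.swap_apply_self] at h2
  have TXs : ∀ j, T j * X j * (T j)⁻¹ = (X j)⁻¹ := fun j => by
    -- Both r and T₀ are involutions, so conjugation by T₀ turns r T₀ into T₀ r, its inverse.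
    have e : T 0 * X 0 * (T 0)⁻¹ = (X 0)⁻¹ := by
      rw [X0, eq_comm, inv_eq_iff_mul_eq_one]
      have h1 := Tsq 0
      have h2 := h.r_sq
      calc r * T 0 * (T 0 * (r * T 0) * (T 0)⁻¹) = r * (T 0 * T 0) * r := by group
        _ = 1 := by rw [h1, mul_one, h2]
    have hT0 := Tconj (Equiv.swap 0 j) 0
    have hX0 := Xconj (Equiv.swap 0 j) 0
    rw [Equiv.swap_apply_left] at hT0 hX0
    rw [← hT0, ← hX0]
    calc _ = π (Equiv.swap 0 j) * (T 0 * X 0 * (T 0)⁻¹) * (π (Equiv.swap 0 j))⁻¹ := by group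
      _ = _ := by rw [e]; group
  have Xcomm : ∀ i j, i ≠ j → Commute (X i) (X j) := fun i j hij => by
    have h01 : (0 : Fin (m + 1)) ≠ ⟨1, by omega⟩ := by simp [Fin.ext_iff]
    refine commute_of_commute_pair Xconj h01 ?_ hij
    have hs0 : adjSwap m 0 = Equiv.swap 0 ⟨1, by omega⟩ := by rw [adjSwap_of_lt hm]; rfl
    have e : X ⟨1, by omega⟩ = s 0 * r * (s 0)⁻¹ * T ⟨1, by omega⟩ := by
      have e1 := Xconj (adjSwap m 0) 0
      have e2 := Tconj (adjSwap m 0) 0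
      rw [hs0, Equiv.swap_apply_left, ← hs0, hπ 0 hm] at e1 e2
      rw [← e1, ← e2, X0]; group
    have hT1 : T 0 = s 0 * T ⟨1, by omega⟩ * (s 0)⁻¹ := by
      have e2 := Tconj (adjSwap m 0) ⟨1, by omega⟩
      rw [hs0, Equiv.swap_apply_right, ← hs0, hπ 0 hm] at e2
      exact e2.symm
    -- The braid relation of length four between r and s₀.
    have c1 : Commute r (s 0 * r * (s 0)⁻¹) := by
      rw [inv_eq_of_mul_eq_one_left (h.typeA.sq 0 hm)]
      have := h.r_braid
      change r * (s 0 * r * s 0) = s 0 * r * s 0 * r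
      rw [this]; group
    have c2 : Commute (T 0) (s 0 * r * (s 0)⁻¹) := by
      rw [hT1]
      exact (Commute.conj_iff (s 0)).2 (rT _ h01.symm).symm
    rw [X0, e]
    exact ((c1.mul_right (rT _ h01.symm)).mul_left (c2.mul_right (Tcomm _ _ h01)))
  let L : (Fin (m + 1) → Multiplicative ℤ) →* G :=
    MonoidHom.noncommPiCoprod (fun i => zpowersHom G (X i)) (fun i j hij x y => by
      simp only [zpowersHom_apply]
      exact ((Xcomm i j hij).zpow_left _).zpow_right _)
  let fn : Multiplicative (Fin (m + 1) → ℤ) →* G :=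
    L.comp (MulEquiv.funMultiplicative (Fin (m + 1)) ℤ).toMonoidHom
  have fns : ∀ j, fn (Multiplicative.ofAdd (Pi.single j 1)) = X j := fun j => by
    have e : (MulEquiv.funMultiplicative (Fin (m + 1)) ℤ) (Multiplicative.ofAdd (Pi.single j 1)) =
        Pi.mulSingle j (Multiplicative.ofAdd 1) := by
      funext i
      change Multiplicative.ofAdd ((Pi.single (M := fun _ => ℤ) j 1 : Fin (m + 1) → ℤ) i) = _
      by_cases hi : i = j
      · subst hi; simp
      · simp [hi]
    exact (congrArg L e).trans ((MonoidHom.noncommPiCoprod_mulSingle _ j _).trans (by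
      rw [zpowersHom_apply, toAdd_ofAdd, zpow_one]))
  have TSX : ∀ (ε : Fin (m + 1) → ℤˣ) j, TS ε * X j * (TS ε)⁻¹ = X j ^ (ε j : ℤ) := by
    intro ε
    induction ε using Pi.mulSingle_induction with
    | one => intro j; simp
    | mul f g hf hg =>
      intro j
      calc TS (f * g) * X j * (TS (f * g))⁻¹ = TS f * (TS g * X j * (TS g)⁻¹) * (TS f)⁻¹ := by
            rw [map_mul]; group
        _ = (TS f * X j * (TS f)⁻¹) ^ (g j : ℤ) := by rw [hg, conj_zpow]
        _ = _ := by rw [hf, ← zpow_mul, Pi.mul_apply, Units.val_mul]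
    | mulSingle i u =>
      intro j
      rcases Int.units_eq_one_or u with rfl | rfl
      · simp
      · rw [TSs]
        by_cases hij : i = j
        · subst hij; rw [TXs]; simp
        · rw [Pi.mulSingle_eq_of_ne (Ne.symm hij), (TX i j hij).eq]; simp
  -- Compatibility of the translation part with conjugation is multiplicative in w, so it suffices
  -- to treat sign changes and permutations on basis vectors.
  have main : ∀ w : HypOct (m + 1), fn.comp (HypOct.latticeAut (m + 1) w).toMonoidHom =
      (MulAut.conj (W₀ w)).toMonoidHom.comp fn := by
    have hmul : ∀ v w : HypOct (m + 1), fn.comp (HypOct.latticeAut (m + 1) v).toMonoidHom =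
      (MulAut.conj (W₀ v)).toMonoidHom.comp fn → fn.comp (HypOct.latticeAut (m + 1) w).toMonoidHom =
      (MulAut.conj (W₀ w)).toMonoidHom.comp fn →
      fn.comp (HypOct.latticeAut (m + 1) (v * w)).toMonoidHom =
      (MulAut.conj (W₀ (v * w))).toMonoidHom.comp fn := by
      intro v w hv hw
      refine MonoidHom.ext fun l => ?_
      have h1 := DFunLike.congr_fun hv (HypOct.latticeAut (m + 1) w l)
      have h2 := DFunLike.congr_fun hw l
      simp only [MonoidHom.comp_apply, MulEquiv.coe_toMonoidHom, MulAut.conj_apply, map_mul,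
        MulAut.mul_apply] at h1 h2 ⊢
      rw [h1, h2]; group
    intro w
    rw [← SemidirectProduct.inl_left_mul_inr_right w]
    refine hmul _ _ (lattice_hom_ext fun j => ?_) (lattice_hom_ext fun j => ?_)
    · simp only [MonoidHom.comp_apply, MulEquiv.coe_toMonoidHom, MulAut.conj_apply, latticeAut_inl,
        map_zpow, fns, W₀, SemidirectProduct.lift_inl, TSX]
    · simp only [MonoidHom.comp_apply, MulEquiv.coe_toMonoidHom, MulAut.conj_apply, latticeAut_inr,
        fns, W₀, SemidirectProduct.lift_inr, Xconj]
  have hflip : ∀ i, SemidirectProduct.lift fn W₀ main (AffWeyl.flip i) = T i := fun i => by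
    rw [AffWeyl.flip, SemidirectProduct.lift_inr]
    change SemidirectProduct.lift TS π _ _ = _
    rw [SemidirectProduct.lift_inl]
    exact TSs i
  refine ⟨SemidirectProduct.lift fn W₀ main, fun i hi => ?_, ?_, ?_⟩
  · rw [SemidirectProduct.lift_inr]
    change SemidirectProduct.lift TS π _ _ = _
    rw [SemidirectProduct.lift_inr, hπ i hi]
  · rw [hflip, Tlast]
  · rw [AffWeyl.affFlip, map_mul, hflip, AffWeyl.tau, SemidirectProduct.lift_inl, fns, X0,
      mul_assoc, Tsq, mul_one]

end Presentation

/-! ### Generation of the affine Weyl group by simple reflections. -/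

section Generation

variable {m : ℕ}

/-- The simple reflections of the affine Weyl group of type `C`. -/
inductive IsSimpleReflection : AffWeyl (m + 1) → Prop
  | swap (i : ℕ) (hi : i < m) :
    IsSimpleReflection (SemidirectProduct.inr (SemidirectProduct.inr (adjSwap m i)))
  | flip : IsSimpleReflection (AffWeyl.flip (Fin.last m))
  | affFlip : IsSimpleReflection (AffWeyl.affFlip 0)

theorem flip_mul_self {n : ℕ} (i : Fin n) : AffWeyl.flip i * AffWeyl.flip i = 1 := by
  rw [AffWeyl.flip, ← map_mul, ← map_mul]
  convert map_one (SemidirectProduct.inr : HypOct n →* AffWeyl n)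
  convert map_one (SemidirectProduct.inl : (Fin n → ℤˣ) →* HypOct n)
  funext k
  by_cases h : k = i
  · subst h; simp
  · simp [h]

theorem affFlip_mul_self {n : ℕ} (i : Fin n) : AffWeyl.affFlip i * AffWeyl.affFlip i = 1 := by
  have e : AffWeyl.flip i * AffWeyl.tau (Pi.single i 1) =
      (AffWeyl.tau (Pi.single i 1))⁻¹ * AffWeyl.flip i := by
    have h := SemidirectProduct.inl_aut (φ := HypOct.latticeAut n)
      (SemidirectProduct.inl (Function.update 1 i (-1))) (Multiplicative.ofAdd (Pi.single i 1))
    rw [latticeAut_inl] at h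
    rw [AffWeyl.flip, AffWeyl.tau, ← mul_inv_eq_iff_eq_mul, ← map_inv, ← h]
    simp
  calc AffWeyl.affFlip i * AffWeyl.affFlip i
      = AffWeyl.tau (Pi.single i 1) * (AffWeyl.flip i * AffWeyl.tau (Pi.single i 1)) *
        AffWeyl.flip i := by simp only [AffWeyl.affFlip, mul_assoc]
    _ = AffWeyl.flip i * AffWeyl.flip i := by rw [e, ← mul_assoc, mul_inv_cancel, one_mul]
    _ = 1 := flip_mul_self i

/-- Permutations come from adjacent transpositions, all sign changes from conjugates of one, all
translations from conjugates of τ(e₁) = s₀ · (sign change). The statement concerns the monoid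
generated, so that later inductions need no inverses. -/
theorem closure_isSimpleReflection :
    Submonoid.closure {w : AffWeyl (m + 1) | IsSimpleReflection w} = ⊤ := by
  set S := Submonoid.closure {w : AffWeyl (m + 1) | IsSimpleReflection w}
  have hperm : ∀ p : Equiv.Perm (Fin (m + 1)),
      (SemidirectProduct.inr (SemidirectProduct.inr p) : AffWeyl (m + 1)) ∈ S := by
    intro p
    have hp : p ∈ Submonoid.closure (adjSwap m '' Set.Iio m) := by
      rw [mclosure_adjSwap]; trivial
    induction hp using Submonoid.closure_induction with
    | mem x hx =>
      obtain ⟨i, hi, rfl⟩ := hx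
      exact Submonoid.subset_closure (IsSimpleReflection.swap i hi)
    | one => simp only [map_one]; exact S.one_mem
    | mul x y _ _ hx hy => simp only [map_mul]; exact S.mul_mem hx hy
  have hsign : ∀ ε : Fin (m + 1) → ℤˣ,
      (SemidirectProduct.inr (SemidirectProduct.inl ε) : AffWeyl (m + 1)) ∈ S := by
    intro ε
    induction ε using Pi.mulSingle_induction with
    | one => simp only [map_one]; exact S.one_mem
    | mul f g hf hg => simp only [map_mul]; exact S.mul_mem hf hg
    | mulSingle i u =>
      rcases Int.units_eq_one_or u with rfl | rfl
      · simp only [Pi.mulSingle_one, map_one]; exact S.one_mem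
      have h := SemidirectProduct.inl_aut
        (φ := (mulAutArrow : Equiv.Perm (Fin (m + 1)) →* MulAut (Fin (m + 1) → ℤˣ)))
        (Equiv.swap (Fin.last m) i) (Pi.mulSingle (Fin.last m) (-1))
      rw [mulAutArrow_mulSingle, Equiv.swap_apply_left] at h
      rw [h, map_mul, map_mul]
      exact S.mul_mem (S.mul_mem (hperm _) (Submonoid.subset_closure IsSimpleReflection.flip))
        (hperm _)
  have hhyp : ∀ w : HypOct (m + 1), (SemidirectProduct.inr w : AffWeyl (m + 1)) ∈ S := fun w => by
    rw [← SemidirectProduct.inl_left_mul_inr_right w, map_mul]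
    exact S.mul_mem (hsign _) (hperm _)
  have htau0 : AffWeyl.tau (Pi.single 0 1) ∈ S := by
    have : AffWeyl.tau (Pi.single 0 1) = AffWeyl.affFlip (0 : Fin (m + 1)) * AffWeyl.flip 0 := by
      rw [AffWeyl.affFlip, mul_assoc, flip_mul_self, mul_one]
    rw [this]
    exact S.mul_mem (Submonoid.subset_closure IsSimpleReflection.affFlip) (hhyp _)
  have hconj : ∀ (w : HypOct (m + 1)) l, AffWeyl.tau l ∈ S → (SemidirectProduct.inl
      (HypOct.latticeAut (m + 1) w (Multiplicative.ofAdd l)) : AffWeyl (m + 1)) ∈ S :=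
    fun w l hl => by
      rw [SemidirectProduct.inl_aut]
      exact S.mul_mem (S.mul_mem (hhyp _) hl) (hhyp _)
  have htau1 : ∀ j, AffWeyl.tau (Pi.single j 1) ∈ S := fun j => by
    have := hconj (SemidirectProduct.inr (Equiv.swap 0 j)) _ htau0
    rwa [latticeAut_inr, Equiv.swap_apply_left] at this
  have htau2 : ∀ j, (SemidirectProduct.inl (Multiplicative.ofAdd (Pi.single j 1))⁻¹ :
      AffWeyl (m + 1)) ∈ S := fun j => by
    -- The total sign change turns a translation into its inverse, which supplies inverses inside
    -- the submonoid.
    have := hconj (SemidirectProduct.inl fun _ => -1) _ (htau1 j)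
    rw [latticeAut_inl] at this
    simpa using this
  have htau : ∀ l : Fin (m + 1) → ℤ, AffWeyl.tau l ∈ S := by
    intro l
    induction l using Pi.single_induction with
    | zero => exact S.one_mem
    | add f g hf hg =>
      have : AffWeyl.tau (f + g) = AffWeyl.tau f * AffWeyl.tau g := by
        rw [AffWeyl.tau, ofAdd_add, map_mul]; rfl
      rw [this]; exact S.mul_mem hf hg
    | single i c =>
      have e : ∀ c : ℤ, (Multiplicative.ofAdd (Pi.single i c) : Multiplicative (Fin (m + 1) → ℤ)) =
          Multiplicative.ofAdd (Pi.single i 1) ^ c := fun c => by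
        rw [← ofAdd_zsmul, ← Pi.single_smul]; simp
      rw [AffWeyl.tau, e, map_zpow]
      obtain ⟨d, rfl | rfl⟩ := Int.eq_nat_or_neg c
      · rw [zpow_natCast]; exact S.pow_mem (htau1 i) d
      · rw [zpow_neg, zpow_natCast, ← inv_pow, ← map_inv]; exact S.pow_mem (htau2 i) d
  rw [eq_top_iff]
  intro w _
  rw [← SemidirectProduct.inl_left_mul_inr_right w]
  exact S.mul_mem (htau w.left.toAdd) (hhyp _)

end Generation

/-! ### Commutation of operators acting on different legs. -/

section Commutation

variable {q : ℝ} {κ : ℂ}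

/-- The argument of the second operator depends symmetrically on the signs (a, b), and the first
operator only mixes (a, b) with (b, a). -/
theorem rOp_rOp_comm (z z' h : ℂ) (y : ℤˣ → ℤˣ → ℂ) (hy : ∀ a b, y a b = y b a)
    (F : ℤˣ → ℤˣ → ℤˣ → ℤˣ → ℂ) (a b c d : ℤˣ) :
    rOp q κ z h (fun a b => rOp q κ z' (y a b) (fun c d => F a b c d) c d) a b =
      rOp q κ z' (y a b) (fun c d => rOp q κ z h (fun a b => F a b c d) a b) c d := by
  simp only [rOp, iceOp, hy b a]
  split_ifs <;> ring

theorem rOp_kOp_comm (P : BoundaryParams) (z w h : ℂ) (y : ℤˣ → ℤˣ → ℂ)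
    (hy : ∀ a b, y a b = y b a) (F : ℤˣ → ℤˣ → ℤˣ → ℂ) (a b c : ℤˣ) :
    rOp q κ z h (fun a b => kOp q P w (y a b) (fun c => F a b c) c) a b =
      kOp q P w (y a b) (fun c => rOp q κ z h (fun a b => F a b c) a b) c := by
  simp only [rOp, iceOp, kOp, bdryOp, hy b a]
  split_ifs <;> ring

theorem kOp_kOp_comm (P P' : BoundaryParams) (z w x y : ℂ) (F : ℤˣ → ℤˣ → ℂ) (a b : ℤˣ) :
    kOp q P z x (fun a => kOp q P' w y (fun b => F a b) b) a =
      kOp q P' w y (fun b => kOp q P z x (fun a => F a b) a) b := by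
  simp only [kOp, bdryOp]
  ring

end Commutation

/-! ### Weights of the legs to the left of a given one. -/

section PartialWeights

variable {n : ℕ}

/-- The weight `ε_1 + ⋯ + ε_{i-1}` of the legs to the left of `i`. -/
def preWt (i : Fin n) (ε : Fin n → ℤˣ) : ℂ := ∑ k ∈ Finset.Iio i, wt (ε k)

theorem preWt_update_of_le {i j : Fin n} (h : i ≤ j) (ε : Fin n → ℤˣ) (a : ℤˣ) :
    preWt i (Function.update ε j a) = preWt i ε :=
  Finset.sum_congr rfl fun k hk => by
    rw [Function.update_of_ne (ne_of_lt ((Finset.mem_Iio.1 hk).trans_le h))]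

theorem preWt_update_of_lt {i j : Fin n} (h : j < i) (ε : Fin n → ℤˣ) (a : ℤˣ) :
    preWt i (Function.update ε j a) = preWt i ε - wt (ε j) + wt a := by
  have hj : j ∈ Finset.Iio i := Finset.mem_Iio.2 h
  rw [preWt, preWt, ← Finset.add_sum_erase _ _ hj, ← Finset.add_sum_erase _ _ hj,
    Function.update_self]
  have : ∀ k ∈ (Finset.Iio i).erase j, wt (Function.update ε j a k) = wt (ε k) := fun k hk => by
    rw [Function.update_of_ne (Finset.ne_of_mem_erase hk)]
  rw [Finset.sum_congr rfl this]
  ring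

theorem preWt_upd₂_of_le {i j l : Fin n} (hj : i ≤ j) (hl : i ≤ l) (ε : Fin n → ℤˣ) (a b : ℤˣ) :
    preWt i (upd₂ j l ε a b) = preWt i ε := by
  rw [upd₂, preWt_update_of_le hl, preWt_update_of_le hj]

theorem preWt_upd₂_of_lt {i j l : Fin n} (hjl : j ≠ l) (hj : j < i) (hl : l < i) (ε : Fin n → ℤˣ)
    (a b : ℤˣ) : preWt i (upd₂ j l ε a b) = preWt i ε - wt (ε j) - wt (ε l) + wt a + wt b := by
  rw [upd₂, preWt_update_of_lt hl, preWt_update_of_lt hj, Function.update_of_ne hjl.symm]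
  ring

theorem preWt_succ {i j : Fin n} (h : (j : ℕ) = i + 1) (ε : Fin n → ℤˣ) :
    preWt j ε = preWt i ε + wt (ε i) := by
  have : Finset.Iio j = insert i (Finset.Iio i) := by
    ext k
    simp only [Finset.mem_Iio, Finset.mem_insert, Fin.lt_def, Fin.ext_iff]
    omega
  rw [preWt, this, Finset.sum_insert (by simp), preWt, add_comm]

theorem preWt_zero {i : Fin n} (h : (i : ℕ) = 0) (ε : Fin n → ℤˣ) : preWt i ε = 0 := by
  have : Finset.Iio i = ∅ := by
    ext k
    simp only [Finset.mem_Iio, Fin.lt_def]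
    simp [h]
  rw [preWt, this, Finset.sum_empty]

end PartialWeights

/-! ### The simple reflections as operators including the substitution in z. -/

section Operators

variable {n : ℕ} (q : ℝ) (κ : ℂ)

/-- `(M^{s_i}(z) f(s_i z, ·))(ξ)` for `1 ≤ i < n`. -/
def bulkOp (i j : Fin n) (f : Vars n → Spin n) : Vars n → Spin n := fun x ε =>
  rOp q κ (x.1 i - x.1 j) (2 * x.2 - 2 * κ * preWt i ε)
    (fun a b => f (x.1 ∘ Equiv.swap i j, x.2) (upd₂ i j ε a b)) (ε j) (ε i)

/-- `(M^{s_n}(z) f(s_n z, ·))(ξ)`. -/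
def rightOp (P : BoundaryParams) (i : Fin n) (f : Vars n → Spin n) : Vars n → Spin n := fun x ε =>
  kOp q P (x.1 i) (x.2 - κ * preWt i ε)
    (fun a => f (Function.update x.1 i (-x.1 i), x.2) (Function.update ε i a)) (ε i)

/-- `(M^{s_0}(z) f(s_0 z, ·))(ξ)`. -/
def leftOp (P : BoundaryParams) (i : Fin n) (f : Vars n → Spin n) : Vars n → Spin n := fun x ε =>
  kOp q P (1 / 2 - x.1 i) (-(x.2 - κ * wt (ε i)))
    (fun a => f (Function.update x.1 i (1 - x.1 i), x.2 - κ * wt (ε i) + κ * wt a)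
      (Function.update ε i a)) (ε i)

variable {q κ}


end Operators

/-! ### The Coxeter relations for these operators. -/

section Relations

variable {n : ℕ} {q : ℝ} {κ : ℂ}

theorem comp_swap_comp_swap (z : Fin n → ℂ) (i j : Fin n) :
    (z ∘ Equiv.swap i j) ∘ Equiv.swap i j = z := by
  funext k; simp

theorem upd₂_update_comm {i j l : Fin n} (hi : i ≠ l) (hj : j ≠ l) (ε : Fin n → ℤˣ) (a b c : ℤˣ) :
    upd₂ i j (Function.update ε l c) a b = Function.update (upd₂ i j ε a b) l c := by
  rw [upd₂, upd₂, Function.update_comm hi.symm, Function.update_comm hj.symm]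

/-- The dynamical arguments depend on the sign vector, which has finitely many values; one generic
set of points therefore serves all of them. -/
theorem eventually_br_dyn_sub (hq0 : 0 < q) (hq1 : q < 1) {s : ℂ} (hs : s ≠ 0) {α : Type*}
    [Finite α] (c : α → ℂ) :
    ∀ᶠ x : Vars n in generic (Vars n), ∀ a, br q (s * x.2 - c a) ≠ 0 := by
  rw [eventually_all]
  intro a
  simp only [sub_eq_add_neg]
  exact eventually_br_dyn hq0 hq1 hs _

theorem eventually_KRegular_sub (hq0 : 0 < q) (hq1 : q < 1) (P : BoundaryParams) (i : Fin n)
    {s t : ℂ} (hs : s ≠ 0) (ht : t ≠ 0) (c : ℂ) {α : Type*} [Finite α] (d : α → ℂ) :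
    ∀ᶠ x : Vars n in generic (Vars n), ∀ a, KRegular q P (s * x.1 i + c) (t * x.2 - d a) := by
  rw [eventually_all]
  intro a
  simp only [sub_eq_add_neg]
  exact eventually_KRegular_coord hq0 hq1 P i hs ht _ _

theorem bulkOp_bulkOp (hq0 : 0 < q) (hq1 : q < 1) {i j : Fin n} (hij : i < j) :
    ∀ᶠ x in generic (Vars n), ∀ f ε, bulkOp q κ i j (bulkOp q κ i j f) x ε = f x ε := by
  filter_upwards [eventually_rOp_regular hq0 hq1 κ hij.ne, eventually_br_dyn_sub hq0 hq1
    two_ne_zero fun ε => 2 * κ * preWt i ε] with x r h f ε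
  simp only [bulkOp, preWt_upd₂_of_le le_rfl hij.le, upd₂_upd₂ _ _ _ _ _ hij.ne,
    upd₂_left _ _ _ hij.ne, upd₂_right, Function.comp_apply, Equiv.swap_apply_left,
    Equiv.swap_apply_right, comp_swap_comp_swap]
  rw [← neg_sub (x.1 i)]
  have := rOp_unitarity hq0 hq1 κ r.1 r.2.1 r.2.2.1 (h ε) (fun a b => f x (upd₂ i j ε a b))
    (ε i) (ε j)
  rw [upd₂_self] at this
  exact this

theorem bulkOp_upd₃_fst {i j l : Fin n} (hij : i < j) (hjl : j < l) (f : Vars n → Spin n)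
    (x : Vars n) (ε : Fin n → ℤˣ) (a b c : ℤˣ) : bulkOp q κ i j f x (upd₃ i j l ε a b c) =
      rOp q κ (x.1 i - x.1 j) (2 * x.2 - 2 * κ * preWt i ε)
        (fun a b => f (x.1 ∘ Equiv.swap i j, x.2) (upd₃ i j l ε a b c)) b a := by
  have hil := hij.trans hjl
  simp only [bulkOp, upd₂_upd₃_fst _ _ _ _ _ _ hij.ne hil.ne hjl.ne, upd₃_fst _ _ _ _ hij.ne hil.ne,
    upd₃_snd _ _ _ _ hjl.ne]
  rw [upd₃, preWt_update_of_le hil.le, preWt_upd₂_of_le le_rfl hij.le]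

theorem bulkOp_upd₃_snd {i j l : Fin n} (hij : (j : ℕ) = i + 1) (hjl : j < l) (f : Vars n → Spin n)
    (x : Vars n) (ε : Fin n → ℤˣ) (a b c : ℤˣ) : bulkOp q κ j l f x (upd₃ i j l ε a b c) =
      rOp q κ (x.1 j - x.1 l) (2 * x.2 - 2 * κ * preWt i ε - 2 * κ * wt a)
        (fun b c => f (x.1 ∘ Equiv.swap j l, x.2) (upd₃ i j l ε a b c)) c b := by
  have hij' : i < j := Fin.lt_def.2 (by omega)
  have hil := hij'.trans hjl
  simp only [bulkOp, upd₂_upd₃_snd _ _ _ _ _ _ hij'.ne hil.ne hjl.ne,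
    upd₃_snd _ _ _ _ hjl.ne, upd₃_thd, preWt_succ hij, upd₃_fst _ _ _ _ hij'.ne hil.ne]
  rw [upd₃, preWt_update_of_le hil.le, preWt_upd₂_of_le le_rfl hij'.le]
  congr 1; ring

/-- The weight left of i is a constant for all operators involved, and the pair (j, l) sees in
addition the weight of leg i. This is the pattern of the braid form of the Yang-Baxter equation at
2ξ - 2κ `preWt i`. -/
theorem bulkOp_braid (hq0 : 0 < q) (hq1 : q < 1) {i j l : Fin n} (hij : (j : ℕ) = i + 1)
    (hjl : (l : ℕ) = j + 1) : ∀ᶠ x in generic (Vars n), ∀ f ε,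
      bulkOp q κ i j (bulkOp q κ j l (bulkOp q κ i j f)) x ε =
        bulkOp q κ j l (bulkOp q κ i j (bulkOp q κ j l f)) x ε := by
  have hij' : i < j := Fin.lt_def.2 (by omega)
  have hjl' : j < l := Fin.lt_def.2 (by omega)
  have hil := hij'.trans hjl'
  filter_upwards [eventually_rOp_regular hq0 hq1 κ hij'.ne, eventually_rOp_regular hq0 hq1 κ hjl'.ne,
    eventually_rOp_regular hq0 hq1 κ hil.ne, eventually_br_dyn_sub hq0 hq1
    two_ne_zero fun ε => 2 * κ * preWt i ε, eventually_br_dyn_sub hq0 hq1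
    two_ne_zero fun ε => 2 * κ * preWt i ε - 2 * κ, eventually_br_dyn_sub hq0 hq1
    two_ne_zero fun ε => 2 * κ * preWt i ε + 2 * κ] with x r1 r2 r3 h1 h2 h3 f ε
  rw [← upd₃_self (i := i) (j := j) (l := l) ε]
  generalize ε i = a; generalize ε j = b; generalize ε l = c
  have e : ((x.1 ∘ Equiv.swap i j) ∘ Equiv.swap j l) ∘ Equiv.swap i j =
      ((x.1 ∘ Equiv.swap j l) ∘ Equiv.swap i j) ∘ Equiv.swap j l := by
    have : Equiv.swap i j * Equiv.swap j l * Equiv.swap i j =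
        Equiv.swap j l * Equiv.swap i j * Equiv.swap j l := by
      rw [Equiv.swap_mul_swap_mul_swap hij'.ne hil.ne, Equiv.swap_comm i j, Equiv.swap_comm j l,
        Equiv.swap_mul_swap_mul_swap hjl'.ne' hil.ne', Equiv.swap_comm]
    funext k
    exact congrArg x.1 (DFunLike.congr_fun this k)
  simp only [bulkOp_upd₃_fst hij' hjl', bulkOp_upd₃_snd hij hjl', Function.comp_apply,
    Equiv.swap_apply_left, Equiv.swap_apply_right,
    Equiv.swap_apply_of_ne_of_ne hil.ne' hjl'.ne', Equiv.swap_apply_of_ne_of_ne hij'.ne hil.ne, e]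
  have hs : x.1 i - x.1 l = x.1 j - x.1 l + (x.1 i - x.1 j) := by ring
  rw [hs] at r3 ⊢
  have key := rOp_braid hq0 hq1 κ r2.1 r1.1 r3.1 r2.2.1 r1.2.1 r3.2.1 (h1 ε)
    (by have := h2 ε; rwa [← sub_add] at this) (by have := h3 ε; rwa [← sub_sub] at this)
    (fun a b c => f (((x.1 ∘ Equiv.swap j l) ∘ Equiv.swap i j) ∘ Equiv.swap j l, x.2)
      (upd₃ i j l ε a b c)) a b c
  exact key.symm

/-- The right pair sees the left one only through the total weight of legs i and j, which R
preserves. -/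
theorem bulkOp_comm {i j i' j' : Fin n} (hij : i < j) (hj : j < i') (hi' : i' < j') (x : Vars n)
    (f : Vars n → Spin n) (ε : Fin n → ℤˣ) :
    bulkOp q κ i j (bulkOp q κ i' j' f) x ε = bulkOp q κ i' j' (bulkOp q κ i j f) x ε := by
  have hji' : j ≠ i' := hj.ne
  have hjj' : j ≠ j' := (hj.trans hi').ne
  have hii' : i ≠ i' := (hij.trans hj).ne
  have hij' : i ≠ j' := ((hij.trans hj).trans hi').ne
  have hU : ∀ a b c d, upd₂ i j (upd₂ i' j' ε c d) a b = upd₂ i' j' (upd₂ i j ε a b) c d := by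
    intro a b c d
    rw [upd₂.eq_1 i' j', upd₂_update_comm hij' hjj', upd₂_update_comm hii' hji', ← upd₂.eq_1 i' j']
  have hx : (x.1 ∘ Equiv.swap i j) ∘ Equiv.swap i' j' = (x.1 ∘ Equiv.swap i' j') ∘ Equiv.swap i j := by
    funext k
    have : Equiv.swap i j * Equiv.swap i' j' = Equiv.swap i' j' * Equiv.swap i j := by
      refine (Equiv.Perm.Disjoint.commute ?_).eq
      rw [Equiv.Perm.disjoint_iff_disjoint_support, Equiv.Perm.support_swap hij.ne,
        Equiv.Perm.support_swap hi'.ne]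
      simp [hji'.symm, hjj'.symm, hii'.symm, hij'.symm]
    exact congrArg x.1 (DFunLike.congr_fun this k)
  simp only [bulkOp, preWt_upd₂_of_le (hij.trans hj).le ((hij.trans hj).trans hi').le,
    preWt_upd₂_of_lt hij.ne (hij.trans hj) hj, Function.comp_apply,
    upd₂_of_ne _ _ _ hii'.symm hji'.symm, upd₂_of_ne _ _ _ hij'.symm hjj'.symm,
    upd₂_of_ne _ _ _ hii' hij', upd₂_of_ne _ _ _ hji' hjj', hU,
    Equiv.swap_apply_of_ne_of_ne hii'.symm hji'.symm, Equiv.swap_apply_of_ne_of_ne hij'.symm hjj'.symm,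
    Equiv.swap_apply_of_ne_of_ne hii' hij', Equiv.swap_apply_of_ne_of_ne hji' hjj']
  have key := rOp_rOp_comm (q := q) (κ := κ) (x.1 i - x.1 j) (x.1 i' - x.1 j')
    (2 * x.2 - 2 * κ * preWt i ε) (fun a b => 2 * x.2 - 2 * κ *
      (preWt i' ε - wt (ε i) - wt (ε j) + wt a + wt b)) (fun a b => by ring)
    (fun a b c d => f ((x.1 ∘ Equiv.swap i' j') ∘ Equiv.swap i j, x.2)
      (upd₂ i' j' (upd₂ i j ε a b) c d)) (ε j) (ε i) (ε j') (ε i')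
  rw [hx]
  refine key.trans ?_
  congr 1; ring

theorem rightOp_rightOp (hq0 : 0 < q) (hq1 : q < 1) (P : BoundaryParams) (i : Fin n) :
    ∀ᶠ x in generic (Vars n), ∀ f ε, rightOp q κ P i (rightOp q κ P i f) x ε = f x ε := by
  filter_upwards [eventually_KRegular_sub hq0 hq1 P i one_ne_zero one_ne_zero 0
    fun ε => κ * preWt i ε] with x h f ε
  have h := h ε
  rw [one_mul, one_mul, add_zero] at h
  simp only [rightOp, preWt_update_of_le le_rfl, Function.update_idem, Function.update_self,
    neg_neg, Function.update_eq_self]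
  have := kOp_unitarity hq0 hq1 h (fun a => f x (Function.update ε i a)) (ε i)
  rw [Function.update_eq_self] at this
  exact this

/-- The operator changes ξ and ε_i so that ξ - κε_i is conserved; K is thus evaluated twice at the
same dynamical value. -/
theorem leftOp_leftOp (hq0 : 0 < q) (hq1 : q < 1) (P : BoundaryParams) (i : Fin n) :
    ∀ᶠ x in generic (Vars n), ∀ f ε, leftOp q κ P i (leftOp q κ P i f) x ε = f x ε := by
  filter_upwards [eventually_KRegular_sub hq0 hq1 P i (neg_ne_zero.2 one_ne_zero)
    (neg_ne_zero.2 one_ne_zero) (1 / 2) fun a => -(κ * wt a)] with x h f ε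
  have h := h (ε i)
  rw [show -1 * x.1 i + 1 / 2 = 1 / 2 - x.1 i by ring,
    show -1 * x.2 - -(κ * wt (ε i)) = -(x.2 - κ * wt (ε i)) by ring] at h
  simp only [leftOp, Function.update_idem, Function.update_self, sub_sub_cancel,
    Function.update_eq_self, add_sub_cancel_right]
  rw [show 1 / 2 - (1 - x.1 i) = -(1 / 2 - x.1 i) by ring]
  have := kOp_unitarity hq0 hq1 h (fun a => f (x.1, x.2 - κ * wt (ε i) + κ * wt a)
    (Function.update ε i a)) (ε i)
  rw [Function.update_eq_self, sub_add_cancel] at this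
  exact this

theorem bulkOp_rightOp_comm (P : BoundaryParams) {i j l : Fin n} (hij : i < j) (hjl : j < l)
    (x : Vars n) (f : Vars n → Spin n) (ε : Fin n → ℤˣ) :
    bulkOp q κ i j (rightOp q κ P l f) x ε = rightOp q κ P l (bulkOp q κ i j f) x ε := by
  have hil := hij.trans hjl
  have hU := upd₂_update_comm hil.ne hjl.ne ε
  have hx : Function.update (x.1 ∘ Equiv.swap i j) l (-x.1 l) =
      Function.update x.1 l (-x.1 l) ∘ Equiv.swap i j := by
    funext k
    by_cases hk : k = l
    · subst hk; simp [Equiv.swap_apply_of_ne_of_ne hil.ne' hjl.ne']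
    · have : Equiv.swap i j k ≠ l := fun e => hk (by
        rw [Equiv.swap_apply_eq_iff, Equiv.swap_apply_of_ne_of_ne hil.ne' hjl.ne'] at e; exact e)
      simp [hk, this]
  simp only [bulkOp, rightOp, preWt_upd₂_of_lt hij.ne hil hjl, preWt_update_of_le hil.le,
    Function.comp_apply, upd₂_of_ne _ _ _ hil.ne' hjl.ne', hU, Function.update_of_ne hil.ne,
    Function.update_of_ne hjl.ne, Equiv.swap_apply_of_ne_of_ne hil.ne' hjl.ne', hx]
  have key := rOp_kOp_comm (q := q) (κ := κ) P (x.1 i - x.1 j) (x.1 l)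
    (2 * x.2 - 2 * κ * preWt i ε) (fun a b => x.2 - κ *
      (preWt l ε - wt (ε i) - wt (ε j) + wt a + wt b)) (fun a b => by ring)
    (fun a b c => f (Function.update x.1 l (-x.1 l) ∘ Equiv.swap i j, x.2)
      (Function.update (upd₂ i j ε a b) l c)) (ε j) (ε i) (ε l)
  refine key.trans ?_
  congr 1; ring

theorem bulkOp_leftOp_comm (P : BoundaryParams) {i j l : Fin n} (hij : i < j) (hl : l < i)
    (x : Vars n) (f : Vars n → Spin n) (ε : Fin n → ℤˣ) :
    bulkOp q κ i j (leftOp q κ P l f) x ε = leftOp q κ P l (bulkOp q κ i j f) x ε := by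
  have hlj := hl.trans hij
  have hU := upd₂_update_comm hl.ne' hlj.ne' ε
  have hx : Function.update (x.1 ∘ Equiv.swap i j) l (1 - x.1 l) =
      Function.update x.1 l (1 - x.1 l) ∘ Equiv.swap i j := by
    funext k
    by_cases hk : k = l
    · subst hk; simp [Equiv.swap_apply_of_ne_of_ne hl.ne hlj.ne]
    · have : Equiv.swap i j k ≠ l := fun e => hk (by
        rw [Equiv.swap_apply_eq_iff, Equiv.swap_apply_of_ne_of_ne hl.ne hlj.ne] at e; exact e)
      simp [hk, this]
  -- The shift of ξ caused by the left boundary compensates the change of weight of leg l, so R sees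
  -- the same argument.
  have hp : ∀ c, 2 * (x.2 - κ * wt (ε l) + κ * wt c) - 2 * κ * (preWt i ε - wt (ε l) + wt c) =
      2 * x.2 - 2 * κ * preWt i ε := fun c => by ring
  simp only [bulkOp, leftOp, preWt_update_of_lt hl,
    Function.comp_apply, upd₂_of_ne _ _ _ hl.ne hlj.ne, hU, Function.update_of_ne hl.ne',
    Function.update_of_ne hlj.ne', Equiv.swap_apply_of_ne_of_ne hl.ne hlj.ne, hx, hp]
  exact rOp_kOp_comm (q := q) (κ := κ) P (x.1 i - x.1 j) (1 / 2 - x.1 l)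
    (2 * x.2 - 2 * κ * preWt i ε) (fun a b => -(x.2 - κ * wt (ε l))) (fun a b => rfl)
    (fun a b c => f (Function.update x.1 l (1 - x.1 l) ∘ Equiv.swap i j,
      x.2 - κ * wt (ε l) + κ * wt c) (Function.update (upd₂ i j ε a b) l c)) (ε j) (ε i) (ε l)

theorem leftOp_rightOp_comm (P P' : BoundaryParams) {i j : Fin n} (hij : i < j)
    (x : Vars n) (f : Vars n → Spin n) (ε : Fin n → ℤˣ) :
    leftOp q κ P i (rightOp q κ P' j f) x ε = rightOp q κ P' j (leftOp q κ P i f) x ε := by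
  have hp : ∀ c, x.2 - κ * wt (ε i) + κ * wt c - κ * (preWt j ε - wt (ε i) + wt c) =
      x.2 - κ * preWt j ε := fun c => by ring
  simp only [leftOp, rightOp, preWt_update_of_lt hij, hp, Function.update_of_ne hij.ne,
    Function.update_of_ne hij.ne', Function.update_comm hij.ne]
  exact kOp_kOp_comm (q := q) P P' (1 / 2 - x.1 i) (x.1 j) (-(x.2 - κ * wt (ε i)))
    (x.2 - κ * preWt j ε) (fun a b => f (Function.update (Function.update x.1 j (-x.1 j)) i
      (1 - x.1 i), x.2 - κ * wt (ε i) + κ * wt a)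
      (Function.update (Function.update ε j b) i a)) (ε i) (ε j)

theorem swap_update_update (z : Fin n → ℂ) {i j : Fin n} (hij : i ≠ j) (g : ℂ → ℂ) :
    Function.update (z ∘ Equiv.swap i j) j (g (z i)) ∘ Equiv.swap i j =
      Function.update z i (g (z i)) := by
  funext k
  by_cases hi : k = i
  · subst hi; simp
  by_cases hj : k = j
  · subst hj; simp [hij, hi]
  · simp [hi, hj, Equiv.swap_apply_of_ne_of_ne hi hj]

/-- On the last two legs this is the right reflection equation with ξ replaced by ξ - κ `preWt i`.
-/
theorem bulkOp_rightOp_reflection (hq0 : 0 < q) (hq1 : q < 1) (P : BoundaryParams) {i j : Fin n}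
    (hij : (j : ℕ) = i + 1) : ∀ᶠ x in generic (Vars n), ∀ f ε,
      bulkOp q κ i j (rightOp q κ P j (bulkOp q κ i j (rightOp q κ P j f))) x ε =
        rightOp q κ P j (bulkOp q κ i j (rightOp q κ P j (bulkOp q κ i j f))) x ε := by
  have hij' : i < j := Fin.lt_def.2 (by omega)
  have K := fun l (c : ℂ) => eventually_KRegular_sub (n := n) hq0 hq1 P l one_ne_zero one_ne_zero 0
    fun ε => κ * preWt i ε + c
  simp only [one_mul, add_zero] at K
  filter_upwards [eventually_rOp_regular hq0 hq1 κ hij'.ne, eventually_br_dyn_sub hq0 hq1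
    two_ne_zero fun ε => 2 * κ * preWt i ε, K i κ, K i (-κ), K j κ, K j (-κ)]
    with x r h k1 k2 k3 k4 f ε
  rw [← upd₂_self (i := i) (j := j) ε]
  have L1 : ∀ f (x : Vars n) a b, bulkOp q κ i j f x (upd₂ i j ε a b) =
      rOp q κ (x.1 i - x.1 j) (2 * (x.2 - κ * preWt i ε))
        (fun a b => f (x.1 ∘ Equiv.swap i j, x.2) (upd₂ i j ε a b)) b a := by
    intro f x a b
    simp only [bulkOp, preWt_upd₂_of_le le_rfl hij'.le, upd₂_upd₂ _ _ _ _ _ hij'.ne,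
      upd₂_left _ _ _ hij'.ne, upd₂_right]
    congr 1; ring
  have L2 : ∀ f (x : Vars n) a b, rightOp q κ P j f x (upd₂ i j ε a b) =
      kOp q P (x.1 j) (x.2 - κ * preWt i ε - κ * wt a)
        (fun b => f (Function.update x.1 j (-x.1 j), x.2) (upd₂ i j ε a b)) b := by
    intro f x a b
    simp only [rightOp, preWt_succ hij, preWt_upd₂_of_le le_rfl hij'.le, update_upd₂_right,
      upd₂_left _ _ _ hij'.ne, upd₂_right]
    congr 1; ring
  have e := swap_update_update x.1 hij'.ne fun u => -u
  simp only [L1, L2, Function.comp_apply, Equiv.swap_apply_left, Equiv.swap_apply_right, e,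
    Function.update_self, Function.update_of_ne hij'.ne, Function.update_of_ne hij'.ne',
    sub_neg_eq_add]
  rw [show Function.update (Function.update x.1 j (-x.1 j) ∘ Equiv.swap i j) j (-x.1 i) ∘
      Equiv.swap i j = Function.update (Function.update x.1 i (-x.1 i)) j (-x.1 j) by
    have := swap_update_update (Function.update x.1 j (-x.1 j)) hij'.ne fun u => -u
    rw [Function.update_of_ne hij'.ne] at this
    rw [this, Function.update_comm hij'.ne']]
  have key := rOp_kOp_reflection (ξ := x.2 - κ * preWt i ε) hq0 hq1 κ r.1 r.2.2.2.1 r.2.1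
    r.2.2.2.2 (by have := h ε; rwa [show 2 * x.2 - 2 * κ * preWt i ε =
      2 * (x.2 - κ * preWt i ε) by ring] at this)
    (by have := k2 ε; rwa [← sub_eq_add_neg, ← sub_add] at this)
    (by have := k1 ε; rwa [← sub_sub] at this)
    (by have := k4 ε; rwa [← sub_eq_add_neg, ← sub_add] at this)
    (by have := k3 ε; rwa [← sub_sub] at this)
    (fun a b => f (Function.update (Function.update x.1 i (-x.1 i)) j (-x.1 j), x.2)
      (upd₂ i j ε a b)) (ε i) (ε j)
  rw [add_comm (x.1 j), show -x.1 j + x.1 i = x.1 i - x.1 j by ring]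
  exact key

theorem rOp_congr {z h : ℂ} {f g : ℤˣ → ℤˣ → ℂ} {a b : ℤˣ} (h1 : f a b = g a b)
    (h2 : f b a = g b a) : rOp q κ z h f a b = rOp q κ z h g a b := by
  simp only [rOp, iceOp, h1, h2]

/-- On the first two legs nothing lies to the left, and all operators conserve ξ - κ(ε_i + ε_j).
With this quantity as new variable the relation is the right reflection equation at its negative,
with spectral parameters 1/2 - z_j and 1/2 - z_i. -/
theorem bulkOp_leftOp_reflection (hq0 : 0 < q) (hq1 : q < 1) (P : BoundaryParams) {i j : Fin n}
    (hi : (i : ℕ) = 0) (hij : i < j) : ∀ᶠ x in generic (Vars n), ∀ f ε,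
      bulkOp q κ i j (leftOp q κ P i (bulkOp q κ i j (leftOp q κ P i f))) x ε =
        leftOp q κ P i (bulkOp q κ i j (leftOp q κ P i (bulkOp q κ i j f))) x ε := by
  have K := fun l (c : ℂ) => eventually_KRegular_sub (n := n) hq0 hq1 P l
    (neg_ne_zero.2 one_ne_zero) (neg_ne_zero.2 one_ne_zero) (1 / 2)
    fun p : ℤˣ × ℤˣ => -(κ * (wt p.1 + wt p.2)) + c
  filter_upwards [eventually_rOp_regular hq0 hq1 κ hij.ne, eventually_br_dyn_sub hq0 hq1
    (s := -2) (by simp) fun p : ℤˣ × ℤˣ => -(2 * (κ * (wt p.1 + wt p.2))), K i κ, K i (-κ), K j κ,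
    K j (-κ), eventually_br_coord_add hq0 hq1 hij.ne 1,
    eventually_br_coord_add hq0 hq1 hij.ne (1 - 2 * κ)] with x r h k1 k2 k3 k4 c1 c2 f ε
  -- Here ξ is the conserved quantity, and the original dynamical variable is ξ + κ(a + b) for the
  -- current signs a, b.
  have main : ∀ a b ξ, (ξ = x.2 - κ * (wt a + wt b)) →
      bulkOp q κ i j (leftOp q κ P i (bulkOp q κ i j (leftOp q κ P i f)))
        (x.1, ξ + κ * (wt a + wt b)) (upd₂ i j ε a b) =
      leftOp q κ P i (bulkOp q κ i j (leftOp q κ P i (bulkOp q κ i j f)))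
        (x.1, ξ + κ * (wt a + wt b)) (upd₂ i j ε a b) := by
    intro a b ξ hξ
    have L1 : ∀ f (z : Fin n → ℂ) a b,
        bulkOp q κ i j f (z, ξ + κ * (wt a + wt b)) (upd₂ i j ε a b) =
        rOp q κ (z i - z j) (2 * -ξ) (fun b a => f (z ∘ Equiv.swap i j, ξ + κ * (wt a + wt b))
          (upd₂ i j ε a b)) a b := by
      intro f z a b
      simp only [bulkOp, preWt_zero hi, upd₂_upd₂ _ _ _ _ _ hij.ne, upd₂_left _ _ _ hij.ne,
        upd₂_right, mul_zero, sub_zero]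
      rw [show 2 * (ξ + κ * (wt a + wt b)) = 2 * ξ + 2 * κ * (wt b + wt a) by ring,
        rOp_add_weights, mul_neg, rOp_neg]
      exact rOp_congr (by rw [add_comm (wt b)]) rfl
    have L2 : ∀ f (z : Fin n → ℂ) a b,
        leftOp q κ P i f (z, ξ + κ * (wt a + wt b)) (upd₂ i j ε a b) =
        kOp q P (1 / 2 - z i) (-ξ - κ * wt b) (fun a => f (Function.update z i (1 - z i),
          ξ + κ * (wt a + wt b)) (upd₂ i j ε a b)) a := by
      intro f z a b
      simp only [leftOp, update_upd₂_left _ _ _ _ hij.ne, upd₂_left _ _ _ hij.ne]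
      rw [show -(ξ + κ * (wt a + wt b) - κ * wt a) = -ξ - κ * wt b by ring]
      simp only [show ∀ c, ξ + κ * (wt a + wt b) - κ * wt a + κ * wt c = ξ + κ * (wt c + wt b) from
        fun c => by ring]
    have e1 := swap_update_update (x.1 ∘ Equiv.swap i j) hij.ne.symm fun u => 1 - u
    rw [Equiv.swap_comm j i, comp_swap_comp_swap, Function.comp_apply, Equiv.swap_apply_right] at e1
    have e3 : Function.update (Function.update (x.1 ∘ Equiv.swap i j) i (1 - x.1 j) ∘ Equiv.swap i j)
        i (1 - x.1 i) = Function.update (Function.update x.1 i (1 - x.1 i) ∘ Equiv.swap i j)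
        i (1 - x.1 j) ∘ Equiv.swap i j := by
      funext k
      by_cases h1 : k = i
      · subst h1; simp [hij.ne']
      by_cases h2 : k = j
      · subst h2; simp [h1]
      · simp [h1, Equiv.swap_apply_of_ne_of_ne h1 h2]
    simp only [L1, L2, Function.comp_apply, Equiv.swap_apply_left, Equiv.swap_apply_right,
      Function.update_self, Function.update_of_ne hij.ne', e3]
    have hx2 : -ξ = -x.2 + κ * (wt a + wt b) := by rw [hξ]; ring
    have key := rOp_kOp_reflection (z := 1 / 2 - x.1 j) (w := 1 / 2 - x.1 i) (ξ := -ξ) (P := P) hq0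
      hq1 κ (by rw [sub_sub_sub_cancel_left]; exact r.1) ?_
      (by rw [sub_sub_sub_cancel_left]; exact r.2.1) ?_ ?_ ?_ ?_ ?_ ?_
      (fun b a => f (Function.update (Function.update x.1 i (1 - x.1 i) ∘ Equiv.swap i j)
        i (1 - x.1 j) ∘ Equiv.swap i j, ξ + κ * (wt a + wt b)) (upd₂ i j ε a b)) b a
    · rw [sub_sub_sub_cancel_left, show 1 / 2 - x.1 j + (1 / 2 - x.1 i) = 1 - x.1 j - x.1 i by ring]
        at key
      rw [show 1 - x.1 i - x.1 j = 1 - x.1 j - x.1 i by ring,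
        show 1 - x.1 j - (1 - x.1 i) = x.1 i - x.1 j by ring]
      exact key
    · rwa [show 1 / 2 - x.1 j + (1 / 2 - x.1 i) = 1 - (x.1 i + x.1 j) by ring]
    · rw [show 2 * κ - (1 / 2 - x.1 j + (1 / 2 - x.1 i)) = -(1 - 2 * κ - (x.1 i + x.1 j)) by ring,
        br_neg hq0 hq1]
      exact neg_ne_zero.2 c2
    · have := h (a, b)
      rwa [show -2 * x.2 - -(2 * (κ * (wt a + wt b))) = 2 * -ξ by rw [hx2]; ring] at this
    · have := k4 (a, b)
      rwa [show -1 * x.1 j + 1 / 2 = 1 / 2 - x.1 j by ring,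
        show -1 * x.2 - (-(κ * (wt a + wt b)) + -κ) = -ξ + κ by rw [hx2]; ring] at this
    · have := k3 (a, b)
      rwa [show -1 * x.1 j + 1 / 2 = 1 / 2 - x.1 j by ring,
        show -1 * x.2 - (-(κ * (wt a + wt b)) + κ) = -ξ - κ by rw [hx2]; ring] at this
    · have := k2 (a, b)
      rwa [show -1 * x.1 i + 1 / 2 = 1 / 2 - x.1 i by ring,
        show -1 * x.2 - (-(κ * (wt a + wt b)) + -κ) = -ξ + κ by rw [hx2]; ring] at this
    · have := k1 (a, b)
      rwa [show -1 * x.1 i + 1 / 2 = 1 / 2 - x.1 i by ring,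
        show -1 * x.2 - (-(κ * (wt a + wt b)) + κ) = -ξ - κ by rw [hx2]; ring] at this
  have := main (ε i) (ε j) _ rfl
  rwa [upd₂_self, sub_add_cancel] at this

end Relations

/-! ### Operators on meromorphic functions given by formulas. -/

section ActsAsCalculus

variable {n : ℕ}

theorem mem_meroSpin_iff {f : Vars n → Spin n} :
    (f : Germ (generic (Vars n)) (Spin n)) ∈ MeroSpin n ↔ ∀ ε, IsMeromorphic fun x => f x ε := by
  constructor
  · rintro ⟨g, hg, e⟩ ε
    have e' : f =ᶠ[generic (Vars n)] g := Germ.coe_eq.1 e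
    exact (hg ε).congr (e'.mono fun x hx => by rw [hx])
  · exact fun h => ⟨f, h, rfl⟩

/-- The formula is applied to a chosen representative; `hcongr` makes the class of the result
independent of the choice. -/
theorem exists_actsAs {Φ : (Vars n → Spin n) → Vars n → Spin n}
    (hadd : ∀ f g, Φ (f + g) = Φ f + Φ g) (hsmul : ∀ (c : ℂ) f, Φ (c • f) = c • Φ f)
    (hcongr : ∀ f g, f =ᶠ[generic (Vars n)] g → Φ f =ᶠ[generic (Vars n)] Φ g)
    (hmero : ∀ f : Vars n → Spin n, (∀ ε, IsMeromorphic fun x => f x ε) →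
      ∀ ε, IsMeromorphic fun x => Φ f x ε) :
    ∃ D : Module.End ℂ (MeroSpin n), ActsAs D Φ := by
  choose rep hrep using fun F : MeroSpin n => F.2
  have key : ∀ (F : MeroSpin n) (f : Vars n → Spin n), F.1 = ↑f →
      (↑(Φ (rep F)) : Germ (generic (Vars n)) (Spin n)) = ↑(Φ f) := fun F f e =>
    Germ.coe_eq.2 (hcongr _ _ (Germ.coe_eq.1 ((hrep F).2.symm.trans e)))
  refine ⟨⟨⟨fun F => ⟨↑(Φ (rep F)), mem_meroSpin_iff.2 (hmero _ (hrep F).1)⟩, fun F G => ?_⟩,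
    fun c F => ?_⟩, fun f hf => key ⟨f, hf⟩ f rfl⟩
  · refine Subtype.ext ((key (F + G) (rep F + rep G) ?_).trans ?_)
    · rw [Germ.coe_add, ← (hrep F).2, ← (hrep G).2]; rfl
    · rw [hadd]; rfl
  · refine Subtype.ext ((key (c • F) (c • rep F) ?_).trans ?_)
    · rw [Germ.coe_smul, ← (hrep F).2]; rfl
    · rw [hsmul]; rfl

namespace ActsAs

variable {D D' : Module.End ℂ (MeroSpin n)} {Φ Ψ : (Vars n → Spin n) → Vars n → Spin n}

theorem mem (h : ActsAs D Φ) {f : Vars n → Spin n}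
    (hf : (f : Germ (generic (Vars n)) (Spin n)) ∈ MeroSpin n) :
    (↑(Φ f) : Germ (generic (Vars n)) (Spin n)) ∈ MeroSpin n := by
  rw [← h f hf]; exact Subtype.property _

theorem mul (h : ActsAs D Φ) (h' : ActsAs D' Ψ) : ActsAs (D * D') fun f => Φ (Ψ f) := by
  intro f hf
  have e : D' ⟨f, hf⟩ = ⟨↑(Ψ f), h'.mem hf⟩ := Subtype.ext (h' f hf)
  rw [Module.End.mul_apply, e]
  exact h _ _

theorem one : ActsAs (1 : Module.End ℂ (MeroSpin n)) fun f => f := fun _ _ => rfl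

theorem unique (h : ActsAs D Φ) (h' : ActsAs D' Ψ)
    (e : ∀ f : Vars n → Spin n, ∀ᶠ x in generic (Vars n), Φ f x = Ψ f x) : D = D' := by
  refine LinearMap.ext fun F => ?_
  obtain ⟨_, f, hf, rfl⟩ := F
  exact Subtype.ext (((h f _).trans (Germ.coe_eq.2 (e f))).trans (h' f _).symm)

theorem congr (h : ActsAs D Φ) (e : ∀ f x, Φ f x = Ψ f x) : ActsAs D Ψ := by
  have : Φ = Ψ := funext fun f => funext fun x => e f x
  rwa [← this]

theorem weylAct (u : AffWeyl n) :
    ActsAs (weylAct u) fun f x => f (u⁻¹.act x.1, x.2) := fun _ _ => rfl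

end ActsAs

theorem weylAct_one : weylAct (1 : AffWeyl n) = 1 :=
  (ActsAs.weylAct 1).unique .one fun f => .of_forall fun x => by rw [inv_one, AffWeyl.act_one]

theorem weylAct_mul (u v : AffWeyl n) : weylAct (u * v) = weylAct u * weylAct v :=
  (ActsAs.weylAct (u * v)).unique ((ActsAs.weylAct u).mul (.weylAct v)) fun f =>
    .of_forall fun x => by rw [mul_inv_rev, AffWeyl.act_mul]

theorem weylAct_mul_inv (u : AffWeyl n) : weylAct u * weylAct u⁻¹ = 1 := by
  rw [← weylAct_mul, mul_inv_cancel, weylAct_one]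

theorem weylAct_inv_mul (u : AffWeyl n) : weylAct u⁻¹ * weylAct u = 1 := by
  rw [← weylAct_mul, inv_mul_cancel, weylAct_one]

end ActsAsCalculus

/-! ### Difference operators combined with a Weyl group substitution. -/

section TwistedOperators

variable {n : ℕ} (κ : ℂ)

/-- The transformation `(z, ξ) ↦ (u⁻¹ z, ξ + 2κk)`. -/
def twist (u : AffWeyl n) (k : ℤ) : Vars n ≃ₜ Vars n where
  toFun x := (u⁻¹.act x.1, x.2 + 2 * κ * k)
  invFun x := (u.act x.1, x.2 - 2 * κ * k)
  left_inv x := by simp [← AffWeyl.act_mul, AffWeyl.act_one]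
  right_inv x := by simp [← AffWeyl.act_mul, AffWeyl.act_one]
  continuous_toFun := by
    unfold AffWeyl.act HypOct.act; simp only [Units.smul_def, zsmul_eq_mul]; fun_prop
  continuous_invFun := by
    unfold AffWeyl.act HypOct.act; simp only [Units.smul_def, zsmul_eq_mul]; fun_prop

theorem twist_apply (u : AffWeyl n) (k : ℤ) (x : Vars n) :
    twist κ u k x = (u⁻¹.act x.1, x.2 + 2 * κ * k) := rfl

theorem twist_analyticAt (u : AffWeyl n) (k : ℤ) (x : Vars n) :
    AnalyticAt ℂ (twist κ u k) x := by
  refine AnalyticAt.prod (f := fun y : Vars n => u⁻¹.act y.1)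
    (g := fun y : Vars n => y.2 + 2 * κ * k) ?_ (by fun_prop)
  exact AnalyticAt.comp (g := Prod.fst) analyticAt_fst (varsHomeo_analyticAt u⁻¹ x)

/-- The operator `f ↦ ∑_k c_k(z, ξ) f(u⁻¹ z, ξ + 2κk)`. -/
def twistOp (u : AffWeyl n) (S : Finset ℤ) (c : ℤ → Vars n → SpinOp n) (f : Vars n → Spin n) :
    Vars n → Spin n := fun x => ∑ k ∈ S, (c k x).mulVec (f (twist κ u k x))

theorem exists_actsAs_twistOp (u : AffWeyl n) (S : Finset ℤ) (c : ℤ → Vars n → SpinOp n)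
    (hc : ∀ k ∈ S, ∀ ε' ε, IsMeromorphic fun x => c k x ε' ε) :
    ∃ D : Module.End ℂ (MeroSpin n), ActsAs D (twistOp κ u S c) := by
  refine exists_actsAs (fun f g => ?_) (fun a f => ?_) (fun f g h => ?_) fun f hf ε' => ?_
  · funext x
    simp [twistOp, Matrix.mulVec_add, Finset.sum_add_distrib]
  · funext x
    simp [twistOp, Matrix.mulVec_smul, Finset.smul_sum]
  · have : ∀ k ∈ S, ∀ᶠ x in generic (Vars n), f (twist κ u k x) = g (twist κ u k x) :=
      fun k _ => (generic_tendsto (twist κ u k)).eventually h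
    filter_upwards [(Finset.eventually_all S).2 this] with x hx
    exact Finset.sum_congr rfl fun k hk => by rw [hx k hk]
  · simp only [twistOp, Finset.sum_apply, Matrix.mulVec, dotProduct]
    exact .sum _ fun k hk => .sum _ fun ε _ =>
      (hc k hk ε' ε).mul ((hf ε).comp_homeo (twist κ u k) (twist_analyticAt κ u k))

end TwistedOperators

/-! ### Matrix coefficients of the generators. -/

section Generators

variable {n : ℕ}

theorem swap_inv_act (i j : Fin n) (z : Fin n → ℂ) :
    (AffWeyl.swap i j)⁻¹.act z = z ∘ Equiv.swap i j := by
  have : (AffWeyl.swap i j)⁻¹ = AffWeyl.swap i j := by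
    rw [AffWeyl.swap, ← map_inv, ← map_inv, Equiv.swap_inv]
  rw [this]
  funext k
  change (1 : ℤˣ) • z ((Equiv.swap i j)⁻¹ k) + ((0 : ℤ) : ℂ) = _
  simp

theorem flip_inv_act (i : Fin n) (z : Fin n → ℂ) :
    (AffWeyl.flip i)⁻¹.act z = Function.update z i (-z i) := by
  rw [inv_eq_of_mul_eq_one_left (flip_mul_self i)]
  funext k
  change (Function.update (1 : Fin n → ℤˣ) i (-1) k) • z k + ((0 : ℤ) : ℂ) = _
  by_cases h : k = i
  · subst h; simp
  · simp [h]

theorem affFlip_inv_act (i : Fin n) (z : Fin n → ℂ) :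
    (AffWeyl.affFlip i)⁻¹.act z = Function.update z i (1 - z i) := by
  rw [inv_eq_of_mul_eq_one_left (affFlip_mul_self i), AffWeyl.affFlip, AffWeyl.act_mul,
    ← inv_eq_of_mul_eq_one_left (flip_mul_self i), flip_inv_act]
  funext k
  change (1 : ℤˣ) • Function.update z i (-z i) k +
    ((Pi.single (M := fun _ => ℤ) i 1 k : ℤ) : ℂ) = _
  by_cases h : k = i
  · subst h; simp; ring
  · simp [h]

variable (q : ℝ) (κ : ℂ)

/-- The coefficient of `M^{s_i}`, `1 ≤ i < n`. -/
def bulkCoeff (i j : Fin n) (_ : ℤ) (x : Vars n) : SpinOp n :=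
  permOp i j * leg₂ i j fun ε => RBa q κ (x.1 i - x.1 j) (2 * x.2 - 2 * κ * preWt i ε)

/-- The coefficient of `M^{s_n}`. -/
def rightCoeff (P : BoundaryParams) (i : Fin n) (_ : ℤ) (x : Vars n) : SpinOp n :=
  leg₁ i fun ε => KBa q P (x.1 i) (x.2 - κ * preWt i ε)

/-- The coefficients of `M^{s_0}`. -/
def leftCoeff (P : BoundaryParams) (i : Fin n) (k : ℤ) (x : Vars n) : SpinOp n :=
  Matrix.of fun ε' ε => if ((ε i : ℤˣ) : ℤ) - (ε' i : ℤ) = 2 * k then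
    leg₁ i (fun _ => KBaLeft q P (1 / 2 - x.1 i) (x.2 - κ * wt (ε' i))) ε' ε else 0

variable {q κ}

theorem permOp_mul_apply (i j : Fin n) (A : SpinOp n) (ε' ε : Fin n → ℤˣ) :
    (permOp i j * A) ε' ε = A (ε' ∘ Equiv.swap i j) ε := by
  rw [Matrix.mul_apply, Finset.sum_eq_single (ε' ∘ Equiv.swap i j)]
  · have : ε' = (ε' ∘ Equiv.swap i j) ∘ Equiv.swap i j := by funext k; simp
    rw [permOp, Matrix.of_apply, if_pos this, one_mul]
  · intro δ _ hδ
    rw [permOp, Matrix.of_apply, if_neg, zero_mul]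
    rintro rfl
    exact hδ (by funext k; simp)
  · simp

theorem permOp_mulVec (i j : Fin n) (v : Spin n) (ε : Fin n → ℤˣ) :
    (permOp i j).mulVec v ε = v (ε ∘ Equiv.swap i j) := by
  rw [Matrix.mulVec, dotProduct, Finset.sum_eq_single (ε ∘ Equiv.swap i j)]
  · have : ε = (ε ∘ Equiv.swap i j) ∘ Equiv.swap i j := by funext k; simp
    rw [permOp, Matrix.of_apply, if_pos this, one_mul]
  · intro δ _ hδ
    rw [permOp, Matrix.of_apply, if_neg, zero_mul]
    rintro rfl
    exact hδ (by funext k; simp)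
  · simp

theorem comp_swap_eq_upd₂ {i j : Fin n} (hij : i ≠ j) (ε : Fin n → ℤˣ) :
    ε ∘ Equiv.swap i j = upd₂ i j ε (ε j) (ε i) := by
  funext k
  by_cases hi : k = i
  · subst hi; simp [upd₂_left _ _ _ hij]
  by_cases hj : k = j
  · subst hj; simp [upd₂_right]
  · simp [upd₂_of_ne _ _ _ hi hj, Equiv.swap_apply_of_ne_of_ne hi hj]

theorem bulkCoeff_mulVec {i j : Fin n} (hij : i < j) (k : ℤ) (x : Vars n) (v : Spin n)
    (ε : Fin n → ℤˣ) : (bulkCoeff q κ i j k x).mulVec v ε =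
      rOp q κ (x.1 i - x.1 j) (2 * x.2 - 2 * κ * preWt i ε) (fun a b => v (upd₂ i j ε a b))
        (ε j) (ε i) := by
  rw [bulkCoeff, ← Matrix.mulVec_mulVec, permOp_mulVec, leg₂_RBa_mulVec κ hij.ne _
    (fun ε => 2 * x.2 - 2 * κ * preWt i ε)
    (fun ε => by rw [preWt_upd₂_of_le le_rfl hij.le]), comp_swap_eq_upd₂ hij.ne]
  simp only [upd₂_upd₂ _ _ _ _ _ hij.ne, upd₂_left _ _ _ hij.ne, upd₂_right,
    preWt_upd₂_of_le le_rfl hij.le]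

theorem rightCoeff_mulVec (P : BoundaryParams) (i : Fin n) (k : ℤ) (x : Vars n) (v : Spin n)
    (ε : Fin n → ℤˣ) : (rightCoeff q κ P i k x).mulVec v ε =
      kOp q P (x.1 i) (x.2 - κ * preWt i ε) (fun a => v (Function.update ε i a)) (ε i) := by
  rw [rightCoeff, leg₁_KBa_mulVec P i _ (fun ε => x.2 - κ * preWt i ε)
    fun ε a => by rw [preWt_update_of_le le_rfl]]

theorem twistOp_bulk {i j : Fin n} (hij : i < j) (f : Vars n → Spin n) (x : Vars n) :
    twistOp κ (AffWeyl.swap i j) {0} (bulkCoeff q κ i j) f x = bulkOp q κ i j f x := by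
  funext ε
  rw [twistOp, Finset.sum_singleton, bulkCoeff_mulVec hij, bulkOp, twist_apply, swap_inv_act]
  simp

theorem twistOp_right (P : BoundaryParams) (i : Fin n) (f : Vars n → Spin n) (x : Vars n) :
    twistOp κ (AffWeyl.flip i) {0} (rightCoeff q κ P i) f x = rightOp q κ P i f x := by
  funext ε
  rw [twistOp, Finset.sum_singleton, rightCoeff_mulVec, rightOp, twist_apply, flip_inv_act]
  simp

/-- Conjugation by the weight shifts makes the entry from δ to ε act with the shift κ(δ_i - ε_i),
which is 0 or ±2κ; each entry thus occurs for exactly one k. The function g is arbitrary so that the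
formula applies both with and without the substitution in z. -/
theorem leftCoeff_mulVec_sum (P : BoundaryParams) (i : Fin n) (x : Vars n) (g : ℂ → Spin n)
    (ε : Fin n → ℤˣ) : ∑ k ∈ ({-1, 0, 1} : Finset ℤ),
      (leftCoeff q κ P i k x).mulVec (g (2 * κ * k)) ε =
      kOp q P (1 / 2 - x.1 i) (-(x.2 - κ * wt (ε i)))
        (fun a => g (κ * wt a - κ * wt (ε i)) (Function.update ε i a)) (ε i) := by
  have h1 : ∀ k : ℤ, (leftCoeff q κ P i k x).mulVec (g (2 * κ * k)) ε =
      ∑ δ, if ((δ i : ℤˣ) : ℤ) - (ε i : ℤ) = 2 * k then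
        leg₁ i (fun _ => KBaLeft q P (1 / 2 - x.1 i) (x.2 - κ * wt (ε i))) ε δ *
          g (κ * wt (δ i) - κ * wt (ε i)) δ else 0 := by
    intro k
    rw [Matrix.mulVec, dotProduct]
    refine Finset.sum_congr rfl fun δ _ => ?_
    rw [leftCoeff, Matrix.of_apply]
    split_ifs with h
    · have h' : wt (δ i) - wt (ε i) = 2 * k := by
        rw [wt, wt]; exact_mod_cast h
      rw [← mul_sub, h', show 2 * κ * (k : ℂ) = κ * (2 * k) by ring]
    · rw [zero_mul]
  simp only [h1]
  rw [Finset.sum_comm]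
  have h2 : ∀ δ : Fin n → ℤˣ, (∑ k ∈ ({-1, 0, 1} : Finset ℤ),
      if ((δ i : ℤˣ) : ℤ) - (ε i : ℤ) = 2 * k then
        leg₁ i (fun _ => KBaLeft q P (1 / 2 - x.1 i) (x.2 - κ * wt (ε i))) ε δ *
          g (κ * wt (δ i) - κ * wt (ε i)) δ else 0) =
      leg₁ i (fun _ => KBaLeft q P (1 / 2 - x.1 i) (x.2 - κ * wt (ε i))) ε δ *
          g (κ * wt (δ i) - κ * wt (ε i)) δ := by
    intro δ
    rw [Finset.sum_insert (by decide), Finset.sum_insert (by decide), Finset.sum_singleton]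
    rcases Int.units_eq_one_or (δ i) with e | e <;> rcases Int.units_eq_one_or (ε i) with e' | e' <;>
      simp [e, e']
  rw [Finset.sum_congr rfl fun δ _ => h2 δ]
  have h3 := leg₁_KBa_mulVec (q := q) P i (1 / 2 - x.1 i) (fun _ => -(x.2 - κ * wt (ε i)))
    (fun _ _ => rfl) (fun δ => g (κ * wt (δ i) - κ * wt (ε i)) δ) ε
  simp only [Function.update_self] at h3
  exact h3

theorem twistOp_left (P : BoundaryParams) (i : Fin n) (f : Vars n → Spin n) (x : Vars n) :
    twistOp κ (AffWeyl.affFlip i) {-1, 0, 1} (leftCoeff q κ P i) f x = leftOp q κ P i f x := by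
  funext ε
  rw [twistOp, Finset.sum_apply]
  simp only [twist_apply, affFlip_inv_act]
  rw [leftCoeff_mulVec_sum P i x (fun s => f (Function.update x.1 i (1 - x.1 i), x.2 + s)), leftOp]
  congr 1
  funext a
  congr 2
  ring

theorem analyticAt_vars_coord (i : Fin n) (x : Vars n) :
    AnalyticAt ℂ (fun y : Vars n => y.1 i) x :=
  ((ContinuousLinearMap.proj (R := ℂ) (φ := fun _ : Fin n => ℂ) i).comp
    (ContinuousLinearMap.fst ℂ (Fin n → ℂ) ℂ)).analyticAt x

theorem isMeromorphic_bulkCoeff (hq0 : 0 < q) (hq1 : q < 1) {i j : Fin n} (hij : i ≠ j) (k : ℤ)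
    (ε' ε : Fin n → ℤˣ) : IsMeromorphic fun x => bulkCoeff q κ i j k x ε' ε := by
  simp only [bulkCoeff, permOp_mul_apply, leg₂, Matrix.of_apply]
  split_ifs
  · refine (isMeromorphic_RBa hq0 hq1 κ _ _).comp (φ := fun x : Vars n =>
      (x.1 i - x.1 j, 2 * x.2 - 2 * κ * preWt i ε)) (fun x => AnalyticAt.prod
        (f := fun x : Vars n => x.1 i - x.1 j)
        (g := fun x : Vars n => 2 * x.2 - 2 * κ * preWt i ε)
        ((analyticAt_vars_coord i x).sub (analyticAt_vars_coord j x)) (by fun_prop)) ?_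
    refine isOpenMap_of_directions (Pi.single i 1, 0) (0, 2⁻¹) fun x a b => ?_
    ext <;> simp [hij.symm] <;> ring
  · exact .zero

theorem isMeromorphic_rightCoeff (hq0 : 0 < q) (hq1 : q < 1) (P : BoundaryParams) (i : Fin n)
    (k : ℤ) (ε' ε : Fin n → ℤˣ) : IsMeromorphic fun x => rightCoeff q κ P i k x ε' ε := by
  simp only [rightCoeff, leg₁, Matrix.of_apply]
  split_ifs
  · refine (isMeromorphic_KBa hq0 hq1 P _ _).comp (φ := fun x : Vars n =>
      (x.1 i, x.2 - κ * preWt i ε)) (fun x => AnalyticAt.prod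
        (f := fun x : Vars n => x.1 i) (g := fun x : Vars n => x.2 - κ * preWt i ε)
        (analyticAt_vars_coord i x) (by fun_prop)) ?_
    have := isOpenMap_coord_dyn i one_ne_zero one_ne_zero 0 (-(κ * preWt i ε))
    simpa [sub_eq_add_neg] using this
  · exact .zero

theorem isMeromorphic_leftCoeff (hq0 : 0 < q) (hq1 : q < 1) (P : BoundaryParams) (i : Fin n)
    (k : ℤ) (ε' ε : Fin n → ℤˣ) : IsMeromorphic fun x => leftCoeff q κ P i k x ε' ε := by
  simp only [leftCoeff, leg₁, Matrix.of_apply]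
  split_ifs
  · refine (isMeromorphic_KBaLeft hq0 hq1 P _ _).comp (φ := fun x : Vars n =>
      (1 / 2 - x.1 i, x.2 - κ * wt (ε' i))) (fun x => AnalyticAt.prod
        (f := fun x : Vars n => 1 / 2 - x.1 i) (g := fun x : Vars n => x.2 - κ * wt (ε' i))
        (analyticAt_const.sub (analyticAt_vars_coord i x)) (by fun_prop)) ?_
    have := isOpenMap_coord_dyn i (neg_ne_zero.2 one_ne_zero) one_ne_zero (1 / 2)
      (-(κ * wt (ε' i)))
    simpa [sub_eq_add_neg, add_comm] using this
  · exact .zero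
  · exact .zero

theorem exists_actsAs_bulkOp (hq0 : 0 < q) (hq1 : q < 1) (κ : ℂ) {i j : Fin n} (hij : i < j) :
    ∃ D : Module.End ℂ (MeroSpin n), ActsAs D (bulkOp q κ i j) := by
  obtain ⟨D, hD⟩ := exists_actsAs_twistOp κ (AffWeyl.swap i j) {0} (bulkCoeff q κ i j)
    fun k _ => isMeromorphic_bulkCoeff hq0 hq1 hij.ne k
  exact ⟨D, hD.congr (twistOp_bulk hij)⟩

theorem exists_actsAs_rightOp (hq0 : 0 < q) (hq1 : q < 1) (κ : ℂ) (P : BoundaryParams)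
    (i : Fin n) : ∃ D : Module.End ℂ (MeroSpin n), ActsAs D (rightOp q κ P i) := by
  obtain ⟨D, hD⟩ := exists_actsAs_twistOp κ (AffWeyl.flip i) {0} (rightCoeff q κ P i)
    fun k _ => isMeromorphic_rightCoeff hq0 hq1 P i k
  exact ⟨D, hD.congr (twistOp_right P i)⟩

theorem exists_actsAs_leftOp (hq0 : 0 < q) (hq1 : q < 1) (κ : ℂ) (P : BoundaryParams)
    (i : Fin n) : ∃ D : Module.End ℂ (MeroSpin n), ActsAs D (leftOp q κ P i) := by
  obtain ⟨D, hD⟩ := exists_actsAs_twistOp κ (AffWeyl.affFlip i) {-1, 0, 1} (leftCoeff q κ P i)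
    fun k _ => isMeromorphic_leftCoeff hq0 hq1 P i k
  exact ⟨D, hD.congr (twistOp_left P i)⟩

end Generators

/-! ### The representation of the affine Weyl group. -/

section Representation

variable {m : ℕ} {q : ℝ}

/-- Relations valid at generic points are identities between operators on meromorphic functions. The
generators are involutions, hence units, and the Coxeter presentation extends them to W. -/
theorem exists_representation (hq0 : 0 < q) (hq1 : q < 1) (κ : ℂ) (Pl Pr : BoundaryParams)
    (hm : 0 < m) : ∃ ρ : AffWeyl (m + 1) →* Module.End ℂ (MeroSpin (m + 1)),
      (∀ i j : Fin (m + 1), (j : ℕ) = i + 1 → ActsAs (ρ (AffWeyl.swap i j)) (bulkOp q κ i j)) ∧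
      ActsAs (ρ (AffWeyl.flip (Fin.last m))) (rightOp q κ Pr (Fin.last m)) ∧
      ActsAs (ρ (AffWeyl.affFlip 0)) (leftOp q κ Pl 0) := by
  choose B hB using fun (i j : Fin (m + 1)) (hij : i < j) => exists_actsAs_bulkOp hq0 hq1 κ hij
  obtain ⟨T, hT⟩ := exists_actsAs_rightOp (n := m + 1) hq0 hq1 κ Pr (Fin.last m)
  obtain ⟨Z, hZ⟩ := exists_actsAs_leftOp (n := m + 1) hq0 hq1 κ Pl 0
  have B2 : ∀ i j hij, B i j hij * B i j hij = 1 := fun i j hij =>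
    ((hB i j hij).mul (hB i j hij)).unique .one fun f =>
      (bulkOp_bulkOp hq0 hq1 hij).mono fun x hx => funext fun ε => hx f ε
  have T2 : T * T = 1 := (hT.mul hT).unique .one fun f =>
    (rightOp_rightOp hq0 hq1 Pr _).mono fun x hx => funext fun ε => hx f ε
  have Z2 : Z * Z = 1 := (hZ.mul hZ).unique .one fun f =>
    (leftOp_leftOp hq0 hq1 Pl _).mono fun x hx => funext fun ε => hx f ε
  have lt : ∀ {i : ℕ} (h : i < m), (⟨i, by omega⟩ : Fin (m + 1)) < ⟨i + 1, by omega⟩ :=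
    fun h => Fin.lt_def.2 (Nat.lt_succ_self _)
  let s : ℕ → (Module.End ℂ (MeroSpin (m + 1)))ˣ := fun i =>
    if h : i < m then ⟨B _ _ (lt h), B _ _ (lt h), B2 _ _ _, B2 _ _ _⟩ else 1
  have hs : ∀ i (h : i < m), (s i : Module.End ℂ (MeroSpin (m + 1))) = B _ _ (lt h) :=
    fun i h => by simp only [s, dif_pos h]
  let t : (Module.End ℂ (MeroSpin (m + 1)))ˣ := ⟨T, T, T2, T2⟩
  let r : (Module.End ℂ (MeroSpin (m + 1)))ˣ := ⟨Z, Z, Z2, Z2⟩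
  have hC : IsAffineTypeC m s t r := by
    refine ⟨⟨fun i hi => ?_, fun i hi => ?_, fun i j hij hj => ?_⟩, Units.ext T2, Units.ext Z2,
      fun i hi => ?_, ?_, fun i h0 hi => ?_, ?_, ?_⟩
    · refine Units.ext ?_
      rw [Units.val_mul, hs i hi, B2]; rfl
    · refine Units.ext ?_
      simp only [Units.val_mul, hs i (by omega : i < m), hs (i + 1) hi]
      exact (((hB _ _ _).mul (hB _ _ _)).mul (hB _ _ _)).unique
        (((hB _ _ _).mul (hB _ _ _)).mul (hB _ _ _)) fun f =>
        (bulkOp_braid hq0 hq1 rfl rfl).mono fun x hx => funext fun ε => hx f ε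
    · refine Units.ext ?_
      simp only [Units.val_mul, hs i (by omega : i < m), hs j hj]
      exact ((hB _ _ _).mul (hB _ _ _)).unique ((hB _ _ _).mul (hB _ _ _)) fun f =>
        .of_forall fun x => funext fun ε =>
          bulkOp_comm (lt (show i < m by omega)) (Fin.lt_def.2 (by simpa using hij)) (lt hj) x f ε
    · refine Units.ext ?_
      simp only [Units.val_mul, hs i (by omega : i < m)]
      exact ((hB _ _ _).mul hT).unique (hT.mul (hB _ _ _)) fun f =>
        .of_forall fun x => funext fun ε =>
          bulkOp_rightOp_comm Pr (lt (show i < m by omega)) (Fin.lt_def.2 (by simpa using hi)) x f ε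
    · refine Units.ext ?_
      simp only [Units.val_mul, hs (m - 1) (by omega : m - 1 < m)]
      have e : (⟨m - 1 + 1, by omega⟩ : Fin (m + 1)) = Fin.last m := Fin.ext (by simp; omega)
      have hb := hB _ _ (lt (show m - 1 < m by omega))
      refine (((hb.mul hT).mul hb).mul hT).unique (((hT.mul hb).mul hT).mul hb) fun f => ?_
      refine (bulkOp_rightOp_reflection (κ := κ) (i := ⟨m - 1, by omega⟩) (j := Fin.last m) hq0 hq1 Pr
        (by simp; omega)).mono fun x hx => funext fun ε => ?_
      simp only [e]
      exact hx f ε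
    · refine Units.ext ?_
      simp only [Units.val_mul, hs i hi]
      exact ((hB _ _ _).mul hZ).unique (hZ.mul (hB _ _ _)) fun f =>
        .of_forall fun x => funext fun ε =>
          bulkOp_leftOp_comm Pl (lt hi) (Fin.lt_def.2 (by simpa using h0)) x f ε
    · refine Units.ext ?_
      simp only [Units.val_mul, hs 0 hm]
      have hb := hB _ _ (lt hm)
      exact (((hb.mul hZ).mul hb).mul hZ).unique (((hZ.mul hb).mul hZ).mul hb) fun f =>
        (bulkOp_leftOp_reflection hq0 hq1 Pl rfl (lt hm)).mono fun x hx => funext fun ε => hx f ε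
    · refine Units.ext ?_
      exact (hZ.mul hT).unique (hT.mul hZ) fun f => .of_forall fun x => funext fun ε =>
        leftOp_rightOp_comm Pl Pr (Fin.lt_def.2 (by simpa using hm)) x f ε
  obtain ⟨f, f1, f2, f3⟩ := hC.exists_hom hm
  refine ⟨(Units.coeHom _).comp f, fun i j hij => ?_, ?_, ?_⟩
  · have hi : (i : ℕ) < m := by omega
    have e : AffWeyl.swap i j = SemidirectProduct.inr (SemidirectProduct.inr (adjSwap m i)) := by
      rw [adjSwap_of_lt hi, AffWeyl.swap]
      congr 3
      exact Fin.ext hij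
    obtain rfl : j = ⟨i + 1, Nat.succ_lt_succ hi⟩ := Fin.ext hij
    rw [MonoidHom.comp_apply, e, f1 i hi, Units.coeHom_apply, hs i hi]
    exact hB _ _ _
  · rw [MonoidHom.comp_apply, f2]; exact hT
  · rw [MonoidHom.comp_apply, f3]; exact hZ

end Representation

/-! ### Multipliers of R under shifts by periods. -/

section Multipliers

variable {q : ℝ}

theorem apply_add_int_mul {f : ℂ → ℂ} {p a : ℂ} (h : ∀ x, f (x + p) = Complex.exp a * f x) (m : ℤ)
    (x : ℂ) : f (x + m * p) = Complex.exp (m * a) * f x := by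
  have hnat : ∀ (k : ℕ) (x : ℂ), f (x + k * p) = Complex.exp (k * a) * f x := by
    intro k
    induction k with
    | zero => intro x; simp
    | succ k ih =>
      intro x
      rw [show x + ((k + 1 : ℕ) : ℂ) * p = (x + k * p) + p by push_cast; ring, h, ih, ← mul_assoc,
        ← Complex.exp_add]
      congr 2
      push_cast; ring
  obtain ⟨k, rfl | rfl⟩ := m.eq_nat_or_neg
  · exact_mod_cast hnat k x
  · have := hnat k (x + ((-(k : ℤ) : ℤ) : ℂ) * p)
    rw [show x + ((-(k : ℤ) : ℤ) : ℂ) * p + k * p = x by push_cast; ring] at this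
    rw [this, ← mul_assoc, ← Complex.exp_add]
    simp

theorem theta_q_mul (hq0 : 0 < q) (hq1 : q < 1) {x : ℂ} (hx : x ≠ 0) :
    theta q (q * x) = -x⁻¹ * theta q x := by
  have hq := ofReal_q_ne_zero hq0
  rw [theta_eq_qPoch hq0 hq1, theta_eq_qPoch hq0 hq1, qPoch_eq_mul hq0 hq1 x,
    show (q : ℂ) / (q * x) = x⁻¹ by field_simp, qPoch_eq_mul hq0 hq1 x⁻¹, ← div_eq_mul_inv]
  field_simp
  ring

theorem theta_mul_qpow_add_one (hq0 : 0 < q) (hq1 : q < 1) {c : ℂ} (hc : c ≠ 0) (x : ℂ) :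
    theta q (c * (q : ℂ) ^ (x + 1)) = -(c * (q : ℂ) ^ x)⁻¹ * theta q (c * (q : ℂ) ^ x) := by
  rw [← theta_q_mul hq0 hq1 (mul_ne_zero hc (qpow_ne_zero hq0 x)), qpow_add hq0, Complex.cpow_one]
  congr 1
  ring

theorem theta_mul_qpow_sub_one (hq0 : 0 < q) (hq1 : q < 1) {c : ℂ} (hc : c ≠ 0) (x : ℂ) :
    theta q (c * (q : ℂ) ^ (x - 1)) = -(c * (q : ℂ) ^ (x - 1)) * theta q (c * (q : ℂ) ^ x) := by
  have h := theta_mul_qpow_add_one hq0 hq1 hc (x - 1)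
  have := mul_ne_zero hc (qpow_ne_zero hq0 (x - 1))
  rw [sub_add_cancel] at h
  rw [h, neg_mul, neg_mul, mul_neg, neg_neg, mul_inv_cancel_left₀ this]

theorem theta_qpow_add_one (hq0 : 0 < q) (hq1 : q < 1) (x : ℂ) :
    theta q ((q : ℂ) ^ (x + 1)) = -((q : ℂ) ^ x)⁻¹ * theta q ((q : ℂ) ^ x) := by
  simpa using theta_mul_qpow_add_one hq0 hq1 one_ne_zero x

theorem theta_qpow_sub_one (hq0 : 0 < q) (hq1 : q < 1) (x : ℂ) :
    theta q ((q : ℂ) ^ (x - 1)) = -(q : ℂ) ^ (x - 1) * theta q ((q : ℂ) ^ x) := by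
  simpa using theta_mul_qpow_sub_one hq0 hq1 one_ne_zero x

theorem qpow_add_qper (hq0 : 0 < q) (hq1 : q < 1) (x : ℂ) :
    (q : ℂ) ^ (x + qper q) = (q : ℂ) ^ x := by
  rw [qpow_add hq0, qpow_qper hq0 hq1, mul_one]

theorem qpow_sub_qper (hq0 : 0 < q) (hq1 : q < 1) (x : ℂ) :
    (q : ℂ) ^ (x - qper q) = (q : ℂ) ^ x := by
  rw [← qpow_add_qper hq0 hq1 (x - qper q), sub_add_cancel]

theorem exp_mul_div {a b E Q : ℂ} (hQ : Q ≠ 0) : (E * Q * a) / (Q * b) = E * (a / b) := by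
  rw [mul_comm E, mul_assoc, mul_div_mul_left _ _ hQ, mul_div_assoc]

variable (κ : ℂ)

theorem ABa_add_one (hq0 : 0 < q) (hq1 : q < 1) (z w : ℂ) :
    ABa q κ (z + 1) w = Complex.exp (Real.log q * (-2 * κ)) * ABa q κ z w := by
  have e : (q : ℂ) ^ (-z - 1) = Complex.exp (Real.log q * (-2 * κ)) * (q : ℂ) ^ (2 * κ - z - 1) := by
    rw [qpow_eq_exp hq0, qpow_eq_exp hq0, ← Complex.exp_add]; congr 1; ring
  rw [ABa, ABa, show -(z + 1) = -z - 1 by ring, show 2 * κ - (z + 1) = 2 * κ - z - 1 by ring,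
    theta_qpow_sub_one hq0 hq1, theta_qpow_sub_one hq0 hq1, e,
    ← exp_mul_div (neg_ne_zero.2 (qpow_ne_zero hq0 (2 * κ - z - 1)))]
  congr 1 <;> ring

theorem BBa_add_one (hq0 : 0 < q) (hq1 : q < 1) (z w : ℂ) :
    BBa q κ (z + 1) w = Complex.exp (Real.log q * (-2 * κ - w)) * BBa q κ z w := by
  have e : (q : ℂ) ^ (-z - w - 1) =
      Complex.exp (Real.log q * (-2 * κ - w)) * (q : ℂ) ^ (2 * κ - z - 1) := by
    rw [qpow_eq_exp hq0, qpow_eq_exp hq0, ← Complex.exp_add]; congr 1; ring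
  rw [BBa, BBa, show -(z + 1) - w = -z - w - 1 by ring,
    show 2 * κ - (z + 1) = 2 * κ - z - 1 by ring,
    theta_qpow_sub_one hq0 hq1, theta_qpow_sub_one hq0 hq1, e,
    ← exp_mul_div (neg_ne_zero.2 (qpow_ne_zero hq0 (2 * κ - z - 1)))]
  congr 1 <;> ring

theorem ABa_dyn_add_one (hq0 : 0 < q) (hq1 : q < 1) (z w : ℂ) :
    ABa q κ z (w + 1) = Complex.exp (Real.log q * (-2 * κ)) * ABa q κ z w := by
  have e : ((q : ℂ) ^ (2 * κ + w))⁻¹ =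
      Complex.exp (Real.log q * (-2 * κ)) * ((q : ℂ) ^ w)⁻¹ := by
    rw [qpow_eq_exp hq0, qpow_eq_exp hq0, ← Complex.exp_neg, ← Complex.exp_neg,
      ← Complex.exp_add]; congr 1; ring
  rw [ABa, ABa, ← add_assoc, theta_qpow_add_one hq0 hq1, theta_qpow_add_one hq0 hq1, e,
    ← exp_mul_div (neg_ne_zero.2 (inv_ne_zero (qpow_ne_zero hq0 w)))]
  congr 1 <;> ring

theorem BBa_dyn_add_one (hq0 : 0 < q) (hq1 : q < 1) (z w : ℂ) :
    BBa q κ z (w + 1) = Complex.exp (Real.log q * (-z)) * BBa q κ z w := by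
  have e : (q : ℂ) ^ (-z - w - 1) =
      Complex.exp (Real.log q * (-z)) * (q : ℂ) ^ (-w - 1) := by
    rw [qpow_eq_exp hq0, qpow_eq_exp hq0, ← Complex.exp_add]; congr 1; ring
  rw [BBa, BBa, show -z - (w + 1) = -z - w - 1 by ring, show -(w + 1) = -w - 1 by ring,
    theta_qpow_sub_one hq0 hq1, theta_qpow_sub_one hq0 hq1, e,
    ← exp_mul_div (neg_ne_zero.2 (qpow_ne_zero hq0 (-w - 1)))]
  congr 1 <;> ring

theorem ABa_add_qper (hq0 : 0 < q) (hq1 : q < 1) (z w : ℂ) :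
    ABa q κ (z + qper q) w = ABa q κ z w := by
  rw [ABa, ABa, ← sub_sub, show -(z + qper q) = -z - qper q by ring]
  simp only [qpow_sub_qper hq0 hq1]

theorem BBa_add_qper (hq0 : 0 < q) (hq1 : q < 1) (z w : ℂ) :
    BBa q κ (z + qper q) w = BBa q κ z w := by
  rw [BBa, BBa, ← sub_sub, show -(z + qper q) - w = -z - w - qper q by ring]
  simp only [qpow_sub_qper hq0 hq1]

theorem ABa_dyn_add_qper (hq0 : 0 < q) (hq1 : q < 1) (z w : ℂ) :
    ABa q κ z (w + qper q) = ABa q κ z w := by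
  rw [ABa, ABa, ← add_assoc]
  simp only [qpow_add_qper hq0 hq1]

theorem BBa_dyn_add_qper (hq0 : 0 < q) (hq1 : q < 1) (z w : ℂ) :
    BBa q κ z (w + qper q) = BBa q κ z w := by
  rw [BBa, BBa, ← sub_sub, show -(w + qper q) = -w - qper q by ring]
  simp only [qpow_sub_qper hq0 hq1]

/-- Every sign is an integer, so quasi-periodicity in the dynamical variable is preserved by the
substitution `x ↦ ν x`. -/
theorem apply_wt_mul_add {f : ℂ → ℂ} {p a : ℂ} (h : ∀ x, f (x + p) = Complex.exp a * f x) (ν : ℤˣ)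
    (m : ℤ) (x : ℂ) : f (wt ν * (x + m * p)) = Complex.exp (wt ν * m * a) * f (wt ν * x) := by
  have := apply_add_int_mul h ((ν : ℤ) * m) (wt ν * x)
  rw [Int.cast_mul] at this
  rw [wt] at this ⊢
  rw [← this]
  congr 1
  ring

theorem apply_wt_mul_add_period {f : ℂ → ℂ} {p : ℂ} (h : ∀ x, f (x + p) = f x) (ν : ℤˣ)
    (m : ℤ) (x : ℂ) : f (wt ν * (x + m * p)) = f (wt ν * x) := by
  simpa using apply_wt_mul_add (f := f) (p := p) (a := 0) (fun x => by simpa using h x) ν m x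

theorem RBa_eq_zero_or (z w : ℂ) (ν μ : ℤˣ × ℤˣ) :
    RBa q κ z w ν μ = 0 ∨ ν = μ ∨ ν = μ.swap := by
  simp only [RBa, Matrix.of_apply]
  split_ifs <;> simp_all

theorem RBa_self_eq (z w : ℂ) {ν : ℤˣ × ℤˣ} (h : ν.1 = ν.2) : RBa q κ z w ν ν = 1 := by
  simp [RBa, h]

theorem RBa_self_ne (z w : ℂ) {ν : ℤˣ × ℤˣ} (h : ν.1 ≠ ν.2) :
    RBa q κ z w ν ν = ABa q κ z (wt ν.1 * w) := by
  simp [RBa, h]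

theorem RBa_swap_ne (z w : ℂ) {μ : ℤˣ × ℤˣ} (h : μ.1 ≠ μ.2) :
    RBa q κ z w μ.swap μ = BBa q κ z (wt μ.2 * w) := by
  have : μ.swap ≠ μ := fun e => h (by simpa using congrArg Prod.snd e)
  simp [RBa, this]

/-- One formula in the weights covers all entries, so that the exponent can later be recognised as a
difference of gauge terms: the first summand sees the diagonal entries with ν₁ ≠ ν₂, and the second
is ±w off the diagonal. -/
theorem RBa_add_int_spectral (hq0 : 0 < q) (hq1 : q < 1) (m : ℤ) (z w : ℂ) (ν μ : ℤˣ × ℤˣ) :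
    RBa q κ (z + m) w ν μ = Complex.exp (Real.log q * m *
      (κ * (wt ν.1 * wt ν.2 - 1) - w * (wt ν.1 - wt μ.1) / 2)) * RBa q κ z w ν μ := by
  have hA := fun w => apply_add_int_mul (f := fun z => ABa q κ z w)
    (fun z => ABa_add_one κ hq0 hq1 z w) m z
  have hB := fun w => apply_add_int_mul (f := fun z => BBa q κ z w)
    (fun z => BBa_add_one κ hq0 hq1 z w) m z
  simp only [mul_one] at hA hB
  have hdiag : ν = μ → RBa q κ (z + m) w ν μ = Complex.exp (Real.log q * m *
      (κ * (wt ν.1 * wt ν.2 - 1) - w * (wt ν.1 - wt μ.1) / 2)) * RBa q κ z w ν μ := by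
    rintro rfl
    by_cases h : ν.1 = ν.2
    · rw [RBa_self_eq κ _ _ h, RBa_self_eq κ _ _ h, h, wt_mul_self]; simp
    · have h2 : ν.2 = -ν.1 := by
        revert h; generalize ν.1 = a; generalize ν.2 = b; revert a b; decide
      rw [RBa_self_ne κ _ _ h, RBa_self_ne κ _ _ h, hA, h2, wt_neg]
      congr 2
      linear_combination (Real.log q * m * κ : ℂ) * wt_mul_self ν.1
  rcases RBa_eq_zero_or (q := q) κ z w ν μ with h | h | h
  · rcases RBa_eq_zero_or (q := q) κ (z + m) w ν μ with h' | h' | h'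
    · rw [h, h', mul_zero]
    · exact hdiag h'
    · by_cases e : μ.1 = μ.2
      · exact hdiag (h'.trans (Prod.ext e.symm e))
      · subst h'
        rw [RBa_swap_ne κ _ _ e] at h
        rw [RBa_swap_ne κ _ _ e, RBa_swap_ne κ _ _ e, hB, h, mul_zero, mul_zero]
  · exact hdiag h
  · by_cases e : μ.1 = μ.2
    · exact hdiag (h.trans (Prod.ext e.symm e))
    · subst h
      have h2 : μ.1 = -μ.2 := by
        revert e; generalize μ.1 = a; generalize μ.2 = b; revert a b; decide
      rw [RBa_swap_ne κ _ _ e, RBa_swap_ne κ _ _ e, hB, Prod.fst_swap, Prod.snd_swap, h2, wt_neg]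
      congr 2
      linear_combination (Real.log q * m * κ : ℂ) * wt_mul_self μ.2

/-- The shift is by 2 because R enters with the dynamical argument 2ξ. -/
theorem RBa_add_two_dyn (hq0 : 0 < q) (hq1 : q < 1) (z w : ℂ) (ν μ : ℤˣ × ℤˣ) :
    RBa q κ z (w + 2) ν μ = Complex.exp (Real.log q *
      (-z * (wt ν.1 - wt μ.1) - κ * (wt ν.1 - wt ν.2 + wt μ.1 - wt μ.2))) * RBa q κ z w ν μ := by
  have hA := fun ν => apply_wt_mul_add (ABa_dyn_add_one κ hq0 hq1 z) ν 2 w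
  have hB := fun ν => apply_wt_mul_add (BBa_dyn_add_one κ hq0 hq1 z) ν 2 w
  simp only [mul_one, Int.cast_ofNat] at hA hB
  have hdiag : ν = μ → RBa q κ z (w + 2) ν μ = Complex.exp (Real.log q *
      (-z * (wt ν.1 - wt μ.1) - κ * (wt ν.1 - wt ν.2 + wt μ.1 - wt μ.2))) *
        RBa q κ z w ν μ := by
    rintro rfl
    by_cases h : ν.1 = ν.2
    · rw [RBa_self_eq κ _ _ h, RBa_self_eq κ _ _ h, h]; simp
    · have h2 : ν.2 = -ν.1 := by
        revert h; generalize ν.1 = a; generalize ν.2 = b; revert a b; decide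
      rw [RBa_self_ne κ _ _ h, RBa_self_ne κ _ _ h, hA, h2, wt_neg]
      congr 2
      ring
  rcases RBa_eq_zero_or (q := q) κ z w ν μ with h | h | h
  · rcases RBa_eq_zero_or (q := q) κ z (w + 2) ν μ with h' | h' | h'
    · rw [h, h', mul_zero]
    · exact hdiag h'
    · by_cases e : μ.1 = μ.2
      · exact hdiag (h'.trans (Prod.ext e.symm e))
      · subst h'
        rw [RBa_swap_ne κ _ _ e] at h
        rw [RBa_swap_ne κ _ _ e, RBa_swap_ne κ _ _ e, hB, h, mul_zero, mul_zero]
  · exact hdiag h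
  · by_cases e : μ.1 = μ.2
    · exact hdiag (h.trans (Prod.ext e.symm e))
    · subst h
      have h2 : μ.1 = -μ.2 := by
        revert e; generalize μ.1 = a; generalize μ.2 = b; revert a b; decide
      rw [RBa_swap_ne κ _ _ e, RBa_swap_ne κ _ _ e, hB, Prod.fst_swap, Prod.snd_swap, h2, wt_neg]
      congr 2
      ring

theorem RBa_add_qper_spectral (hq0 : 0 < q) (hq1 : q < 1) (m : ℤ) (z w : ℂ) (ν μ : ℤˣ × ℤˣ) :
    RBa q κ (z + m * qper q) w ν μ = RBa q κ z w ν μ := by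
  have hA : ∀ w, ABa q κ (z + m * qper q) w = ABa q κ z w := fun w => by
    simpa using apply_add_int_mul (f := fun z => ABa q κ z w) (a := 0)
      (fun z => by simpa using ABa_add_qper κ hq0 hq1 z w) m z
  have hB : ∀ w, BBa q κ (z + m * qper q) w = BBa q κ z w := fun w => by
    simpa using apply_add_int_mul (f := fun z => BBa q κ z w) (a := 0)
      (fun z => by simpa using BBa_add_qper κ hq0 hq1 z w) m z
  simp only [RBa, Matrix.of_apply, hA, hB]

theorem RBa_add_qper_dyn (hq0 : 0 < q) (hq1 : q < 1) (m : ℤ) (z w : ℂ) (ν μ : ℤˣ × ℤˣ) :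
    RBa q κ z (w + m * qper q) ν μ = RBa q κ z w ν μ := by
  simp only [RBa, Matrix.of_apply, apply_wt_mul_add_period (ABa_dyn_add_qper κ hq0 hq1 z),
    apply_wt_mul_add_period (BBa_dyn_add_qper κ hq0 hq1 z)]

end Multipliers

/-! ### Multipliers of K under shifts by periods. -/

section BoundaryMultipliers

variable {q : ℝ} (P : BoundaryParams)

/-- The exponential factor of 𝓒 is made to cancel the multipliers of the theta functions under the
shift by 1. -/
theorem Cfun_add_one (hq0 : 0 < q) (hq1 : q < 1) (z x : ℂ) :
    Cfun q P (z + 1) x = Cfun q P z x := by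
  have ha := qpow_ne_zero hq0 (P.ζ + P.ζ')
  have hd := neg_ne_zero.2 (qpow_ne_zero hq0 (1 / 2 + P.ζ' - P.υ'))
  have hx := qpow_ne_zero hq0 x
  have hz := qpow_ne_zero hq0 (-z - 1)
  have e1 : (q : ℂ) ^ (-((P.ζ + P.υ - (z + 1)) * (P.ζ + P.ζ' - x))) * (q : ℂ) ^ x =
      (q : ℂ) ^ (P.ζ + P.ζ') * (q : ℂ) ^ (-((P.ζ + P.υ - z) * (P.ζ + P.ζ' - x))) := by
    rw [← qpow_add hq0, ← qpow_add hq0]; congr 1; ring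
  have e2 : theta q (-(q : ℂ) ^ (1 / 2 + P.ζ' - P.υ') * (q : ℂ) ^ (x - (z + 1)) /
      (q : ℂ) ^ (P.ζ + P.ζ')) = -(-(q : ℂ) ^ (1 / 2 + P.ζ' - P.υ') / (q : ℂ) ^ (P.ζ + P.ζ') *
      ((q : ℂ) ^ (-z - 1) * (q : ℂ) ^ x)) * theta q (-(q : ℂ) ^ (1 / 2 + P.ζ' - P.υ') *
        (q : ℂ) ^ (x - z) / (q : ℂ) ^ (P.ζ + P.ζ')) := by
    have := theta_mul_qpow_sub_one hq0 hq1 (div_ne_zero hd ha) (x - z)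
    rw [← qpow_add hq0, show -z - 1 + x = x - z - 1 by ring, mul_div_right_comm,
      mul_div_right_comm, ← this, sub_sub]
  have e3 : theta q (-(q : ℂ) ^ (1 / 2 + P.ζ' - P.υ') * (q : ℂ) ^ (-(z + 1))) =
      -(-(q : ℂ) ^ (1 / 2 + P.ζ' - P.υ') * (q : ℂ) ^ (-z - 1)) *
        theta q (-(q : ℂ) ^ (1 / 2 + P.ζ' - P.υ') * (q : ℂ) ^ (-z)) := by
    rw [show -(z + 1) = -z - 1 by ring, theta_mul_qpow_sub_one hq0 hq1 hd]
  have e1' := eq_div_of_mul_eq hx e1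
  simp only [Cfun, e1', e2, e3]
  generalize (q : ℂ) ^ (P.ζ + P.ζ') = a at *
  generalize -(q : ℂ) ^ (1 / 2 + P.ζ' - P.υ') = d at *
  generalize (q : ℂ) ^ x = X at *
  generalize (q : ℂ) ^ (-z - 1) = Z at *
  generalize theta q (d * (q : ℂ) ^ (-z)) = t1
  generalize theta q ((q : ℂ) ^ (2 * x)) = t2
  field_simp

theorem Cfun_dyn_add_one (hq0 : 0 < q) (hq1 : q < 1) (z x : ℂ) :
    Cfun q P z (x + 1) = Cfun q P z x := by
  have ha := qpow_ne_zero hq0 (P.ζ + P.ζ')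
  have hb := neg_ne_zero.2 (qpow_ne_zero hq0 (P.ζ - P.ζ'))
  have hc := qpow_ne_zero hq0 (1 / 2 + P.υ + P.υ')
  have hd := neg_ne_zero.2 (qpow_ne_zero hq0 (1 / 2 + P.ζ' - P.υ'))
  have hx := qpow_ne_zero hq0 x
  have hz := qpow_ne_zero hq0 (-z)
  have hq := ofReal_q_ne_zero hq0
  have e1 : (q : ℂ) ^ (-((P.ζ + P.υ - z) * (P.ζ + P.ζ' - (x + 1)))) * q =
      (-(q : ℂ) ^ (P.ζ - P.ζ') * (q : ℂ) ^ (1 / 2 + P.υ + P.υ') *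
        -(q : ℂ) ^ (1 / 2 + P.ζ' - P.υ') * (q : ℂ) ^ (-z)) *
      (q : ℂ) ^ (-((P.ζ + P.υ - z) * (P.ζ + P.ζ' - x))) := by
    have : (q : ℂ) ^ (-((P.ζ + P.υ - z) * (P.ζ + P.ζ' - (x + 1)))) * (q : ℂ) ^ (1 : ℂ) =
      ((q : ℂ) ^ (P.ζ - P.ζ') * (q : ℂ) ^ (1 / 2 + P.υ + P.υ') *
        (q : ℂ) ^ (1 / 2 + P.ζ' - P.υ') * (q : ℂ) ^ (-z)) *
      (q : ℂ) ^ (-((P.ζ + P.υ - z) * (P.ζ + P.ζ' - x))) := by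
      simp only [← qpow_add hq0]; congr 1; ring
    rw [Complex.cpow_one] at this
    rw [this]; ring
  have e2 : theta q (-(q : ℂ) ^ (1 / 2 + P.ζ' - P.υ') * (q : ℂ) ^ (x + 1 - z) /
      (q : ℂ) ^ (P.ζ + P.ζ')) = -(-(q : ℂ) ^ (1 / 2 + P.ζ' - P.υ') / (q : ℂ) ^ (P.ζ + P.ζ') *
      ((q : ℂ) ^ x * (q : ℂ) ^ (-z)))⁻¹ * theta q (-(q : ℂ) ^ (1 / 2 + P.ζ' - P.υ') *
        (q : ℂ) ^ (x - z) / (q : ℂ) ^ (P.ζ + P.ζ')) := by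
    have := theta_mul_qpow_add_one hq0 hq1 (div_ne_zero hd ha) (x - z)
    rw [← qpow_add hq0, ← sub_eq_add_neg, mul_div_right_comm,
      mul_div_right_comm, ← this, show x + 1 - z = x - z + 1 by ring]
  have e3 : theta q ((q : ℂ) ^ (2 * (x + 1))) =
      (q * ((q : ℂ) ^ x) ^ 4)⁻¹ * theta q ((q : ℂ) ^ (2 * x)) := by
    rw [show 2 * (x + 1) = 2 * x + 1 + 1 by ring, theta_qpow_add_one hq0 hq1,
      theta_qpow_add_one hq0 hq1, qpow_add hq0 (2 * x) 1, Complex.cpow_one,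
      show (q : ℂ) ^ (2 * x) = ((q : ℂ) ^ x) ^ 2 by
        rw [two_mul, qpow_add hq0, sq]]
    field_simp
  have e1' := eq_div_of_mul_eq hq e1
  simp only [Cfun, e1', e2, e3, theta_mul_qpow_add_one hq0 hq1 ha,
    theta_mul_qpow_add_one hq0 hq1 hb, theta_mul_qpow_add_one hq0 hq1 hc]
  generalize (q : ℂ) ^ (P.ζ + P.ζ') = a at *
  generalize -(q : ℂ) ^ (P.ζ - P.ζ') = b at *
  generalize (q : ℂ) ^ (1 / 2 + P.υ + P.υ') = c at *
  generalize -(q : ℂ) ^ (1 / 2 + P.ζ' - P.υ') = d at *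
  generalize theta q ((q : ℂ) ^ (2 * x)) = t2
  generalize (q : ℂ) ^ x = X at *
  generalize (q : ℂ) ^ (-z) = Z at *
  generalize theta q (d * Z) = t1
  field_simp

/-- The theta functions depend on q^z only, so the multiplier comes from the exponential factor
alone. -/
theorem Cfun_add_qper (hq0 : 0 < q) (hq1 : q < 1) (z x : ℂ) : Cfun q P (z + qper q) x =
    Complex.exp (2 * Real.pi * Complex.I * (P.ζ + P.ζ' - x)) * Cfun q P z x := by
  have e : (q : ℂ) ^ (-((P.ζ + P.υ - (z + qper q)) * (P.ζ + P.ζ' - x))) =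
      Complex.exp (2 * Real.pi * Complex.I * (P.ζ + P.ζ' - x)) *
        (q : ℂ) ^ (-((P.ζ + P.υ - z) * (P.ζ + P.ζ' - x))) := by
    rw [qpow_eq_exp hq0, qpow_eq_exp hq0, ← Complex.exp_add, ← log_mul_qper hq0 hq1]
    congr 1; ring
  simp only [Cfun, e, show x - (z + qper q) = x - z - qper q by ring,
    show -(z + qper q) = -z - qper q by ring, qpow_sub_qper hq0 hq1]
  ring

theorem Cfun_dyn_add_qper (hq0 : 0 < q) (hq1 : q < 1) (z x : ℂ) : Cfun q P z (x + qper q) =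
    Complex.exp (2 * Real.pi * Complex.I * (P.ζ + P.υ - z)) * Cfun q P z x := by
  have e : (q : ℂ) ^ (-((P.ζ + P.υ - z) * (P.ζ + P.ζ' - (x + qper q)))) =
      Complex.exp (2 * Real.pi * Complex.I * (P.ζ + P.υ - z)) *
        (q : ℂ) ^ (-((P.ζ + P.υ - z) * (P.ζ + P.ζ' - x))) := by
    rw [qpow_eq_exp hq0, qpow_eq_exp hq0, ← Complex.exp_add, ← log_mul_qper hq0 hq1]
    congr 1; ring
  simp only [Cfun, e, show x + qper q - z = x - z + qper q by ring,
    show 2 * (x + qper q) = 2 * x + qper q + qper q by ring, qpow_add_qper hq0 hq1]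
  ring

theorem Cfun_sub_one (hq0 : 0 < q) (hq1 : q < 1) (z x : ℂ) : Cfun q P (z - 1) x = Cfun q P z x := by
  rw [← Cfun_add_one P hq0 hq1, sub_add_cancel]

theorem Cfun_dyn_sub_one (hq0 : 0 < q) (hq1 : q < 1) (z x : ℂ) :
    Cfun q P z (x - 1) = Cfun q P z x := by
  rw [← Cfun_dyn_add_one P hq0 hq1, sub_add_cancel]

theorem Cfun_sub_qper (hq0 : 0 < q) (hq1 : q < 1) (z x : ℂ) : Cfun q P (z - qper q) x =
    Complex.exp (-(2 * Real.pi * Complex.I * (P.ζ + P.ζ' - x))) * Cfun q P z x := by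
  have := Cfun_add_qper P hq0 hq1 (z - qper q) x
  rw [sub_add_cancel] at this
  rw [this, ← mul_assoc, ← Complex.exp_add, neg_add_cancel, Complex.exp_zero, one_mul]

theorem Cfun_dyn_sub_qper (hq0 : 0 < q) (hq1 : q < 1) (z x : ℂ) : Cfun q P z (x - qper q) =
    Complex.exp (-(2 * Real.pi * Complex.I * (P.ζ + P.υ - z))) * Cfun q P z x := by
  have := Cfun_dyn_add_qper P hq0 hq1 z (x - qper q)
  rw [sub_add_cancel] at this
  rw [this, ← mul_assoc, ← Complex.exp_add, neg_add_cancel, Complex.exp_zero, one_mul]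

theorem alphaBa_add_one (hq0 : 0 < q) (hq1 : q < 1) (z x : ℂ) :
    alphaBa q P (z + 1) x = Complex.exp (Real.log q * (2 * x)) * alphaBa q P z x := by
  simp only [alphaBa, neg_add', Cfun_add_one _ hq0 hq1, Cfun_dyn_add_one _ hq0 hq1,
    Cfun_dyn_sub_one _ hq0 hq1, show 2 * (z + 1) * x = 2 * x + 2 * z * x by ring, qpow_add hq0,
    ← qpow_eq_exp hq0]
  ring

theorem alphaBa_dyn_add_one (hq0 : 0 < q) (hq1 : q < 1) (z x : ℂ) :
    alphaBa q P z (x + 1) = Complex.exp (Real.log q * (2 * z)) * alphaBa q P z x := by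
  simp only [alphaBa, Cfun_add_one _ hq0 hq1, Cfun_dyn_add_one _ hq0 hq1,
    show 2 * z * (x + 1) = 2 * z + 2 * z * x by ring, qpow_add hq0, ← qpow_eq_exp hq0]
  ring

theorem betaBa_add_one (hq0 : 0 < q) (hq1 : q < 1) (z x : ℂ) :
    betaBa q P (z + 1) x = betaBa q P z x := by
  simp only [betaBa, neg_add', Cfun_add_one _ hq0 hq1, Cfun_dyn_sub_one _ hq0 hq1]

theorem betaBa_dyn_add_one (hq0 : 0 < q) (hq1 : q < 1) (z x : ℂ) :
    betaBa q P z (x + 1) = betaBa q P z x := by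
  simp only [betaBa, neg_add', Cfun_dyn_add_one _ hq0 hq1, Cfun_sub_one _ hq0 hq1]

/-- Both terms of the numerator acquire the same multiplier: the duality exchanges ζ + υ with ζ + ζ'
just as it exchanges the roles of z and ξ. -/
theorem alphaBa_add_qper (hq0 : 0 < q) (hq1 : q < 1) (z x : ℂ) : alphaBa q P (z + qper q) x =
    Complex.exp (4 * Real.pi * Complex.I * (P.ζ + P.ζ')) * alphaBa q P z x := by
  have e : (q : ℂ) ^ (2 * (z + qper q) * x) =
      Complex.exp (4 * Real.pi * Complex.I * x) * (q : ℂ) ^ (2 * z * x) := by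
    rw [qpow_eq_exp hq0, qpow_eq_exp hq0, ← Complex.exp_add]
    congr 1
    linear_combination 2 * x * log_mul_qper hq0 hq1
  have e2 : Complex.exp (4 * Real.pi * Complex.I * (P.ζ + P.ζ')) =
      Complex.exp (2 * Real.pi * Complex.I * (P.ζ + P.ζ' - x)) *
      Complex.exp (2 * Real.pi * Complex.I * (P.ζ + P.ζ' - x)) *
      Complex.exp (4 * Real.pi * Complex.I * x) := by
    simp only [← Complex.exp_add]; congr 1; ring
  simp only [alphaBa, neg_add', Cfun_add_qper _ hq0 hq1, Cfun_dyn_add_qper _ hq0 hq1,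
    Cfun_dyn_sub_qper _ hq0 hq1, BoundaryParams.dual, e, e2, Complex.exp_neg]
  simp only [div_eq_mul_inv, mul_inv, inv_inv]
  ring

theorem alphaBa_dyn_add_qper (hq0 : 0 < q) (hq1 : q < 1) (z x : ℂ) :
    alphaBa q P z (x + qper q) = alphaBa q P z x := by
  have e : (q : ℂ) ^ (2 * z * (x + qper q)) =
      Complex.exp (4 * Real.pi * Complex.I * z) * (q : ℂ) ^ (2 * z * x) := by
    rw [qpow_eq_exp hq0, qpow_eq_exp hq0, ← Complex.exp_add]
    congr 1
    linear_combination 2 * z * log_mul_qper hq0 hq1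
  have e2 : Complex.exp (2 * Real.pi * Complex.I * (P.ζ + P.υ - z)) *
      Complex.exp (4 * Real.pi * Complex.I * z) *
      (Complex.exp (2 * Real.pi * Complex.I * (P.ζ + P.υ - -z)))⁻¹ = 1 := by
    simp only [← Complex.exp_neg, ← Complex.exp_add]
    rw [Complex.exp_eq_one_iff]
    exact ⟨0, by push_cast; ring⟩
  simp only [alphaBa, Cfun_add_qper _ hq0 hq1, Cfun_dyn_add_qper _ hq0 hq1,
    BoundaryParams.dual, e]
  simp only [div_eq_mul_inv, mul_inv]
  rw [← one_mul ((Cfun q P z x - _) * _ * _), ← e2]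
  ring

theorem betaBa_add_qper (hq0 : 0 < q) (hq1 : q < 1) (z x : ℂ) : betaBa q P (z + qper q) x =
    Complex.exp (4 * Real.pi * Complex.I * (P.ζ + P.ζ')) * betaBa q P z x := by
  have e2 : Complex.exp (4 * Real.pi * Complex.I * (P.ζ + P.ζ')) =
      Complex.exp (2 * Real.pi * Complex.I * (P.ζ + P.ζ' - x)) *
      Complex.exp (2 * Real.pi * Complex.I * (P.ζ + P.ζ' - -x)) := by
    simp only [← Complex.exp_add]; congr 1; ring
  simp only [betaBa, neg_add', Cfun_add_qper _ hq0 hq1, Cfun_dyn_sub_qper _ hq0 hq1,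
    BoundaryParams.dual, e2, Complex.exp_neg]
  simp only [div_eq_mul_inv, mul_inv, inv_inv]
  ring

theorem betaBa_dyn_add_qper (hq0 : 0 < q) (hq1 : q < 1) (z x : ℂ) : betaBa q P z (x + qper q) =
    Complex.exp (4 * Real.pi * Complex.I * (P.ζ + P.υ)) * betaBa q P z x := by
  have e2 : Complex.exp (4 * Real.pi * Complex.I * (P.ζ + P.υ)) =
      Complex.exp (2 * Real.pi * Complex.I * (P.ζ + P.υ - z)) *
      Complex.exp (2 * Real.pi * Complex.I * (P.ζ + P.υ - -z)) := by
    simp only [← Complex.exp_add]; congr 1; ring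
  simp only [betaBa, neg_add', Cfun_sub_qper _ hq0 hq1, Cfun_dyn_add_qper _ hq0 hq1,
    BoundaryParams.dual, e2, Complex.exp_neg]
  simp only [div_eq_mul_inv, mul_inv, inv_inv]
  ring

theorem KBa_self (z x : ℂ) (ν : ℤˣ) : KBa q P z x ν ν = alphaBa q P z (wt ν * x) := by
  simp [KBa]

theorem KBa_neg (z x : ℂ) (μ : ℤˣ) : KBa q P z x (-μ) μ = betaBa q P z (wt (-μ) * x) := by
  simp [KBa]

theorem sign_eq_or_eq_neg (ν μ : ℤˣ) : ν = μ ∨ ν = -μ := by revert ν μ; decide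

theorem KBa_add_int_spectral (hq0 : 0 < q) (hq1 : q < 1) (m : ℤ) (z x : ℂ) (ν μ : ℤˣ) :
    KBa q P (z + m) x ν μ =
      Complex.exp (Real.log q * m * x * (wt ν + wt μ)) * KBa q P z x ν μ := by
  rcases sign_eq_or_eq_neg ν μ with rfl | rfl
  · have := apply_add_int_mul (f := fun z => alphaBa q P z (wt ν * x))
      (fun z => alphaBa_add_one P hq0 hq1 z _) m z
    rw [mul_one] at this
    rw [KBa_self, KBa_self, this]
    congr 2; ring
  · have := apply_add_int_mul (f := fun z => betaBa q P z (wt (-μ) * x)) (a := 0)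
      (fun z => by simpa using betaBa_add_one P hq0 hq1 z _) m z
    rw [mul_one] at this
    rw [KBa_neg, KBa_neg, this, wt_neg]
    simp

theorem KBa_add_int_dyn (hq0 : 0 < q) (hq1 : q < 1) (m : ℤ) (z x : ℂ) (ν μ : ℤˣ) :
    KBa q P z (x + m) ν μ =
      Complex.exp (Real.log q * m * z * (wt ν + wt μ)) * KBa q P z x ν μ := by
  rcases sign_eq_or_eq_neg ν μ with rfl | rfl
  · have := apply_wt_mul_add (alphaBa_dyn_add_one P hq0 hq1 z) ν m x
    rw [mul_one] at this
    rw [KBa_self, KBa_self, this]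
    congr 2; ring
  · have := apply_wt_mul_add_period (betaBa_dyn_add_one P hq0 hq1 z) (-μ) m x
    rw [mul_one] at this
    rw [KBa_neg, KBa_neg, this, wt_neg]
    simp

theorem KBa_add_qper_spectral (hq0 : 0 < q) (hq1 : q < 1) (m : ℤ) (z x : ℂ) (ν μ : ℤˣ) :
    KBa q P (z + m * qper q) x ν μ =
      Complex.exp (m * (4 * Real.pi * Complex.I * (P.ζ + P.ζ'))) * KBa q P z x ν μ := by
  rcases sign_eq_or_eq_neg ν μ with rfl | rfl
  · rw [KBa_self, KBa_self]
    exact apply_add_int_mul (f := fun z => alphaBa q P z (wt ν * x))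
      (fun z => alphaBa_add_qper P hq0 hq1 z _) m z
  · rw [KBa_neg, KBa_neg]
    exact apply_add_int_mul (f := fun z => betaBa q P z (wt (-μ) * x))
      (fun z => betaBa_add_qper P hq0 hq1 z _) m z

theorem KBa_add_qper_dyn (hq0 : 0 < q) (hq1 : q < 1) (m : ℤ) (z x : ℂ) (ν μ : ℤˣ) :
    KBa q P z (x + m * qper q) ν μ =
      Complex.exp (m * (2 * Real.pi * Complex.I * (P.ζ + P.υ)) * (wt ν - wt μ)) *
        KBa q P z x ν μ := by
  rcases sign_eq_or_eq_neg ν μ with rfl | rfl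
  · rw [KBa_self, KBa_self, apply_wt_mul_add_period (alphaBa_dyn_add_qper P hq0 hq1 z)]
    simp
  · rw [KBa_neg, KBa_neg, apply_wt_mul_add (betaBa_dyn_add_qper P hq0 hq1 z), wt_neg]
    congr 2; ring

end BoundaryMultipliers

/-! ### Quasi-periodicity of coefficients up to gauge terms. -/

section PeriodData

variable {n : ℕ}

/-- A family of periods of `ℂ^n × ℂ` indexed by `ℤ^n`, together with the gauge exponents by which
the coefficients of a difference operator are transformed under the shift by a period. -/
structure PeriodData (n : ℕ) where
  per : (Fin n → ℤ) → Vars n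
  gauge : (Fin n → ℤ) → Vars n → (Fin n → ℤˣ) → ℂ
  slope : ℂ

/-- The family of periods is permuted by the Weyl group. -/
def PeriodData.IsEquivariant (κ : ℂ) (F : PeriodData n) : Prop :=
  ∀ u k x l, twist κ u k (x + F.per l) = twist κ u k x + F.per (u.right⁻¹.act l)

/-- The coefficients `c_k` of `f ↦ ∑_k c_k(z, ξ) f(u⁻¹ z, ξ + 2κk)` are quasi-periodic. -/
def PeriodData.IsQuasiPeriodic (κ : ℂ) (F : PeriodData n) (u : AffWeyl n) (S : Finset ℤ)
    (c : ℤ → Vars n → SpinOp n) : Prop :=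
  ∀ l, ∃ A : ℂ, ∀ k ∈ S, ∀ ε' ε x, c k (x + F.per l) ε' ε =
    Complex.exp (A + k * F.slope + F.gauge (u.right⁻¹.act l) (twist κ u k x) ε -
      F.gauge l x ε') * c k x ε' ε

/-- `D` is of the form `f ↦ ∑_k c_k(z, ξ) f(u⁻¹ z, ξ + 2κk)` with meromorphic coefficients that are
quasi-periodic with respect to all `F i`. -/
def IsTwistedOperator {ι : Type*} (κ : ℂ) (F : ι → PeriodData n) (u : AffWeyl n)
    (D : Module.End ℂ (MeroSpin n)) : Prop :=
  ∃ (S : Finset ℤ) (c : ℤ → Vars n → SpinOp n),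
    (∀ k ∈ S, ∀ ε' ε, IsMeromorphic fun x => c k x ε' ε) ∧ ActsAs D (twistOp κ u S c) ∧
    ∀ i, (F i).IsQuasiPeriodic κ u S c

variable {κ : ℂ}

theorem twist_mul (u v : AffWeyl n) (k l : ℤ) (x : Vars n) :
    twist κ (u * v) (k + l) x = twist κ v l (twist κ u k x) := by
  simp only [twist_apply, mul_inv_rev, AffWeyl.act_mul]
  congr 1
  push_cast
  ring

theorem twist_one (x : Vars n) : twist κ (1 : AffWeyl n) 0 x = x := by
  simp [twist_apply, AffWeyl.act_one]

theorem ActsAs.untwist {κ : ℂ} {u : AffWeyl n} {D : Module.End ℂ (MeroSpin n)} {S : Finset ℤ}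
    {c : ℤ → Vars n → SpinOp n} (h : ActsAs D (twistOp κ u S c)) :
    ActsAs (D * _root_.weylAct u⁻¹)
      fun f x => ∑ k ∈ S, (c k x).mulVec (f (x.1, x.2 + 2 * κ * k)) :=
  (h.mul (ActsAs.weylAct u⁻¹)).congr fun f x => by
    simp only [twistOp, twist_apply, inv_inv, ← AffWeyl.act_mul, mul_inv_cancel, AffWeyl.act_one]

namespace IsTwistedOperator

variable {ι : Type*} {F : ι → PeriodData n} {u v : AffWeyl n} {D D' : Module.End ℂ (MeroSpin n)}

theorem one : IsTwistedOperator κ F 1 1 := by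
  refine ⟨{0}, fun _ _ => 1, fun k _ ε' ε => ?_, ActsAs.one.congr fun f x => ?_, fun i l =>
    ⟨0, fun k hk ε' ε x => ?_⟩⟩
  · exact .of_analytic fun x => analyticAt_const
  · simp [twistOp, twist_one]
  · obtain rfl := Finset.mem_singleton.1 hk
    by_cases h : ε' = ε
    · subst h
      rw [SemidirectProduct.one_right, inv_one, HypOct.act_one, twist_one]
      simp
    · change (1 : SpinOp n) ε' ε = _ * (1 : SpinOp n) ε' ε
      rw [Matrix.one_apply_ne h, mul_zero]

/-- A coefficient of the product is a sum over intermediate sign vectors δ. The gauge term at δ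
appears with plus sign in the first factor and with minus sign in the second, at the same point and
for the same period u⁻¹l by equivariance. So it cancels, and all summands share one multiplier. -/
theorem mul (hF : ∀ i, (F i).IsEquivariant κ) (h : IsTwistedOperator κ F u D)
    (h' : IsTwistedOperator κ F v D') : IsTwistedOperator κ F (u * v) (D * D') := by
  obtain ⟨S, c, hc, hD, hS⟩ := h
  obtain ⟨S', c', hc', hD', hS'⟩ := h'
  refine ⟨Finset.image₂ (· + ·) S S', fun k x => ∑ a ∈ S, ∑ b ∈ S',
    if a + b = k then c a x * c' b (twist κ u a x) else 0, fun k _ ε' ε => ?_,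
    (hD.mul hD').congr fun f x => ?_, fun i l => ?_⟩
  · simp only [Matrix.sum_apply]
    refine .sum _ fun a ha => .sum _ fun b hb => ?_
    split_ifs
    · simp only [Matrix.mul_apply]
      exact .sum _ fun δ _ => (hc a ha _ _).mul
        ((hc' b hb δ ε).comp_homeo (twist κ u a) (twist_analyticAt κ u a))
    · exact .zero
  · simp only [twistOp, Matrix.sum_mulVec, Matrix.mulVec_sum, Matrix.mulVec_mulVec, ← twist_mul]
    symm
    rw [Finset.sum_comm]
    refine Finset.sum_congr rfl fun a ha => ?_
    rw [Finset.sum_comm]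
    refine Finset.sum_congr rfl fun b hb => ?_
    rw [Finset.sum_eq_single_of_mem (a + b) (Finset.mem_image₂_of_mem ha hb), if_pos rfl]
    intro k _ hk
    rw [if_neg hk.symm, Matrix.zero_mulVec]
  · obtain ⟨A, hA⟩ := hS i l
    obtain ⟨A', hA'⟩ := hS' i (u.right⁻¹.act l)
    refine ⟨A + A', fun k _ ε' ε x => ?_⟩
    simp only [Matrix.sum_apply, Finset.mul_sum]
    refine Finset.sum_congr rfl fun a ha => Finset.sum_congr rfl fun b hb => ?_
    split_ifs with hk
    · simp only [Matrix.mul_apply, Finset.mul_sum]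
      refine Finset.sum_congr rfl fun δ _ => ?_
      rw [hF i, hA a ha, hA' b hb, mul_mul_mul_comm, ← Complex.exp_add, ← twist_mul, hk,
        SemidirectProduct.mul_right, mul_inv_rev, HypOct.act_mul, ← hk]
      congr 2
      push_cast
      ring
    · rw [Matrix.zero_apply, mul_zero]

theorem isDifferenceOperator (h : IsTwistedOperator κ F u D) :
    IsDifferenceOperator (D * weylAct u⁻¹) := by
  obtain ⟨S, c, hc, hD', -⟩ := h
  have hD := hD'.untwist
  -- For κ = 0 different k give the same shift, so the coefficients are collected by the value of
  -- 2κk.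
  refine ⟨S.image fun k : ℤ => 2 * κ * (k : ℂ), fun a x => 
    ∑ k ∈ S.filter fun k : ℤ => 2 * κ * (k : ℂ) = a, c k x,
    fun a _ ε' ε => ?_, hD.congr fun f x => ?_⟩
  · simp only [Matrix.sum_apply]
    exact .sum _ fun k hk => hc k (Finset.mem_filter.1 hk).1 _ _
  · rw [← Finset.sum_fiberwise_of_maps_to (g := fun k : ℤ => 2 * κ * (k : ℂ))
      (fun k hk => Finset.mem_image_of_mem (fun k : ℤ => 2 * κ * (k : ℂ)) hk)]
    refine Finset.sum_congr rfl fun a _ => ?_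
    rw [Matrix.sum_mulVec]
    refine Finset.sum_congr rfl fun k hk => ?_
    rw [(Finset.mem_filter.1 hk).2]

end IsTwistedOperator

end PeriodData

/-! ### The four families of periods and their gauges. -/

section Families

variable {n : ℕ} (q : ℝ) (κ : ℂ)

/-- Shifts of the `z_i` by integers. -/
def spectralUnit (n : ℕ) : PeriodData n where
  per l := (fun i => l i, 0)
  -- At the right boundary l_i changes sign, so the difference of the gauge terms turns into the sum
  -- of weights in the multiplier of K.
  gauge l x ε := -(Real.log q * ∑ j, l j * (x.2 - κ * preWt j ε) * wt (ε j))
  slope := 0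

/-- Shifts of the `z_i` by integer multiples of `2πi / log q`. -/
def spectralImag (n : ℕ) : PeriodData n where
  per l := (fun i => l i * qper q, 0)
  gauge _ _ _ := 0
  slope := 0

/-- The shift of `ξ` by `1`. -/
def dynamicalUnit (n : ℕ) : PeriodData n where
  per _ := (0, 1)
  -- The constant grows by 2κ from leg to leg, as the multiplier of R demands, and vanishes on the
  -- last leg, since K contributes no constant. The value left over on the first leg is compensated
  -- by the slope.
  gauge _ x ε := Real.log q * ∑ j : Fin n, (2 * κ * ((j : ℂ) + 1 - n) - x.1 j) * wt (ε j)
  slope := Real.log q * (1 + 4 * κ * (n - 1))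

/-- The shift of `ξ` by `2πi / log q`. -/
def dynamicalImag (Pl Pr : BoundaryParams) (n : ℕ) : PeriodData n where
  per _ := (0, qper q)
  -- This matches the multiplier of the right K-matrix. At the left boundary the total weight
  -- changes in proportion to k, which is why that contribution goes into the slope.
  gauge _ _ ε := -(2 * Real.pi * Complex.I * (Pr.ζ + Pr.υ) * ∑ j, wt (ε j))
  slope := 4 * Real.pi * Complex.I * (Pl.ζ + Pl.υ + (Pr.ζ + Pr.υ))

theorem act_add_mul_intCast (u : AffWeyl n) (z : Fin n → ℂ) (l : Fin n → ℤ) (p : ℂ) :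
    u.act (z + fun i => (l i : ℂ) * p) = u.act z + fun i => ((u.right.act l i : ℤ) : ℂ) * p := by
  funext i
  simp only [AffWeyl.act, HypOct.act, Pi.add_apply]
  rcases Int.units_eq_one_or (u.right.left i) with h | h <;> rw [h] <;> simp <;> ring

theorem spectralUnit_isEquivariant : (spectralUnit q κ n).IsEquivariant κ := fun u k x l => by
  have := act_add_mul_intCast u⁻¹ x.1 l 1
  simp only [mul_one] at this
  refine Prod.ext this ?_
  simp [twist_apply, spectralUnit]

theorem spectralImag_isEquivariant : (spectralImag q n).IsEquivariant κ := fun u k x l => by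
  refine Prod.ext (act_add_mul_intCast u⁻¹ x.1 l (qper q)) ?_
  simp [twist_apply, spectralImag]

theorem dynamicalUnit_isEquivariant : (dynamicalUnit q κ n).IsEquivariant κ := fun u k x l => by
  refine Prod.ext ?_ ?_
  · simp [twist_apply, dynamicalUnit]
  · simp [twist_apply, dynamicalUnit]; ring

theorem dynamicalImag_isEquivariant (Pl Pr : BoundaryParams) :
    (dynamicalImag q Pl Pr n).IsEquivariant κ := fun u k x l => by
  refine Prod.ext ?_ ?_
  · simp [twist_apply, dynamicalImag]
  · simp [twist_apply, dynamicalImag]; ring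

/-- The periods of the boundary quantum KZB equations. -/
def kzbPeriods (Pl Pr : BoundaryParams) (n : ℕ) : Fin 4 → PeriodData n :=
  ![spectralUnit q κ n, spectralImag q n, dynamicalUnit q κ n, dynamicalImag q Pl Pr n]

theorem kzbPeriods_isEquivariant (Pl Pr : BoundaryParams) (i : Fin 4) :
    (kzbPeriods q κ Pl Pr n i).IsEquivariant κ := by
  fin_cases i
  exacts [spectralUnit_isEquivariant q κ, spectralImag_isEquivariant q κ,
    dynamicalUnit_isEquivariant q κ, dynamicalImag_isEquivariant q κ Pl Pr]

end Families

/-! ### Quasi-periodicity of the bulk generators. -/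

section GeneratorPeriods

variable {n : ℕ} {q : ℝ} {κ : ℂ}

theorem swap_right_inv_act (i j : Fin n) (l : Fin n → ℤ) :
    (AffWeyl.swap i j).right⁻¹.act l = l ∘ Equiv.swap i j := by
  rw [AffWeyl.swap, SemidirectProduct.right_inr, ← map_inv, Equiv.swap_inv]
  funext k
  change (1 : ℤˣ) • l ((Equiv.swap i j)⁻¹ k) = _
  simp

theorem flip_right_inv_act (i : Fin n) (l : Fin n → ℤ) :
    (AffWeyl.flip i).right⁻¹.act l = Function.update l i (-l i) := by
  rw [← SemidirectProduct.inv_right, inv_eq_of_mul_eq_one_left (flip_mul_self i)]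
  funext k
  change (Function.update (1 : Fin n → ℤˣ) i (-1) k) • l k = _
  by_cases h : k = i
  · subst h; simp
  · simp [h]

theorem affFlip_right_inv_act (i : Fin n) (l : Fin n → ℤ) :
    (AffWeyl.affFlip i).right⁻¹.act l = Function.update l i (-l i) := by
  rw [← flip_right_inv_act, AffWeyl.affFlip, SemidirectProduct.mul_right, AffWeyl.tau,
    SemidirectProduct.right_inl, one_mul]

theorem sum_eq_of_eq_off {f g : Fin n → ℂ} {i : Fin n} (h : ∀ k, k ≠ i → f k = g k) :
    ∑ k, f k = ∑ k, g k + (f i - g i) := by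
  rw [← Finset.add_sum_erase _ f (Finset.mem_univ i), ← Finset.add_sum_erase _ g (Finset.mem_univ i),
    Finset.sum_congr rfl fun k hk => h k (Finset.ne_of_mem_erase hk)]
  ring

theorem sum_eq_of_eq_off_pair {f g : Fin n → ℂ} {i j : Fin n} (hij : i ≠ j)
    (h : ∀ k, k ≠ i → k ≠ j → f k = g k) :
    ∑ k, f k = ∑ k, g k + (f i - g i) + (f j - g j) := by
  rw [sum_eq_of_eq_off (g := Function.update g i (f i)) (i := j) fun k hk => ?_,
    sum_eq_of_eq_off (f := Function.update g i (f i)) (g := g) (i := i) fun k hk => ?_]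
  · rw [Function.update_self, Function.update_of_ne hij.symm]
  · rw [Function.update_of_ne hk]
  · by_cases hi : k = i
    · subst hi; rw [Function.update_self]
    · rw [Function.update_of_ne hi, h k hi hk]

theorem bulkCoeff_apply (i j : Fin n) (k : ℤ) (x : Vars n) (ε' ε : Fin n → ℤˣ) :
    bulkCoeff q κ i j k x ε' ε = if ∀ l, l ≠ i → l ≠ j → ε' l = ε l then
      RBa q κ (x.1 i - x.1 j) (2 * x.2 - 2 * κ * preWt i ε) (ε' j, ε' i) (ε i, ε j) else 0 := by
  have : (∀ l, l ≠ i → l ≠ j → (ε' ∘ Equiv.swap i j) l = ε l) ↔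
      ∀ l, l ≠ i → l ≠ j → ε' l = ε l :=
    forall_congr' fun l => forall_congr' fun hi => forall_congr' fun hj => by
      rw [Function.comp_apply, Equiv.swap_apply_of_ne_of_ne hi hj]
  rw [bulkCoeff, permOp_mul_apply, leg₂, Matrix.of_apply, if_congr this rfl rfl]
  simp only [Function.comp_apply, Equiv.swap_apply_left, Equiv.swap_apply_right]

/-- Entries that change another leg or the total weight are zero, so only the remaining ones need a
multiplier. -/
theorem bulkCoeff_eq_exp_mul {i j : Fin n} {k : ℤ} {x y : Vars n} {ε' ε : Fin n → ℤˣ} {E : ℂ}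
    (h : (∀ l, l ≠ i → l ≠ j → ε' l = ε l) → wt (ε' i) + wt (ε' j) = wt (ε i) + wt (ε j) →
      RBa q κ (y.1 i - y.1 j) (2 * y.2 - 2 * κ * preWt i ε) (ε' j, ε' i) (ε i, ε j) =
        Complex.exp E *
          RBa q κ (x.1 i - x.1 j) (2 * x.2 - 2 * κ * preWt i ε) (ε' j, ε' i) (ε i, ε j)) :
    bulkCoeff q κ i j k y ε' ε = Complex.exp E * bulkCoeff q κ i j k x ε' ε := by
  rw [bulkCoeff_apply, bulkCoeff_apply]
  split_ifs with hoff
  · by_cases hs : wt (ε' i) + wt (ε' j) = wt (ε i) + wt (ε j)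
    · exact h hoff hs
    · have hz : ∀ z w, RBa q κ z w (ε' j, ε' i) (ε i, ε j) = 0 := fun z w => by
        rcases RBa_eq_zero_or (q := q) κ z w (ε' j, ε' i) (ε i, ε j) with h | h | h
        · exact h
        · simp only [Prod.mk.injEq] at h
          rw [h.1, h.2, add_comm] at hs
          exact absurd rfl hs
        · simp only [Prod.swap_prod_mk, Prod.mk.injEq] at h
          rw [h.1, h.2] at hs
          exact absurd rfl hs
      rw [hz, hz, mul_zero]
  · rw [mul_zero]

theorem preWt_eq_of_eq_off_pair {i j k : Fin n} (hij : (j : ℕ) = i + 1) {ε' ε : Fin n → ℤˣ}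
    (hoff : ∀ l, l ≠ i → l ≠ j → ε' l = ε l)
    (hs : wt (ε' i) + wt (ε' j) = wt (ε i) + wt (ε j)) (hk : k ≠ j) :
    preWt k ε' = preWt k ε := by
  have hne : i ≠ j := fun e => by rw [e] at hij; omega
  have e : ε' = upd₂ i j ε (ε' i) (ε' j) := by
    funext l
    by_cases h1 : l = i
    · subst h1; rw [upd₂_left _ _ _ hne]
    by_cases h2 : l = j
    · subst h2; rw [upd₂_right]
    rw [upd₂_of_ne _ _ _ h1 h2, hoff l h1 h2]
  rw [e]
  rcases lt_or_ge j k with h | h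
  · rw [preWt_upd₂_of_lt hne (Fin.lt_def.2 (by have := Fin.lt_def.1 h; omega)) h]
    linear_combination hs
  · have h' : k ≤ i := by
      have h1 := Fin.le_def.1 h
      have h2 : (k : ℕ) ≠ j := fun e => hk (Fin.ext e)
      exact Fin.le_def.2 (by omega)
    exact preWt_upd₂_of_le h' h _ _ _

theorem bulkCoeff_isQuasiPeriodic (hq0 : 0 < q) (hq1 : q < 1) (Pl Pr : BoundaryParams)
    {i j : Fin n} (hij : (j : ℕ) = i + 1) (s : Fin 4) :
    (kzbPeriods q κ Pl Pr n s).IsQuasiPeriodic κ (AffWeyl.swap i j) {0} (bulkCoeff q κ i j) := by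
  have hne : i ≠ j := fun e => by rw [e] at hij; omega
  intro l
  fin_cases s
  · refine ⟨-(Real.log q * κ * (l i - l j)), fun k hk ε' ε x => bulkCoeff_eq_exp_mul fun hoff hs => ?_⟩
    obtain rfl := Finset.mem_singleton.1 hk
    -- Signs have square one, so equal sums imply equal products.
    have hp : wt (ε' i) * wt (ε' j) = wt (ε i) * wt (ε j) := by
      linear_combination (wt (ε' i) + wt (ε' j) + wt (ε i) + wt (ε j)) / 2 * hs -
        wt_mul_self (ε' i) / 2 - wt_mul_self (ε' j) / 2 + wt_mul_self (ε i) / 2 +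
        wt_mul_self (ε j) / 2
    have hz : (x + ((spectralUnit q κ n).per l)).1 i - (x + ((spectralUnit q κ n).per l)).1 j =
        x.1 i - x.1 j + ((l i - l j : ℤ) : ℂ) := by
      simp [spectralUnit]; ring
    have hxi : (x + ((spectralUnit q κ n).per l)).2 = x.2 := by simp [spectralUnit]
    have hsum := sum_eq_of_eq_off_pair (f := fun k => (l k : ℂ) * (x.2 - κ * preWt k ε') * wt (ε' k))
      (g := fun k => ((l (Equiv.swap i j k) : ℤ) : ℂ) * (x.2 - κ * preWt k ε) * wt (ε k)) hne
      fun k hi hj => by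
        simp only [hoff k hi hj, Equiv.swap_apply_of_ne_of_ne hi hj,
          preWt_eq_of_eq_off_pair hij hoff hs hj]
    simp only [Equiv.swap_apply_left, Equiv.swap_apply_right,
      preWt_eq_of_eq_off_pair hij hoff hs hne, preWt_succ hij] at hsum
    change RBa q κ ((x + ((spectralUnit q κ n).per l)).1 i - (x + ((spectralUnit q κ n).per l)).1 j)
      (2 * (x + ((spectralUnit q κ n).per l)).2 - _) _ _ = Complex.exp (_ + _ *
        (spectralUnit q κ n).slope + (spectralUnit q κ n).gauge _ _ _ -
        (spectralUnit q κ n).gauge _ _ _) * _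
    rw [hz, hxi, RBa_add_int_spectral κ hq0 hq1, swap_right_inv_act]
    congr 2
    simp only [spectralUnit, Function.comp_apply, twist_apply, hsum, Int.cast_zero, mul_zero,
      add_zero]
    push_cast
    linear_combination (Real.log q : ℂ) * (-(l i : ℂ) * (x.2 - κ * preWt i ε) * hs +
      κ * (l i : ℂ) * hp)
  · refine ⟨0, fun k hk ε' ε x => bulkCoeff_eq_exp_mul fun hoff hs => ?_⟩
    have hz : (x + ((spectralImag q n).per l)).1 i - (x + ((spectralImag q n).per l)).1 j =
        x.1 i - x.1 j + ((l i - l j : ℤ) : ℂ) * qper q := by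
      simp [spectralImag]; ring
    have hxi : (x + ((spectralImag q n).per l)).2 = x.2 := by simp [spectralImag]
    change RBa q κ ((x + ((spectralImag q n).per l)).1 i - (x + ((spectralImag q n).per l)).1 j)
      (2 * (x + ((spectralImag q n).per l)).2 - _) _ _ = Complex.exp (_ + _ * 0 + 0 - 0) * _
    rw [hz, hxi, RBa_add_qper_spectral κ hq0 hq1]
    simp
  · refine ⟨0, fun k hk ε' ε x => bulkCoeff_eq_exp_mul fun hoff hs => ?_⟩
    obtain rfl := Finset.mem_singleton.1 hk
    have hz : (x + ((dynamicalUnit q κ n).per l)).1 = x.1 := by simp [dynamicalUnit]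
    have hxi : 2 * (x + ((dynamicalUnit q κ n).per l)).2 - 2 * κ * preWt i ε =
      2 * x.2 - 2 * κ * preWt i ε + 2 := by simp [dynamicalUnit]; ring
    have hsum := sum_eq_of_eq_off_pair
      (f := fun k : Fin n => (2 * κ * ((k : ℂ) + 1 - n) - x.1 k) * wt (ε' k))
      (g := fun k : Fin n => (2 * κ * ((k : ℂ) + 1 - n) - x.1 (Equiv.swap i j k)) * wt (ε k)) hne
      fun k hi hj => by simp only [hoff k hi hj, Equiv.swap_apply_of_ne_of_ne hi hj]
    simp only [Equiv.swap_apply_left, Equiv.swap_apply_right, hij] at hsum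
    change RBa q κ ((x + ((dynamicalUnit q κ n).per l)).1 i -
      (x + ((dynamicalUnit q κ n).per l)).1 j)
      (2 * (x + ((dynamicalUnit q κ n).per l)).2 - _) _ _ = Complex.exp (_ + _ *
        (dynamicalUnit q κ n).slope + (dynamicalUnit q κ n).gauge _ _ _ -
        (dynamicalUnit q κ n).gauge _ _ _) * _
    rw [hxi, hz, RBa_add_two_dyn κ hq0 hq1]
    congr 2
    simp only [dynamicalUnit, Function.comp_apply, twist_apply, swap_inv_act, hsum]
    push_cast
    linear_combination (Real.log q : ℂ) * (2 * κ * ((i : ℂ) + 1 - n) + κ - x.1 i) * hs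
  · refine ⟨0, fun k hk ε' ε x => bulkCoeff_eq_exp_mul fun hoff hs => ?_⟩
    obtain rfl := Finset.mem_singleton.1 hk
    have hz : (x + ((dynamicalImag q Pl Pr n).per l)).1 = x.1 := by simp [dynamicalImag]
    have hxi : 2 * (x + ((dynamicalImag q Pl Pr n).per l)).2 - 2 * κ * preWt i ε =
      2 * x.2 - 2 * κ * preWt i ε + ((2 : ℤ) : ℂ) * qper q := by simp [dynamicalImag]; ring
    have hsum := sum_eq_of_eq_off_pair (f := fun k : Fin n => wt (ε' k))
      (g := fun k : Fin n => wt (ε k)) hne fun k hi hj => by rw [hoff k hi hj]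
    change RBa q κ ((x + ((dynamicalImag q Pl Pr n).per l)).1 i -
      (x + ((dynamicalImag q Pl Pr n).per l)).1 j)
      (2 * (x + ((dynamicalImag q Pl Pr n).per l)).2 - _) _ _ = Complex.exp (_ + _ *
        (dynamicalImag q Pl Pr n).slope + (dynamicalImag q Pl Pr n).gauge _ _ _ -
        (dynamicalImag q Pl Pr n).gauge _ _ _) * _
    rw [hxi, hz, RBa_add_qper_dyn κ hq0 hq1]
    refine (one_mul _).symm.trans ?_
    rw [← Complex.exp_zero]
    congr 2
    simp only [dynamicalImag, hsum]
    push_cast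
    linear_combination -(2 * Real.pi * Complex.I * (Pr.ζ + Pr.υ)) * hs

end GeneratorPeriods

/-! ### Quasi-periodicity of the boundary generators. -/

section BoundaryPeriods

variable {n : ℕ} {q : ℝ} {κ : ℂ}

theorem rightCoeff_eq_exp_mul {P : BoundaryParams} {i : Fin n} {k : ℤ} {x y : Vars n}
    {ε' ε : Fin n → ℤˣ} {E : ℂ}
    (h : (∀ l, l ≠ i → ε' l = ε l) →
      KBa q P (y.1 i) (y.2 - κ * preWt i ε) (ε' i) (ε i) =
        Complex.exp E * KBa q P (x.1 i) (x.2 - κ * preWt i ε) (ε' i) (ε i)) :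
    rightCoeff q κ P i k y ε' ε = Complex.exp E * rightCoeff q κ P i k x ε' ε := by
  simp only [rightCoeff, leg₁, Matrix.of_apply]
  split_ifs with hoff
  · exact h hoff
  · rw [mul_zero]

theorem leftCoeff_eq_exp_mul {P : BoundaryParams} {i : Fin n} {k : ℤ} {x y : Vars n}
    {ε' ε : Fin n → ℤˣ} {E : ℂ}
    (h : (∀ l, l ≠ i → ε' l = ε l) → wt (ε i) - wt (ε' i) = 2 * k →
      KBa q P (1 / 2 - y.1 i) (-(y.2 - κ * wt (ε' i))) (ε' i) (ε i) =
        Complex.exp E * KBa q P (1 / 2 - x.1 i) (-(x.2 - κ * wt (ε' i))) (ε' i) (ε i)) :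
    leftCoeff q κ P i k y ε' ε = Complex.exp E * leftCoeff q κ P i k x ε' ε := by
  simp only [leftCoeff, leg₁, Matrix.of_apply, KBaLeft]
  split_ifs with hk hoff
  · exact h hoff (by rw [wt, wt]; exact_mod_cast hk)
  · rw [mul_zero]
  · rw [mul_zero]

theorem preWt_eq_of_eq_off_of_le {i k : Fin n} {ε' ε : Fin n → ℤˣ}
    (hoff : ∀ l, l ≠ i → ε' l = ε l) (hk : k ≤ i) : preWt k ε' = preWt k ε := by
  have e : ε' = Function.update ε i (ε' i) := by
    rw [Function.eq_update_iff]; exact ⟨rfl, fun l hl => hoff l hl⟩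
  rw [e, preWt_update_of_le hk]

theorem preWt_eq_of_eq_off_of_lt {i k : Fin n} {ε' ε : Fin n → ℤˣ}
    (hoff : ∀ l, l ≠ i → ε' l = ε l) (hk : i < k) :
    preWt k ε' = preWt k ε - wt (ε i) + wt (ε' i) := by
  have e : ε' = Function.update ε i (ε' i) := by
    rw [Function.eq_update_iff]; exact ⟨rfl, fun l hl => hoff l hl⟩
  conv_lhs => rw [e]
  rw [preWt_update_of_lt hk]

theorem rightCoeff_isQuasiPeriodic (hq0 : 0 < q) (hq1 : q < 1) (Pl Pr : BoundaryParams)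
    {i : Fin n} (hi : (i : ℕ) + 1 = n) (s : Fin 4) :
    (kzbPeriods q κ Pl Pr n s).IsQuasiPeriodic κ (AffWeyl.flip i) {0} (rightCoeff q κ Pr i) := by
  have hle : ∀ k : Fin n, k ≤ i := fun k => Fin.le_def.2 (by omega)
  intro l
  fin_cases s
  · refine ⟨0, fun k hk ε' ε x => rightCoeff_eq_exp_mul fun hoff => ?_⟩
    obtain rfl := Finset.mem_singleton.1 hk
    have hz : (x + ((spectralUnit q κ n).per l)).1 i = x.1 i + (l i : ℂ) := by simp [spectralUnit]
    have hxi : (x + ((spectralUnit q κ n).per l)).2 = x.2 := by simp [spectralUnit]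
    have hsum := sum_eq_of_eq_off (f := fun k => (l k : ℂ) * (x.2 - κ * preWt k ε') * wt (ε' k))
      (g := fun k => ((Function.update l i (-l i) k : ℤ) : ℂ) * (x.2 - κ * preWt k ε) * wt (ε k))
      (i := i) fun k hk => by
        simp only [hoff k hk, Function.update_of_ne hk, preWt_eq_of_eq_off_of_le hoff (hle k)]
    simp only [Function.update_self, preWt_eq_of_eq_off_of_le hoff (hle i)] at hsum
    change KBa q Pr ((x + ((spectralUnit q κ n).per l)).1 i)
      ((x + ((spectralUnit q κ n).per l)).2 - _) _ _ = Complex.exp (_ + _ *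
        (spectralUnit q κ n).slope + (spectralUnit q κ n).gauge _ _ _ -
        (spectralUnit q κ n).gauge _ _ _) * _
    rw [hz, hxi, KBa_add_int_spectral Pr hq0 hq1, flip_right_inv_act]
    congr 2
    simp only [spectralUnit, twist_apply, hsum, Int.cast_zero, mul_zero, add_zero]
    push_cast
    ring
  · refine ⟨l i * (4 * Real.pi * Complex.I * (Pr.ζ + Pr.ζ')), fun k hk ε' ε x =>
      rightCoeff_eq_exp_mul fun hoff => ?_⟩
    have hz : (x + ((spectralImag q n).per l)).1 i = x.1 i + (l i : ℂ) * qper q := by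
      simp [spectralImag]
    have hxi : (x + ((spectralImag q n).per l)).2 = x.2 := by simp [spectralImag]
    change KBa q Pr ((x + ((spectralImag q n).per l)).1 i)
      ((x + ((spectralImag q n).per l)).2 - _) _ _ = Complex.exp (_ + _ * 0 + 0 - 0) * _
    rw [hz, hxi, KBa_add_qper_spectral Pr hq0 hq1]
    simp
  · refine ⟨0, fun k hk ε' ε x => rightCoeff_eq_exp_mul fun hoff => ?_⟩
    obtain rfl := Finset.mem_singleton.1 hk
    have hz : (x + ((dynamicalUnit q κ n).per l)).1 = x.1 := by simp [dynamicalUnit]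
    have hxi : (x + ((dynamicalUnit q κ n).per l)).2 - κ * preWt i ε =
      x.2 - κ * preWt i ε + ((1 : ℤ) : ℂ) := by simp [dynamicalUnit]; ring
    have hsum := sum_eq_of_eq_off
      (f := fun k : Fin n => (2 * κ * ((k : ℂ) + 1 - n) - x.1 k) * wt (ε' k))
      (g := fun k : Fin n => (2 * κ * ((k : ℂ) + 1 - n) -
        Function.update x.1 i (-x.1 i) k) * wt (ε k))
      (i := i) fun k hk => by simp only [hoff k hk, Function.update_of_ne hk]
    simp only [Function.update_self] at hsum
    have hn : (i : ℂ) + 1 - n = 0 := sub_eq_zero.2 (by exact_mod_cast hi)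
    change KBa q Pr ((x + ((dynamicalUnit q κ n).per l)).1 i)
      ((x + ((dynamicalUnit q κ n).per l)).2 - _) _ _ = Complex.exp (_ + _ *
        (dynamicalUnit q κ n).slope + (dynamicalUnit q κ n).gauge _ _ _ -
        (dynamicalUnit q κ n).gauge _ _ _) * _
    rw [hxi, hz, KBa_add_int_dyn Pr hq0 hq1]
    congr 2
    simp only [dynamicalUnit, twist_apply, flip_inv_act, hsum, hn]
    push_cast
    ring
  · refine ⟨0, fun k hk ε' ε x => rightCoeff_eq_exp_mul fun hoff => ?_⟩
    obtain rfl := Finset.mem_singleton.1 hk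
    have hz : (x + ((dynamicalImag q Pl Pr n).per l)).1 = x.1 := by simp [dynamicalImag]
    have hxi : (x + ((dynamicalImag q Pl Pr n).per l)).2 - κ * preWt i ε =
      x.2 - κ * preWt i ε + ((1 : ℤ) : ℂ) * qper q := by simp [dynamicalImag]; ring
    have hsum := sum_eq_of_eq_off (f := fun k : Fin n => wt (ε' k))
      (g := fun k : Fin n => wt (ε k)) (i := i) fun k hk => by rw [hoff k hk]
    change KBa q Pr ((x + ((dynamicalImag q Pl Pr n).per l)).1 i)
      ((x + ((dynamicalImag q Pl Pr n).per l)).2 - _) _ _ = Complex.exp (_ + _ *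
        (dynamicalImag q Pl Pr n).slope + (dynamicalImag q Pl Pr n).gauge _ _ _ -
        (dynamicalImag q Pl Pr n).gauge _ _ _) * _
    rw [hxi, hz, KBa_add_qper_dyn Pr hq0 hq1]
    congr 2
    simp only [dynamicalImag, hsum]
    push_cast
    ring

theorem leftCoeff_isQuasiPeriodic (hq0 : 0 < q) (hq1 : q < 1) (Pl Pr : BoundaryParams)
    {i : Fin n} (hi : (i : ℕ) = 0) (s : Fin 4) :
    (kzbPeriods q κ Pl Pr n s).IsQuasiPeriodic κ (AffWeyl.affFlip i) {-1, 0, 1}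
      (leftCoeff q κ Pl i) := by
  have hlt : ∀ k : Fin n, k ≠ i → i < k := fun k hk => Fin.lt_def.2 (by
    have : (k : ℕ) ≠ i := fun e => hk (Fin.ext e)
    omega)
  intro l
  fin_cases s
  · refine ⟨-(2 * Real.log q * κ * l i), fun k _ ε' ε x => leftCoeff_eq_exp_mul fun hoff hk => ?_⟩
    have hz : 1 / 2 - (x + ((spectralUnit q κ n).per l)).1 i =
      1 / 2 - x.1 i + ((-l i : ℤ) : ℂ) := by simp [spectralUnit]; ring
    have hxi : (x + ((spectralUnit q κ n).per l)).2 = x.2 := by simp [spectralUnit]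
    -- Away from leg i the change of the partial weights is cancelled by the shift of ξ by 2κk, as
    -- ε_i - ε'_i = 2k.
    have hsum := sum_eq_of_eq_off (f := fun k => (l k : ℂ) * (x.2 - κ * preWt k ε') * wt (ε' k))
      (g := fun a => ((Function.update l i (-l i) a : ℤ) : ℂ) *
        (x.2 + 2 * κ * k - κ * preWt a ε) * wt (ε a))
      (i := i) fun a ha => by
        simp only [hoff a ha, Function.update_of_ne ha, preWt_eq_of_eq_off_of_lt hoff (hlt a ha)]
        linear_combination (l a : ℂ) * κ * wt (ε a) * hk
    simp only [Function.update_self, preWt_zero hi] at hsum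
    change KBa q Pl (1 / 2 - (x + ((spectralUnit q κ n).per l)).1 i)
      (-((x + ((spectralUnit q κ n).per l)).2 - _)) _ _ = Complex.exp (_ + _ *
        (spectralUnit q κ n).slope + (spectralUnit q κ n).gauge _ _ _ -
        (spectralUnit q κ n).gauge _ _ _) * _
    rw [hz, hxi, KBa_add_int_spectral Pl hq0 hq1, affFlip_right_inv_act]
    congr 2
    simp only [spectralUnit, twist_apply, hsum]
    push_cast
    linear_combination (Real.log q * l i * κ : ℂ) * (wt (ε i) * hk - wt_mul_self (ε i) -
      wt_mul_self (ε' i))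
  · refine ⟨-l i * (4 * Real.pi * Complex.I * (Pl.ζ + Pl.ζ')), fun k _ ε' ε x =>
      leftCoeff_eq_exp_mul fun hoff hk => ?_⟩
    have hz : 1 / 2 - (x + ((spectralImag q n).per l)).1 i =
      1 / 2 - x.1 i + ((-l i : ℤ) : ℂ) * qper q := by simp [spectralImag]; ring
    have hxi : (x + ((spectralImag q n).per l)).2 = x.2 := by simp [spectralImag]
    change KBa q Pl (1 / 2 - (x + ((spectralImag q n).per l)).1 i)
      (-((x + ((spectralImag q n).per l)).2 - _)) _ _ = Complex.exp (_ + _ * 0 + 0 - 0) * _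
    rw [hz, hxi, KBa_add_qper_spectral Pl hq0 hq1]
    simp
  · refine ⟨0, fun k _ ε' ε x => leftCoeff_eq_exp_mul fun hoff hk => ?_⟩
    have hz : (x + ((dynamicalUnit q κ n).per l)).1 = x.1 := by simp [dynamicalUnit]
    have hxi : -((x + ((dynamicalUnit q κ n).per l)).2 - κ * wt (ε' i)) =
      -(x.2 - κ * wt (ε' i)) + ((-1 : ℤ) : ℂ) := by simp [dynamicalUnit]; ring
    have hsum := sum_eq_of_eq_off
      (f := fun k : Fin n => (2 * κ * ((k : ℂ) + 1 - n) - x.1 k) * wt (ε' k))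
      (g := fun k : Fin n => (2 * κ * ((k : ℂ) + 1 - n) -
        Function.update x.1 i (1 - x.1 i) k) * wt (ε k))
      (i := i) fun k hk => by simp only [hoff k hk, Function.update_of_ne hk]
    simp only [Function.update_self, hi, Nat.cast_zero] at hsum
    change KBa q Pl (1 / 2 - (x + ((dynamicalUnit q κ n).per l)).1 i)
      (-((x + ((dynamicalUnit q κ n).per l)).2 - _)) _ _ = Complex.exp (_ + _ *
        (dynamicalUnit q κ n).slope + (dynamicalUnit q κ n).gauge _ _ _ -
        (dynamicalUnit q κ n).gauge _ _ _) * _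
    rw [hxi, hz, KBa_add_int_dyn Pl hq0 hq1]
    congr 2
    simp only [dynamicalUnit, twist_apply, affFlip_inv_act, hsum]
    push_cast
    linear_combination (Real.log q * (1 / 2 + 2 * κ * (n - 1)) : ℂ) * hk
  · refine ⟨0, fun k _ ε' ε x => leftCoeff_eq_exp_mul fun hoff hk => ?_⟩
    have hz : (x + ((dynamicalImag q Pl Pr n).per l)).1 = x.1 := by simp [dynamicalImag]
    have hxi : -((x + ((dynamicalImag q Pl Pr n).per l)).2 - κ * wt (ε' i)) =
      -(x.2 - κ * wt (ε' i)) + ((-1 : ℤ) : ℂ) * qper q := by simp [dynamicalImag]; ring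
    have hsum := sum_eq_of_eq_off (f := fun k : Fin n => wt (ε' k))
      (g := fun k : Fin n => wt (ε k)) (i := i) fun k hk => by rw [hoff k hk]
    change KBa q Pl (1 / 2 - (x + ((dynamicalImag q Pl Pr n).per l)).1 i)
      (-((x + ((dynamicalImag q Pl Pr n).per l)).2 - _)) _ _ = Complex.exp (_ + _ *
        (dynamicalImag q Pl Pr n).slope + (dynamicalImag q Pl Pr n).gauge _ _ _ -
        (dynamicalImag q Pl Pr n).gauge _ _ _) * _
    rw [hxi, hz, KBa_add_qper_dyn Pl hq0 hq1]
    congr 2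
    simp only [dynamicalImag, hsum]
    push_cast
    linear_combination (2 * Real.pi * Complex.I * (Pl.ζ + Pl.υ + (Pr.ζ + Pr.υ))) * hk

end BoundaryPeriods

/-! ### Ellipticity of the coefficients of translations. -/

section Ellipticity

variable {n : ℕ} {q : ℝ} {κ : ℂ}

theorem isEllipticAlong_of_exp_linear {E : Type*} [NormedAddCommGroup E] [NormedSpace ℂ E] {e : E}
    {f : E → ℂ} (h : ∀ p : ℂ, p = 1 ∨ p = qper q → ∃ (A : ℂ) (φ : E →ₗ[ℂ] ℂ), φ e = 0 ∧
      ∀ x, f (x + p • e) = Complex.exp (A + φ x) * f x) : IsEllipticAlong q e f := by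
  intro p hp
  obtain ⟨A, φ, h0, hf⟩ := h p hp
  refine ⟨AffineMap.const ℂ E A + φ.toAffineMap, by simp [h0], .of_forall fun x => ?_⟩
  rw [hf]
  simp

theorem tau_right_inv_act (l m : Fin n → ℤ) : (AffWeyl.tau l).right⁻¹.act m = m := by
  rw [AffWeyl.tau, SemidirectProduct.right_inl, inv_one, HypOct.act_one]

theorem tau_inv_act (l : Fin n → ℤ) (z : Fin n → ℂ) (j : Fin n) :
    (AffWeyl.tau l)⁻¹.act z j = z j - l j := by
  rw [AffWeyl.tau, ← map_inv]
  change (1 : ℤˣ) • z j + ((-l j : ℤ) : ℂ) = _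
  simp [sub_eq_add_neg]

/-- A translation fixes the index l of the period, so the multiplier is a difference of values of
one gauge function. For a unit shift of z_j it depends on ξ only, for the unit shift of ξ on z only,
and for the imaginary periods it is constant; it is affine in each case and free of the shifted
variable. -/
theorem isElliptic_of_isQuasiPeriodic {Pl Pr : BoundaryParams} {l : Fin n → ℤ} {S : Finset ℤ}
    {c : ℤ → Vars n → SpinOp n}
    (h : ∀ i, (kzbPeriods q κ Pl Pr n i).IsQuasiPeriodic κ (AffWeyl.tau l) S c) {k : ℤ} (hk : k ∈ S)
    {ε' ε : Fin n → ℤˣ} (hc : IsMeromorphic fun x => c k x ε' ε) :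
    IsElliptic q fun x => c k x ε' ε := by
  refine ⟨hc, fun j => isEllipticAlong_of_exp_linear ?_, isEllipticAlong_of_exp_linear ?_⟩
  · rintro p (rfl | rfl)
    · obtain ⟨A, hA⟩ := h 0 (Pi.single j 1)
      have hper : ∀ x : Vars n, x + (1 : ℂ) • ((Pi.single j 1, 0) : Vars n) =
          x + (spectralUnit q κ n).per (Pi.single j 1) := fun x => by
        refine Prod.ext (funext fun i => ?_) (by simp [spectralUnit])
        by_cases hi : i = j
        · subst hi; simp [spectralUnit]
        · simp [spectralUnit, hi]
      set v : Fin n → ℤ := Pi.single j 1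
      have hsum : ∀ (s t : ℂ) (δ : Fin n → ℤˣ), ∑ a, v a * (s + t - κ * preWt a δ) * wt (δ a) =
          s * ∑ a, v a * wt (δ a) + ∑ a, v a * (t - κ * preWt a δ) * wt (δ a) := fun s t δ => by
        rw [Finset.mul_sum, ← Finset.sum_add_distrib]
        exact Finset.sum_congr rfl fun a _ => by ring
      refine ⟨A - Real.log q * ∑ a, v a * (2 * κ * k - κ * preWt a ε) * wt (ε a) +
        Real.log q * ∑ a, v a * (0 - κ * preWt a ε') * wt (ε' a),
        (Real.log q * (∑ a, v a * wt (ε' a) - ∑ a, v a * wt (ε a)) : ℂ) • LinearMap.snd ℂ _ _,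
        by simp, fun x => ?_⟩
      rw [hper]
      refine (hA k hk ε' ε x).trans ?_
      rw [tau_right_inv_act]
      congr 2
      have h1 := hsum x.2 (2 * κ * k) ε
      have h2 := hsum x.2 0 ε'
      rw [add_zero] at h2
      change A + k * 0 + -(Real.log q * ∑ a, v a * (x.2 + 2 * κ * k - κ * preWt a ε) * wt (ε a)) -
        -(Real.log q * ∑ a, v a * (x.2 - κ * preWt a ε') * wt (ε' a)) = _ + _ * x.2
      rw [h1, h2]
      ring
    · obtain ⟨A, hA⟩ := h 1 (Pi.single j 1)
      have hper : ∀ x : Vars n, x + qper q • ((Pi.single j 1, 0) : Vars n) =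
          x + (spectralImag q n).per (Pi.single j 1) := fun x => by
        refine Prod.ext (funext fun i => ?_) (by simp [spectralImag])
        by_cases hi : i = j
        · subst hi; simp [spectralImag]
        · simp [spectralImag, hi]
      refine ⟨A, 0, rfl, fun x => ?_⟩
      rw [hper]
      refine (hA k hk ε' ε x).trans ?_
      congr 2
      change A + k * 0 + 0 - 0 = A + 0
      ring
  · rintro p (rfl | rfl)
    · obtain ⟨A, hA⟩ := h 2 0
      have hper : ∀ x : Vars n, x + (1 : ℂ) • ((0, 1) : Vars n) =
          x + (dynamicalUnit q κ n).per 0 := fun x => by simp [dynamicalUnit]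
      have hsum : ∀ (s : Fin n → ℂ) (t : Fin n → ℂ) (δ : Fin n → ℤˣ),
          ∑ a : Fin n, (2 * κ * ((a : ℂ) + 1 - n) - (s a - t a)) * wt (δ a) =
          ∑ a : Fin n, (2 * κ * ((a : ℂ) + 1 - n) + t a) * wt (δ a) - ∑ a, wt (δ a) * s a :=
        fun s t δ => by
          rw [← Finset.sum_sub_distrib]
          exact Finset.sum_congr rfl fun a _ => by ring
      refine ⟨A + k * (Real.log q * (1 + 4 * κ * (n - 1))) +
        Real.log q * ∑ a : Fin n, (2 * κ * ((a : ℂ) + 1 - n) + l a) * wt (ε a) -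
        Real.log q * ∑ a : Fin n, (2 * κ * ((a : ℂ) + 1 - n) + 0) * wt (ε' a),
        (Real.log q : ℂ) • ((∑ a, wt (ε' a) • LinearMap.proj a - ∑ a, wt (ε a) • LinearMap.proj a :
          (Fin n → ℂ) →ₗ[ℂ] ℂ) ∘ₗ LinearMap.fst ℂ _ _),
        by simp, fun x => ?_⟩
      rw [hper]
      refine (hA k hk ε' ε x).trans ?_
      congr 2
      have h1 := hsum x.1 (fun a => l a) ε
      have h2 := hsum x.1 0 ε'
      simp only [Pi.zero_apply, sub_zero] at h2
      simp only [kzbPeriods, Matrix.cons_val, dynamicalUnit, twist_apply, tau_inv_act, h1, h2,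
        LinearMap.smul_apply, LinearMap.comp_apply, LinearMap.sub_apply, LinearMap.sum_apply,
        LinearMap.proj_apply, LinearMap.fst_apply, smul_eq_mul]
      ring
    · obtain ⟨A, hA⟩ := h 3 0
      have hper : ∀ x : Vars n, x + qper q • ((0, 1) : Vars n) =
          x + (dynamicalImag q Pl Pr n).per 0 := fun x => by simp [dynamicalImag]
      refine ⟨A + k * (dynamicalImag q Pl Pr n).slope + (dynamicalImag q Pl Pr n).gauge 0 0 ε -
        (dynamicalImag q Pl Pr n).gauge 0 0 ε', 0, rfl, fun x => ?_⟩
      rw [hper]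
      refine (hA k hk ε' ε x).trans ?_
      rw [LinearMap.zero_apply, add_zero]
      rfl

end Ellipticity

/-! ### Cocycles and representations. -/

section Cocycle

variable {n : ℕ}

/-- A representation of the affine Weyl group twisted by its action on the spectral parameters. -/
def cocycleOf (ρ : AffWeyl n →* Module.End ℂ (MeroSpin n)) (v : AffWeyl n) :
    Module.End ℂ (MeroSpin n) := ρ v * weylAct v⁻¹

variable (ρ : AffWeyl n →* Module.End ℂ (MeroSpin n))

theorem cocycleOf_mul_weylAct (v : AffWeyl n) : cocycleOf ρ v * weylAct v = ρ v := by
  rw [cocycleOf, mul_assoc, weylAct_inv_mul, mul_one]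

theorem cocycleOf_mul (u v : AffWeyl n) :
    cocycleOf ρ (u * v) = cocycleOf ρ u * substOp u (cocycleOf ρ v) := by
  rw [substOp, ← mul_assoc, ← mul_assoc, cocycleOf_mul_weylAct, cocycleOf, cocycleOf, map_mul,
    mul_inv_rev, weylAct_mul, mul_assoc, mul_assoc, mul_assoc]

theorem tau_add (l m : Fin n → ℤ) : AffWeyl.tau (l + m) = AffWeyl.tau l * AffWeyl.tau m := by
  rw [AffWeyl.tau, ofAdd_add, map_mul]; rfl

theorem kzbOp_cocycleOf (l : Fin n → ℤ) : kzbOp (cocycleOf ρ) l = ρ (AffWeyl.tau l) :=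
  cocycleOf_mul_weylAct ρ _

theorem isCompatibleSystem_cocycleOf : IsCompatibleSystem (cocycleOf ρ) where
  comm l m := by
    rw [← cocycleOf_mul, ← cocycleOf_mul, ← tau_add, ← tau_add, add_comm]
  kzbOp_zero := by
    rw [kzbOp_cocycleOf, AffWeyl.tau, ofAdd_zero, map_one, map_one]
  kzbOp_add l m := by
    simp only [kzbOp_cocycleOf, tau_add, map_mul]

/-- The representation attached to a cocycle. -/
def representationOf {M : AffWeyl n → Module.End ℂ (MeroSpin n)} (hM : IsCocycle M) :
    AffWeyl n →* Module.End ℂ (MeroSpin n) where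
  toFun v := M v * weylAct v
  map_one' := by rw [hM.map_one, weylAct_one, one_mul]
  map_mul' u v := by
    rw [hM.map_mul, substOp, weylAct_mul]
    simp only [mul_assoc]
    rw [← mul_assoc (weylAct u⁻¹), weylAct_inv_mul, one_mul]

/-- Passing to v ↦ M^v · v turns cocycles into homomorphisms, which are determined on a generating
set. -/
theorem eq_cocycleOf {M : AffWeyl n → Module.End ℂ (MeroSpin n)} (hM : IsCocycle M)
    {s : Set (AffWeyl n)} (hs : Submonoid.closure s = ⊤) (h : ∀ v ∈ s, M v = cocycleOf ρ v) :
    M = cocycleOf ρ := by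
  have : representationOf hM = ρ := MonoidHom.eq_of_eqOn_denseM hs fun v hv => by
    change M v * weylAct v = ρ v
    rw [h v hv, cocycleOf_mul_weylAct]
  funext v
  rw [cocycleOf, ← this]
  change M v = M v * weylAct v * weylAct v⁻¹
  rw [mul_assoc, weylAct_mul_inv, mul_one]

end Cocycle

/-! ### Assembly of the theorem. -/

section Main

variable {m : ℕ} {q : ℝ} {κ : ℂ} {Pl Pr : BoundaryParams}
  {ρ : AffWeyl (m + 1) →* Module.End ℂ (MeroSpin (m + 1))}

theorem inr_adjSwap {i : ℕ} (hi : i < m) :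
    (SemidirectProduct.inr (SemidirectProduct.inr (adjSwap m i)) : AffWeyl (m + 1)) =
      AffWeyl.swap ⟨i, by omega⟩ ⟨i + 1, by omega⟩ := by
  rw [adjSwap_of_lt hi, AffWeyl.swap]

/-- The property holds for the simple reflections and is stable under products. -/
theorem isTwistedOperator_representation (hq0 : 0 < q) (hq1 : q < 1)
    (hb : ∀ i j : Fin (m + 1), (j : ℕ) = i + 1 →
      ActsAs (ρ (AffWeyl.swap i j)) (bulkOp q κ i j))
    (hr : ActsAs (ρ (AffWeyl.flip (Fin.last m))) (rightOp q κ Pr (Fin.last m)))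
    (hl : ActsAs (ρ (AffWeyl.affFlip 0)) (leftOp q κ Pl 0)) (w : AffWeyl (m + 1)) :
    IsTwistedOperator κ (kzbPeriods q κ Pl Pr (m + 1)) w (ρ w) := by
  have hw : w ∈ Submonoid.closure {w : AffWeyl (m + 1) | IsSimpleReflection w} := by
    rw [closure_isSimpleReflection]; trivial
  induction hw using Submonoid.closure_induction with
  | mem x hx =>
    rcases hx with ⟨i, hi⟩ | _ | _
    · rw [inr_adjSwap hi]
      have hlt : (⟨i, by omega⟩ : Fin (m + 1)) < ⟨i + 1, by omega⟩ :=
        Fin.lt_def.2 (Nat.lt_succ_self i)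
      exact ⟨{0}, _, fun k _ => isMeromorphic_bulkCoeff hq0 hq1 hlt.ne k,
        (hb _ _ rfl).congr fun f x => (twistOp_bulk hlt f x).symm,
        bulkCoeff_isQuasiPeriodic hq0 hq1 Pl Pr rfl⟩
    · exact ⟨{0}, _, fun k _ => isMeromorphic_rightCoeff hq0 hq1 Pr _ k,
        hr.congr fun f x => (twistOp_right Pr _ f x).symm,
        rightCoeff_isQuasiPeriodic hq0 hq1 Pl Pr (by simp)⟩
    · exact ⟨{-1, 0, 1}, _, fun k _ => isMeromorphic_leftCoeff hq0 hq1 Pl _ k,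
        hl.congr fun f x => (twistOp_left Pl _ f x).symm,
        leftCoeff_isQuasiPeriodic hq0 hq1 Pl Pr rfl⟩
  | one => rw [map_one]; exact .one
  | mul x y _ _ hx hy => rw [map_mul]; exact .mul (kzbPeriods_isEquivariant q κ Pl Pr) hx hy

theorem hasGeneratorValues_cocycleOf
    (hb : ∀ i j : Fin (m + 1), (j : ℕ) = i + 1 →
      ActsAs (ρ (AffWeyl.swap i j)) (bulkOp q κ i j))
    (hr : ActsAs (ρ (AffWeyl.flip (Fin.last m))) (rightOp q κ Pr (Fin.last m)))
    (hl : ActsAs (ρ (AffWeyl.affFlip 0)) (leftOp q κ Pl 0)) :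
    HasGeneratorValues κ (RBa q κ) (KBaLeft q Pl) (KBa q Pr) (cocycleOf ρ) where
  left_boundary i hi := by
    obtain rfl : i = 0 := Fin.ext hi
    refine ((hl.congr fun f x => (twistOp_left Pl _ f x).symm).untwist).congr fun f x => ?_
    funext ε
    rw [Finset.sum_apply, leftCoeff_mulVec_sum Pl 0 x (fun s => f (x.1, x.2 + s))]
    refine Eq.trans ?_ (leg₁_KBa_mulVec (q := q) Pl 0 (1 / 2 - x.1 0)
      (fun _ => -(x.2 + -κ * wt (ε 0))) (fun _ _ => rfl) _ ε).symm
    simp only [weightShift, Function.update_self, neg_mul, ← sub_eq_add_neg]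
    congr 1
    funext a
    congr 2
    ring
  bulk i j hij := by
    have hlt : i < j := Fin.lt_def.2 (by omega)
    refine (((hb i j hij).congr fun f x => (twistOp_bulk hlt f x).symm).untwist).congr fun f x => ?_
    simp only [Finset.sum_singleton, Int.cast_zero, mul_zero, add_zero]
    rfl
  right_boundary i hi := by
    obtain rfl : i = Fin.last m := Fin.ext (by simpa using hi)
    refine ((hr.congr fun f x => (twistOp_right Pr _ f x).symm).untwist).congr fun f x => ?_
    simp only [Finset.sum_singleton, Int.cast_zero, mul_zero, add_zero]
    rfl

theorem eq_cocycleOf_of_hasGeneratorValues {R : RFamily} {Kl Kr : KFamily}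
    {M : AffWeyl (m + 1) → Module.End ℂ (MeroSpin (m + 1))} (hM : IsCocycle M)
    (h : HasGeneratorValues κ R Kl Kr M) (hρ : HasGeneratorValues κ R Kl Kr (cocycleOf ρ)) :
    M = cocycleOf ρ := by
  refine eq_cocycleOf ρ hM closure_isSimpleReflection ?_
  rintro v (⟨i, hi⟩ | _ | _)
  · rw [inr_adjSwap hi]
    exact (h.bulk _ _ rfl).unique (hρ.bulk _ _ rfl) fun f => .of_forall fun x => rfl
  · exact (h.right_boundary _ (by simp)).unique (hρ.right_boundary _ (by simp)) fun f =>
      .of_forall fun x => rfl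
  · exact (h.left_boundary _ rfl).unique (hρ.left_boundary _ rfl) fun f => .of_forall fun x => rfl

end Main

theorem corollary2p20 (n : ℕ) (hn : 2 ≤ n) (q : ℝ) (hq0 : 0 < q) (hq1 : q < 1) (κ : ℂ)
    (Pl Pr : BoundaryParams) :
    (IsDynamicalR κ (RBa q κ) ∧ IsUnitaryR (RBa q κ) ∧ IceRule (RBa q κ)) ∧
    (IsLeftDynamicalK κ (RBa q κ) (KBaLeft q Pl) ∧ IsUnitaryK (KBaLeft q Pl)) ∧
    (IsRightDynamicalK κ (RBa q κ) (KBa q Pr) ∧ IsUnitaryK (KBa q Pr)) ∧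
    ∃ M : AffWeyl n → Module.End ℂ (MeroSpin n),
      (IsCocycle M ∧ HasGeneratorValues κ (RBa q κ) (KBaLeft q Pl) (KBa q Pr) M) ∧
      (∀ M' : AffWeyl n → Module.End ℂ (MeroSpin n),
        IsCocycle M' → HasGeneratorValues κ (RBa q κ) (KBaLeft q Pl) (KBa q Pr) M' → M' = M) ∧
      IsCompatibleSystem M ∧
      ∀ l : Fin n → ℤ, HasEllipticCoefficients q κ (M (AffWeyl.tau l)) := by
  obtain ⟨m, rfl⟩ : ∃ m, n = m + 1 := ⟨n - 1, by omega⟩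
  obtain ⟨ρ, hb, hr, hl⟩ := exists_representation hq0 hq1 κ Pl Pr (by omega : 0 < m)
  have hT := isTwistedOperator_representation hq0 hq1 hb hr hl
  have hρ := hasGeneratorValues_cocycleOf hb hr hl
  refine ⟨⟨isDynamicalR_RBa hq0 hq1 κ, isUnitaryR_RBa hq0 hq1 κ, iceRule_RBa κ⟩,
    ⟨isLeftDynamicalK_KBaLeft hq0 hq1 κ Pl, (isUnitaryK_KBa hq0 hq1 Pl).2⟩,
    ⟨isRightDynamicalK_KBa hq0 hq1 κ Pr, (isUnitaryK_KBa hq0 hq1 Pr).1⟩,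
    cocycleOf ρ, ⟨⟨fun v => (hT v).isDifferenceOperator, ?_, cocycleOf_mul ρ⟩, hρ⟩,
    fun M' hM' h => eq_cocycleOf_of_hasGeneratorValues hM' h hρ, isCompatibleSystem_cocycleOf ρ,
    fun l => ?_⟩
  · rw [cocycleOf, map_one, inv_one, weylAct_one, one_mul]
  · obtain ⟨S, c, hc, hD, hS⟩ := hT (AffWeyl.tau l)
    exact ⟨S, c, fun k hk ε' ε => isElliptic_of_isQuasiPeriodic hS hk (hc k hk ε' ε), hD.untwist⟩

end
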